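/- Let $\mathbb{K}$ be a field. **$A_\infty$-categories.** A (small) strictly unital $A_\infty$-category $\mathcal{A}$ over $\mathbb{K}$ consists of a set $\mathrm{Ob}(\mathcal{A})$, $\mathbb{Z}$-graded vector spaces $\mathcal{A}_\bullet(x,y)$ (homological grading), linear maps $m_k:\mathcal{A}_\bullet(x_0,x_1)\otimes\cdots\otimes\mathcal{A}_\bullet(x_{k-1},x_k)\to\mathcal{A}_\bullet(x_0,x_k)$ of degree $k-2$ for all $k\ge 1$ and all objects $x_0,\dots,x_k$, and elements $1_x\in\mathcal{A}_0(x,x)$, such that for all $k\ge1$ $$\sum_{r+s+t=k,\ s>0}(-1)^{r+st}\,m_{r+1+t}(\mathrm{id}^{\otimes r}\otimes m_s\otimes\mathrm{id}^{\otimes t})=0,$$ $m_1(1_x)=0$, $m_2(1_x\otimes v)=v=m_2(v\otimes 1_y)$ for $v\in\mathcal{A}_\bullet(x,y)$, and $m_k$ vanishes for $k>2$ as soon as one of its arguments is an identity $1_x$. Here and below, tensor products of homogeneous maps are evaluated with the Koszul sign rule $(\alpha\otimes\beta)(u\otimes v)=(-1)^{|\beta||u|}\alpha(u)\otimes\beta(v)$.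 For positive integers $i_1,\dots,i_r$ put $\epsilon_g(i_1,\dots,i_r)=\sum_{l=1}^{r-1}(r-l)(i_l-1)$. An $A_\infty$-functor $f:\mathcal{A}\to\mathcal{B}$ consists of a map $f_0:\mathrm{Ob}(\mathcal{A})\to\mathrm{Ob}(\mathcal{B})$ and linear maps $f_k:\mathcal{A}_\bullet(x_0,x_1)\otimes\cdots\otimes\mathcal{A}_\bullet(x_{k-1},x_k)\to\mathcal{B}_\bullet(f_0(x_0),f_0(x_k))$ of degree $k-1$ for $k\geq 1$, such that for all $k\ge 1$ $$\sum_{r+s+t=k,\ s>0}(-1)^{r+st}f_{r+1+t}(\mathrm{id}^{\otimes r}\otimes m_s\otimes\mathrm{id}^{\otimes t})=\sum_{r>0,\ i_j>0,\ i_1+\cdots+i_r=k}(-1)^{\epsilon_g(i_1,\dots,i_r)}m_r(f_{i_1}\otimes\cdots\otimes f_{i_r}),$$ $f_1(1_x)=1_{f_0(x)}$, and $f_k$ vanishes for $k>1$ as soon as one of its arguments is an identity. The identity functor has $(\mathrm{id})_0=\mathrm{id}$, $(\mathrm{id})_1=\mathrm{id}$ and $(\mathrm{id})_k=0$ for $k>1$.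 The composite of $f:\mathcal{A}\to\mathcal{B}$ and $g:\mathcal{B}\to\mathcal{C}$ has $(g\circ f)_0=g_0\circ f_0$ and $$(g\circ f)_k=\sum_{r>0,\ i_j>0,\ i_1+\cdots+i_r=k}(-1)^{\epsilon_g(i_1,\dots,i_r)}g_r(f_{i_1}\otimes\cdots\otimes f_{i_r})\qquad (k\geq 1).$$ **Necklaces.** Let $\mathcal{F}$ be the category of finite intervals: its objects are the $[n]=\{0,\dots,n\}$ with $n\ge0$, and its morphisms are the order preserving maps that preserve both endpoints. It is strict monoidal for $[m]+[n]=[m+n]$. A necklace is a pair $(T,p)$ with $p\ge0$ and $T=\{0=t_0<\cdots<t_k=p\}\subseteq[p]$. It is written $T=\Delta^{n_1}\vee\cdots\vee\Delta^{n_k}$ with $n_i=t_i-t_{i-1}$, and the $\Delta^{n_i}$ are its beads. In particular $\Delta^n=(\{0,n\},n)$, and $\Delta^0=(\{0\},0)$ has no beads. Put $\ell(T)=k$, $\dim(T)=p-k$, $\epsilon(T)=\epsilon_g(n_1,\dots,n_k)$ and $T^c=[p]\setminus T$. A necklace map $(T,p)\to(U,q)$ is a morphism $f:[p]\to[q]$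 of $\mathcal{F}$ with $U\subseteq f(T)$. It is inert if $p=q$ and $f=\mathrm{id}$, active if $f(T)=U$, and injective or surjective if $f$ is so. The wedge is $(T,p)\vee(U,q)=(T\cup(p+U),p+q)$. Every necklace map factors uniquely as an active surjective map followed by an injective map. Every inert map to $U=\Delta^{n_1}\vee\cdots\vee\Delta^{n_l}$ is uniquely a wedge $\nu=\nu_1\vee\cdots\vee\nu_l$ of inert maps $\nu_i:S_i\to\Delta^{n_i}$, and one puts $\varphi(\nu)=\sum_{i<j}\dim(S_i)(\ell(S_j)-1)$. For $g:U\to T$ and a map $h:S\to\Delta^{n_k}$ to the $k$-th bead of $U$, write $g\circ_k h=g\circ(\mathrm{id}\vee h\vee\mathrm{id})$, and, for $h=\nu$ inert, $\varphi_k(\nu)=\varphi(\mathrm{id}\vee\nu\vee\mathrm{id})$. For $i\in U^c$, let $\delta_i$ be the injective necklace map to $U$ that omits the vertex $i$ and whose domain has as joints the preimages of the joints of $U$. **Templicial vector spaces.** For a set $O$, a $\mathbb{K}$-quiver on $O$ is a family $(Q(a,b))_{a,b\in O}$ of vector spaces; put $(P\otimes_O Q)(a,b)=\bigoplus_{c\in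 O}P(a,c)\otimes Q(c,b)$, with unit $\mathbb{K}_O$ given by $\mathbb{K}_O(a,a)=\mathbb{K}$ and $\mathbb{K}_O(a,b)=0$ for $a\neq b$. A templicial vector space $(X,O)$ is a set $O$ with a colax monoidal functor $X$ from $\mathcal{F}^{op}$ to $\mathbb{K}$-quivers on $O$, with comultiplications $\mu_{p,q}:X_{p+q}\to X_p\otimes_O X_q$ and a counit $X_0\to\mathbb{K}_O$, that is strongly unital: the counit is an isomorphism. A map $(X,O)\to(Y,P)$ is a map of sets $\phi:O\to P$ with linear maps $X_n(a,b)\to Y_n(\phi a,\phi b)$ that are natural in $[n]$ and compatible with comultiplications and counits. **The nerve of $\mathcal{A}$.** Put $(s\mathcal{A})_n=\mathcal{A}_{n-1}$, and for $U=\Delta^{n_1}\vee\cdots\vee\Delta^{n_l}$ put $(s\mathcal{A})_U=(s\mathcal{A})_{n_1}\otimes_{\mathrm{Ob}(\mathcal A)}\cdots\otimes_{\mathrm{Ob}(\mathcal A)}(s\mathcal{A})_{n_l}$, which is $\mathbb{K}_{\mathrm{Ob}(\mathcal A)}$ for $l=0$. In all tensors and signs below, an element of $(s\mathcal A)_n=\mathcal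 A_{n-1}$ has degree $n-1$. For a necklace $T$ and $a,b\in\mathrm{Ob}(\mathcal{A})$, let $N^{A_\infty}_{\mathbb{K}}(\mathcal{A})_T(a,b)$ be the space of all families $(y_g)_g$ with $y_g\in(s\mathcal{A})_U(a,b)$, indexed by the injective necklace maps $g:U\hookrightarrow T$, that satisfy for every such $g$, with $U=\Delta^{n_1}\vee\cdots\vee\Delta^{n_l}$ and $U^c=\{i_1<\cdots<i_d\}$, the relation $$(\mathrm{TAN})\qquad\sum_{k=1}^{l}\ \sum_{\nu:S\hookrightarrow\Delta^{n_k}\text{ inert}}(-1)^{\epsilon(S)+\varphi_k(\nu)}(\mathrm{id}^{\otimes k-1}\otimes m_{\ell(S)}\otimes\mathrm{id}^{\otimes l-k})(y_{g\circ_k\nu})=\sum_{j=1}^{d}(-1)^{j-1}y_{g\circ\delta_{i_j}}.$$ An active surjective map is a wedge $e=e_1\vee\cdots\vee e_l$ of surjective maps $e_i:\Delta^{n_i}\to\Delta^{m_i}$, $n_i>0$; put $\bar e=\bar e_1\otimes\cdots\otimes\bar e_l$, where $\bar e_i$ is the unit $\mathbb{K}_{\mathrm{Ob}(\mathcal{A})}\to\mathcal{A}_0=(s\mathcal{A})_1$,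 $1\mapsto 1_x$, if $e_i:\Delta^1\to\Delta^0$, it is the identity if $e_i$ is an identity, and $0$ otherwise. For a necklace map $h:T\to T'$ and a family $y$ for $T'$, let $h^*(y)_g=\bar e(y_{g'})$, where $h\circ g=g'\circ e$ with $e$ active surjective and $g'$ injective. For an $A_\infty$-functor $f:\mathcal A\to\mathcal B$ and a necklace $T$ put, for $g:U\hookrightarrow T$ injective and $U=\Delta^{n_1}\vee\cdots\vee\Delta^{n_l}$, $$f_T(y)_g=\sum_{\nu=\nu_1\vee\cdots\vee\nu_l:\ S_1\vee\cdots\vee S_l\hookrightarrow U\text{ inert}}(-1)^{\epsilon(S_1)+\cdots+\epsilon(S_l)+\varphi(\nu)}(f_{\ell(S_1)}\otimes\cdots\otimes f_{\ell(S_l)})(y_{g\circ\nu}).$$ **Proposition.** With these identities and this composition, strictly unital $A_\infty$-categories and $A_\infty$-functors form a category $A_\infty\mathrm{Cat}_{su}$, and the constructions $\mathcal{A}\mapsto N^{A_\infty}_{\mathbb{K}}(\mathcal{A})$ and $f\mapsto N^{A_\infty}_{\mathbb{K}}(f)$ are well defined and give a functor from $A_\infty\mathrm{Cat}_{su}$ to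 templicial vector spaces. Explicitly: 1. The maps $h^*$ preserve the (TAN) relations, and make $T\mapsto N^{A_\infty}_{\mathbb{K}}(\mathcal{A})_T(a,b)$ a contravariant functor on necklaces. 2. For all necklaces $T_1,T_2$, sending $x\otimes y$ with $x\in N^{A_\infty}_{\mathbb{K}}(\mathcal{A})_{T_1}(a,c)$ and $y\in N^{A_\infty}_{\mathbb{K}}(\mathcal{A})_{T_2}(c,b)$ to $(x_{g_1}\otimes y_{g_2})_{g_1\vee g_2}$ defines an isomorphism $N^{A_\infty}_{\mathbb{K}}(\mathcal{A})_{T_1}\otimes_{\mathrm{Ob}(\mathcal{A})}N^{A_\infty}_{\mathbb{K}}(\mathcal{A})_{T_2}\cong N^{A_\infty}_{\mathbb{K}}(\mathcal{A})_{T_1\vee T_2}$, which is natural in $T_1$ and $T_2$. 3. For every $A_\infty$-functor $f:\mathcal{A}\to\mathcal{B}$, the maps $f_T$ preserve the (TAN) relations, commute with the maps $h^*$, and are compatible with the isomorphisms of part 2. Moreover $(\mathrm{id}_{\mathcal{A}})_T=\mathrm{id}$ and $(g\circ f)_T=g_T\circ f_T$ for all $T$. 4. The quivers $N^{A_\infty}_{\mathbb{K}}(\mathcal{A})_n=N^{A_\infty}_{\mathbb{K}}(\mathcal{A})_{\Delta^n}$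 on $\mathrm{Ob}(\mathcal{A})$ form a templicial vector space $N^{A_\infty}_{\mathbb{K}}(\mathcal{A})$, in which a morphism $[m]\to[n]$ of $\mathcal F$ acts by $h^*$ for the induced map $h:\Delta^m\to\Delta^n$, the comultiplication $\mu_{p,q}$ is $\nu_{p,q}^*$ for the inert map $\nu_{p,q}:\Delta^p\vee\Delta^q\to\Delta^{p+q}$, followed by the inverse of the isomorphism of part 2, and the counit is given by $y\mapsto y_{\mathrm{id}_{\Delta^0}}\in\mathbb{K}$ on $N^{A_\infty}_{\mathbb{K}}(\mathcal{A})_0(a,a)$. For an $A_\infty$-functor $f$, the map $f_0$ on objects and the maps $f_{\Delta^n}$ form a map of templicial vector spaces $N^{A_\infty}_{\mathbb{K}}(f):N^{A_\infty}_{\mathbb{K}}(\mathcal{A})\to N^{A_\infty}_{\mathbb{K}}(\mathcal{B})$. The assignments $\mathcal A\mapsto N^{A_\infty}_{\mathbb{K}}(\mathcal{A})$ and $f\mapsto N^{A_\infty}_{\mathbb{K}}(f)$ define a functor. -/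

import Mathlib

open CategoryTheory TensorProduct DirectSum
open scoped Classical

universe u

noncomputable section

/-! ## Endpoint-preserving order maps and necklaces -/

/-- A morphism `[m] ⟶ [n]` of the category of finite intervals: an order preserving map
`{0, …, m} → {0, …, n}` that preserves both endpoints. -/
@[ext]
structure EndHom (m n : ℕ) where
  toFun : Fin (m + 1) → Fin (n + 1)
  mono : Monotone toFun
  map_zero : toFun 0 = 0
  map_last : toFun (Fin.last m) = Fin.last n

namespace EndHom

/-- The identity of `[m]`. -/
def id (m : ℕ) : EndHom m m := ⟨fun i => i, fun _ _ h => h, rfl, rfl⟩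

/-- Composition, in diagrammatic order: first `f`, then `g`. -/
def comp {m n k : ℕ} (f : EndHom m n) (g : EndHom n k) : EndHom m k where
  toFun i := g.toFun (f.toFun i)
  mono := g.mono.comp f.mono
  map_zero := by rw [f.map_zero, g.map_zero]
  map_last := by rw [f.map_last, g.map_last]

/-- The identification `[m] = [n]` for `m = n`. -/
def ofEq {m n : ℕ} (h : m = n) : EndHom m n := h ▸ EndHom.id m

/-- The monoidal product `f + g : [m + p] ⟶ [n + q]` of `f : [m] ⟶ [n]` and `g : [p] ⟶ [q]`:
it is `f` on `{0, …, m}` and `n + g (i - m)` for `i ≥ m`. -/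
def add {m n p q : ℕ} (f : EndHom m n) (g : EndHom p q) : EndHom (m + p) (n + q) where
  toFun i := if h : i.val ≤ m
    then ⟨(f.toFun ⟨i.val, by omega⟩).val, by have := (f.toFun ⟨i.val, by omega⟩).isLt; omega⟩
    else ⟨n + (g.toFun ⟨i.val - m, by omega⟩).val, by
      have := (g.toFun ⟨i.val - m, by omega⟩).isLt; omega⟩
  mono := by
    intro i j hij
    have hij' : i.val ≤ j.val := hij
    by_cases hi : i.val ≤ m <;> by_cases hj : j.val ≤ m
    · simp only [hi, hj, dif_pos]
      exact f.mono (a := ⟨i.val, by omega⟩) (b := ⟨j.val, by omega⟩) hij'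
    · simp only [hi, hj, dif_pos, dif_neg, not_false_eq_true, Fin.mk_le_mk]
      have := (f.toFun ⟨i.val, by omega⟩).isLt
      omega
    · omega
    · simp only [hi, hj, dif_neg, not_false_eq_true, Fin.mk_le_mk]
      have h : (⟨i.val - m, by omega⟩ : Fin (p + 1)) ≤ ⟨j.val - m, by omega⟩ := by
        simp only [Fin.mk_le_mk]; omega
      have := g.mono h
      have h2 : (g.toFun ⟨i.val - m, by omega⟩).val ≤ (g.toFun ⟨j.val - m, by omega⟩).val := this
      omega
  map_zero := by
    simp [f.map_zero]
  map_last := by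
    ext
    by_cases hp : p = 0
    · subst hp
      have h1 : (f.toFun ⟨m, by omega⟩) = Fin.last n := f.map_last
      have h2 : g.toFun 0 = Fin.last q := g.map_last
      have h3 : Fin.last q = 0 := h2.symm.trans g.map_zero
      have h4 : q = 0 := by simpa [Fin.ext_iff] using h3
      subst h4
      simp [h1]
    · have h1 : ¬ (m + p ≤ m) := by omega
      have h2 : g.toFun ⟨p, by omega⟩ = Fin.last q := g.map_last
      simp [h1, h2]

/-- The image of `h : [m] ⟶ [n]` has `h.imLen + 1` elements. -/
def imLen {m n : ℕ} (h : EndHom m n) : ℕ := (Finset.univ.image h.toFun).card - 1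

theorem card_image {m n : ℕ} (h : EndHom m n) :
    (Finset.univ.image h.toFun).card = h.imLen + 1 := by
  have : 0 < (Finset.univ.image h.toFun).card :=
    Finset.card_pos.mpr ⟨h.toFun 0, Finset.mem_image_of_mem _ (Finset.mem_univ _)⟩
  unfold imLen
  omega

/-- The increasing enumeration of the image of `h`. -/
def imEmb {m n : ℕ} (h : EndHom m n) : Fin (h.imLen + 1) → Fin (n + 1) :=
  (Finset.univ.image h.toFun).orderEmbOfFin h.card_image

/-- The corestriction of `h` to its image. -/
def imProj {m n : ℕ} (h : EndHom m n) (i : Fin (m + 1)) : Fin (h.imLen + 1) :=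
  ((Finset.univ.image h.toFun).orderIsoOfFin h.card_image).symm
    ⟨h.toFun i, Finset.mem_image_of_mem _ (Finset.mem_univ _)⟩

theorem imEmb_imProj {m n : ℕ} (h : EndHom m n) (i : Fin (m + 1)) :
    h.imEmb (h.imProj i) = h.toFun i := by
  simp [imEmb, imProj, ← Finset.coe_orderIsoOfFin_apply]

theorem imEmb_strictMono {m n : ℕ} (h : EndHom m n) : StrictMono h.imEmb :=
  ((Finset.univ.image h.toFun).orderEmbOfFin h.card_image).strictMono

theorem imProj_surjective {m n : ℕ} (h : EndHom m n) : Function.Surjective h.imProj := by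
  intro j
  have hj : h.imEmb j ∈ Finset.univ.image h.toFun :=
    Finset.orderEmbOfFin_mem _ h.card_image j
  obtain ⟨i, -, hi⟩ := Finset.mem_image.mp hj
  exact ⟨i, h.imEmb_strictMono.injective (by rw [imEmb_imProj, hi])⟩

theorem imProj_mono {m n : ℕ} (h : EndHom m n) : Monotone h.imProj := by
  intro i j hij
  rw [← h.imEmb_strictMono.le_iff_le, imEmb_imProj, imEmb_imProj]
  exact h.mono hij

theorem imProj_zero {m n : ℕ} (h : EndHom m n) : h.imProj 0 = 0 := by
  obtain ⟨i, hi⟩ := h.imProj_surjective 0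
  exact le_antisymm (hi ▸ h.imProj_mono (Fin.zero_le i)) (Fin.zero_le _)

theorem imProj_last {m n : ℕ} (h : EndHom m n) : h.imProj (Fin.last m) = Fin.last _ := by
  obtain ⟨i, hi⟩ := h.imProj_surjective (Fin.last _)
  exact le_antisymm (Fin.le_last _) (hi ▸ h.imProj_mono (Fin.le_last i))

/-- The surjective part of the factorization of `h` through its image. -/
def epi {m n : ℕ} (h : EndHom m n) : EndHom m h.imLen :=
  ⟨h.imProj, h.imProj_mono, h.imProj_zero, h.imProj_last⟩

/-- The injective part of the factorization of `h` through its image. -/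
def inc {m n : ℕ} (h : EndHom m n) : EndHom h.imLen n where
  toFun := h.imEmb
  mono := h.imEmb_strictMono.monotone
  map_zero := by rw [← h.imProj_zero, imEmb_imProj, h.map_zero]
  map_last := by rw [← h.imProj_last, imEmb_imProj, h.map_last]

/-- The inner face map `δ_i : [p - 1] ⟶ [p]` that omits the vertex `i`, for `0 < i < p`. -/
def face {p : ℕ} (i : Fin (p + 1)) (h0 : i ≠ 0) (hl : i ≠ Fin.last p) : EndHom (p - 1) p where
  toFun j := if j.val < i.val then ⟨j.val, by omega⟩
    else ⟨j.val + 1, by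
      have h1 : i.val ≠ 0 := fun h => h0 (Fin.ext h)
      omega⟩
  mono := by
    intro j k hjk
    have hjk' : j.val ≤ k.val := hjk
    by_cases hj : j.val < i.val <;> by_cases hk : k.val < i.val <;>
      simp only [hj, hk, if_true, if_false, Fin.mk_le_mk] <;> omega
  map_zero := by
    have h1 : 0 < i.val := Nat.pos_of_ne_zero fun h => h0 (Fin.ext h)
    simp [h1]
  map_last := by
    have h0' : i.val ≠ 0 := fun h => h0 (Fin.ext h)
    have h1 : i.val ≠ p := fun h => hl (Fin.ext h)
    have h2 : ¬ (p - 1 < i.val) := by omega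
    ext
    simp only [Fin.val_last, h2, if_false]
    omega

end EndHom

/-- The subset of `{0, …, n}` defined by a predicate that holds at `0` and `n`. -/
def jointsOf {n : ℕ} (P : Fin (n + 1) → Prop) (h0 : P 0) (hl : P (Fin.last n)) :
    CompositionAsSet n where
  boundaries := Finset.univ.filter P
  zero_mem := by simp [h0]
  getLast_mem := Finset.mem_filter.mpr ⟨Finset.mem_univ _, hl⟩

theorem mem_jointsOf {n : ℕ} (P : Fin (n + 1) → Prop) (h0 : P 0) (hl : P (Fin.last n))
    (i : Fin (n + 1)) : i ∈ (jointsOf P h0 hl).boundaries ↔ P i := by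
  simp [jointsOf]

/-- A necklace `(T, p)`: a natural number `p` and a subset `T` of `{0, …, p}` containing `0` and
`p`.  If `T = {0 = t₀ < t₁ < … < t_k = p}`, this is the necklace
`Δ^{t₁} ∨ Δ^{t₂ - t₁} ∨ … ∨ Δ^{p - t_{k-1}}`.  Thus `T.blocks` is the list of the dimensions of the
beads, `T.blocksFun i` is the dimension of the `i`-th bead, `T.length` is the bead length, and
`T.boundary` is the enumeration `t`. -/
structure Nec where
  p : ℕ
  T : CompositionAsSet p

/-- A necklace map `(T, p) ⟶ (U, q)`: an endpoint-preserving order map `f : [p] ⟶ [q]` with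
`U ⊆ f(T)`. -/
@[ext]
structure NecHom (T U : Nec) extends EndHom T.p U.p where
  joints : U.T.boundaries ⊆ T.T.boundaries.image toFun

instance : Category Nec where
  Hom := NecHom
  id T := { EndHom.id T.p with joints := fun i hi => Finset.mem_image.mpr ⟨i, hi, rfl⟩ }
  comp {T U V} f g :=
    { EndHom.comp f.toEndHom g.toEndHom with
      joints := by
        intro v hv
        obtain ⟨w, hw, rfl⟩ := Finset.mem_image.mp (g.joints hv)
        obtain ⟨t, ht, rfl⟩ := Finset.mem_image.mp (f.joints hw)
        exact Finset.mem_image.mpr ⟨t, ht, rfl⟩ }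
  id_comp _ := rfl
  comp_id _ := rfl
  assoc _ _ _ := rfl

/-- The subset `{0, n}` of `{0, …, n}`. -/
def oneBead (n : ℕ) : CompositionAsSet n where
  boundaries := {0, Fin.last n}
  zero_mem := by simp
  getLast_mem := by simp

namespace Nec

/-- The simplex `Δ^n` as a necklace. -/
def simplex (n : ℕ) : Nec := ⟨n, oneBead n⟩

/-- The map `Δ^m ⟶ Δ^n` induced by `[m] ⟶ [n]`. -/
def simplexMap {m n : ℕ} (f : EndHom m n) : simplex m ⟶ simplex n :=
  { f with
    joints := by
      intro i hi
      have hi' : i = 0 ∨ i = Fin.last n := by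
        have hi'' : i ∈ ({0, Fin.last _} : Finset _) := hi
        exact (Finset.mem_insert.mp hi'').imp_right Finset.mem_singleton.mp
      rcases hi' with rfl | rfl
      · exact Finset.mem_image.mpr ⟨0, (simplex m).T.zero_mem, f.map_zero⟩
      · exact Finset.mem_image.mpr ⟨Fin.last m, (simplex m).T.getLast_mem, f.map_last⟩ }

/-- The wedge `(T, p) ∨ (U, q) = (T ∪ (p + U), p + q)`. -/
def wedge (T U : Nec) : Nec where
  p := T.p + U.p
  T := jointsOf
    (fun j => (∃ t ∈ T.T.boundaries, j.val = t.val) ∨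
      (∃ w ∈ U.T.boundaries, j.val = T.p + w.val))
    (Or.inl ⟨0, T.T.zero_mem, rfl⟩) (Or.inr ⟨Fin.last _, U.T.getLast_mem, rfl⟩)

theorem mem_wedge (T U : Nec) (j : Fin (T.p + U.p + 1)) :
    j ∈ (T.wedge U).T.boundaries ↔
      (∃ t ∈ T.T.boundaries, j.val = t.val) ∨ (∃ w ∈ U.T.boundaries, j.val = T.p + w.val) :=
  mem_jointsOf (fun j : Fin (T.p + U.p + 1) => (∃ t ∈ T.T.boundaries, j.val = t.val) ∨
    (∃ w ∈ U.T.boundaries, j.val = T.p + w.val))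
    (Or.inl ⟨0, T.T.zero_mem, rfl⟩) (Or.inr ⟨Fin.last _, U.T.getLast_mem, rfl⟩) j

/-- The wedge of two necklace maps. -/
def wedgeMap {T T' U U' : Nec} (f : T ⟶ T') (g : U ⟶ U') : T.wedge U ⟶ T'.wedge U' :=
  { EndHom.add f.toEndHom g.toEndHom with
    joints := by
      intro j hj
      rcases (mem_wedge _ _ _).mp hj with ⟨t', ht', hjt⟩ | ⟨w', hw', hjw⟩
      · obtain ⟨t, ht, rfl⟩ := Finset.mem_image.mp (f.joints ht')
        refine Finset.mem_image.mpr ⟨⟨t.val, by have := t.isLt; simp only [wedge]; omega⟩, ?_, ?_⟩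
        · exact (mem_wedge _ _ _).mpr (Or.inl ⟨t, ht, rfl⟩)
        · have : t.val ≤ T.p := Nat.le_of_lt_succ t.isLt
          ext
          simp [EndHom.add, this, hjt]
      · obtain ⟨w, hw, rfl⟩ := Finset.mem_image.mp (g.joints hw')
        refine Finset.mem_image.mpr
          ⟨⟨T.p + w.val, by have := w.isLt; simp only [wedge]; omega⟩, ?_, ?_⟩
        · exact (mem_wedge _ _ _).mpr (Or.inr ⟨w, hw, rfl⟩)
        · ext
          by_cases h0 : w.val = 0
          · have hw0 : w = 0 := Fin.ext h0
            subst hw0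
            have h1 : g.toFun 0 = 0 := g.map_zero
            have h2 : f.toFun ⟨T.p, by omega⟩ = Fin.last _ := f.map_last
            rw [h1] at hjw
            simp [EndHom.add, h2, hjw]
          · have : ¬ (T.p + w.val ≤ T.p) := by omega
            simp [EndHom.add, h0, hjw] }

/-- The inert map `ν_{p,q} : Δ^p ∨ Δ^q ⟶ Δ^{p+q}`, which is the identity on vertices. -/
def splitMap (p q : ℕ) : (simplex p).wedge (simplex q) ⟶ simplex (p + q) :=
  { EndHom.id (p + q) with
    joints := by
      intro i hi
      have hi' : i = 0 ∨ i = Fin.last (p + q) := by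
        have hi'' : i ∈ ({0, Fin.last _} : Finset _) := hi
        exact (Finset.mem_insert.mp hi'').imp_right Finset.mem_singleton.mp
      rcases hi' with rfl | rfl
      · exact Finset.mem_image.mpr ⟨0, ((simplex p).wedge (simplex q)).T.zero_mem, rfl⟩
      · exact Finset.mem_image.mpr ⟨_, ((simplex p).wedge (simplex q)).T.getLast_mem, rfl⟩ }

/-- The necklace obtained from `U = Δ^{n₁} ∨ … ∨ Δ^{n_l}` by replacing every bead `Δ^{n_k}` by a
necklace `S_k` with the same vertices, that is `S₁ ∨ … ∨ S_l`. -/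
def refine (U : Nec) (S : ∀ k : Fin U.T.length, CompositionAsSet (U.T.blocksFun k)) : Nec where
  p := U.p
  T := jointsOf
    (fun j => j ∈ U.T.boundaries ∨ ∃ k, ∃ i ∈ (S k).boundaries,
      j.val = (U.T.boundary ⟨k.val, U.T.lt_length' k⟩).val + i.val)
    (Or.inl U.T.zero_mem) (Or.inl U.T.getLast_mem)

theorem mem_refine (U : Nec) (S : ∀ k : Fin U.T.length, CompositionAsSet (U.T.blocksFun k))
    (j : Fin (U.p + 1)) :
    j ∈ (U.refine S).T.boundaries ↔ j ∈ U.T.boundaries ∨ ∃ k, ∃ i ∈ (S k).boundaries,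
      j.val = (U.T.boundary ⟨k.val, U.T.lt_length' k⟩).val + i.val :=
  mem_jointsOf (fun j => j ∈ U.T.boundaries ∨ ∃ k, ∃ i ∈ (S k).boundaries,
    j.val = (U.T.boundary ⟨k.val, U.T.lt_length' k⟩).val + i.val)
    (Or.inl U.T.zero_mem) (Or.inl U.T.getLast_mem) j

/-- The inert map `S₁ ∨ … ∨ S_l ⟶ Δ^{n₁} ∨ … ∨ Δ^{n_l} = U`.  Every inert map to `U` is of this form
for a unique family `S`. -/
def inert (U : Nec) (S : ∀ k : Fin U.T.length, CompositionAsSet (U.T.blocksFun k)) :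
    U.refine S ⟶ U :=
  { EndHom.id U.p with
    joints := by
      intro i hi
      refine Finset.mem_image.mpr ⟨i, ?_, rfl⟩
      exact (mem_refine _ _ _).mpr (Or.inl hi) }

/-- The family of beads of `U`, with the `k`-th one replaced by `S`.  The map `U.inert` of it is
`id ∨ ν ∨ id` for the inert map `ν : S ⟶ Δ^{n_k}`. -/
def atBead (U : Nec) (k : Fin U.T.length) (S : CompositionAsSet (U.T.blocksFun k)) :
    ∀ i : Fin U.T.length, CompositionAsSet (U.T.blocksFun i) :=
  Function.update (fun i => oneBead (U.T.blocksFun i)) k S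

/-- The signature `∑_{i < j} dim(S_i) (ℓ(S_j) - 1)` of the inert map `S₁ ∨ … ∨ S_l ⟶ U`. -/
def phi (U : Nec) (S : ∀ k : Fin U.T.length, CompositionAsSet (U.T.blocksFun k)) : ℕ :=
  ∑ i, ∑ j ∈ Finset.Ioi i, (U.T.blocksFun i - (S i).length) * ((S j).length - 1)

theorem ne_zero_of_compl (U : Nec) {i : Fin (U.p + 1)} (hi : i ∉ U.T.boundaries) : i ≠ 0 :=
  fun h => hi (h ▸ U.T.zero_mem)

theorem ne_last_of_compl (U : Nec) {i : Fin (U.p + 1)} (hi : i ∉ U.T.boundaries) :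
    i ≠ Fin.last U.p :=
  fun h => hi (h ▸ U.T.getLast_mem)

/-- The necklace obtained from `U` by removing the vertex `i`, which is not a joint. -/
def face (U : Nec) (i : Fin (U.p + 1)) (hi : i ∉ U.T.boundaries) : Nec where
  p := U.p - 1
  T := jointsOf
    (fun j =>
      (EndHom.face i (U.ne_zero_of_compl hi) (U.ne_last_of_compl hi)).toFun j ∈ U.T.boundaries)
    (by rw [EndHom.map_zero]; exact U.T.zero_mem)
    (by rw [EndHom.map_last]; exact U.T.getLast_mem)

theorem mem_face (U : Nec) (i : Fin (U.p + 1)) (hi : i ∉ U.T.boundaries)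
    (j : Fin (U.p - 1 + 1)) :
    j ∈ (U.face i hi).T.boundaries ↔
      (EndHom.face i (U.ne_zero_of_compl hi) (U.ne_last_of_compl hi)).toFun j ∈ U.T.boundaries :=
  mem_jointsOf (fun j =>
    (EndHom.face i (U.ne_zero_of_compl hi) (U.ne_last_of_compl hi)).toFun j ∈ U.T.boundaries)
    (by rw [EndHom.map_zero]; exact U.T.zero_mem)
    (by rw [EndHom.map_last]; exact U.T.getLast_mem) j

/-- The necklace map `δ_i`. -/
def faceMap (U : Nec) (i : Fin (U.p + 1)) (hi : i ∉ U.T.boundaries) : U.face i hi ⟶ U :=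
  { EndHom.face i (U.ne_zero_of_compl hi) (U.ne_last_of_compl hi) with
    joints := by
      intro w hw
      have hne : w.val ≠ i.val := fun h => hi (Fin.ext h ▸ hw)
      have h0 : i.val ≠ 0 := fun h => U.ne_zero_of_compl hi (Fin.ext h)
      have hl : i.val ≠ U.p := fun h => U.ne_last_of_compl hi (Fin.ext h)
      have key : ∃ j : Fin (U.p - 1 + 1),
          (EndHom.face i (U.ne_zero_of_compl hi) (U.ne_last_of_compl hi)).toFun j = w := by
        by_cases hlt : w.val < i.val
        · refine ⟨⟨w.val, by omega⟩, ?_⟩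
          ext
          simp [EndHom.face, hlt]
        · refine ⟨⟨w.val - 1, by omega⟩, ?_⟩
          have h1 : ¬ (w.val - 1 < i.val) := by omega
          ext
          simp only [EndHom.face, h1, if_false]
          omega
      obtain ⟨j, hj⟩ := key
      refine Finset.mem_image.mpr ⟨j, ?_, hj⟩
      exact (mem_face _ _ _ _).mpr (hj ▸ hw) }

/-- The image of a necklace map. -/
def image {T U : Nec} (h : T ⟶ U) : Nec where
  p := h.toEndHom.imLen
  T :=
    { boundaries := T.T.boundaries.image h.toEndHom.epi.toFun
      zero_mem := Finset.mem_image.mpr ⟨0, T.T.zero_mem, h.toEndHom.epi.map_zero⟩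
      getLast_mem := Finset.mem_image.mpr ⟨_, T.T.getLast_mem, h.toEndHom.epi.map_last⟩ }

/-- The active surjective part of the (epi, mono) factorization of a necklace map. -/
def imageEpi {T U : Nec} (h : T ⟶ U) : T ⟶ image h :=
  { h.toEndHom.epi with joints := fun _ hi => hi }

/-- The injective part of the (epi, mono) factorization of a necklace map. -/
def imageInc {T U : Nec} (h : T ⟶ U) : image h ⟶ U :=
  { h.toEndHom.inc with
    joints := by
      intro i hi
      obtain ⟨t, ht, rfl⟩ := Finset.mem_image.mp (h.joints hi)
      exact Finset.mem_image.mpr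
        ⟨h.toEndHom.epi.toFun t, Finset.mem_image_of_mem _ ht, h.toEndHom.imEmb_imProj t⟩ }

theorem imageEpi_imageInc {T U : Nec} (h : T ⟶ U) : imageEpi h ≫ imageInc h = h :=
  NecHom.ext (funext fun i => h.toEndHom.imEmb_imProj i)

end Nec

/-- An injective necklace map `hom : dom ↪ T` into `T`. -/
structure NecSub (T : Nec) where
  dom : Nec
  hom : dom ⟶ T
  inj : Function.Injective hom.toFun

namespace NecSub

/-- The composite `g ∘ h` with an injective necklace map `h`. -/
def comp {T : Nec} (g : NecSub T) {V : Nec} (h : V ⟶ g.dom)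
    (hh : Function.Injective h.toFun) : NecSub T :=
  ⟨V, h ≫ g.hom, g.inj.comp hh⟩

/-- The composite of an injective necklace map `g : U ↪ T` with the inert map
`S₁ ∨ … ∨ S_l ⟶ U`. -/
def inert {T : Nec} (g : NecSub T)
    (S : ∀ k : Fin g.dom.T.length, CompositionAsSet (g.dom.T.blocksFun k)) : NecSub T :=
  g.comp (g.dom.inert S) fun _ _ h => h

theorem face_injective (U : Nec) (i : Fin (U.p + 1)) (hi : i ∉ U.T.boundaries) :
    Function.Injective (U.faceMap i hi).toFun := by
  intro j k hjk
  have h : (EndHom.face i (U.ne_zero_of_compl hi) (U.ne_last_of_compl hi)).toFun j =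
      (EndHom.face i (U.ne_zero_of_compl hi) (U.ne_last_of_compl hi)).toFun k := hjk
  have h' := congrArg Fin.val h
  ext
  by_cases hj : j.val < i.val <;> by_cases hk : k.val < i.val <;>
    simp [EndHom.face, hj, hk] at h' <;> omega

/-- The composite `g ∘ δ_i`, for `i` a vertex of the domain of `g` that is not a joint. -/
def face {T : Nec} (g : NecSub T) (i : Fin (g.dom.p + 1)) (hi : i ∉ g.dom.T.boundaries) :
    NecSub T :=
  g.comp (g.dom.faceMap i hi) (face_injective g.dom i hi)

/-- The injective part of the (epi, mono) factorization of a necklace map. -/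
def ofMap {T U : Nec} (h : T ⟶ U) : NecSub U :=
  ⟨Nec.image h, Nec.imageInc h, h.toEndHom.imEmb_strictMono.injective⟩

/-- The identity of `T`. -/
def refl (T : Nec) : NecSub T := ⟨T, 𝟙 T, fun _ _ h => h⟩

theorem wedge_injective {T T' U U' : Nec} (f : T ⟶ T') (g : U ⟶ U')
    (hf : Function.Injective f.toFun) (hg : Function.Injective g.toFun) :
    Function.Injective (Nec.wedgeMap f g).toFun := by
  intro i j hij
  have h : (EndHom.add (NecHom.toEndHom f) (NecHom.toEndHom g)).toFun i =
      (EndHom.add (NecHom.toEndHom f) (NecHom.toEndHom g)).toFun j := hij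
  have h' := congrArg Fin.val h
  have hg0 : g.toFun 0 = 0 := g.map_zero
  have hpos : ∀ (w : Fin (U.p + 1)), w.val ≠ 0 → (g.toFun w).val ≠ 0 := by
    intro w hw h0
    exact hw (congrArg Fin.val (hg ((Fin.ext h0 : g.toFun w = 0).trans hg0.symm)))
  have hi1 : i.val < T.p + U.p + 1 := i.isLt
  have hj1 : j.val < T.p + U.p + 1 := j.isLt
  ext
  by_cases hi : i.val ≤ T.p <;> by_cases hj : j.val ≤ T.p
  · simp only [EndHom.add, hi, hj, dif_pos] at h'
    have := congrArg Fin.val (hf (Fin.ext h'))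
    exact this
  · simp only [EndHom.add, hi, hj, dif_pos, dif_neg, not_false_eq_true] at h'
    have h2 := hpos ⟨j.val - T.p, by omega⟩ (by simp only; omega)
    have h3 := (f.toFun ⟨i.val, by omega⟩).isLt
    omega
  · simp only [EndHom.add, hi, hj, dif_pos, dif_neg, not_false_eq_true] at h'
    have h2 := hpos ⟨i.val - T.p, by omega⟩ (by simp only; omega)
    have h3 := (f.toFun ⟨j.val, by omega⟩).isLt
    omega
  · simp only [EndHom.add, hi, hj, dif_neg, not_false_eq_true] at h'
    have h2 : (g.toFun ⟨i.val - T.p, by omega⟩) = (g.toFun ⟨j.val - T.p, by omega⟩) :=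
      Fin.ext (by omega)
    have h3 := congrArg Fin.val (hg h2)
    simp only at h3
    omega

/-- The wedge of two injective necklace maps. -/
def wedge {T₁ T₂ : Nec} (g₁ : NecSub T₁) (g₂ : NecSub T₂) : NecSub (T₁.wedge T₂) :=
  ⟨g₁.dom.wedge g₂.dom, Nec.wedgeMap g₁.hom g₂.hom, wedge_injective _ _ g₁.inj g₂.inj⟩

end NecSub

/-- `ε_g(n₁, …, n_r) = ∑_{l=1}^{r-1} (r - l) (n_l - 1)`.  For a necklace `T` with beads of dimensions
`n₁, …, n_r` this is its signature `ε(T)`. -/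
def epsG : List ℕ → ℕ
  | [] => 0
  | n :: ns => ns.length * (n - 1) + epsG ns

/-! ## Graded quivers and their tensors -/

/-- A set of objects, and for any two of them a `ℤ`-graded vector space: `Q.Hom x y d` is the
component `Q_d(x, y)` of (homological) degree `d`. -/
structure GradedQuiver (K : Type u) [Field K] where
  Ob : Type u
  Hom : Ob → Ob → ℤ → ModuleCat.{u} K

namespace GradedQuiver

variable {K : Type u} [Field K]

/-- The direct sum of all the spaces `Q_d(x, y)`. -/
abbrev Tot (Q : GradedQuiver K) : Type u :=
  ⨁ p : Q.Ob × Q.Ob × ℤ, Q.Hom p.1 p.2.1 p.2.2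

/-- An element of `Q_d(x, y)`, in the total space. -/
def of (Q : GradedQuiver K) (x y : Q.Ob) (d : ℤ) : Q.Hom x y d →ₗ[K] Q.Tot :=
  DirectSum.lof K (Q.Ob × Q.Ob × ℤ) (fun p => Q.Hom p.1 p.2.1 p.2.2) (x, y, d)

/-- The tensor algebra of the total space.  For `x_i ∈ Q_{d_i}(c_{i-1}, c_i)`, the pure tensor
`x₁ ⊗ ⋯ ⊗ x_l` is the product of the `x_i` in this algebra, and the tensor product of graded
quivers `⨁_c Q_{d₁}(a, c₁) ⊗ Q_{d₂}(c₁, c₂) ⊗ ⋯ ⊗ Q_{d_l}(c_{l-1}, b)` is the subspace spanned by such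
products. -/
abbrev Ten (Q : GradedQuiver K) : Type u := TensorAlgebra K Q.Tot

/-- An element of `Q_d(x, y)`, in the tensor algebra. -/
def el (Q : GradedQuiver K) {x y : Q.Ob} {d : ℤ} (v : Q.Hom x y d) : Q.Ten :=
  TensorAlgebra.ι K (Q.of x y d v)

/-- For a list `n₁, …, n_l` of positive integers and `(sQ)_n = Q_{n-1}`, this is the space
`((sQ)_{n₁} ⊗ ⋯ ⊗ (sQ)_{n_l})(a, b)
  = ⨁_{a = c₀, c₁, …, c_l = b} Q_{n₁ - 1}(c₀, c₁) ⊗ ⋯ ⊗ Q_{n_l - 1}(c_{l-1}, c_l)`.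
For the empty list, it is `K` if `a = b`, and `0` otherwise. -/
def shiftTen (Q : GradedQuiver K) (n : List ℕ) (a b : Q.Ob) : Submodule K Q.Ten :=
  Submodule.span K {w | ∃ c : Fin (n.length + 1) → Q.Ob, c 0 = a ∧ c (Fin.last _) = b ∧
    ∃ x : ∀ i : Fin n.length, Q.Hom (c i.castSucc) (c i.succ) ((n.get i : ℤ) - 1),
      w = (List.ofFn fun i => Q.el (x i)).prod}

/-- Two linear maps agree on the tensors `x₁ ⊗ ⋯ ⊗ x_k` of composable elements
`x_i ∈ Q_{d_i}(c_{i-1}, c_i)`. -/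
def EqOnPaths (Q : GradedQuiver K) (k : ℕ) {V : Type u} [AddCommGroup V] [Module K V]
    (α β : Q.Ten →ₗ[K] V) : Prop :=
  ∀ (c : Fin (k + 1) → Q.Ob) (d : Fin k → ℤ) (x : ∀ i, Q.Hom (c i.castSucc) (c i.succ) (d i)),
    α (List.ofFn fun i => Q.el (x i)).prod = β (List.ofFn fun i => Q.el (x i)).prod

/-- The projection `v₁ ⊗ ⋯ ⊗ v_{r+t} ↦ (v₁ ⊗ ⋯ ⊗ v_r) ⊗ (v_{r+1} ⊗ ⋯ ⊗ v_{r+t})`, and `0` on tensors whose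
length is not `r + t`. -/
def split (Q : GradedQuiver K) (r t : ℕ) : Q.Ten →ₗ[K] Q.Ten ⊗[K] Q.Ten :=
  TensorProduct.map TensorPower.toTensorAlgebra TensorPower.toTensorAlgebra ∘ₗ
    (TensorPower.mulEquiv (R := K) (M := Q.Tot) (n := r) (m := t)).symm.toLinearMap ∘ₗ
    DirectSum.component K ℕ (fun n => ⨂[K]^n Q.Tot) (r + t) ∘ₗ
    TensorAlgebra.toDirectSum.toLinearMap

/-- For `α, β : Q.Ten → R.Ten`, the map that is `(α ⊗ β)` on tensors of length `r + t`, where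
`α` is applied to the first `r` factors and `β` to the last `t`, and `0` on other tensors. -/
def tens {Q R : GradedQuiver K} (r t : ℕ) (α β : Q.Ten →ₗ[K] R.Ten) : Q.Ten →ₗ[K] R.Ten :=
  LinearMap.mul' K R.Ten ∘ₗ TensorProduct.map α β ∘ₗ Q.split r t

/-- The automorphism `x ↦ (-1)^{|x|} x` of the total space. -/
def parityTot (Q : GradedQuiver K) : Q.Tot →ₗ[K] Q.Tot :=
  DirectSum.toModule K _ _ fun p => ((p.2.2.negOnePow : ℤ) : K) • Q.of p.1 p.2.1 p.2.2

/-- The Koszul sign of moving a map of degree `e` past tensors: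
`x₁ ⊗ ⋯ ⊗ x_r ↦ (-1)^{e (|x₁| + ⋯ + |x_r|)} x₁ ⊗ ⋯ ⊗ x_r`.  It depends on the parity of `e` only. -/
def koszul (Q : GradedQuiver K) (e : ℕ) : Q.Ten →ₗ[K] Q.Ten :=
  if Even e then LinearMap.id else
    (TensorAlgebra.lift K (TensorAlgebra.ι K ∘ₗ Q.parityTot)).toLinearMap

/-- A family of multilinear maps with `n + 1` arguments and of degree `e`: for any objects
`x₀, …, x_{n+1}`, a map `Q(x₀, x₁) ⊗ ⋯ ⊗ Q(x_n, x_{n+1}) → R(φ x₀, φ x_{n+1})` of degree `e`. -/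
def Family (Q R : GradedQuiver K) (φ : Q.Ob → R.Ob) (n : ℕ) (e : ℤ) : Type u :=
  ∀ (x : Fin (n + 2) → Q.Ob) (d : Fin (n + 1) → ℤ),
    MultilinearMap K (fun i : Fin (n + 1) => Q.Hom (x i.castSucc) (x i.succ) (d i))
      (R.Hom (φ (x 0)) (φ (x (Fin.last (n + 1)))) (∑ i, d i + e))

/-- The sequence of objects that a composable sequence of pairs of objects passes through. -/
def verts (Q : GradedQuiver K) {n : ℕ} (p : Fin (n + 1) → Q.Ob × Q.Ob × ℤ) : Fin (n + 2) → Q.Ob :=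
  Fin.cons (p 0).1 fun i => (p i).2.1

theorem verts_castSucc (Q : GradedQuiver K) {n : ℕ} (p : Fin (n + 1) → Q.Ob × Q.Ob × ℤ)
    (h : ∀ i : Fin n, (p i.castSucc).2.1 = (p i.succ).1) (i : Fin (n + 1)) :
    (p i).1 = Q.verts p i.castSucc := by
  refine Fin.cases rfl (fun j => ?_) i
  rw [← h j]
  rfl

/-- The identification `Q_d(x, y) = Q_d(x', y)` for `x = x'`. -/
def castSrc (Q : GradedQuiver K) {x x' y : Q.Ob} {d : ℤ} (h : x = x') :
    Q.Hom x y d →ₗ[K] Q.Hom x' y d :=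
  h ▸ LinearMap.id

/-- The extension of a family to a multilinear map of total spaces, which is `0` on sequences of
elements that are not composable. -/
def Family.total {Q R : GradedQuiver K} {φ : Q.Ob → R.Ob} {n : ℕ} {e : ℤ}
    (μ : Family Q R φ n e) : MultilinearMap K (fun _ : Fin (n + 1) => Q.Tot) R.Tot :=
  MultilinearMap.fromDFinsuppEquiv (fun _ : Fin (n + 1) => Q.Ob × Q.Ob × ℤ) K
    (M := fun _ p => Q.Hom p.1 p.2.1 p.2.2)
    fun p =>
      if h : ∀ i : Fin n, (p i.castSucc).2.1 = (p i.succ).1 then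
        (R.of _ _ _).compMultilinearMap
          ((μ (Q.verts p) fun i => (p i).2.2).compLinearMap fun i =>
            Q.castSrc (Q.verts_castSucc p h i))
      else 0

/-- The map of tensors `Q.Ten → R.Tot` given by a family with `n + 1` arguments on tensors of
length `n + 1`, and `0` on tensors of other lengths. -/
def Family.onTen {Q R : GradedQuiver K} {φ : Q.Ob → R.Ob} {n : ℕ} {e : ℤ}
    (μ : Family Q R φ n e) : Q.Ten →ₗ[K] R.Tot :=
  PiTensorProduct.lift μ.total ∘ₗ
    DirectSum.component K ℕ (fun n => ⨂[K]^n Q.Tot) (n + 1) ∘ₗ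
    TensorAlgebra.toDirectSum.toLinearMap

end GradedQuiver

/-! ## Strictly unital `A_∞`-categories -/

/-- The data of a strictly unital `A_∞`-category: objects, graded vector spaces of morphisms,
multiplications and identities.  Here `mul n` is the multiplication `m_{n+1}`, which has `n + 1`
arguments and degree `(n + 1) - 2`. -/
structure AInfData (K : Type u) [Field K] extends GradedQuiver K where
  mul : ∀ n : ℕ, GradedQuiver.Family toGradedQuiver toGradedQuiver (fun x => x) n ((n : ℤ) - 1)
  one : ∀ x : Ob, Hom x x 0

namespace AInfData

variable {K : Type u} [Field K]

/-- The multiplication `m_k`, for `k ≥ 1`, as a map of tensors. -/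
def m (A : AInfData K) : ℕ → (A.Ten →ₗ[K] A.Tot)
  | 0 => 0
  | n + 1 => (A.mul n).onTen

/-- The map `id^{⊗ r} ⊗ m_s ⊗ id^{⊗ t}` on tensors of length `r + s + t`, with the Koszul sign
`(-1)^{(s - 2) (|x₁| + ⋯ + |x_r|)}` on elements. -/
def midMul (A : AInfData K) (r s t : ℕ) : A.Ten →ₗ[K] A.Ten :=
  GradedQuiver.tens r (s + t) (A.koszul s)
    (GradedQuiver.tens s t (TensorAlgebra.ι K ∘ₗ A.m s) LinearMap.id)

end AInfData

/-- A strictly unital `A_∞`-category. -/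
structure AInfCat (K : Type u) [Field K] extends AInfData K where
  /-- `∑_{r + s + t = k} (-1)^{r + s t} m_{r + 1 + t} (id^{⊗ r} ⊗ m_s ⊗ id^{⊗ t}) = 0`. -/
  rel : ∀ k : ℕ, 1 ≤ k → toAInfData.EqOnPaths k
    (∑ v ∈ (Finset.Nat.antidiagonalTuple 3 k).filter (fun v => 0 < v 1),
      (-1 : K) ^ (v 0 + v 1 * v 2) •
        (toAInfData.m (v 0 + 1 + v 2) ∘ₗ toAInfData.midMul (v 0) (v 1) (v 2))) 0
  one_cycle : ∀ x, toAInfData.m 1 (toAInfData.el (one x)) = 0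
  one_mul : ∀ (x y : Ob) (d : ℤ) (v : Hom x y d),
    toAInfData.m 2 (toAInfData.el (one x) * toAInfData.el v) = toAInfData.of x y d v
  mul_one : ∀ (x y : Ob) (d : ℤ) (v : Hom x y d),
    toAInfData.m 2 (toAInfData.el v * toAInfData.el (one y)) = toAInfData.of x y d v
  mul_unit : ∀ (k : ℕ), 2 < k → ∀ (x : Ob) (X Y : toAInfData.Ten),
    toAInfData.m k (X * toAInfData.el (one x) * Y) = 0

/-- The data of an `A_∞`-functor: a map of objects, and multilinear maps.  Here `comps n` is the
component `f_{n+1}`, which has `n + 1` arguments and degree `(n + 1) - 1`. -/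
@[ext]
structure AInfFunctorData {K : Type u} [Field K] (A B : AInfData K) where
  obj : A.Ob → B.Ob
  comps : ∀ n : ℕ, GradedQuiver.Family A.toGradedQuiver B.toGradedQuiver obj n (n : ℤ)

namespace AInfFunctorData

variable {K : Type u} [Field K] {A B : AInfData K}

/-- The component `f_k`, for `k ≥ 1`, as a map of tensors. -/
def F (f : AInfFunctorData A B) : ℕ → (A.Ten →ₗ[K] B.Tot)
  | 0 => 0
  | n + 1 => (f.comps n).onTen

/-- The map `f_{i₁} ⊗ ⋯ ⊗ f_{i_r}` on tensors of length `i₁ + ⋯ + i_r`, with the Koszul sign on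
elements: `(f ⊗ g)(X ⊗ Y) = (-1)^{|g| |X|} f(X) ⊗ g(Y)`, where `f_{i₂} ⊗ ⋯ ⊗ f_{i_r}` has degree
`(i₂ - 1) + ⋯ + (i_r - 1)`.  For `r = 0`, it is the identity of `K`. -/
def tensF (f : AInfFunctorData A B) : List ℕ → (A.Ten →ₗ[K] B.Ten)
  | [] => Algebra.linearMap K B.Ten ∘ₗ TensorAlgebra.algebraMapInv.toLinearMap
  | i :: is =>
    GradedQuiver.tens i is.sum
      (TensorAlgebra.ι K ∘ₗ f.F i ∘ₗ A.koszul (is.map fun j => j - 1).sum) (f.tensF is)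

end AInfFunctorData

/-- An `A_∞`-functor between strictly unital `A_∞`-categories. -/
@[ext]
structure AInfFunctor {K : Type u} [Field K] (A B : AInfCat K) extends
    AInfFunctorData A.toAInfData B.toAInfData where
  /-- `∑_{r + s + t = k} (-1)^{r + s t} f_{r + 1 + t} (id^{⊗ r} ⊗ m_s ⊗ id^{⊗ t})
    = ∑_{i₁ + ⋯ + i_r = k} (-1)^{ε_g(i₁, …, i_r)} m_r (f_{i₁} ⊗ ⋯ ⊗ f_{i_r})`. -/
  rel : ∀ k : ℕ, 1 ≤ k → A.EqOnPaths k
    (∑ v ∈ (Finset.Nat.antidiagonalTuple 3 k).filter (fun v => 0 < v 1),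
      (-1 : K) ^ (v 0 + v 1 * v 2) •
        (toAInfFunctorData.F (v 0 + 1 + v 2) ∘ₗ A.midMul (v 0) (v 1) (v 2)))
    (∑ c : Composition k, (-1 : K) ^ epsG c.blocks •
      (B.m c.length ∘ₗ toAInfFunctorData.tensF c.blocks))
  unit : ∀ x, toAInfFunctorData.F 1 (A.el (A.one x)) = B.of _ _ 0 (B.one (obj x))
  higher_unit : ∀ (k : ℕ), 1 < k → ∀ (x : A.Ob) (X Y : A.Ten),
    toAInfFunctorData.F k (X * A.el (A.one x) * Y) = 0

/-- `f` is the identity `A_∞`-functor: it is the identity on objects, `f₁ = id`, and `f_k = 0` for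
`k > 1`. -/
def AInfFunctor.IsId {K : Type u} [Field K] {A : AInfCat K} (f : AInfFunctor A A) : Prop :=
  (∀ x, f.obj x = x) ∧
  (∀ (x y : A.Ob) (d : ℤ) (v : A.Hom x y d), f.F 1 (A.el v) = A.of x y d v) ∧
  ∀ k, 1 < k → f.F k = 0

/-- `h` is the composite `g ∘ f` of `A_∞`-functors: `h₀ = g₀ ∘ f₀`, and
`h_k = ∑_{i₁ + ⋯ + i_r = k} (-1)^{ε_g(i₁, …, i_r)} g_r (f_{i₁} ⊗ ⋯ ⊗ f_{i_r})` for `k ≥ 1`. -/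
def AInfFunctor.IsComp {K : Type u} [Field K] {A B C : AInfCat K} (f : AInfFunctor A B)
    (g : AInfFunctor B C) (h : AInfFunctor A C) : Prop :=
  (∀ x, h.obj x = g.obj (f.obj x)) ∧
  ∀ k, 1 ≤ k → A.EqOnPaths k (h.F k) (∑ c : Composition k, (-1 : K) ^ epsG c.blocks •
    (g.F c.length ∘ₗ f.tensF c.blocks))

/-- The category of strictly unital `A_∞`-categories and `A_∞`-functors, given its identities and its
composition. -/
@[reducible]
def ainfCategory (K : Type u) [Field K]
    (idF : ∀ A : AInfCat K, AInfFunctor A A)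
    (compF : ∀ {A B C : AInfCat K}, AInfFunctor A B → AInfFunctor B C → AInfFunctor A C)
    (id_comp : ∀ {A B : AInfCat K} (f : AInfFunctor A B), compF (idF A) f = f)
    (comp_id : ∀ {A B : AInfCat K} (f : AInfFunctor A B), compF f (idF B) = f)
    (assoc : ∀ {A B C D : AInfCat K} (f : AInfFunctor A B) (g : AInfFunctor B C)
      (h : AInfFunctor C D), compF (compF f g) h = compF f (compF g h)) :
    Category.{u} (AInfCat K) where
  Hom := AInfFunctor
  id := idF
  comp := compF
  id_comp := id_comp
  comp_id := comp_id
  assoc := assoc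

/-! ## The families indexed by injective necklace maps -/

/-- The pairs `(n_i, m_i)` of dimensions of the maps of beads `e_i : Δ^{n_i} ⟶ Δ^{m_i}` of an active
necklace map `e = e₁ ∨ ⋯ ∨ e_l`. -/
def beadDims {U V : Nec} (e : U ⟶ V) : List (ℕ × ℕ) :=
  List.ofFn fun i : Fin U.T.length =>
    (U.T.blocksFun i,
      (e.toFun (U.T.boundary ⟨i.val + 1, U.T.lt_length i⟩)).val -
        (e.toFun (U.T.boundary ⟨i.val, U.T.lt_length' i⟩)).val)

namespace AInfCat

variable {K : Type u} [Field K]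

/-- The map of tensors `ē = ē₁ ⊗ ⋯ ⊗ ē_l` of an active surjective necklace map `e = e₁ ∨ ⋯ ∨ e_l`, on
tensors that start at the object `c`, where `e_i : Δ^{n_i} ⟶ Δ^{m_i}`, and the `(n_i, m_i)` are given
as a list.  Here `ē_i` is the unit for `Δ^1 ⟶ Δ^0`, the identity if `e_i` is an identity, that is for
`n_i = m_i`, and `0` otherwise. The tensor that `ē` is applied to has one factor for every `i` with
`m_i ≠ 0`. -/
def degen (A : AInfCat K) : A.Ob → List (ℕ × ℕ) → (A.Ten →ₗ[K] A.Ten)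
  | _, [] => Algebra.linearMap K A.Ten ∘ₗ TensorAlgebra.algebraMapInv.toLinearMap
  | c, (n, m) :: L =>
    if n = m then
      TensorProduct.lift
        (DirectSum.toModule K _ _ fun p : A.Ob × A.Ob × ℤ =>
          LinearMap.lcomp K A.Ten (A.degen p.2.1 L) ∘ₗ LinearMap.mul K A.Ten ∘ₗ
            TensorAlgebra.ι K ∘ₗ A.of p.1 p.2.1 p.2.2) ∘ₗ
      TensorProduct.map TensorAlgebra.ιInv LinearMap.id ∘ₗ
      A.split 1 (L.filter fun q => q.2 ≠ 0).length
    else if n = 1 ∧ m = 0 then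
      LinearMap.mulLeft K (A.el (A.one c)) ∘ₗ A.degen c L
    else 0

/-- The map `f^*` of families indexed by injective necklace maps, for a necklace map `h : T ⟶ T'`:
if `h ∘ g = g' ∘ e` with `e` active surjective and `g'` injective, then `(h^* y)_g = ē (y_{g'})`.
It acts on families with values in tensors that start at `a`. -/
def pull (A : AInfCat K) {T T' : Nec} (h : T ⟶ T') (a : A.Ob) (y : NecSub T' → A.Ten) :
    NecSub T → A.Ten :=
  fun g => A.degen a (beadDims (Nec.imageEpi (g.hom ≫ h))) (y (NecSub.ofMap (g.hom ≫ h)))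

/-- The (TAN) relation at an injective necklace map `g : U ↪ T`, where `U = Δ^{n₁} ∨ ⋯ ∨ Δ^{n_l}`. -/
def TAN (A : AInfCat K) {T : Nec} (y : NecSub T → A.Ten) (g : NecSub T) : Prop :=
  ∑ k : Fin g.dom.T.length, ∑ S : CompositionAsSet (g.dom.T.blocksFun k),
    (-1 : K) ^ (epsG S.blocks + g.dom.phi (g.dom.atBead k S)) •
      A.midMul k.val S.length (g.dom.T.length - 1 - k.val) (y (g.inert (g.dom.atBead k S))) =
  ∑ i : {i : Fin (g.dom.p + 1) // i ∉ g.dom.T.boundaries},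
    (-1 : K) ^ (Finset.univ.filter fun i' : Fin (g.dom.p + 1) =>
      i' ∉ g.dom.T.boundaries ∧ i' < i.1).card • y (g.face i.1 i.2)

/-- The space `N_T(a, b)` of families `(y_g)` indexed by the injective necklace maps `g : U ↪ T`, with
`y_g ∈ (sA)_U(a, b)`, that satisfy the (TAN) relations.  (There are finitely many such `g`.) -/
def nerve (A : AInfCat K) (T : Nec) (a b : A.Ob) : Submodule K (NecSub T → A.Ten) where
  carrier := {y | (∀ g, y g ∈ A.shiftTen g.dom.T.blocks a b) ∧ ∀ g, A.TAN y g}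
  add_mem' := by
    rintro y z ⟨hy, hy'⟩ ⟨hz, hz'⟩
    refine ⟨fun g => Submodule.add_mem _ (hy g) (hz g), fun g => ?_⟩
    have h1 := hy' g
    have h2 := hz' g
    unfold TAN at h1 h2 ⊢
    simp only [Pi.add_apply, map_add, smul_add, Finset.sum_add_distrib, h1, h2]
  zero_mem' := by
    refine ⟨fun g => Submodule.zero_mem _, fun g => ?_⟩
    unfold TAN
    simp only [Pi.zero_apply, map_zero, smul_zero, Finset.sum_const_zero]
  smul_mem' := by
    rintro c y ⟨hy, hy'⟩
    refine ⟨fun g => Submodule.smul_mem _ c (hy g), fun g => ?_⟩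
    have h1 := hy' g
    unfold TAN at h1 ⊢
    simp only [Pi.smul_apply, map_smul, smul_comm _ c, ← Finset.smul_sum, h1]

/-- For `x ⊗ y` in `N_{T₁}(a, c) ⊗ N_{T₂}(c, b)`, the component `x_{g₁} ⊗ y_{g₂}` at `g₁ ∨ g₂` of the
canonical map `⨁_c N_{T₁}(a, c) ⊗ N_{T₂}(c, b) → ⨁_{g : U ↪ T₁ ∨ T₂} (sA)_U(a, b)`. -/
def wedgeAt (A : AInfCat K) {T₁ T₂ : Nec} (a b : A.Ob) (g₁ : NecSub T₁) (g₂ : NecSub T₂) :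
    (⨁ c, (A.nerve T₁ a c) ⊗[K] (A.nerve T₂ c b)) →ₗ[K] A.Ten :=
  DirectSum.toModule K A.Ob _ fun c =>
    TensorProduct.lift ((LinearMap.mul K A.Ten).compl₁₂
      (LinearMap.proj g₁ ∘ₗ (A.nerve T₁ a c).subtype)
      (LinearMap.proj g₂ ∘ₗ (A.nerve T₂ c b).subtype))

end AInfCat

/-- The map `f_T` on families, for an `A_∞`-functor `f`:
`f_T(y)_g = ∑_ν (-1)^{ε(S₁) + ⋯ + ε(S_l) + φ(ν)} (f_{ℓ(S₁)} ⊗ ⋯ ⊗ f_{ℓ(S_l)})(y_{g ∘ ν})`, where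
`g : U ↪ T`, and the sum is over the inert maps `ν : S₁ ∨ ⋯ ∨ S_l ↪ U`. -/
def AInfFunctor.push {K : Type u} [Field K] {A B : AInfCat K} (f : AInfFunctor A B) {T : Nec}
    (y : NecSub T → A.Ten) : NecSub T → B.Ten :=
  fun g => ∑ S : (∀ k : Fin g.dom.T.length, CompositionAsSet (g.dom.T.blocksFun k)),
    (-1 : K) ^ ((∑ k, epsG (S k).blocks) + g.dom.phi S) •
      f.tensF (List.ofFn fun k => (S k).length) (y (g.inert S))

/-! ## Templicial vector spaces -/

section Templicial

variable {K : Type u} [Field K]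

/-- The component at `(a, b)` of the associator `(P ⊗_O Q) ⊗_O R ≅ P ⊗_O (Q ⊗_O R)` of linear quivers,
where `(P ⊗_O Q)(a, b) = ⨁_c P(a, c) ⊗ Q(c, b)`. -/
def quivAssoc {O : Type u} (P Q R : O → O → ModuleCat.{u} K) (a b : O) :
    (⨁ c, (⨁ d, P a d ⊗[K] Q d c) ⊗[K] R c b) →ₗ[K]
      (⨁ d, P a d ⊗[K] (⨁ c, Q d c ⊗[K] R c b)) :=
  DirectSum.toModule K O _ fun c => TensorProduct.lift
    (DirectSum.toModule K O _ fun d => TensorProduct.curry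
      (DirectSum.lof K O (fun d => P a d ⊗[K] (⨁ c, Q d c ⊗[K] R c b)) d ∘ₗ
        LinearMap.lTensor (P a d) (DirectSum.lof K O (fun c => Q d c ⊗[K] R c b) c) ∘ₗ
        (TensorProduct.assoc K (P a d) (Q d c) (R c b)).toLinearMap))

/-- The map of tensor products of quivers given by quiver maps over a map of objects `φ`. -/
def quivMap {O O' : Type u} (φ : O → O') {P Q : O → O → ModuleCat.{u} K}
    {P' Q' : O' → O' → ModuleCat.{u} K}
    (α : ∀ a b, P a b →ₗ[K] P' (φ a) (φ b)) (β : ∀ a b, Q a b →ₗ[K] Q' (φ a) (φ b)) (a b : O) :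
    (⨁ c, P a c ⊗[K] Q c b) →ₗ[K] ⨁ c, P' (φ a) c ⊗[K] Q' c (φ b) :=
  DirectSum.toModule K O _ fun c =>
    DirectSum.lof K O' (fun c => P' (φ a) c ⊗[K] Q' c (φ b)) (φ c) ∘ₗ
      TensorProduct.map (α a c) (β c b)

/-- The structure of a templicial vector space with object set `O` on linear quivers `X_n`: a strongly
unital colax monoidal functor from the opposite of the category of finite intervals to linear quivers
on `O`, with value `X_n` at `[n]`. -/
structure TemplicialStr {O : Type u} (X : ℕ → O → O → ModuleCat.{u} K) where
  /-- the functor, on morphisms -/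
  map : ∀ {m n : ℕ} (_ : EndHom m n) (a b : O), X n a b →ₗ[K] X m a b
  map_id : ∀ (n : ℕ) (a b : O), map (EndHom.id n) a b = LinearMap.id
  map_comp : ∀ {m n k : ℕ} (f : EndHom m n) (g : EndHom n k) (a b : O),
    map (f.comp g) a b = map f a b ∘ₗ map g a b
  /-- the comultiplications `X_{p+q} → X_p ⊗_O X_q` -/
  comul : ∀ (p q : ℕ) (a b : O), X (p + q) a b →ₗ[K] ⨁ c, X p a c ⊗[K] X q c b
  comul_map : ∀ {p p' q q' : ℕ} (f : EndHom p p') (g : EndHom q q') (a b : O),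
    comul p q a b ∘ₗ map (f.add g) a b =
      quivMap (fun c => c) (map f) (map g) a b ∘ₗ comul p' q' a b
  coassoc : ∀ (p q r : ℕ) (a b : O),
    quivAssoc (X p) (X q) (X r) a b ∘ₗ
        DirectSum.lmap (fun c => LinearMap.rTensor (X r c b) (comul p q a c)) ∘ₗ
        comul (p + q) r a b ∘ₗ map (EndHom.ofEq (Nat.add_assoc p q r)) a b =
      DirectSum.lmap (fun c => LinearMap.lTensor (X p a c) (comul q r c b)) ∘ₗ
        comul p (q + r) a b
  /-- the counit `X_0 → K_O`, where `K_O(a, b)` is `K` for `a = b`, and `0` otherwise -/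
  counit : ∀ a : O, X 0 a a →ₗ[K] K
  counit_left : ∀ (n : ℕ) (a b : O),
    (TensorProduct.lid K (X n a b)).toLinearMap ∘ₗ LinearMap.rTensor (X n a b) (counit a) ∘ₗ
        DirectSum.component K O (fun c => X 0 a c ⊗[K] X n c b) a ∘ₗ
        comul 0 n a b ∘ₗ map (EndHom.ofEq (Nat.zero_add n)) a b = LinearMap.id
  counit_right : ∀ (n : ℕ) (a b : O),
    (TensorProduct.rid K (X n a b)).toLinearMap ∘ₗ LinearMap.lTensor (X n a b) (counit b) ∘ₗ
        DirectSum.component K O (fun c => X n a c ⊗[K] X 0 c b) b ∘ₗ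
        comul n 0 a b = LinearMap.id
  /-- the counit is an isomorphism at `(a, a)` -/
  counit_bijective : ∀ a, Function.Bijective (counit a)
  /-- the counit is an isomorphism at `(a, b)` for `a ≠ b` -/
  counit_off_diagonal : ∀ a b, a ≠ b → Subsingleton (X 0 a b)

variable (K) in
/-- A templicial vector space. -/
structure TemplicialVect where
  Ob : Type u
  X : ℕ → Ob → Ob → ModuleCat.{u} K
  str : TemplicialStr X

/-- A map of templicial vector spaces: a map of objects, and quiver maps over it that are natural and
compatible with the comultiplications and the counits. -/
@[ext]
structure TemplicialHom (X Y : TemplicialVect K) where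
  obj : X.Ob → Y.Ob
  app : ∀ (n : ℕ) (a b : X.Ob), X.X n a b →ₗ[K] Y.X n (obj a) (obj b)
  naturality : ∀ {m n : ℕ} (f : EndHom m n) (a b : X.Ob),
    app m a b ∘ₗ X.str.map f a b = Y.str.map f (obj a) (obj b) ∘ₗ app n a b
  comul : ∀ (p q : ℕ) (a b : X.Ob),
    quivMap obj (app p) (app q) a b ∘ₗ X.str.comul p q a b =
      Y.str.comul p q (obj a) (obj b) ∘ₗ app (p + q) a b
  counit : ∀ a : X.Ob, Y.str.counit (obj a) ∘ₗ app 0 a a = X.str.counit a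

theorem quivMap_id {O : Type u} {P Q : O → O → ModuleCat.{u} K} (a b : O) :
    quivMap (fun c => c) (P := P) (Q := Q) (fun _ _ => LinearMap.id) (fun _ _ => LinearMap.id) a b =
      LinearMap.id := by
  refine DirectSum.linearMap_ext _ fun c => ?_
  ext x y
  simp [quivMap]

theorem quivMap_comp {O O' O'' : Type u} (φ : O → O') (ψ : O' → O'')
    {P Q : O → O → ModuleCat.{u} K} {P' Q' : O' → O' → ModuleCat.{u} K}
    {P'' Q'' : O'' → O'' → ModuleCat.{u} K}
    (α : ∀ a b, P a b →ₗ[K] P' (φ a) (φ b)) (β : ∀ a b, Q a b →ₗ[K] Q' (φ a) (φ b))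
    (α' : ∀ a b, P' a b →ₗ[K] P'' (ψ a) (ψ b)) (β' : ∀ a b, Q' a b →ₗ[K] Q'' (ψ a) (ψ b))
    (a b : O) :
    quivMap (fun c => ψ (φ c)) (P := P) (Q := Q) (P' := P'') (Q' := Q'')
        (fun a b => α' (φ a) (φ b) ∘ₗ α a b) (fun a b => β' (φ a) (φ b) ∘ₗ β a b) a b =
      quivMap ψ α' β' (φ a) (φ b) ∘ₗ quivMap φ α β a b := by
  refine DirectSum.linearMap_ext _ fun c => ?_
  ext x y
  simp [quivMap]

instance : Category (TemplicialVect K) where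
  Hom := TemplicialHom
  id X :=
    { obj := fun a => a
      app := fun _ _ _ => LinearMap.id
      naturality := fun _ _ _ => rfl
      comul := fun p q a b => by rw [quivMap_id]; rfl
      counit := fun _ => rfl }
  comp {X Y Z} f g :=
    { obj := fun a => g.obj (f.obj a)
      app := fun n a b => g.app n (f.obj a) (f.obj b) ∘ₗ f.app n a b
      naturality := fun h a b => by
        rw [LinearMap.comp_assoc, f.naturality, ← LinearMap.comp_assoc, g.naturality,
          LinearMap.comp_assoc]
      comul := fun p q a b => by
        rw [quivMap_comp f.obj g.obj, LinearMap.comp_assoc, f.comul, ← LinearMap.comp_assoc,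
          g.comul, LinearMap.comp_assoc]
      counit := fun a => by
        rw [← LinearMap.comp_assoc, g.counit, f.counit] }
  id_comp _ := rfl
  comp_id _ := rfl
  assoc _ _ _ := rfl

end Templicial

/-- The linear quivers `N_{Δ^n}`. -/
def AInfCat.nerveQuiver {K : Type u} [Field K] (A : AInfCat K) (n : ℕ) (a b : A.Ob) :
    ModuleCat.{u} K :=
  ModuleCat.of K (A.nerve (Nec.simplex n) a b)

end

noncomputable section

section

open List (map_cons length_map map_append append_assoc cons_append length_flatten length_cons
  sum_cons length_append nil_append map_congr_left take_append_drop flatten_cons mem_map map_ofFn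
  singleton_append filter_map ext_getElem filter_cons_of_neg filter_cons_of_pos map_nil
  length_pos_iff)
open LinearMap (rTensor lTensor mulLeft mulRight mulLeft_apply mulRight_apply)
open TensorAlgebra (ι ιInv)
open Finset (sum_congr)
open Finset.HasAntidiagonal (antidiagonal)

variable {K : Type u} [Field K]

open NecSub (wedge ofMap)
open Nec (simplex wedgeMap splitMap simplexMap atBead)

/-! ## Sums over decompositions of lists -/

section ListSums

variable {α β M N : Type*} [AddCommMonoid M] [AddCommMonoid N]

/-- The sum of `f u v` over all decompositions `L = u ++ v`. -/
def dsum : (List α → List α → M) → List α → M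
  | f, [] => f [] []
  | f, h :: t => f [] (h :: t) + dsum (fun u v => f (h :: u) v) t

@[simp] theorem dsum_nil (f : List α → List α → M) : dsum f [] = f [] [] := rfl

theorem dsum_cons (f : List α → List α → M) (h : α) (t : List α) :
    dsum f (h :: t) = f [] (h :: t) + dsum (fun u v => f (h :: u) v) t := rfl

theorem dsum_congr {f g : List α → List α → M} {L : List α}
    (h : ∀ u v, u ++ v = L → f u v = g u v) : dsum f L = dsum g L := by
  induction L generalizing f g with
  | nil => exact h _ _ rfl
  | cons a t ih =>
    rw [dsum_cons, dsum_cons, h [] (a :: t) rfl]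
    grind

theorem map_dsum (φ : M →+ N) (f : List α → List α → M) (L : List α) :
    φ (dsum f L) = dsum (fun u v => φ (f u v)) L := by
  induction L generalizing f with
  | nil => rfl
  | cons a t ih => rw [dsum_cons, dsum_cons, map_add, ih]

theorem lmap_dsum {R : Type*} [Semiring R] [Module R M] [Module R N] (φ : M →ₗ[R] N)
    (f : List α → List α → M) (L : List α) :
    φ (dsum f L) = dsum (fun u v => φ (f u v)) L :=
  map_dsum φ.toAddMonoidHom f L

theorem dsum_add (f g : List α → List α → M) (L : List α) :
    dsum (fun u v => f u v + g u v) L = dsum f L + dsum g L := by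
  induction L generalizing f g with
  | nil => rfl
  | cons a t ih => rw [dsum_cons, dsum_cons, dsum_cons, ih]; abel

theorem dsum_zero (L : List α) : dsum (fun _ _ => (0 : M)) L = 0 := by
  induction L with
  | nil => rfl
  | cons a t ih => rw [dsum_cons, ih, add_zero]

theorem dsum_smul {R : Type*} [Semiring R] [Module R M] (c : R) (f : List α → List α → M)
    (L : List α) : dsum (fun u v => c • f u v) L = c • dsum f L :=
  (map_dsum (DistribSMul.toAddMonoidHom M c) f L).symm

theorem dsum_assoc (f : List α → List α → List α → M) (L : List α) :
    dsum (fun w v => dsum (fun u₁ u₂ => f u₁ u₂ v) w) L =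
      dsum (fun u w => dsum (fun v₁ v₂ => f u v₁ v₂) w) L := by
  induction L generalizing f with
  | nil => rfl
  | cons a t ih =>
    simp only [dsum_cons, dsum_nil, dsum_add, ih, add_assoc]

theorem dsum_snoc_nil (f : List α → List α → M) (h : α) (t : List α)
    (hf : ∀ u v, u ++ v = h :: t → u ≠ [] → f u v = 0) : dsum f (h :: t) = f [] (h :: t) := by
  rw [dsum_cons, dsum_congr (g := fun _ _ => 0), dsum_zero, add_zero]
  grind

theorem sum_antidiagonal_eq_dsum (f : List α → List α → M) (L : List α) :
    ∑ ij ∈ antidiagonal L.length, f (L.take ij.1) (L.drop ij.1) = dsum f L := by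
  induction L generalizing f with
  | nil => simp
  | cons a t ih =>
    rw [length_cons, Finset.Nat.sum_antidiagonal_succ, dsum_cons, ← ih]
    simp

/-- The sum of `f u x v` over all decompositions `L = u ++ x :: v`. -/
def psum : (List α → α → List α → M) → List α → M
  | _, [] => 0
  | f, h :: t => f [] h t + psum (fun u x v => f (h :: u) x v) t

@[simp] theorem psum_nil (f : List α → α → List α → M) : psum f [] = 0 := rfl

theorem psum_cons (f : List α → α → List α → M) (h : α) (t : List α) :
    psum f (h :: t) = f [] h t + psum (fun u x v => f (h :: u) x v) t := rfl

theorem psum_congr {f g : List α → α → List α → M} {L : List α}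
    (h : ∀ u x v, u ++ x :: v = L → f u x v = g u x v) : psum f L = psum g L := by
  induction L generalizing f g with
  | nil => rfl
  | cons a t ih =>
    rw [psum_cons, psum_cons, h [] a t rfl]
    grind

theorem map_psum (φ : M →+ N) (f : List α → α → List α → M) (L : List α) :
    φ (psum f L) = psum (fun u x v => φ (f u x v)) L := by
  induction L generalizing f with
  | nil => exact map_zero φ
  | cons a t ih => rw [psum_cons, psum_cons, map_add, ih]

theorem lmap_psum {R : Type*} [Semiring R] [Module R M] [Module R N] (φ : M →ₗ[R] N)
    (f : List α → α → List α → M) (L : List α) :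
    φ (psum f L) = psum (fun u x v => φ (f u x v)) L :=
  map_psum φ.toAddMonoidHom f L

theorem psum_append (f : List α → α → List α → M) (L₁ L₂ : List α) :
    psum f (L₁ ++ L₂) = psum (fun u x v => f u x (v ++ L₂)) L₁ +
      psum (fun u x v => f (L₁ ++ u) x v) L₂ := by
  induction L₁ generalizing f with
  | nil => simp
  | cons a t ih => simp only [cons_append, psum_cons, ih, add_assoc]

theorem psum_map (φ : β → α) (f : List α → α → List α → M) (L : List β) :
    psum f (L.map φ) = psum (fun u x v => f (u.map φ) (φ x) (v.map φ)) L := by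
  induction L generalizing f with
  | nil => rfl
  | cons a t ih => simp only [map_cons, psum_cons, ih, map_nil]

theorem dsum_eq_psum (f : List α → List α → M) (L : List α) :
    dsum f L = psum (fun u x v => f u (x :: v)) L + f L [] := by
  induction L generalizing f with
  | nil => simp
  | cons a t ih => rw [dsum_cons, psum_cons, ih, add_assoc]

theorem sum_fin_eq_psum (f : List α → α → List α → M) (L : List α) :
    ∑ k : Fin L.length, f (L.take k) (L.get k) (L.drop (k + 1)) = psum f L := by
  induction L generalizing f with
  | nil => simp
  | cons a t ih =>
    simp only [length_cons, psum_cons, ← ih, Fin.sum_univ_succ]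
    simp

/-- Auxiliary recursion for `csum`: `cur` is the part that is being built. -/
def csumAux : (List (List α) → M) → List α → List α → M
  | f, cur, [] => f [cur]
  | f, cur, h :: t => csumAux (fun S => f (cur :: S)) [h] t + csumAux f (cur ++ [h]) t

/-- The sum of `f S` over all decompositions `S` of a list into nonempty parts. -/
def csum : (List (List α) → M) → List α → M
  | f, [] => f []
  | f, h :: t => csumAux f [h] t

@[simp] theorem csum_nil (f : List (List α) → M) : csum f [] = f [] := rfl

theorem csumAux_eq (f : List (List α) → M) (cur t : List α) :
    csumAux f cur t = dsum (fun u v => csum (fun S => f ((cur ++ u) :: S)) v) t := by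
  induction t generalizing f cur with
  | nil => simp [csumAux]
  | cons h t ih =>
    rw [csumAux, ih, ih, dsum_cons, csum, ih]
    simp

theorem csum_cons (f : List (List α) → M) (h : α) (t : List α) :
    csum f (h :: t) = dsum (fun u v => csum (fun S => f ((h :: u) :: S)) v) t :=
  csumAux_eq f [h] t

theorem csum_congr {f g : List (List α) → M} {L : List α}
    (h : ∀ S : List (List α), S.flatten = L → (∀ s ∈ S, s ≠ []) → f S = g S) :
    csum f L = csum g L := by
  match L, h with
  | [], h => exact h [] rfl (by simp)
  | a :: t, h =>
    rw [csum_cons, csum_cons]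
    refine dsum_congr fun u v huv => csum_congr fun S hS hS' => h _ ?_ ?_
    · simp [hS, huv]
    · simpa using hS'
termination_by L.length
decreasing_by simp [← huv]

theorem map_csum (φ : M →+ N) (f : List (List α) → M) (L : List α) :
    φ (csum f L) = csum (fun S => φ (f S)) L := by
  match L with
  | [] => rfl
  | a :: t =>
    rw [csum_cons, csum_cons, map_dsum]
    exact dsum_congr fun u v huv => map_csum φ _ v
termination_by L.length
decreasing_by simp [← huv]

theorem lmap_csum {R : Type*} [Semiring R] [Module R M] [Module R N] (φ : M →ₗ[R] N)
    (f : List (List α) → M) (L : List α) :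
    φ (csum f L) = csum (fun S => φ (f S)) L :=
  map_csum φ.toAddMonoidHom f L

theorem csum_add (f g : List (List α) → M) (L : List α) :
    csum (fun S => f S + g S) L = csum f L + csum g L := by
  match L with
  | [] => rfl
  | a :: t =>
    rw [csum_cons, csum_cons, csum_cons, ← dsum_add]
    exact dsum_congr fun u v huv => csum_add _ _ v
termination_by L.length
decreasing_by simp [← huv]

theorem csum_zero (L : List α) : csum (fun _ => (0 : M)) L = 0 := by
  match L with
  | [] => rfl
  | a :: t =>
    rw [csum_cons, dsum_congr (g := fun _ _ => 0), dsum_zero]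
    exact fun u v huv => csum_zero v
termination_by L.length
decreasing_by simp [← huv]

/-- The sum over all decompositions, as an additive map. -/
def csumHom (L : List α) : (List (List α) → M) →+ M where
  toFun f := csum f L
  map_zero' := csum_zero L
  map_add' f g := csum_add f g L

theorem csum_comm (f : List (List α) → List (List β) → M) (L : List α) (L' : List β) :
    csum (fun S => csum (fun R => f S R) L') L = csum (fun R => csum (fun S => f S R) L) L' := by
  have h := map_csum (csumHom (M := M) L') f L
  refine h.symm.trans (csum_congr fun R _ _ => ?_)
  exact map_csum (Pi.evalAddMonoidHom _ R) f L

theorem csum_dsum (g : List (List α) → List (List α) → M) (L : List α) :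
    csum (fun S => dsum g S) L = dsum (fun u v => csum (fun P => csum (fun R => g P R) v) u) L := by
  match L with
  | [] => rfl
  | a :: t =>
    rw [csum_cons, dsum_cons]
    simp only [csum_cons, csum_nil, dsum_cons, csum_add, dsum_add]
    congr 1
    rw [dsum_assoc (fun u₁ u₂ v => csum (fun P => csum (fun R => g ((a :: u₁) :: P) R) v) u₂)]
    exact dsum_congr fun u v huv => csum_dsum _ v
termination_by L.length
decreasing_by simp [← huv]

/-- The sum of `f LL` over all refinements `LL` of a list of lists: every member is decomposed into
nonempty parts. -/
def rsum : (List (List (List α)) → M) → List (List α) → M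
  | f, [] => f []
  | f, x :: X => csum (fun S => rsum (fun LL => f (S :: LL)) X) x

@[simp] theorem rsum_nil (f : List (List (List α)) → M) : rsum f [] = f [] := rfl

theorem rsum_cons (f : List (List (List α)) → M) (x : List α) (X : List (List α)) :
    rsum f (x :: X) = csum (fun S => rsum (fun LL => f (S :: LL)) X) x := rfl

theorem rsum_congr {f g : List (List (List α)) → M} {X : List (List α)}
    (h : ∀ LL : List (List (List α)), LL.map List.flatten = X →
      (∀ S ∈ LL, ∀ s ∈ S, s ≠ []) → f LL = g LL) :
    rsum f X = rsum g X := by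
  induction X generalizing f g with
  | nil => exact h [] rfl (by simp)
  | cons x X ih =>
    rw [rsum_cons, rsum_cons]
    refine csum_congr fun S hS hS' => ih fun LL hL hL' => h _ (by grind) (by grind)

theorem map_rsum (φ : M →+ N) (f : List (List (List α)) → M) (X : List (List α)) :
    φ (rsum f X) = rsum (fun S => φ (f S)) X := by
  induction X generalizing f with
  | nil => rfl
  | cons x X ih => rw [rsum_cons, rsum_cons, map_csum]; simp only [ih]

theorem lmap_rsum {R : Type*} [Semiring R] [Module R M] [Module R N] (φ : M →ₗ[R] N)
    (f : List (List (List α)) → M) (L : List (List α)) :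
    φ (rsum f L) = rsum (fun S => φ (f S)) L :=
  map_rsum φ.toAddMonoidHom f L

theorem rsum_append (f : List (List (List α)) → M) (X Y : List (List α)) :
    rsum f (X ++ Y) = rsum (fun P => rsum (fun R => f (P ++ R)) Y) X := by
  induction X generalizing f with
  | nil => rfl
  | cons x X ih => simp only [cons_append, rsum_cons, ih]

theorem rsum_singleton (f : List (List (List α)) → M) (x : List α) :
    rsum f [x] = csum (fun S => f [S]) x := rfl

theorem csum_rsum (f : List (List (List α)) → M) (L : List α) :
    csum (fun S => rsum f S) L = csum (fun S => csum f S) L := by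
  match L with
  | [] => rfl
  | a :: t =>
    have key : ∀ u v, u ++ v = t →
        csum (fun S => rsum f ((a :: u) :: S)) v =
        dsum (fun u₁ u₂ => csum (fun P => csum (fun S => csum
          (fun Q => f (((a :: u₁) :: P) :: Q)) S) v) u₂) u := by
      intro u v huv
      simp only [rsum_cons]
      rw [csum_comm]
      have : ∀ P : List (List α), csum (fun S => rsum (fun LL => f (P :: LL)) S) v =
          csum (fun S => csum (fun LL => f (P :: LL)) S) v := fun P => csum_rsum _ v
      simp only [this, csum_cons]
    rw [csum_cons, csum_cons, dsum_congr key,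
      dsum_assoc (fun u₁ u₂ v => csum (fun P => csum (fun S => csum
          (fun Q => f (((a :: u₁) :: P) :: Q)) S) v) u₂)]
    refine dsum_congr fun u v huv => ?_
    simp only [csum_cons]
    rw [csum_dsum (fun P R => csum (fun Q => f (((a :: u) :: P) :: Q)) R)]
termination_by L.length
decreasing_by simp [← huv]

theorem sum_composition_succ (n : ℕ) (g : List ℕ → M) :
    ∑ c : Composition (n + 1), g c.blocks =
      ∑ ij ∈ antidiagonal n, ∑ c : Composition ij.2, g ((ij.1 + 1) :: c.blocks) := by
  rw [Finset.sum_sigma']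
  symm
  refine Finset.sum_bij
    (fun x hx => (⟨(x.1.1 + 1) :: x.2.blocks, ?_, ?_⟩ : Composition (n + 1))) ?_ ?_ ?_ ?_
  · intro i hi
    rcases List.mem_cons.mp hi with rfl | hi
    · omega
    · exact x.2.blocks_pos hi
  · have := (Finset.mem_sigma.mp hx).1
    simp only [Finset.HasAntidiagonal.mem_antidiagonal] at this
    simp only [sum_cons, x.2.blocks_sum]
    omega
  · intro _ _; exact Finset.mem_univ _
  · rintro ⟨⟨i, j⟩, c⟩ hx ⟨⟨i', j'⟩, c'⟩ hx' h
    have h1 := (Finset.mem_sigma.mp hx).1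
    have h2 := (Finset.mem_sigma.mp hx').1
    simp only [Finset.HasAntidiagonal.mem_antidiagonal] at h1 h2
    have h3 := congrArg Composition.blocks h
    simp only [List.cons.injEq] at h3
    obtain ⟨h4, h5⟩ := h3
    have hi : i = i' := by omega
    have hj : j = j' := by omega
    subst hi hj
    have : c = c' := Composition.ext h5
    rw [this]
  · intro c _
    have hb := c.blocks_sum
    have hp := @c.blocks_pos
    match hc : c.blocks with
    | [] => rw [hc] at hb; simp at hb
    | b :: l =>
      rw [hc] at hb
      have hb0 : 0 < b := hp (by rw [hc]; simp)
      simp only [sum_cons] at hb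
      refine ⟨⟨(b - 1, n + 1 - b), ⟨l, fun {i} hi => hp (by rw [hc]; simp [hi]), by omega⟩⟩, ?_, ?_⟩
      · simp; omega
      · apply Composition.ext
        simp only [hc]
        congr 1
        omega
  · intro _ _; rfl

theorem sum_composition_eq_csum (f : List (List α) → M) (L : List α) {n : ℕ} (hn : L.length = n) :
    ∑ c : Composition n, f (L.splitWrtCompositionAux c.blocks) = csum f L := by
  induction n using Nat.strong_induction_on generalizing L f with
  | _ n IH =>
  subst hn
  match L, IH with
  | [], _ =>
    have h : ∀ c : Composition ([] : List α).length, c.blocks = [] :=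
      fun c => (Composition.blocks_eq_nil c).mpr rfl
    have : Subsingleton (Composition ([] : List α).length) :=
      ⟨fun c c' => Composition.ext ((h c).trans (h c').symm)⟩
    rw [Fintype.sum_subsingleton _ (⟨[], by simp, rfl⟩ : Composition ([] : List α).length)]
    rfl
  | a :: t, IH =>
    rw [csum_cons, ← sum_antidiagonal_eq_dsum]
    rw [length_cons, sum_composition_succ _ fun l =>
      f (List.splitWrtCompositionAux (a :: t) l)]
    refine sum_congr rfl fun ij hij => ?_
    have hij' := Finset.HasAntidiagonal.mem_antidiagonal.mp hij
    rw [← IH ij.2 (by simp; omega) _ (t.drop ij.1) (by simp; omega)]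
    refine sum_congr rfl fun c _ => ?_
    rw [List.splitWrtCompositionAux_cons]
    simp

theorem sum_composition_length (g : List ℕ → M) (L : List α) {n : ℕ} (hn : L.length = n) :
    ∑ c : Composition n, g c.blocks = csum (fun S => g (S.map List.length)) L := by
  subst hn
  rw [← sum_composition_eq_csum _ L rfl]
  refine sum_congr rfl fun c _ => ?_
  congr 1
  exact (List.map_length_splitWrtComposition L c).symm

theorem sum_antidiagonalTuple_three (k : ℕ) (g : ℕ → ℕ → ℕ → M) :
    ∑ v ∈ Finset.Nat.antidiagonalTuple 3 k, g (v 0) (v 1) (v 2) =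
      ∑ ij ∈ antidiagonal k, ∑ pq ∈ antidiagonal ij.2, g ij.1 pq.1 pq.2 := by
  rw [Finset.sum_sigma']
  refine Finset.sum_bij' (fun v _ => ⟨(v 0, v 1 + v 2), (v 1, v 2)⟩)
    (fun x _ => ![x.1.1, x.2.1, x.2.2]) ?_ ?_ ?_ ?_ ?_
  · intro v hv
    have := Finset.Nat.mem_antidiagonalTuple.mp hv
    rw [Fin.sum_univ_three] at this
    simp; omega
  · rintro ⟨⟨i, j⟩, ⟨p, q⟩⟩ hx
    simp only [Finset.mem_sigma, Finset.HasAntidiagonal.mem_antidiagonal] at hx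
    rw [Finset.Nat.mem_antidiagonalTuple, Fin.sum_univ_three]
    simp; omega
  · intro v _
    funext i
    fin_cases i <;> rfl
  · simp_all
  · intro v _; rfl

theorem sum_antidiagonalTuple_eq_dsum (f : List α → List α → List α → M) (L : List α) :
    ∑ v ∈ Finset.Nat.antidiagonalTuple 3 L.length,
      f (L.take (v 0)) ((L.drop (v 0)).take (v 1)) ((L.drop (v 0)).drop (v 1)) =
    dsum (fun u w => dsum (fun p q => f u p q) w) L := by
  rw [sum_antidiagonalTuple_three L.length fun r s _ =>
      f (L.take r) ((L.drop r).take s) ((L.drop r).drop s), ← sum_antidiagonal_eq_dsum]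
  refine sum_congr rfl fun ij hij => ?_
  have hij' := Finset.HasAntidiagonal.mem_antidiagonal.mp hij
  rw [← sum_antidiagonal_eq_dsum]
  grind

end ListSums

/-! ## Tensors of homogeneous elements -/

namespace GradedQuiver

variable {Q R : GradedQuiver K}

/-- Homogeneous elements of a graded quiver. -/
abbrev HEl (Q : GradedQuiver K) : Type u := Σ p : Q.Ob × Q.Ob × ℤ, Q.Hom p.1 p.2.1 p.2.2

/-- A homogeneous element, in the total space. -/
def tot (h : Q.HEl) : Q.Tot := Q.of h.1.1 h.1.2.1 h.1.2.2 h.2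

/-- The tensor of a list of homogeneous elements. -/
def ten (L : List Q.HEl) : Q.Ten := (L.map fun h => ι K (tot h)).prod

@[simp] theorem ten_nil : ten ([] : List Q.HEl) = 1 := rfl

theorem ten_cons (h : Q.HEl) (L : List Q.HEl) :
    ten (h :: L) = ι K (tot h) * ten L := by simp [ten]

theorem ten_append (L L' : List Q.HEl) : ten (L ++ L') = ten L * ten L' := by simp [ten]

theorem ten_singleton (h : Q.HEl) : ten [h] = ι K (tot h) := by simp [ten]

theorem el_eq {x y : Q.Ob} {d : ℤ} (v : Q.Hom x y d) :
    Q.el v = ten [(⟨(x, y, d), v⟩ : Q.HEl)] := by simp [ten]; rfl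

theorem span_ten : Submodule.span K (Set.range (ten (Q := Q))) = ⊤ := by
  rw [eq_top_iff]
  rintro X -
  induction X using TensorAlgebra.induction with
  | algebraMap r =>
    rw [Algebra.algebraMap_eq_smul_one]
    exact Submodule.smul_mem _ _ (Submodule.subset_span ⟨[], rfl⟩)
  | ι v =>
    induction v using DirectSum.induction_on with
    | zero => rw [map_zero]; exact Submodule.zero_mem _
    | of p v => exact Submodule.subset_span ⟨[⟨p, v⟩], ten_singleton _⟩
    | add x y hx hy => rw [map_add]; exact Submodule.add_mem _ hx hy
  | mul a b ha hb =>
    have := Submodule.mul_mem_mul ha hb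
    rw [Submodule.span_mul_span] at this
    refine Submodule.span_mono ?_ this
    rintro _ ⟨_, ⟨L, rfl⟩, _, ⟨L', rfl⟩, rfl⟩
    exact ⟨L ++ L', ten_append _ _⟩
  | add a b ha hb => exact Submodule.add_mem _ ha hb

theorem ten_ext {V : Type*} [AddCommMonoid V] [Module K V] {α β : Q.Ten →ₗ[K] V}
    (h : ∀ L, α (ten L) = β (ten L)) : α = β := by
  refine LinearMap.ext_on span_ten ?_
  rintro _ ⟨L, rfl⟩
  exact h L

theorem ten_induction {P : Q.Ten → Prop} (X : Q.Ten) (h : ∀ L, P (ten L)) (h0 : P 0)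
    (hadd : ∀ X Y, P X → P Y → P (X + Y)) (hsmul : ∀ (c : K) X, P X → P (c • X)) : P X := by
  have hX : X ∈ Submodule.span K (Set.range (ten (Q := Q))) := by rw [span_ten]; trivial
  induction hX using Submodule.span_induction with
  | mem x hx => obtain ⟨L, rfl⟩ := hx; exact h L
  | zero => exact h0
  | add x y _ _ hx hy => exact hadd x y hx hy
  | smul c x _ hx => exact hsmul c x hx

theorem ten_eq_tprod (L : List Q.HEl) :
    ten L = TensorAlgebra.tprod K Q.Tot L.length (fun i => tot (L.get i)) := by
  rw [TensorAlgebra.tprod_apply, ten]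
  congr 1
  apply ext_getElem <;> simp

theorem toDirectSum_ten (L : List Q.HEl) :
    TensorAlgebra.toDirectSum (ten L) =
      DirectSum.of (fun n => ⨂[K]^n Q.Tot) L.length
        (PiTensorProduct.tprod K fun i => tot (L.get i)) := by
  rw [ten_eq_tprod, TensorAlgebra.toDirectSum_tensorPower_tprod]

theorem toDirectSum_append (L L' : List Q.HEl) :
    TensorAlgebra.toDirectSum (ten (L ++ L')) =
      DirectSum.of (fun n => ⨂[K]^n Q.Tot) (L.length + L'.length)
        (TensorPower.mulEquiv ((PiTensorProduct.tprod K fun i => tot (L.get i)) ⊗ₜ[K]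
          (PiTensorProduct.tprod K fun i => tot (L'.get i)))) := by
  rw [ten_append, map_mul, toDirectSum_ten, toDirectSum_ten, DirectSum.of_mul_of,
    TensorPower.gMul_def]

theorem component_toDirectSum_ne (L : List Q.HEl) {n : ℕ} (h : L.length ≠ n) :
    component K ℕ (fun n => ⨂[K]^n Q.Tot) n (TensorAlgebra.toDirectSum (ten L)) = 0 := by
  rw [toDirectSum_ten]
  rw [← lof_eq_of K, component.of]
  exact dif_neg h

theorem split_append (L L' : List Q.HEl) :
    Q.split L.length L'.length (ten (L ++ L')) = ten L ⊗ₜ[K] ten L' := by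
  simp only [split, LinearMap.comp_apply, AlgHom.toLinearMap_apply]
  rw [toDirectSum_append]
  have h := component.lof_self (M := fun n => ⨂[K]^n Q.Tot) K (L.length + L'.length)
    (TensorPower.mulEquiv ((PiTensorProduct.tprod K fun i => tot (L.get i)) ⊗ₜ[K]
          (PiTensorProduct.tprod K fun i => tot (L'.get i))))
  rw [lof_eq_of] at h
  rw [h, LinearEquiv.coe_coe, LinearEquiv.symm_apply_apply, map_tmul,
    TensorPower.toTensorAlgebra_tprod, TensorPower.toTensorAlgebra_tprod, ← ten_eq_tprod,
    ← ten_eq_tprod]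

theorem split_append' (L L' : List Q.HEl) {r t : ℕ} (hr : L.length = r) (ht : L'.length = t) :
    Q.split r t (ten L * ten L') = ten L ⊗ₜ[K] ten L' := by
  subst hr ht
  rw [← ten_append, split_append]

theorem tens_append (r t : ℕ) (α β : Q.Ten →ₗ[K] R.Ten) (L L' : List Q.HEl)
    (hr : L.length = r) (ht : L'.length = t) :
    tens r t α β (ten (L ++ L')) = α (ten L) * β (ten L') := by
  subst hr ht
  simp only [tens, LinearMap.comp_apply, split_append]
  simp

/-- The linear map on tensors that is `α k` on tensors of length `k`. -/
def byLen {V : Type*} [AddCommGroup V] [Module K V] (α : ℕ → (Q.Ten →ₗ[K] V)) : Q.Ten →ₗ[K] V :=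
  DirectSum.toModule K ℕ V (fun n => α n ∘ₗ TensorPower.toTensorAlgebra) ∘ₗ
    TensorAlgebra.toDirectSum.toLinearMap

theorem byLen_ten {V : Type*} [AddCommGroup V] [Module K V] (α : ℕ → (Q.Ten →ₗ[K] V))
    (L : List Q.HEl) : byLen α (ten L) = α L.length (ten L) := by
  simp only [byLen, LinearMap.comp_apply, AlgHom.toLinearMap_apply]
  rw [toDirectSum_ten, ← lof_eq_of K, toModule_lof, LinearMap.comp_apply,
    TensorPower.toTensorAlgebra_tprod, ← ten_eq_tprod]

/-- Deconcatenation of tensors. -/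
def delta (Q : GradedQuiver K) : Q.Ten →ₗ[K] Q.Ten ⊗[K] Q.Ten :=
  byLen fun n => ∑ ij ∈ antidiagonal n, Q.split ij.1 ij.2

theorem delta_ten (L : List Q.HEl) :
    Q.delta (ten L) = dsum (fun u v => ten u ⊗ₜ[K] ten v) L := by
  rw [delta, byLen_ten, LinearMap.sum_apply, ← sum_antidiagonal_eq_dsum]
  refine sum_congr rfl fun ij hij => ?_
  have h := Finset.HasAntidiagonal.mem_antidiagonal.mp hij
  have := split_append' (L.take ij.1) (L.drop ij.1) (r := ij.1) (t := ij.2) (by simp; omega)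
    (by simp; omega)
  rwa [← ten_append, take_append_drop] at this

/-- The linear map that multiplies the tensor of a list of homogeneous elements by a scalar. -/
def weight (Q : GradedQuiver K) (c : List (Q.Ob × Q.Ob × ℤ) → K) : Q.Ten →ₗ[K] Q.Ten :=
  DirectSum.toModule K ℕ _ (fun n => PiTensorProduct.lift
    (MultilinearMap.fromDFinsuppEquiv (fun _ : Fin n => Q.Ob × Q.Ob × ℤ) K
      (M := fun _ p => Q.Hom p.1 p.2.1 p.2.2) fun p =>
        c (List.ofFn p) • (TensorAlgebra.tprod K Q.Tot n).compLinearMap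
          fun i => Q.of (p i).1 (p i).2.1 (p i).2.2)) ∘ₗ
    TensorAlgebra.toDirectSum.toLinearMap

theorem weight_ten (c : List (Q.Ob × Q.Ob × ℤ) → K) (L : List Q.HEl) :
    Q.weight c (ten L) = c (L.map Sigma.fst) • ten L := by
  simp only [weight, LinearMap.comp_apply, AlgHom.toLinearMap_apply]
  rw [toDirectSum_ten, ← lof_eq_of K]
  refine (toModule_lof K _ _).trans ?_
  refine (PiTensorProduct.lift.tprod _).trans ?_
  have h := MultilinearMap.fromDFinsuppEquiv_single (R := K)
    (κ := fun _ : Fin L.length => Q.Ob × Q.Ob × ℤ)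
    (M := fun _ p => Q.Hom p.1 p.2.1 p.2.2) (fun p =>
        c (List.ofFn p) • (TensorAlgebra.tprod K Q.Tot L.length).compLinearMap
          fun i => Q.of (p i).1 (p i).2.1 (p i).2.2) (fun i => (L.get i).1) (fun i => (L.get i).2)
  refine h.trans ?_
  have h2 : List.ofFn (fun i => (L.get i).1) = L.map Sigma.fst := by
    apply ext_getElem <;> simp
  rw [h2, ten_eq_tprod]
  rfl

/-- The list is a composable path from `a` to `b`. -/
def IsPath : Q.Ob → List Q.HEl → Q.Ob → Prop
  | a, [], b => a = b
  | a, h :: t, b => h.1.1 = a ∧ IsPath h.1.2.1 t b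

theorem isPath_append {a b : Q.Ob} {L L' : List Q.HEl} :
    IsPath a (L ++ L') b ↔ ∃ c, IsPath a L c ∧ IsPath c L' b := by
  induction L generalizing a with
  | nil => simp [IsPath]
  | cons h t ih => simp only [cons_append, IsPath, ih]; tauto

theorem IsPath.tgt_unique {a b b' : Q.Ob} {L : List Q.HEl} (h : IsPath a L b)
    (h' : IsPath a L b') : b = b' := by
  induction L generalizing a with
  | nil => exact h.symm.trans h'
  | cons x t ih => exact ih h.2 h'.2

/-- The list of degrees. -/
def degs (L : List Q.HEl) : List ℤ := L.map fun h => h.1.2.2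

@[simp] theorem degs_nil : degs ([] : List Q.HEl) = [] := rfl
@[simp] theorem degs_cons (h : Q.HEl) (L : List Q.HEl) : degs (h :: L) = h.1.2.2 :: degs L := rfl
@[simp] theorem degs_append (L L' : List Q.HEl) : degs (L ++ L') = degs L ++ degs L' := by
  simp [degs]
@[simp] theorem length_degs (L : List Q.HEl) : (degs L).length = L.length := by simp [degs]

theorem isPath_ofFn {n : ℕ} (c : Fin (n + 1) → Q.Ob) (d : Fin n → ℤ)
    (x : ∀ i, Q.Hom (c i.castSucc) (c i.succ) (d i)) :
    IsPath (c 0) (List.ofFn fun i => (⟨(c i.castSucc, c i.succ, d i), x i⟩ : Q.HEl))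
      (c (Fin.last n)) := by
  induction n with
  | zero => simp [IsPath]
  | succ n ih =>
    rw [List.ofFn_succ]
    exact ⟨rfl, ih (fun i => c i.succ) (fun i => d i.succ) (fun i => x i.succ)⟩

theorem exists_fin_path {a b : Q.Ob} {L : List Q.HEl} (h : IsPath a L b) {n : ℕ}
    (hn : L.length = n) :
    ∃ (c : Fin (n + 1) → Q.Ob) (d : Fin n → ℤ)
      (x : ∀ i, Q.Hom (c i.castSucc) (c i.succ) (d i)),
      c 0 = a ∧ c (Fin.last _) = b ∧
      L = List.ofFn fun i => (⟨(c i.castSucc, c i.succ, d i), x i⟩ : Q.HEl) := by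
  subst hn
  induction L generalizing a with
  | nil => exact ⟨fun _ => a, Fin.elim0, fun i => i.elim0, rfl, h, rfl⟩
  | cons y t ih =>
    obtain ⟨⟨s, t', e⟩, v⟩ := y
    obtain ⟨c, d, x, h0, hl, ht⟩ := ih h.2
    have hs : s = a := h.1
    change c 0 = t' at h0
    subst hs h0
    refine ⟨Fin.cons s c, Fin.cons e d,
      fun i => Fin.cases (motive := fun i => Q.Hom ((Fin.cons s c : Fin _ → Q.Ob) i.castSucc)
        ((Fin.cons s c : Fin _ → Q.Ob) i.succ) ((Fin.cons e d : Fin _ → ℤ) i)) v (fun i => x i) i,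
      rfl, hl, ?_⟩
    have h1 := List.ofFn_succ (f := fun i : Fin (t.length + 1) =>
        (⟨((Fin.cons s c : Fin _ → Q.Ob) i.castSucc, (Fin.cons s c : Fin _ → Q.Ob) i.succ,
          (Fin.cons e d : Fin _ → ℤ) i), Fin.cases (motive := fun i => Q.Hom ((Fin.cons s c : Fin _ → Q.Ob) i.castSucc)
        ((Fin.cons s c : Fin _ → Q.Ob) i.succ) ((Fin.cons e d : Fin _ → ℤ) i)) v (fun i => x i) i⟩ : Q.HEl))
    refine Eq.trans ?_ h1.symm
    exact congrArg (List.cons _) ht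

theorem ofFn_el_prod {n : ℕ} (p : Fin n → Q.Ob × Q.Ob × ℤ)
    (x : ∀ i, Q.Hom (p i).1 (p i).2.1 (p i).2.2) :
    (List.ofFn fun i => Q.el (x i)).prod = ten (List.ofFn fun i => (⟨p i, x i⟩ : Q.HEl)) := by
  rw [ten, map_ofFn]
  rfl

theorem degs_ofFn {n : ℕ} (p : Fin n → Q.Ob × Q.Ob × ℤ)
    (x : ∀ i, Q.Hom (p i).1 (p i).2.1 (p i).2.2) :
    degs (List.ofFn fun i => (⟨p i, x i⟩ : Q.HEl)) = List.ofFn fun i => (p i).2.2 := by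
  rw [degs, map_ofFn]
  rfl

theorem eqOnPaths_iff {k : ℕ} {V : Type u} [AddCommGroup V] [Module K V] {α β : Q.Ten →ₗ[K] V} :
    Q.EqOnPaths k α β ↔
      ∀ a L b, IsPath a L b → L.length = k → α (ten L) = β (ten L) := by
  constructor
  · rintro h a L b hL rfl
    obtain ⟨c, d, x, -, -, hx⟩ := exists_fin_path hL rfl
    have := h c d x
    rwa [ofFn_el_prod (fun i => (c i.castSucc, c i.succ, d i)), ← hx] at this
  · intro h c d x
    rw [ofFn_el_prod (fun i => (c i.castSucc, c i.succ, d i))]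
    exact h _ _ _ (isPath_ofFn c d x) (by simp)

theorem shiftTen_eq (n : List ℕ) (a b : Q.Ob) :
    Q.shiftTen n a b = Submodule.span K {w | ∃ L : List Q.HEl, IsPath a L b ∧
      degs L = n.map (fun i : ℕ => (i : ℤ) - 1) ∧ w = ten L} := by
  unfold shiftTen
  congr 1
  ext w
  constructor
  · rintro ⟨c, rfl, rfl, x, rfl⟩
    refine ⟨_, isPath_ofFn c _ x, ?_, ofFn_el_prod (fun i => (c i.castSucc, c i.succ, _)) x⟩
    rw [degs_ofFn (fun i => (c i.castSucc, c i.succ, _))]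
    apply ext_getElem <;> simp
  · rintro ⟨L, hL, hd, rfl⟩
    have hlen : n.length = L.length := by
      have := congrArg List.length hd
      simpa using this.symm
    obtain ⟨c, d, x, h0, hl, hx⟩ := exists_fin_path hL hlen.symm
    have hd' : List.ofFn d = n.map (fun i : ℕ => (i : ℤ) - 1) := by
      rw [← hd]; conv_rhs => rw [hx]
      rw [degs_ofFn (fun i => (c i.castSucc, c i.succ, _))]
    have hd'' : d = fun i => ((n.get i : ℕ) : ℤ) - 1 := by
      apply List.ofFn_injective
      rw [hd']
      apply ext_getElem <;> simp
    subst hd''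
    refine ⟨c, h0, hl, x, ?_⟩
    rw [ofFn_el_prod (fun i => (c i.castSucc, c i.succ, _)), ← hx]

/-! ### Families of multilinear maps -/

section Family

variable {φ : Q.Ob → R.Ob} {n : ℕ} {e : ℤ}

theorem onTen_ne (μ : Family Q R φ n e) (L : List Q.HEl) (h : L.length ≠ n + 1) :
    μ.onTen (ten L) = 0 := by
  simp only [Family.onTen, LinearMap.comp_apply, AlgHom.toLinearMap_apply]
  rw [component_toDirectSum_ne L h, map_zero]

theorem onTen_ofFn (μ : Family Q R φ n e) (p : Fin (n + 1) → Q.Ob × Q.Ob × ℤ)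
    (x : ∀ i, Q.Hom (p i).1 (p i).2.1 (p i).2.2) :
    μ.onTen (ten (List.ofFn fun i => (⟨p i, x i⟩ : Q.HEl))) =
      (if h : ∀ i : Fin n, (p i.castSucc).2.1 = (p i.succ).1 then
        (R.of _ _ _).compMultilinearMap
          ((μ (Q.verts p) fun i => (p i).2.2).compLinearMap fun i =>
            Q.castSrc (Q.verts_castSucc p h i))
      else 0 : MultilinearMap K (fun i : Fin (n + 1) => Q.Hom (p i).1 (p i).2.1 (p i).2.2) R.Tot)
        x := by
  rw [← ofFn_el_prod]
  have h1 : (List.ofFn fun i => Q.el (x i)).prod = TensorAlgebra.tprod K Q.Tot (n + 1)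
      (fun i => Q.of _ _ _ (x i)) := by
    rw [TensorAlgebra.tprod_apply]; rfl
  simp only [Family.onTen, LinearMap.comp_apply, AlgHom.toLinearMap_apply]
  rw [h1, TensorAlgebra.toDirectSum_tensorPower_tprod, ← lof_eq_of K,
    component.lof_self, PiTensorProduct.lift.tprod]
  exact MultilinearMap.fromDFinsuppEquiv_single (R := K)
    (κ := fun _ : Fin (n + 1) => Q.Ob × Q.Ob × ℤ)
    (M := fun _ p => Q.Hom p.1 p.2.1 p.2.2) _ p x

theorem onTen_path (μ : Family Q R φ n e) (c : Fin (n + 2) → Q.Ob) (d : Fin (n + 1) → ℤ)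
    (x : ∀ i, Q.Hom (c i.castSucc) (c i.succ) (d i)) :
    μ.onTen (ten (List.ofFn fun i => (⟨(c i.castSucc, c i.succ, d i), x i⟩ : Q.HEl))) =
      R.of _ _ _ (μ c d x) := by
  rw [onTen_ofFn μ (fun i => (c i.castSucc, c i.succ, d i)) x]
  refine (congrArg (fun f : MultilinearMap K _ _ => f x) (dif_pos fun i => rfl)).trans ?_
  have key : ∀ (c' : Fin (n + 2) → Q.Ob) (hc : c = c')
      (h : ∀ i : Fin (n + 1), c i.castSucc = c' i.castSucc)
      (h' : ∀ i : Fin (n + 1), c i.succ = c' i.succ)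
      (z : ∀ i, Q.Hom (c' i.castSucc) (c' i.succ) (d i)) (_ : ∀ i, HEq (z i) (x i)),
      R.of _ _ _ (μ c' d z) = R.of _ _ _ (μ c d x) := by
    rintro _ rfl - - z hz
    have : z = x := funext fun i => eq_of_heq (hz i)
    rw [this]
  have hc : c = Q.verts (fun i => (c i.castSucc, c i.succ, d i)) := by
    funext i
    refine Fin.cases rfl (fun j => rfl) i
  refine key _ hc (fun i => congrFun hc _) (fun i => congrFun hc _) _ ?_
  intro i
  have h2 : ∀ {x x' y : Q.Ob} {d : ℤ} (h : x = x') (v : Q.Hom x y d),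
      HEq (Q.castSrc h v) v := by
    rintro x _ y d rfl v; rfl
  exact h2 _ _

/-- The properties of a linear map of tensors that is given by a family of multilinear maps. -/
structure IsFam (φ : Q.Ob → R.Ob) (k : ℕ) (e : ℤ) (α : Q.Ten →ₗ[K] R.Tot) : Prop where
  ne : ∀ L : List Q.HEl, L.length ≠ k → α (ten L) = 0
  not_path : ∀ L : List Q.HEl, (¬ ∃ a b, IsPath a L b) → α (ten L) = 0
  hom : ∀ a L b, IsPath a L b → L.length = k →
    ∃ h : R.HEl, h.1 = (φ a, φ b, (degs L).sum + e) ∧ α (ten L) = tot h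

theorem Family.isFam (μ : Family Q R φ n e) : IsFam φ (n + 1) e μ.onTen where
  ne := onTen_ne μ
  not_path := by
    intro L hL
    by_cases hn : L.length = n + 1
    · have hL' : L = List.ofFn fun i : Fin (n + 1) =>
          (⟨(L.get (Fin.cast hn.symm i)).1, (L.get (Fin.cast hn.symm i)).2⟩ : Q.HEl) := by
        apply ext_getElem
        · simp [hn]
        · grind
      rw [hL', onTen_ofFn μ (fun i => (L.get (Fin.cast hn.symm i)).1)
        (fun i => (L.get (Fin.cast hn.symm i)).2), dif_neg]
      · rfl
      · intro h
        have aux : ∀ (n : ℕ) (f : Fin (n + 1) → Q.HEl),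
            (∀ i : Fin n, (f i.castSucc).1.2.1 = (f i.succ).1.1) →
            ∃ b, IsPath (f 0).1.1 (List.ofFn f) b := by
          intro n
          induction n with
          | zero => intro f _; exact ⟨_, rfl, rfl⟩
          | succ n ih =>
            intro f hf
            obtain ⟨b, hb⟩ := ih (fun i => f i.succ) (fun i => hf i.succ)
            refine ⟨b, ?_⟩
            rw [List.ofFn_succ]
            refine ⟨rfl, ?_⟩
            have := hf 0
            rw [Fin.castSucc_zero] at this
            rw [this]
            exact hb
        grind
    · exact onTen_ne μ L hn
  hom := by
    intro a L b hL hn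
    obtain ⟨c, d, x, h0, hl, hx⟩ := exists_fin_path hL hn
    have hd : (degs L).sum = ∑ i, d i := by
      rw [hx, degs_ofFn (fun i => (c i.castSucc, c i.succ, _)), List.sum_ofFn]
    subst h0 hl
    refine ⟨⟨(φ (c 0), φ (c (Fin.last (n + 1))), ∑ i, d i + e), μ c d x⟩, ?_, ?_⟩
    · rw [hd]
    · rw [hx, onTen_path]; rfl

/-- The family of multilinear maps given by a linear map of tensors. -/
def famOf (φ : Q.Ob → R.Ob) (n : ℕ) (e : ℤ) (α : Q.Ten →ₗ[K] R.Tot) : Family Q R φ n e :=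
  fun c d => (component K _ (fun p : R.Ob × R.Ob × ℤ => R.Hom p.1 p.2.1 p.2.2)
      (φ (c 0), φ (c (Fin.last (n + 1))), ∑ i, d i + e) ∘ₗ α).compMultilinearMap
    ((TensorAlgebra.tprod K Q.Tot (n + 1)).compLinearMap
      fun i => Q.of (c i.castSucc) (c i.succ) (d i))

theorem onTen_famOf {α : Q.Ten →ₗ[K] R.Tot} (hα : IsFam φ (n + 1) e α) :
    (famOf φ n e α).onTen = α := by
  refine ten_ext fun L => ?_
  by_cases hn : L.length = n + 1
  · by_cases hp : ∃ a b, IsPath a L b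
    · obtain ⟨a, b, hL⟩ := hp
      obtain ⟨c, d, x, h0, hl, hx⟩ := exists_fin_path hL hn
      obtain ⟨h, hh, hh'⟩ := hα.hom a L b hL hn
      have hd : (degs L).sum = ∑ i, d i := by
        rw [hx, degs_ofFn (fun i => (c i.castSucc, c i.succ, _)), List.sum_ofFn]
      subst h0 hl
      rw [hd] at hh
      obtain ⟨p, v⟩ := h
      change p = _ at hh
      subst hh
      rw [hh']
      conv_lhs => rw [hx]
      rw [onTen_path]
      have h3 : famOf φ n e α c d x = v := by
        have h4 : (TensorAlgebra.tprod K Q.Tot (n + 1)) (fun i => Q.of (c i.castSucc) (c i.succ) (d i) (x i)) = ten L := by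
          rw [hx, TensorAlgebra.tprod_apply, ten, map_ofFn]
          rfl
        simp only [famOf, LinearMap.compMultilinearMap_apply, MultilinearMap.compLinearMap_apply,
          LinearMap.comp_apply]
        rw [h4, hh']
        exact component.lof_self _ _ _
      rw [h3]
      rfl
    · rw [hα.not_path L hp, (Family.isFam _).not_path L hp]
  · rw [hα.ne L hn, onTen_ne _ L hn]

theorem onTen_injective {μ ν : Family Q R φ n e} (h : μ.onTen = ν.onTen) : μ = ν := by
  funext c d
  refine MultilinearMap.ext fun x => ?_
  have h1 := onTen_path μ c d x
  rw [h, onTen_path] at h1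
  exact (DFinsupp.single_injective h1).symm

end Family

end GradedQuiver

section ListSums

variable {α M : Type*} [AddCommMonoid M]

theorem dsum_append_cons (f : List α → List α → M) (L₁ : List α) (x : α) (L₂ : List α) :
    dsum f (L₁ ++ x :: L₂) = dsum (fun u v => f u (v ++ x :: L₂)) L₁ +
      dsum (fun u v => f (L₁ ++ x :: u) v) L₂ := by
  induction L₁ generalizing f with
  | nil => simp [dsum_cons]
  | cons a t ih => simp only [cons_append, dsum_cons, ih, add_assoc]

theorem dsum_eq_first {f : List α → List α → M} {L : List α}
    (h : ∀ u v, u ++ v = L → u ≠ [] → f u v = 0) : dsum f L = f [] L := by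
  cases L with
  | nil => rfl
  | cons a t => exact dsum_snoc_nil f a t h

theorem dsum_eq_last {f : List α → List α → M} {L : List α}
    (h : ∀ u v, u ++ v = L → v ≠ [] → f u v = 0) : dsum f L = f L [] := by
  induction L generalizing f with
  | nil => rfl
  | cons a t ih =>
    rw [dsum_cons, h [] (a :: t) rfl (by simp), zero_add]
    grind

end ListSums

/-! ## Signs -/

section Sign

variable (K : Type*) [Field K]

/-- The sign `(-1)^n` in a field. -/
def sgn (n : ℤ) : K := ((n.negOnePow : ℤ) : K)

variable {K}

theorem sgn_add (a b : ℤ) : sgn K (a + b) = sgn K a * sgn K b := by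
  simp [sgn, Int.negOnePow_add]

@[simp] theorem sgn_zero : sgn K 0 = 1 := by simp [sgn]

theorem sgn_congr {a b : ℤ} (h : Even (a - b)) : sgn K a = sgn K b := by
  unfold sgn
  rw [(Int.negOnePow_eq_iff a b).mpr h]

theorem sgn_mul_self (a : ℤ) : sgn K a * sgn K a = 1 := by
  rw [← sgn_add, ← sgn_zero]
  exact sgn_congr ⟨a, by ring⟩

theorem neg_one_pow_eq_sgn (n : ℕ) : (-1 : K) ^ n = sgn K n := by
  simp [sgn]

theorem sgn_one : sgn K 1 = -1 := by simp [sgn]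

/-- The exponent of the Koszul sign `s^{⊗ l}` on elements of given degrees. -/
def shiftExp : List ℤ → ℤ
  | [] => 0
  | d :: ds => ds.length * d + shiftExp ds

theorem shiftExp_append (u v : List ℤ) :
    shiftExp (u ++ v) = shiftExp u + v.length * u.sum + shiftExp v := by
  induction u with
  | nil => simp [shiftExp]
  | cons d u ih => simp only [cons_append, shiftExp, ih, length_append, sum_cons]; push_cast; ring

theorem shiftExp_map_sub_one (n : List ℕ) (h : ∀ i ∈ n, 0 < i) :
    shiftExp (n.map fun i : ℕ => (i : ℤ) - 1) = epsG n := by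
  induction n with
  | nil => rfl
  | cons a t ih =>
    have ha : 0 < a := h a (by simp)
    simp only [map_cons, shiftExp, epsG, length_map]
    grind

end Sign

namespace GradedQuiver

variable {Q R S : GradedQuiver K}

/-- The augmentation of the tensor algebra. -/
abbrev aug (Q : GradedQuiver K) : Q.Ten →ₐ[K] K := TensorAlgebra.algebraMapInv

@[simp] theorem aug_ι (v : Q.Tot) : Q.aug (ι K v) = 0 := by
  simp [aug, TensorAlgebra.algebraMapInv]

@[simp] theorem aug_ι_mul (v : Q.Tot) (X : Q.Ten) : Q.aug (ι K v * X) = 0 := by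
  rw [map_mul, aug_ι, zero_mul]

theorem aug_ten_cons (h : Q.HEl) (L : List Q.HEl) : Q.aug (ten (h :: L)) = 0 := by
  rw [ten_cons, aug_ι_mul]

theorem ιInv_ι_mul (v : Q.Tot) (X : Q.Ten) :
    ιInv (R := K) (ι K v * X) = Q.aug X • v := by
  let _ : Module Kᵐᵒᵖ Q.Tot := Module.compHom _ ((RingHom.id K).fromOpposite mul_comm)
  have : IsCentralScalar K Q.Tot := ⟨fun r m => rfl⟩
  have h : ∀ X : Q.Ten, (TensorAlgebra.toTrivSqZeroExt X).fst = Q.aug X := by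
    intro X
    have : (TrivSqZeroExt.fstHom K K Q.Tot).comp TensorAlgebra.toTrivSqZeroExt = Q.aug := by
      ext v
      simp [aug, TensorAlgebra.algebraMapInv]
    exact AlgHom.congr_fun this X
  change (TensorAlgebra.toTrivSqZeroExt (ι K v * X)).snd = _
  simp_all

theorem ιInv_one : ιInv (R := K) (1 : Q.Ten) = 0 := by
  let _ : Module Kᵐᵒᵖ Q.Tot := Module.compHom _ ((RingHom.id K).fromOpposite mul_comm)
  have : IsCentralScalar K Q.Tot := ⟨fun r m => rfl⟩
  change (TensorAlgebra.toTrivSqZeroExt (1 : Q.Ten)).snd = _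
  rw [map_one]
  rfl

theorem koszul_ten (e : ℕ) (L : List Q.HEl) :
    Q.koszul e (ten L) = sgn K (e * (degs L).sum) • ten L := by
  unfold koszul
  split_ifs with he
  · rw [LinearMap.id_apply]
    have : sgn K (e * (degs L).sum) = 1 := by
      rw [← sgn_zero]
      obtain ⟨r, rfl⟩ := he
      exact sgn_congr ⟨r * (degs L).sum, by push_cast; ring⟩
    rw [this, one_smul]
  · have h : sgn K (e * (degs L).sum) = sgn K (degs L).sum := by
      obtain ⟨r, rfl⟩ := Nat.not_even_iff_odd.mp he
      exact sgn_congr ⟨r * (degs L).sum, by push_cast; ring⟩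
    rw [h, AlgHom.toLinearMap_apply]
    induction L with
    | nil => simp
    | cons x t ih =>
      rw [ten_cons, map_mul, ih (by
        obtain ⟨r, rfl⟩ := Nat.not_even_iff_odd.mp he
        exact sgn_congr ⟨r * (degs t).sum, by push_cast; ring⟩), TensorAlgebra.lift_ι_apply]
      have : Q.parityTot (tot x) = sgn K x.1.2.2 • tot x := by
        unfold parityTot tot of
        exact toModule_lof K (φ := fun p : Q.Ob × Q.Ob × ℤ =>
          ((p.2.2.negOnePow : ℤ) : K) • Q.of p.1 p.2.1 p.2.2) x.1 x.2
      rw [LinearMap.comp_apply, this, map_smul, smul_mul_smul_comm]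
      simp [sgn_add]

/-- The sign `s^{⊗ l}` on tensors. -/
def shiftSign (Q : GradedQuiver K) : Q.Ten →ₗ[K] Q.Ten :=
  Q.weight fun w => sgn K (shiftExp (w.map fun p => p.2.2))

theorem shiftSign_ten (L : List Q.HEl) :
    Q.shiftSign (ten L) = sgn K (shiftExp (degs L)) • ten L := by
  rw [shiftSign, weight_ten, degs, List.map_map]; rfl

/-- The total shifted degree. -/
def sdeg (L : List Q.HEl) : ℤ := (degs L).sum + L.length

@[simp] theorem sdeg_nil : sdeg ([] : List Q.HEl) = 0 := by simp [sdeg]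
theorem sdeg_cons (h : Q.HEl) (L : List Q.HEl) : sdeg (h :: L) = h.1.2.2 + 1 + sdeg L := by
  simp only [sdeg, degs_cons, sum_cons, length_cons]; push_cast; ring
theorem sdeg_append (L L' : List Q.HEl) : sdeg (L ++ L') = sdeg L + sdeg L' := by
  simp only [sdeg, degs_append, List.sum_append, length_append]; push_cast; ring

/-- The parity operator for the shifted degrees. -/
def parity (Q : GradedQuiver K) : Q.Ten →ₗ[K] Q.Ten :=
  Q.weight fun w => sgn K ((w.map fun p => p.2.2).sum + w.length)

theorem parity_ten (L : List Q.HEl) : Q.parity (ten L) = sgn K (sdeg L) • ten L := by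
  rw [parity, weight_ten, sdeg, degs, List.map_map, length_map]; rfl

/-- The map given by `α k` on tensors of length `k`, with the sign `s^{⊗ k}`. -/
def twist {V : Type*} [AddCommGroup V] [Module K V] (α : ℕ → (Q.Ten →ₗ[K] V)) : Q.Ten →ₗ[K] V :=
  byLen fun k => α k ∘ₗ Q.shiftSign

theorem twist_ten {V : Type*} [AddCommGroup V] [Module K V] (α : ℕ → (Q.Ten →ₗ[K] V))
    (L : List Q.HEl) : twist α (ten L) = sgn K (shiftExp (degs L)) • α L.length (ten L) := by
  rw [twist, byLen_ten, LinearMap.comp_apply, shiftSign_ten, map_smul]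

theorem eq_twist_ten {V : Type*} [AddCommGroup V] [Module K V] (α : ℕ → (Q.Ten →ₗ[K] V))
    (L : List Q.HEl) : α L.length (ten L) = sgn K (shiftExp (degs L)) • twist α (ten L) := by
  rw [twist_ten, smul_smul, sgn_mul_self, one_smul]

/-! ### Convolution -/

/-- The convolution product of linear maps, for deconcatenation. -/
def conv (α β : Q.Ten →ₗ[K] R.Ten) : Q.Ten →ₗ[K] R.Ten :=
  LinearMap.mul' K R.Ten ∘ₗ TensorProduct.map α β ∘ₗ Q.delta

theorem conv_ten (α β : Q.Ten →ₗ[K] R.Ten) (L : List Q.HEl) :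
    conv α β (ten L) = dsum (fun u v => α (ten u) * β (ten v)) L := by
  rw [conv, LinearMap.comp_apply, LinearMap.comp_apply, delta_ten, lmap_dsum, lmap_dsum]
  rfl

theorem delta_ι_mul (v : Q.Tot) (X : Q.Ten) :
    Q.delta (ι K v * X) =
      1 ⊗ₜ[K] (ι K v * X) + (ι K v ⊗ₜ[K] 1) * Q.delta X := by
  have h1 : ∀ x : Q.HEl, Q.delta ∘ₗ mulLeft K (ι K (tot x)) =
      TensorProduct.mk K Q.Ten Q.Ten 1 ∘ₗ mulLeft K (ι K (tot x)) +
      mulLeft K ((ι K (tot x) ⊗ₜ[K] 1 : Q.Ten ⊗[K] Q.Ten)) ∘ₗ Q.delta := by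
    intro x
    refine ten_ext fun L => ?_
    simp only [LinearMap.comp_apply, LinearMap.add_apply, mulLeft_apply,
      TensorProduct.mk_apply]
    rw [← ten_cons, delta_ten, delta_ten, dsum_cons, ← mulLeft_apply (R := K), lmap_dsum]
    simp [ten_cons]
  induction v using DirectSum.induction_on with
  | zero => simp
  | of p v => exact LinearMap.congr_fun (h1 ⟨p, v⟩) X
  | add x y hx hy =>
    rw [map_add, add_mul, map_add, hx, hy]
    simp only [TensorProduct.tmul_add, TensorProduct.add_tmul, add_mul]
    abel

/-! ### Coalgebra maps -/

/-- The tensor product of `F` with itself, applied to consecutive groups of factors. -/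
def groupMap (F : Q.Ten →ₗ[K] R.Tot) : List ℕ → (Q.Ten →ₗ[K] R.Ten)
  | [] => Algebra.linearMap K R.Ten ∘ₗ Q.aug.toLinearMap
  | i :: is => tens i is.sum (ι K ∘ₗ F) (groupMap F is)

theorem groupMap_flatten (F : Q.Ten →ₗ[K] R.Tot) (S : List (List Q.HEl)) :
    groupMap F (S.map List.length) (ten S.flatten) =
      (S.map fun s => ι K (F (ten s))).prod := by
  induction S with
  | nil => simp [groupMap]
  | cons s S ih =>
    rw [map_cons, groupMap, flatten_cons,
      tens_append _ _ _ _ _ _ rfl (length_flatten ..), ih, map_cons, List.prod_cons]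
    rfl

/-- The coalgebra map of tensors given by its components `F`. -/
def coMap (F : Q.Ten →ₗ[K] R.Tot) : Q.Ten →ₗ[K] R.Ten :=
  byLen fun k => ∑ c : Composition k, groupMap F c.blocks

theorem coMap_ten (F : Q.Ten →ₗ[K] R.Tot) (L : List Q.HEl) :
    coMap F (ten L) = csum (fun S => (S.map fun s => ι K (F (ten s))).prod) L := by
  rw [coMap, byLen_ten, LinearMap.sum_apply, ← sum_composition_eq_csum _ L rfl]
  refine sum_congr rfl fun c _ => ?_
  rw [← groupMap_flatten]
  have h1 := List.map_length_splitWrtComposition L c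
  have h2 := List.flatten_splitWrtComposition L c
  unfold List.splitWrtComposition at h1 h2
  rw [h1, h2]

@[simp] theorem coMap_one (F : Q.Ten →ₗ[K] R.Tot) : coMap F 1 = 1 := by
  rw [← ten_nil, coMap_ten]; simp

theorem coMap_cons (F : Q.Ten →ₗ[K] R.Tot) (h : Q.HEl) (t : List Q.HEl) :
    coMap F (ten (h :: t)) =
      dsum (fun u v => ι K (F (ten (h :: u))) * coMap F (ten v)) t := by
  rw [coMap_ten, csum_cons]
  refine dsum_congr fun u v _ => ?_
  rw [coMap_ten, ← mulLeft_apply (R := K), lmap_csum]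
  simp

theorem aug_coMap_cons (F : Q.Ten →ₗ[K] R.Tot) (h : Q.HEl) (t : List Q.HEl) :
    R.aug (coMap F (ten (h :: t))) = 0 := by
  rw [coMap_cons, ← AlgHom.toLinearMap_apply, lmap_dsum]
  simp only [AlgHom.toLinearMap_apply, aug_ι_mul, dsum_zero]

theorem aug_coMap (F : Q.Ten →ₗ[K] R.Tot) (X : Q.Ten) : R.aug (coMap F X) = Q.aug X := by
  have : R.aug.toLinearMap ∘ₗ coMap F = Q.aug.toLinearMap := ten_ext fun L => by
    cases L with
    | nil => simp
    | cons h t => simp [aug_coMap_cons, aug_ten_cons]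
  exact LinearMap.congr_fun this X

theorem coMap_eq (F : Q.Ten →ₗ[K] R.Tot) (hF : F 1 = 0) (X : Q.Ten) :
    coMap F X = algebraMap K _ (Q.aug X) + conv (ι K ∘ₗ F) (coMap F) X := by
  have : coMap F = Algebra.linearMap K _ ∘ₗ Q.aug.toLinearMap +
      conv (ι K ∘ₗ F) (coMap F) := ten_ext fun L => by
    cases L with
    | nil =>
      rw [LinearMap.add_apply, conv_ten]
      simp [hF]
    | cons h t =>
      rw [LinearMap.add_apply, conv_ten, dsum_cons, coMap_cons]
      simp [hF, aug_ten_cons]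
  exact LinearMap.congr_fun this X

theorem delta_coMap (F : Q.Ten →ₗ[K] R.Tot) :
    R.delta ∘ₗ coMap F = TensorProduct.map (coMap F) (coMap F) ∘ₗ Q.delta := by
  refine ten_ext fun L => ?_
  rw [LinearMap.comp_apply, LinearMap.comp_apply, delta_ten, lmap_dsum]
  simp only [map_tmul]
  induction hn : L.length using Nat.strong_induction_on generalizing L with
  | _ n ih =>
  subst hn
  cases L with
  | nil => simpa using delta_ten (Q := R) []
  | cons h t =>
    rw [dsum_cons, coMap_cons, lmap_dsum]
    simp only [delta_ι_mul]
    rw [dsum_add]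
    congr 1
    · rw [← TensorProduct.mk_apply, ten_nil, coMap_one, lmap_dsum]
      rfl
    · have h1 : ∀ u v, u ++ v = t →
          (ι K (F (ten (h :: u))) ⊗ₜ[K] 1 : R.Ten ⊗[K] R.Ten) *
            R.delta (coMap F (ten v)) = dsum (fun v₁ v₂ =>
              (ι K (F (ten (h :: u))) * coMap F (ten v₁)) ⊗ₜ[K] coMap F (ten v₂)) v := by
        intro u v huv
        rw [ih v.length (by simp [← huv]) v rfl, ← mulLeft_apply (R := K), lmap_dsum]
        simp
      rw [dsum_congr h1]
      rw [← dsum_assoc fun u v₁ v₂ =>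
        (ι K (F (ten (h :: u))) * coMap F (ten v₁)) ⊗ₜ[K] coMap F (ten v₂)]
      refine dsum_congr fun w v₂ _ => ?_
      rw [coMap_cons]
      have := lmap_dsum ((TensorProduct.mk K R.Ten R.Ten).flip (coMap F (ten v₂)))
        (fun u v => ι K (F (ten (h :: u))) * coMap F (ten v)) w
      simpa using this.symm

theorem conv_coMap (F : Q.Ten →ₗ[K] R.Tot) (α β : R.Ten →ₗ[K] S.Ten) (X : Q.Ten) :
    conv α β (coMap F X) = conv (α ∘ₗ coMap F) (β ∘ₗ coMap F) X := by
  have := LinearMap.congr_fun (delta_coMap F) X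
  simp only [conv, LinearMap.comp_apply] at this ⊢
  rw [this, ← LinearMap.comp_apply (TensorProduct.map α β), ← TensorProduct.map_comp]

theorem coMap_coMap (F : Q.Ten →ₗ[K] R.Tot) (G : R.Ten →ₗ[K] S.Tot) (hG : G 1 = 0) :
    coMap G ∘ₗ coMap F = coMap (G ∘ₗ coMap F) := by
  refine ten_ext fun L => ?_
  rw [LinearMap.comp_apply]
  induction hn : L.length using Nat.strong_induction_on generalizing L with
  | _ n ih =>
  subst hn
  cases L with
  | nil => simp
  | cons h t =>
    rw [coMap_eq G hG, aug_coMap_cons, map_zero, zero_add, conv_coMap, conv_ten, dsum_cons,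
      coMap_cons]
    simp only [LinearMap.comp_apply, ten_nil, coMap_one, hG, map_zero, zero_mul, zero_add]
    refine dsum_congr fun u v huv => ?_
    rw [← ih v.length (by simp [← huv]) v rfl]

/-! ### Coderivations -/

/-- The coderivation of tensors given by its components `b`. -/
def coDer (b : Q.Ten →ₗ[K] Q.Tot) : Q.Ten →ₗ[K] Q.Ten :=
  conv Q.parity (conv (ι K ∘ₗ b) LinearMap.id)

theorem coDer_ten (b : Q.Ten →ₗ[K] Q.Tot) (L : List Q.HEl) :
    coDer b (ten L) = dsum (fun u w => dsum (fun p q =>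
      (sgn K (sdeg u) • ten u) * (ι K (b (ten p)) * ten q)) w) L := by
  rw [coDer, conv_ten]
  refine dsum_congr fun u w _ => ?_
  rw [conv_ten, parity_ten, ← mulLeft_apply (R := K), lmap_dsum]
  rfl

theorem coDer_ι_mul (b : Q.Ten →ₗ[K] Q.Tot) (h : Q.HEl) (X : Q.Ten) :
    coDer b (ι K (tot h) * X) =
      conv (ι K ∘ₗ b) LinearMap.id (ι K (tot h) * X) +
      sgn K (h.1.2.2 + 1) • (ι K (tot h) * coDer b X) := by
  have : coDer b ∘ₗ mulLeft K (ι K (tot h)) =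
      conv (ι K ∘ₗ b) LinearMap.id ∘ₗ mulLeft K (ι K (tot h)) +
      sgn K (h.1.2.2 + 1) • (mulLeft K (ι K (tot h)) ∘ₗ coDer b) := by
    refine ten_ext fun L => ?_
    simp only [LinearMap.comp_apply, LinearMap.add_apply, LinearMap.smul_apply,
      mulLeft_apply]
    rw [← ten_cons]
    rw [coDer, conv_ten Q.parity _ (h :: L), conv_ten Q.parity _ L, dsum_cons]
    congr 1
    · rw [parity_ten]; simp
    · rw [← mulLeft_apply (R := K), lmap_dsum, ← dsum_smul]
      refine dsum_congr fun u v _ => ?_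
      rw [parity_ten, parity_ten, sdeg_cons, sgn_add (h.1.2.2 + 1) (sdeg u), ten_cons]
      simp [mul_assoc, smul_smul]
  exact LinearMap.congr_fun this X

theorem coDer_one (b : Q.Ten →ₗ[K] Q.Tot) (hb : b 1 = 0) : coDer b 1 = 0 := by
  rw [← ten_nil, coDer_ten]
  simp [hb]

theorem conv_ι_cons (b : Q.Ten →ₗ[K] Q.Tot) (hb : b 1 = 0) (h : Q.HEl) (t : List Q.HEl) :
    conv (ι K ∘ₗ b) LinearMap.id (ten (h :: t)) =
      dsum (fun p q => ι K (b (ten (h :: p))) * ten q) t := by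
  rw [conv_ten, dsum_cons]
  simp [hb]

theorem aug_coDer (b : Q.Ten →ₗ[K] Q.Tot) (hb : b 1 = 0) (X : Q.Ten) :
    Q.aug (coDer b X) = 0 := by
  have : Q.aug.toLinearMap ∘ₗ coDer b = 0 := ten_ext fun L => by
    cases L with
    | nil => simp [coDer_one b hb]
    | cons h t =>
      rw [LinearMap.comp_apply, ten_cons, coDer_ι_mul, map_add, ← ten_cons, conv_ι_cons b hb,
        lmap_dsum]
      simp [dsum_zero]
  exact LinearMap.congr_fun this X

theorem delta_coDer (b : Q.Ten →ₗ[K] Q.Tot) (hb : b 1 = 0) :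
    Q.delta ∘ₗ coDer b = (TensorProduct.map (coDer b) LinearMap.id +
      TensorProduct.map Q.parity (coDer b)) ∘ₗ Q.delta := by
  refine ten_ext fun L => ?_
  rw [LinearMap.comp_apply, LinearMap.comp_apply, delta_ten, lmap_dsum]
  simp only [LinearMap.add_apply, map_tmul, LinearMap.id_apply]
  induction L with
  | nil => simp [coDer_one b hb]
  | cons h t ih =>
    have h0 : coDer b (ten (h :: t)) = dsum (fun p q => ι K (b (ten (h :: p))) * ten q) t
        + sgn K (h.1.2.2 + 1) • (ι K (tot h) * coDer b (ten t)) := by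
      rw [ten_cons, coDer_ι_mul, ← ten_cons, conv_ι_cons b hb]
    have h1 : Q.delta (dsum (fun p q => ι K (b (ten (h :: p))) * ten q) t) =
        1 ⊗ₜ[K] dsum (fun p q => ι K (b (ten (h :: p))) * ten q) t +
        dsum (fun w v => dsum (fun p q => ι K (b (ten (h :: p))) * ten q) w
          ⊗ₜ[K] ten v) t := by
      rw [lmap_dsum]
      simp only [delta_ι_mul, delta_ten]
      rw [dsum_add]
      congr 1
      · rw [← TensorProduct.mk_apply, lmap_dsum]; rfl
      · have h2 : ∀ u v, u ++ v = t → (ι K (b (ten (h :: u))) ⊗ₜ[K] 1 : Q.Ten ⊗[K] Q.Ten) *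
            dsum (fun v₁ v₂ => ten v₁ ⊗ₜ[K] ten v₂) v = dsum (fun v₁ v₂ =>
              (ι K (b (ten (h :: u))) * ten v₁) ⊗ₜ[K] ten v₂) v := by
          intro u v _
          rw [← mulLeft_apply (R := K), lmap_dsum]
          simp
        rw [dsum_congr h2]
        rw [← dsum_assoc fun u v₁ v₂ =>
          (ι K (b (ten (h :: u))) * ten v₁) ⊗ₜ[K] ten v₂]
        refine dsum_congr fun w v₂ _ => ?_
        exact (lmap_dsum ((TensorProduct.mk K Q.Ten Q.Ten).flip (ten v₂)) _ w).symm
    rw [h0, map_add, h1, map_smul, delta_ι_mul, ih, dsum_cons, ten_nil, coDer_one b hb,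
      ← ten_nil, parity_ten]
    have h3 : dsum (fun u v => coDer b (ten (h :: u)) ⊗ₜ[K] ten v +
        Q.parity (ten (h :: u)) ⊗ₜ[K] coDer b (ten v)) t =
        dsum (fun w v => dsum (fun p q => ι K (b (ten (h :: p))) * ten q) w
          ⊗ₜ[K] ten v) t +
        sgn K (h.1.2.2 + 1) • ((ι K (tot h) ⊗ₜ[K] 1) *
          dsum (fun u v => coDer b (ten u) ⊗ₜ[K] ten v + Q.parity (ten u) ⊗ₜ[K] coDer b (ten v)) t) := by
      rw [← mulLeft_apply (R := K), lmap_dsum, ← dsum_smul, ← dsum_add]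
      refine dsum_congr fun u v _ => ?_
      have h4 : coDer b (ten (h :: u)) = dsum (fun p q => ι K (b (ten (h :: p))) * ten q) u
        + sgn K (h.1.2.2 + 1) • (ι K (tot h) * coDer b (ten u)) := by
        rw [ten_cons, coDer_ι_mul, ← ten_cons, conv_ι_cons b hb]
      rw [h4, parity_ten, parity_ten, sdeg_cons, sgn_add (h.1.2.2 + 1) (sdeg u), ten_cons]
      simp only [TensorProduct.add_tmul, map_add, mulLeft_apply,
        Algebra.TensorProduct.tmul_mul_tmul, one_mul, smul_add, TensorProduct.smul_tmul',
        mul_smul_comm, smul_smul]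
      abel
    rw [h3, h0]
    simp only [sdeg_nil, sgn_zero, one_smul, ten_nil, TensorProduct.zero_tmul, zero_add,
      TensorProduct.tmul_add, TensorProduct.tmul_smul, smul_add]
    abel

end GradedQuiver

theorem sum_pred_add_length {α : Type*} (S : List (List α)) (hS : ∀ s ∈ S, s ≠ []) :
    (List.map (fun j => j - 1) (S.map List.length)).sum + S.length = S.flatten.length := by
  induction S with
  | nil => rfl
  | cons t S ih =>
    have ht : 0 < t.length := length_pos_iff.mpr (hS t (by simp))
    grind

namespace GradedQuiver

variable {Q R S : GradedQuiver K}

/-- The properties of a map of tensors that is given by a family of multilinear maps, one for every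
number of arguments, all of the same shifted degree. -/
structure HasHom (φ : Q.Ob → R.Ob) (e : ℤ) (α : Q.Ten →ₗ[K] R.Tot) : Prop where
  one : α 1 = 0
  not_path : ∀ L : List Q.HEl, (¬ ∃ a b, IsPath a L b) → α (ten L) = 0
  mem : ∀ a L b, IsPath a L b → α (ten L) ∈ LinearMap.range (R.of (φ a) (φ b) (sdeg L + e))

theorem HasHom.exists_tot {φ : Q.Ob → R.Ob} {e : ℤ} {α : Q.Ten →ₗ[K] R.Tot} (h : HasHom φ e α)
    {a b : Q.Ob} {L : List Q.HEl} (hL : IsPath a L b) :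
    ∃ y : R.HEl, y.1 = (φ a, φ b, sdeg L + e) ∧ α (ten L) = tot y := by
  obtain ⟨v, hv⟩ := h.mem a L b hL
  exact ⟨⟨(φ a, φ b, sdeg L + e), v⟩, rfl, hv.symm⟩

theorem tot_mem_range {y : R.HEl} {a b : R.Ob} {d : ℤ} (h : y.1 = (a, b, d)) :
    tot y ∈ LinearMap.range (R.of a b d) := by
  obtain ⟨p, v⟩ := y
  change p = _ at h
  subst h
  exact ⟨v, rfl⟩

theorem hasHom_twist {φ : Q.Ob → R.Ob} {e : ℤ} {G : ℕ → (Q.Ten →ₗ[K] R.Tot)} (h0 : G 0 = 0)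
    (h : ∀ k : ℕ, IsFam φ (k + 1) ((k : ℤ) + 1 + e) (G (k + 1))) : HasHom φ e (twist G) where
  one := by rw [← ten_nil, twist_ten]; simp [h0]
  not_path L hL := by
    rw [twist_ten]
    cases hk : L.length with
    | zero => rw [h0]; simp
    | succ k => rw [(h k).not_path L hL, smul_zero]
  mem a L b hL := by
    rw [twist_ten]
    refine Submodule.smul_mem _ _ ?_
    cases hk : L.length with
    | zero => rw [h0]; exact Submodule.zero_mem _
    | succ k =>
      obtain ⟨y, hy, hy'⟩ := (h k).hom a L b hL hk
      rw [hy']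
      refine tot_mem_range (hy.trans ?_)
      rw [sdeg, hk]
      push_cast
      congr 2
      ring

/-- The component with `k` arguments of a map of tensors, without the sign `s^{⊗ k}`. -/
def untwist (F : Q.Ten →ₗ[K] R.Tot) (k : ℕ) : Q.Ten →ₗ[K] R.Tot :=
  F ∘ₗ Q.weight fun w => if w.length = k then sgn K (shiftExp (w.map fun p => p.2.2)) else 0

theorem untwist_ten (F : Q.Ten →ₗ[K] R.Tot) (k : ℕ) (L : List Q.HEl) :
    untwist F k (ten L) = if L.length = k then sgn K (shiftExp (degs L)) • F (ten L) else 0 := by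
  rw [untwist, LinearMap.comp_apply, weight_ten, length_map]
  split_ifs with h
  · rw [map_smul, degs, List.map_map]; rfl
  · simp

theorem isFam_untwist {φ : Q.Ob → R.Ob} {e : ℤ} {F : Q.Ten →ₗ[K] R.Tot} (hF : HasHom φ e F)
    (k : ℕ) : IsFam φ k ((k : ℤ) + e) (untwist F k) where
  ne L hL := by rw [untwist_ten, if_neg hL]
  not_path L hL := by rw [untwist_ten, hF.not_path L hL, smul_zero, ite_self]
  hom a L b hL hk := by
    rw [untwist_ten, if_pos hk]
    obtain ⟨v, hv⟩ := Submodule.smul_mem _ (sgn K (shiftExp (degs L))) (hF.mem a L b hL)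
    refine ⟨⟨(φ a, φ b, sdeg L + e), v⟩, ?_, hv.symm⟩
    simp only [sdeg, hk]
    rw [add_assoc]

/-- The span of the tensors of a given length. -/
def lenSpan (Q : GradedQuiver K) (n : ℕ) : Submodule K Q.Ten :=
  Submodule.span K {w | ∃ L : List Q.HEl, L.length = n ∧ w = ten L}

theorem ten_mem_lenSpan (L : List Q.HEl) : ten L ∈ Q.lenSpan L.length :=
  Submodule.subset_span ⟨L, rfl, rfl⟩

theorem lenSpan_induction {n : ℕ} {P : Q.Ten → Prop} {X : Q.Ten} (hX : X ∈ Q.lenSpan n)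
    (h : ∀ L : List Q.HEl, L.length = n → P (ten L)) (h0 : P 0)
    (hadd : ∀ X Y, P X → P Y → P (X + Y)) (hsmul : ∀ (c : K) X, P X → P (c • X)) : P X := by
  induction hX using Submodule.span_induction with
  | mem x hx => obtain ⟨L, hL, rfl⟩ := hx; exact h L hL
  | zero => exact h0
  | add x y _ _ hx hy => exact hadd x y hx hy
  | smul c x _ hx => exact hsmul c x hx

theorem ι_mul_mem_lenSpan (h : Q.HEl) {n : ℕ} {X : Q.Ten} (hX : X ∈ Q.lenSpan n) :
    ι K (tot h) * X ∈ Q.lenSpan (n + 1) := by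
  refine lenSpan_induction (P := fun X => ι K (tot h) * X ∈ Q.lenSpan (n + 1)) hX
    ?_ ?_ ?_ ?_
  · intro L hL
    rw [← ten_cons]
    exact Submodule.subset_span ⟨_, by simp [hL], rfl⟩
  · rw [mul_zero]; exact Submodule.zero_mem _
  · intro X Y hX hY; rw [mul_add]; exact Submodule.add_mem _ hX hY
  · intro c X hX; rw [mul_smul_comm]; exact Submodule.smul_mem _ _ hX

theorem shiftSign_ι_mul (h : Q.HEl) {n : ℕ} {X : Q.Ten} (hX : X ∈ Q.lenSpan n) :
    Q.shiftSign (ι K (tot h) * X) =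
      sgn K (n * h.1.2.2) • (ι K (tot h) * Q.shiftSign X) := by
  refine lenSpan_induction (P := fun X => Q.shiftSign (ι K (tot h) * X) =
      sgn K (n * h.1.2.2) • (ι K (tot h) * Q.shiftSign X)) hX ?_ ?_ ?_ ?_
  · intro L hL
    rw [← ten_cons, shiftSign_ten, shiftSign_ten, ten_cons, mul_smul_comm, smul_smul, ← sgn_add,
      degs_cons, shiftExp, length_degs, hL]
  · simp
  · intro X Y hX hY; rw [mul_add, map_add, hX, hY, map_add, mul_add, smul_add]
  · intro c X hX; rw [mul_smul_comm, map_smul, hX, map_smul, mul_smul_comm, smul_comm]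

theorem eq_twist_of_mem_lenSpan {V : Type*} [AddCommGroup V] [Module K V]
    (α : ℕ → (Q.Ten →ₗ[K] V)) {n : ℕ} {X : Q.Ten} (hX : X ∈ Q.lenSpan n) :
    α n X = twist α (Q.shiftSign X) := by
  refine lenSpan_induction (P := fun X => α n X = twist α (Q.shiftSign X)) hX ?_ ?_ ?_ ?_
  · rintro L rfl
    rw [shiftSign_ten, map_smul, eq_twist_ten]
  · simp
  · intro X Y hX hY; rw [map_add, hX, hY, map_add, map_add]
  · simp_all

end GradedQuiver

open GradedQuiver

namespace AInfData

variable (A : AInfData K)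

theorem m_isFam (k : ℕ) : IsFam (fun x => x) (k + 1) ((k : ℤ) + 1 + (-2)) (A.m (k + 1)) := by
  have := (A.mul k).isFam
  rwa [show (k : ℤ) + 1 + (-2) = k - 1 by ring]

/-- The multiplications of an `A_∞`-category, as a map of tensors with the signs of the bar
construction. -/
def b : A.Ten →ₗ[K] A.Tot := twist A.m

theorem b_hasHom : HasHom (fun x => x) (-2) A.b := hasHom_twist rfl A.m_isFam

theorem sum_midMul {V : Type u} [AddCommGroup V] [Module K V] (G : ℕ → (A.Ten →ₗ[K] V))
    (L : List A.HEl) {k : ℕ} (hk : L.length = k) :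
    (∑ v ∈ (Finset.Nat.antidiagonalTuple 3 k).filter (fun v => 0 < v 1),
      (-1 : K) ^ (v 0 + v 1 * v 2) • (G (v 0 + 1 + v 2) ∘ₗ A.midMul (v 0) (v 1) (v 2))) (ten L) =
    sgn K (shiftExp (degs L)) • twist G (coDer A.b (ten L)) := by
  subst hk
  rw [Finset.sum_filter_of_ne, LinearMap.sum_apply]
  swap
  · intro v _ hv
    by_contra h0
    have h0 : v 1 = 0 := by omega
    apply hv
    have : A.midMul (v 0) (v 1) (v 2) = 0 := by
      rw [h0]
      have hm : A.m 0 = 0 := rfl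
      simp only [midMul, hm, LinearMap.comp_zero, tens, TensorProduct.map_zero_left,
        TensorProduct.map_zero_right, LinearMap.zero_comp]
    rw [this]
    simp
  have key : ∀ u p q : List A.HEl, u ++ (p ++ q) = L →
      (-1 : K) ^ (u.length + p.length * q.length) •
        (G (u.length + 1 + q.length) (A.midMul u.length p.length q.length (ten L))) =
      sgn K (shiftExp (degs L)) • twist G ((sgn K (sdeg u) • ten u) *
        (ι K (A.b (ten p)) * ten q)) := by
    rintro u p q rfl
    have h1 : A.midMul u.length p.length q.length (ten (u ++ (p ++ q))) =
        A.koszul p.length (ten u) * (ι K (A.m p.length (ten p)) * ten q) := by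
      rw [midMul, tens_append _ _ _ _ _ _ rfl (by simp), tens_append _ _ _ _ _ _ rfl rfl]
      rfl
    rw [h1]
    have hz : ∀ hz : A.m p.length (ten p) = 0, (-1 : K) ^ (u.length + p.length * q.length) •
        G (u.length + 1 + q.length) (A.koszul p.length (ten u) *
          (ι K (A.m p.length (ten p)) * ten q)) =
        sgn K (shiftExp (degs (u ++ (p ++ q)))) • twist G ((sgn K (sdeg u) • ten u) *
        (ι K (A.b (ten p)) * ten q)) := by
      intro hz
      rw [b, twist_ten, hz]
      simp
    cases hp : p with
    | nil => subst hp; exact hz rfl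
    | cons x p' =>
      rw [← hp]
      by_cases hpath : ∃ a b, IsPath a p b
      · obtain ⟨a, b, hpath⟩ := hpath
        have hlen : p.length = p'.length + 1 := by simp [hp]
        obtain ⟨y, hy, hy'⟩ := (A.m_isFam p'.length).hom a p b hpath hlen
        rw [← hlen] at hy'
        rw [AInfData.b, twist_ten, hy', koszul_ten]
        have h2 : ten (u ++ y :: q) = ten u * (ι K (tot y) * ten q) := by
          rw [ten_append, ten_cons]
        simp only [map_smul, smul_mul_assoc, mul_smul_comm, ← h2]
        have h3 : (u ++ y :: q).length = u.length + 1 + q.length := by simp; omega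
        rw [← h3, eq_twist_ten, smul_smul, smul_smul, smul_smul, smul_smul]
        congr 1
        rw [neg_one_pow_eq_sgn, ← sgn_add, ← sgn_add, ← sgn_add, ← sgn_add]
        apply sgn_congr
        have hyd : y.1.2.2 = (degs p).sum + p.length - 2 := by
          rw [hy, hlen]; push_cast; ring
        simp only [degs_append, degs_cons, shiftExp_append, shiftExp, length_append,
          length_cons, length_degs, hyd, sdeg]
        push_cast
        refine ⟨p.length * q.length - q.length - shiftExp (degs p), ?_⟩
        ring
      · apply hz
        have hlen : p.length = p'.length + 1 := by simp [hp]
        rw [hlen]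
        exact (A.m_isFam p'.length).not_path p hpath
  have h4 := sum_antidiagonalTuple_eq_dsum (fun u p q =>
      sgn K (shiftExp (degs L)) • twist G ((sgn K (sdeg u) • ten u) *
        (ι K (A.b (ten p)) * ten q))) L
  rw [coDer_ten, lmap_dsum]
  simp only [lmap_dsum, ← dsum_smul]
  refine Eq.trans ?_ h4
  refine sum_congr rfl fun v hv => ?_
  have hv' := Finset.Nat.mem_antidiagonalTuple.mp hv
  rw [Fin.sum_univ_three] at hv'
  have h5 := key (L.take (v 0)) ((L.drop (v 0)).take (v 1)) ((L.drop (v 0)).drop (v 1)) (by simp)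
  have e0 : (L.take (v 0)).length = v 0 := by simp; omega
  have e1 : ((L.drop (v 0)).take (v 1)).length = v 1 := by simp; omega
  have e2 : ((L.drop (v 0)).drop (v 1)).length = v 2 := by simp; omega
  rw [e0, e1, e2] at h5
  exact h5

end AInfData

namespace AInfFunctorData

variable {A B : AInfData K} (f : AInfFunctorData A B)

theorem F_isFam (k : ℕ) : IsFam f.obj (k + 1) ((k : ℤ) + 1 + (-1)) (f.F (k + 1)) := by
  have := (f.comps k).isFam
  rwa [show (k : ℤ) + 1 + (-1) = k by ring]

/-- The components of an `A_∞`-functor, as a map of tensors with the signs of the bar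
construction. -/
def tw : A.Ten →ₗ[K] B.Tot := twist f.F

theorem tw_hasHom : HasHom f.obj (-1) f.tw := hasHom_twist rfl f.F_isFam

theorem tensF_flatten (S : List (List A.HEl)) (hS : ∀ s ∈ S, s ≠ []) :
    f.tensF (S.map List.length) (ten S.flatten) ∈ B.lenSpan S.length ∧
    B.shiftSign (f.tensF (S.map List.length) (ten S.flatten)) =
      ((-1 : K) ^ epsG (S.map List.length) * sgn K (shiftExp (degs S.flatten))) •
        (S.map fun s => ι K (f.tw (ten s))).prod := by
  induction S with
  | nil =>
    have : f.tensF [] (ten ([] : List A.HEl)) = ten ([] : List B.HEl) := by simp [tensF]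
    simp only [map_nil, List.flatten_nil]
    rw [this]
    exact ⟨ten_mem_lenSpan [], by rw [shiftSign_ten]; simp [epsG, shiftExp]⟩
  | cons s S ih =>
    obtain ⟨ih1, ih2⟩ := ih fun t ht => hS t (by simp [ht])
    have hs : s ≠ [] := hS s (by simp)
    have hlen : (List.map (fun j => j - 1) (S.map List.length)).sum + S.length =
        S.flatten.length := sum_pred_add_length S fun t ht => hS t (by simp [ht])
    set e := (List.map (fun j => j - 1) (S.map List.length)).sum with he
    have h1 : f.tensF ((s :: S).map List.length) (ten (s :: S).flatten) =
        (sgn K (e * (degs s).sum) * sgn K (shiftExp (degs s))) •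
        (ι K (f.tw (ten s)) * f.tensF (S.map List.length) (ten S.flatten)) := by
      rw [map_cons, tensF, flatten_cons,
        tens_append _ _ _ _ _ _ rfl (length_flatten ..)]
      rw [LinearMap.comp_apply, LinearMap.comp_apply, ← he, koszul_ten, map_smul,
        eq_twist_ten, map_smul, map_smul, smul_smul, smul_mul_assoc]
      rfl
    rw [h1]
    by_cases hpath : ∃ a b, IsPath a s b
    · obtain ⟨a, b, hpath⟩ := hpath
      obtain ⟨y, hy, hy'⟩ := f.tw_hasHom.exists_tot hpath
      rw [hy']
      refine ⟨Submodule.smul_mem _ _ (ι_mul_mem_lenSpan y ih1), ?_⟩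
      rw [map_smul, shiftSign_ι_mul y ih1, ih2]
      simp only [map_cons, List.prod_cons]
      rw [hy', mul_smul_comm, smul_smul, smul_smul]
      congr 1
      have hyd : y.1.2.2 = sdeg s + -1 := by rw [hy]
      rw [neg_one_pow_eq_sgn, neg_one_pow_eq_sgn, ← sgn_add, ← sgn_add, ← sgn_add, ← sgn_add,
        ← sgn_add]
      congr 1
      have hpos : 0 < s.length := length_pos_iff.mpr hs
      simp only [hyd, sdeg, epsG, flatten_cons, degs_append, shiftExp_append,
        length_degs, ← hlen, length_map]
      push_cast [Nat.cast_sub hpos]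
      ring
    · rw [f.tw_hasHom.not_path s hpath]
      simp [f.tw_hasHom.not_path s hpath]

theorem sum_tensF {V : Type u} [AddCommGroup V] [Module K V] (G : ℕ → (B.Ten →ₗ[K] V))
    (L : List A.HEl) {k : ℕ} (hk : L.length = k) :
    (∑ c : Composition k, (-1 : K) ^ epsG c.blocks • (G c.length ∘ₗ f.tensF c.blocks)) (ten L) =
      sgn K (shiftExp (degs L)) • twist G (coMap f.tw (ten L)) := by
  subst hk
  rw [LinearMap.sum_apply, coMap_ten, lmap_csum, ← sum_composition_eq_csum _ L rfl,
    Finset.smul_sum]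
  refine sum_congr rfl fun c _ => ?_
  have h1 := List.map_length_splitWrtComposition L c
  have h2 := List.flatten_splitWrtComposition L c
  have h3 : ∀ s ∈ List.splitWrtComposition L c, s ≠ [] := fun s hs =>
    length_pos_iff.mp (List.length_pos_of_mem_splitWrtComposition hs)
  unfold List.splitWrtComposition at h1 h2 h3
  obtain ⟨h4, h5⟩ := f.tensF_flatten _ h3
  rw [h1, h2] at h4 h5
  have h6 : (L.splitWrtCompositionAux c.blocks).length = c.length := by
    simpa using congrArg List.length h1
  rw [h6] at h4
  rw [LinearMap.smul_apply, LinearMap.comp_apply, eq_twist_of_mem_lenSpan G h4, h5, map_smul,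
    smul_smul, ← mul_assoc, neg_one_pow_eq_sgn, sgn_mul_self, one_mul]

end AInfFunctorData

namespace GradedQuiver

variable {Q R S : GradedQuiver K}

/-- The span of the tensors of composable paths from `a` to `b` of a given total shifted degree. -/
def pathSpan (Q : GradedQuiver K) (a b : Q.Ob) (d : ℤ) : Submodule K Q.Ten :=
  Submodule.span K {w | ∃ L : List Q.HEl, IsPath a L b ∧ sdeg L = d ∧ w = ten L}

theorem ten_mem_pathSpan {a b : Q.Ob} {L : List Q.HEl} (h : IsPath a L b) :
    ten L ∈ Q.pathSpan a b (sdeg L) :=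
  Submodule.subset_span ⟨L, h, rfl, rfl⟩

theorem eqOn_pathSpan {V : Type*} [AddCommMonoid V] [Module K V] {α β : Q.Ten →ₗ[K] V}
    {a b : Q.Ob} {d : ℤ} (h : ∀ L, IsPath a L b → α (ten L) = β (ten L)) {X : Q.Ten}
    (hX : X ∈ Q.pathSpan a b d) : α X = β X := by
  refine LinearMap.eqOn_span ?_ hX
  rintro _ ⟨L, hL, -, rfl⟩
  exact h L hL

theorem map_pathSpan_le {α : Q.Ten →ₗ[K] R.Ten} {a b : Q.Ob} {d : ℤ} {V : Submodule K R.Ten}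
    (h : ∀ L, IsPath a L b → sdeg L = d → α (ten L) ∈ V) {X : Q.Ten}
    (hX : X ∈ Q.pathSpan a b d) : α X ∈ V := by
  have : Q.pathSpan a b d ≤ V.comap α := by
    refine Submodule.span_le.mpr ?_
    rintro _ ⟨L, hL, hd, rfl⟩
    exact h L hL hd
  exact this hX

theorem ι_mul_mem_pathSpan {a b c : Q.Ob} {d e : ℤ} {v : Q.Tot}
    (hv : v ∈ LinearMap.range (Q.of a c d)) {X : Q.Ten} (hX : X ∈ Q.pathSpan c b e) :
    ι K v * X ∈ Q.pathSpan a b (d + 1 + e) := by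
  obtain ⟨w, rfl⟩ := hv
  refine map_pathSpan_le (α := mulLeft K (ι K (Q.of a c d w)))
    (fun L hL hd => ?_) hX
  refine Submodule.subset_span ⟨⟨(a, c, d), w⟩ :: L, ⟨rfl, hL⟩, ?_, ?_⟩
  · rw [sdeg_cons, hd]
  · rw [ten_cons]; rfl

theorem dsum_mem {α M : Type*} [AddCommMonoid M] [Module K M] (V : Submodule K M)
    {f : List α → List α → M} {L : List α} (h : ∀ u v, u ++ v = L → f u v ∈ V) :
    dsum f L ∈ V := by
  induction L generalizing f with
  | nil => exact h _ _ rfl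
  | cons a t ih =>
    rw [dsum_cons]
    exact V.add_mem (h _ _ rfl) (ih fun u v huv => h _ _ (by rw [← huv]; rfl))

theorem mul_mem_pathSpan {a b c : Q.Ob} {d e : ℤ} {X Y : Q.Ten} (hX : X ∈ Q.pathSpan a c d)
    (hY : Y ∈ Q.pathSpan c b e) : X * Y ∈ Q.pathSpan a b (d + e) := by
  refine map_pathSpan_le (α := mulRight K Y) (fun L hL hd => ?_) hX
  refine map_pathSpan_le (α := mulLeft K (ten L)) (fun M hM he => ?_) hY
  refine Submodule.subset_span ⟨L ++ M, isPath_append.mpr ⟨c, hL, hM⟩, ?_, ?_⟩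
  · rw [sdeg_append, hd, he]
  · rw [ten_append]; rfl

theorem coMap_mem_pathSpan {φ : Q.Ob → R.Ob} {F : Q.Ten →ₗ[K] R.Tot} (hF : HasHom φ (-1) F)
    {a b : Q.Ob} {L : List Q.HEl} (hL : IsPath a L b) :
    coMap F (ten L) ∈ R.pathSpan (φ a) (φ b) (sdeg L) := by
  induction hn : L.length using Nat.strong_induction_on generalizing L a with
  | _ n ih =>
  subst hn
  cases L with
  | nil =>
    rw [ten_nil, coMap_one, sdeg_nil]
    have : a = b := hL
    subst this
    exact ten_mem_pathSpan (L := []) rfl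
  | cons h t =>
    rw [coMap_cons]
    refine dsum_mem _ fun u v huv => ?_
    subst huv
    obtain ⟨c, h1, h2⟩ := isPath_append (L := h :: u).mp hL
    have h3 := ι_mul_mem_pathSpan (hF.mem a _ c h1) (ih v.length (by simp) h2 rfl)
    rwa [show sdeg (h :: u) + -1 + 1 + sdeg v = sdeg (h :: (u ++ v)) by
      rw [← cons_append, sdeg_append]; ring] at h3

theorem coDer_mem_pathSpan {b : Q.Ten →ₗ[K] Q.Tot} (hb : HasHom (fun x => x) (-2) b)
    {x y : Q.Ob} {L : List Q.HEl} (hL : IsPath x L y) :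
    coDer b (ten L) ∈ Q.pathSpan x y (sdeg L - 1) := by
  rw [coDer_ten]
  refine dsum_mem _ fun u w huw => dsum_mem _ fun p q hpq => ?_
  subst hpq huw
  obtain ⟨c, h1, h2⟩ := isPath_append.mp hL
  obtain ⟨d, h3, h4⟩ := isPath_append.mp h2
  have h5 := mul_mem_pathSpan (Submodule.smul_mem _ (sgn K (sdeg u)) (ten_mem_pathSpan h1))
    (ι_mul_mem_pathSpan (hb.mem c _ d h3) (ten_mem_pathSpan h4))
  rwa [show sdeg u + (sdeg p + -2 + 1 + sdeg q) = sdeg (u ++ (p ++ q)) - 1 by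
      rw [sdeg_append, sdeg_append]; ring] at h5

/-- A coalgebra map that is compatible with differentials on generators is a chain map. -/
theorem coMap_coDer {φ : Q.Ob → R.Ob} {F : Q.Ten →ₗ[K] R.Tot} (hF : HasHom φ (-1) F)
    {b : Q.Ten →ₗ[K] Q.Tot} (hb : b 1 = 0) {b' : R.Ten →ₗ[K] R.Tot} (hb' : b' 1 = 0)
    (hrel : ∀ x L y, IsPath x L y → b' (coMap F (ten L)) = F (coDer b (ten L)))
    {x y : Q.Ob} {L : List Q.HEl} (hL : IsPath x L y) :
    coMap F (coDer b (ten L)) = coDer b' (coMap F (ten L)) := by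
  induction hn : L.length using Nat.strong_induction_on generalizing L x with
  | _ n ih =>
  subst hn
  cases L with
  | nil => rw [ten_nil, coDer_one b hb, coMap_one, coDer_one b' hb', map_zero]
  | cons h t =>
    have hl : coMap F (coDer b (ten (h :: t))) =
        dsum (fun u v => ι K (F (coDer b (ten u))) * coMap F (ten v)) (h :: t) +
        dsum (fun u v => ι K (F (Q.parity (ten u))) * coMap F (coDer b (ten v)))
          (h :: t) := by
      rw [coMap_eq F hF.one, aug_coDer b hb, map_zero, zero_add, conv, LinearMap.comp_apply,
        LinearMap.comp_apply]
      have := LinearMap.congr_fun (delta_coDer b hb) (ten (h :: t))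
      rw [LinearMap.comp_apply] at this
      rw [this, LinearMap.comp_apply, delta_ten, lmap_dsum, lmap_dsum, lmap_dsum, ← dsum_add]
      refine dsum_congr fun u v _ => ?_
      simp
    have hr : coDer b' (coMap F (ten (h :: t))) =
        conv (ι K ∘ₗ b') LinearMap.id (coMap F (ten (h :: t))) +
        dsum (fun u v => sgn K (sdeg (h :: u)) • (ι K (F (ten (h :: u))) *
          coDer b' (coMap F (ten v)))) t := by
      rw [coMap_cons, lmap_dsum, lmap_dsum, ← dsum_add]
      refine dsum_congr fun u v huv => ?_
      subst huv
      obtain ⟨c, h1, h2⟩ := isPath_append (L := h :: u).mp hL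
      obtain ⟨z, hz, hz'⟩ := hF.exists_tot h1
      rw [hz', coDer_ι_mul, hz]
      congr 3
      ring
    rw [hl, hr, conv_coMap, conv_ten]
    congr 1
    · refine dsum_congr fun u v huv => ?_
      rw [← huv] at hL
      obtain ⟨c, h1, h2⟩ := isPath_append.mp hL
      rw [← hrel x u c h1]
      rfl
    · rw [dsum_cons, ten_nil, ← ten_nil, parity_ten, ten_nil, map_smul, hF.one, smul_zero,
        map_zero, zero_mul, zero_add]
      refine dsum_congr fun u v huv => ?_
      subst huv
      obtain ⟨c, h1, h2⟩ := isPath_append (L := h :: u).mp hL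
      rw [ih v.length (by simp) h2 rfl, parity_ten]
      simp

theorem coMap_congr_path {F G : Q.Ten →ₗ[K] R.Tot}
    (h : ∀ a L b, IsPath a L b → F (ten L) = G (ten L)) {a b : Q.Ob} {L : List Q.HEl}
    (hL : IsPath a L b) : coMap F (ten L) = coMap G (ten L) := by
  induction hn : L.length using Nat.strong_induction_on generalizing L a with
  | _ n ih =>
  subst hn
  cases L with
  | nil => rw [ten_nil, coMap_one, coMap_one]
  | cons x t =>
    rw [coMap_cons, coMap_cons]
    refine dsum_congr fun u v huv => ?_
    subst huv
    obtain ⟨c, h1, h2⟩ := isPath_append (L := x :: u).mp hL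
    rw [h _ _ _ h1, ih v.length (by simp) h2 rfl]

/-- Composability, for a list of labels of homogeneous elements. -/
def IsPathIdx : Q.Ob → List (Q.Ob × Q.Ob × ℤ) → Q.Ob → Prop
  | a, [], b => a = b
  | a, h :: t, b => h.1 = a ∧ IsPathIdx h.2.1 t b

theorem isPathIdx_map {a b : Q.Ob} {L : List Q.HEl} :
    IsPathIdx a (L.map Sigma.fst) b ↔ IsPath a L b := by
  induction L generalizing a with
  | nil => rfl
  | cons h t ih => simp only [map_cons, IsPathIdx, IsPath, ih]

/-- The projection onto the span of the tensors of composable paths. -/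
def pathProj (Q : GradedQuiver K) : Q.Ten →ₗ[K] Q.Ten :=
  Q.weight fun w => if ∃ a b, IsPathIdx (Q := Q) a w b then 1 else 0

theorem pathProj_ten_of_path {a b : Q.Ob} {L : List Q.HEl} (h : IsPath a L b) :
    Q.pathProj (ten L) = ten L := by
  rw [pathProj, weight_ten, if_pos ⟨a, b, isPathIdx_map.mpr h⟩, one_smul]

theorem pathProj_ten_of_not {L : List Q.HEl} (h : ¬ ∃ a b, IsPath a L b) :
    Q.pathProj (ten L) = 0 := by
  rw [pathProj, weight_ten, if_neg, zero_smul]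
  rintro ⟨a, b, hab⟩
  exact h ⟨a, b, isPathIdx_map.mp hab⟩

theorem pathProj_of_mem {a b : Q.Ob} {d : ℤ} {X : Q.Ten} (hX : X ∈ Q.pathSpan a b d) :
    Q.pathProj X = X :=
  eqOn_pathSpan (β := LinearMap.id) (fun _ hL => pathProj_ten_of_path hL) hX

theorem ιInv_ten_cons (h : Q.HEl) (t : List Q.HEl) :
    ιInv (R := K) (ten (h :: t)) = Q.aug (ten t) • tot h := by
  rw [ten_cons, ιInv_ι_mul]

theorem coMap_ιInv : coMap (ιInv : Q.Ten →ₗ[K] Q.Tot) = LinearMap.id := by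
  refine ten_ext fun L => ?_
  induction L with
  | nil => simp
  | cons h t ih =>
    rw [coMap_cons, dsum_eq_first]
    · rw [ih, ιInv_ten_cons]; simp [ten_cons]
    · intro u v _ hu
      obtain ⟨x, u, rfl⟩ := List.exists_cons_of_ne_nil hu
      rw [ιInv_ten_cons, aug_ten_cons]; simp

theorem ιInv_coMap {F : Q.Ten →ₗ[K] R.Tot} (hF : F 1 = 0) (X : Q.Ten) :
    ιInv (R := K) (coMap F X) = F X := by
  have : ιInv ∘ₗ coMap F = F := ten_ext fun L => by
    cases L with
    | nil => rw [ten_nil, hF, LinearMap.comp_apply, coMap_one, ιInv_one]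
    | cons h t =>
      rw [LinearMap.comp_apply, coMap_cons, lmap_dsum, dsum_eq_last]
      · rw [ιInv_ι_mul]; simp
      · intro u v _ hv
        obtain ⟨x, v, rfl⟩ := List.exists_cons_of_ne_nil hv
        rw [ιInv_ι_mul, aug_coMap_cons, zero_smul]
  exact LinearMap.congr_fun this X

theorem ιInv_coDer {b : Q.Ten →ₗ[K] Q.Tot} (hb : b 1 = 0) (X : Q.Ten) :
    ιInv (R := K) (coDer b X) = b X := by
  have : ιInv ∘ₗ coDer b = b := ten_ext fun L => by
    cases L with
    | nil => rw [ten_nil, hb, LinearMap.comp_apply, coDer_one b hb, map_zero]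
    | cons h t =>
      rw [LinearMap.comp_apply, ten_cons, coDer_ι_mul, map_add, map_smul, ιInv_ι_mul,
        aug_coDer b hb, zero_smul, smul_zero, add_zero, ← ten_cons, conv_ι_cons b hb, lmap_dsum,
        dsum_eq_last]
      · rw [ιInv_ι_mul]; simp
      · intro u v _ hv
        obtain ⟨x, v, rfl⟩ := List.exists_cons_of_ne_nil hv
        rw [ιInv_ι_mul, aug_ten_cons, zero_smul]
  exact LinearMap.congr_fun this X

theorem hasHom_ιInv : HasHom (fun x => x) (-1) (ιInv : Q.Ten →ₗ[K] Q.Tot) where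
  one := ιInv_one
  not_path L hL := by
    cases L with
    | nil => exact ιInv_one
    | cons h t =>
      rw [ιInv_ten_cons]
      cases t with
      | nil => exact absurd ⟨_, _, rfl, rfl⟩ hL
      | cons h' t => rw [aug_ten_cons, zero_smul]
  mem a L b hL := by
    cases L with
    | nil => rw [ten_nil, ιInv_one]; exact Submodule.zero_mem _
    | cons h t =>
      rw [ιInv_ten_cons]
      cases t with
      | nil =>
        refine Submodule.smul_mem _ _ ?_
        obtain ⟨⟨x, y, d⟩, v⟩ := h
        obtain ⟨h1, h2⟩ := hL
        change x = a at h1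
        change y = b at h2
        subst h1 h2
        refine tot_mem_range ?_
        simp [sdeg]
      | cons h' t => rw [aug_ten_cons, zero_smul]; exact Submodule.zero_mem _

end GradedQuiver

open GradedQuiver

/-- The identity of `x`, as a homogeneous element. -/
def AInfData.oneH (A : AInfData K) (x : A.Ob) : A.HEl := ⟨(x, x, 0), A.one x⟩

theorem AInfData.el_one (A : AInfData K) (x : A.Ob) :
    A.el (A.one x) = ten [A.oneH x] := el_eq _

/-- The properties of the components of an `A_∞`-functor, with the signs of the bar construction. -/
structure IsTw (A B : AInfCat K) (φ : A.Ob → B.Ob) (F : A.Ten →ₗ[K] B.Tot) :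
    Prop where
  hom : HasHom φ (-1) F
  rel : ∀ a L b, IsPath a L b → B.b (coMap F (ten L)) = F (coDer A.b (ten L))
  unit : ∀ x, F (ten [A.oneH x]) = tot (B.oneH (φ x))
  higher : ∀ u x v, u ++ v ≠ [] → F (ten (u ++ A.oneH x :: v)) = 0

section

variable {A B C D : AInfCat K}

namespace IsTw

variable {φ : A.Ob → B.Ob} {F : A.Ten →ₗ[K] B.Tot}

theorem coMap_coDer (h : IsTw A B φ F) {x y : A.Ob} {L : List A.HEl} (hL : IsPath x L y) :
    coMap F (coDer A.b (ten L)) = coDer B.b (coMap F (ten L)) :=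
  GradedQuiver.coMap_coDer h.hom A.b_hasHom.one B.b_hasHom.one h.rel hL

theorem coMap_unit (h : IsTw A B φ F) (u : List A.HEl) (x : A.Ob) (v : List A.HEl) :
    coMap F (ten (u ++ A.oneH x :: v)) =
      coMap F (ten u) * ten [B.oneH (φ x)] * coMap F (ten v) := by
  induction hn : u.length using Nat.strong_induction_on generalizing u with
  | _ n ih =>
  subst hn
  cases u with
  | nil =>
    rw [nil_append, coMap_cons, dsum_eq_first]
    · rw [h.unit, ten_nil, coMap_one, one_mul, ten_singleton]
    · intro p q _ hp
      have := h.higher [] x p (by simpa using hp)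
      simp_all
  | cons a t =>
    rw [cons_append, coMap_cons, coMap_cons, dsum_append_cons, ← mulRight_apply (R := K),
      ← mulRight_apply (R := K), lmap_dsum, lmap_dsum]
    rw [dsum_congr (L := v) (g := fun _ _ => 0), dsum_zero, add_zero]
    · refine dsum_congr fun p q hpq => ?_
      rw [ih q.length (by simp [← hpq]) q rfl]
      simp only [mulRight_apply, mul_assoc]
    · intro p q _
      have := h.higher (a :: t) x p (by simp)
      rw [cons_append] at this
      rw [this, map_zero, zero_mul]

theorem unit_mul (h : IsTw A B φ F) (X : A.Ten) (x : A.Ob) (Y : A.Ten) :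
    F (X * ten [A.oneH x] * Y) = (A.aug X * A.aug Y) • tot (B.oneH (φ x)) := by
  induction X using ten_induction with
  | h u =>
    induction Y using ten_induction with
    | h v =>
      rw [← ten_append, ← ten_append]
      cases u with
      | nil =>
        cases v with
        | nil => simpa using h.unit x
        | cons a t =>
          have := h.higher [] x (a :: t) (by simp)
          rw [aug_ten_cons, mul_zero, zero_smul]
          simpa using this
      | cons a t =>
        have := h.higher (a :: t) x v (by simp)
        rw [aug_ten_cons, zero_mul, zero_smul]
        simpa using this
    | h0 => simp
    | hadd X Y hX hY => rw [mul_add, map_add, hX, hY, map_add, mul_add, add_smul]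
    | hsmul c X hX => rw [mul_smul_comm, map_smul, hX, map_smul, smul_eq_mul, smul_smul]; congr 1; ring
  | h0 => simp
  | hadd X Y hX hY => rw [add_mul, add_mul, map_add, hX, hY, map_add, add_mul, add_smul]
  | hsmul c X hX =>
    rw [smul_mul_assoc, smul_mul_assoc, map_smul, hX, map_smul, smul_eq_mul, smul_smul, mul_assoc]

theorem id (A : AInfCat K) : IsTw A A (fun x => x) ιInv where
  hom := hasHom_ιInv
  rel a L b _ := by
    rw [coMap_ιInv, ιInv_coDer A.b_hasHom.one]; rfl
  unit x := by rw [ιInv_ten_cons]; simp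
  higher u x v huv := by
    cases u with
    | nil =>
      obtain ⟨a, t, rfl⟩ := List.exists_cons_of_ne_nil (by simpa using huv : v ≠ [])
      rw [nil_append, ιInv_ten_cons, aug_ten_cons, zero_smul]
    | cons a t =>
      obtain ⟨a', t', h⟩ := List.exists_cons_of_ne_nil (by simp : t ++ A.oneH x :: v ≠ [])
      rw [cons_append, ιInv_ten_cons, h, aug_ten_cons, zero_smul]

/-- The components of a composite. -/
def compTw (F : A.Ten →ₗ[K] B.Tot) (G : B.Ten →ₗ[K] C.Tot) : A.Ten →ₗ[K] C.Tot :=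
  G ∘ₗ coMap F ∘ₗ A.pathProj

theorem compTw_path (F : A.Ten →ₗ[K] B.Tot) (G : B.Ten →ₗ[K] C.Tot) {a b : A.Ob} {L : List A.HEl}
    (hL : IsPath a L b) : compTw F G (ten L) = G (coMap F (ten L)) := by
  rw [compTw, LinearMap.comp_apply, LinearMap.comp_apply, pathProj_ten_of_path hL]

theorem coMap_compTw {F : A.Ten →ₗ[K] B.Tot} {G : B.Ten →ₗ[K] C.Tot} (hG : G 1 = 0) {a b : A.Ob}
    {L : List A.HEl} (hL : IsPath a L b) :
    coMap (compTw F G) (ten L) = coMap G (coMap F (ten L)) := by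
  rw [← LinearMap.comp_apply (coMap G), coMap_coMap F G hG]
  exact coMap_congr_path (fun a L b h => compTw_path F G h) hL

theorem comp (h : IsTw A B φ F) {ψ : B.Ob → C.Ob} {G : B.Ten →ₗ[K] C.Tot} (h' : IsTw B C ψ G) :
    IsTw A C (fun x => ψ (φ x)) (compTw F G) where
  hom :=
    { one := by
        by_cases h0 : Nonempty A.Ob
        · obtain ⟨a⟩ := h0
          rw [← ten_nil, compTw_path F G (show IsPath a [] a from rfl), ten_nil, coMap_one,
            h'.hom.one]
        · rw [← ten_nil, compTw, LinearMap.comp_apply, LinearMap.comp_apply, pathProj_ten_of_not,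
            map_zero, map_zero]
          rintro ⟨a, -⟩
          exact h0 ⟨a⟩
      not_path := fun L hL => by
        rw [compTw, LinearMap.comp_apply, LinearMap.comp_apply, pathProj_ten_of_not hL, map_zero,
            map_zero]
      mem := fun a L b hL => by
        rw [compTw_path F G hL]
        have h1 := coMap_mem_pathSpan h.hom hL
        have : B.pathSpan (φ a) (φ b) (sdeg L) ≤
            (LinearMap.range (C.of (ψ (φ a)) (ψ (φ b)) (sdeg L + -1))).comap G := by
          refine Submodule.span_le.mpr ?_
          rintro _ ⟨M, hM, hd, rfl⟩
          have := h'.hom.mem _ _ _ hM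
          rwa [hd] at this
        exact this h1 }
  rel a L b hL := by
    rw [coMap_compTw h'.hom.one hL]
    have h1 := coMap_mem_pathSpan h.hom hL
    have h2 := eqOn_pathSpan (α := C.b ∘ₗ coMap G) (β := G ∘ₗ coDer B.b)
      (fun M hM => h'.rel _ M _ hM) h1
    refine h2.trans ?_
    rw [LinearMap.comp_apply, ← h.coMap_coDer hL, compTw, LinearMap.comp_apply,
      LinearMap.comp_apply, pathProj_of_mem (coDer_mem_pathSpan A.b_hasHom hL)]
  unit x := by
    rw [compTw_path F G (show IsPath x [A.oneH x] x from ⟨rfl, rfl⟩), coMap_cons, dsum_nil,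
      h.unit, ten_nil, coMap_one, mul_one, ← ten_singleton, h'.unit]
  higher u x v huv := by
    by_cases hp : ∃ a b, IsPath a (u ++ A.oneH x :: v) b
    · obtain ⟨a, b, hp⟩ := hp
      rw [compTw_path F G hp, h.coMap_unit, h'.unit_mul, aug_coMap, aug_coMap]
      cases u with
      | nil =>
        obtain ⟨a, t, rfl⟩ := List.exists_cons_of_ne_nil (by simpa using huv : v ≠ [])
        rw [aug_ten_cons, mul_zero, zero_smul]
      | cons a t => rw [aug_ten_cons, zero_mul, zero_smul]
    · rw [compTw, LinearMap.comp_apply, LinearMap.comp_apply, pathProj_ten_of_not hp, map_zero,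
            map_zero]

end IsTw

theorem sgn_smul_cancel {V : Type*} [AddCommGroup V] [Module K V] (n : ℤ) {x y : V} :
    sgn K n • x = sgn K n • y ↔ x = y := by
  constructor
  · intro h
    have := congrArg (fun z => sgn K n • z) h
    simpa only [smul_smul, sgn_mul_self, one_smul] using this
  · rintro rfl; rfl

namespace AInfFunctor

theorem isTw (f : AInfFunctor A B) : IsTw A B f.obj f.tw where
  hom := f.tw_hasHom
  rel a L b hL := by
    cases hk : L.length with
    | zero =>
      have : L = [] := List.length_eq_zero_iff.mp hk
      subst this
      rw [ten_nil, coMap_one, coDer_one _ A.b_hasHom.one, B.b_hasHom.one, map_zero]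
    | succ k =>
      have h1 := eqOnPaths_iff.mp (f.rel (k + 1) (by omega)) a L b hL hk
      rw [A.sum_midMul f.F L hk, f.sum_tensF B.m L hk, sgn_smul_cancel] at h1
      exact h1.symm
  unit x := by
    have h1 := f.unit x
    rw [AInfData.el_one] at h1
    rw [AInfFunctorData.tw, twist_ten]
    refine (congrArg _ h1).trans ?_
    simp [AInfData.oneH, shiftExp, tot]
    rfl
  higher u x v huv := by
    rw [AInfFunctorData.tw, twist_ten]
    have h1 := f.higher_unit (u ++ A.oneH x :: v).length (by
      have : 0 < (u ++ v).length := length_pos_iff.mpr huv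
      simp at this ⊢; omega) x (ten u) (ten v)
    rw [AInfData.el_one, ← ten_append, ← ten_append, append_assoc, singleton_append] at h1
    rw [h1, smul_zero]

end AInfFunctor

/-- The data of a functor given by its components with the signs of the bar construction. -/
def IsTw.data {φ : A.Ob → B.Ob} {F : A.Ten →ₗ[K] B.Tot} (_ : IsTw A B φ F) :
    AInfFunctorData A.toAInfData B.toAInfData :=
  ⟨φ, fun n => famOf φ n n (untwist F (n + 1))⟩

theorem IsTw.data_F {φ : A.Ob → B.Ob} {F : A.Ten →ₗ[K] B.Tot} (h : IsTw A B φ F) (k : ℕ) :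
    h.data.F k = if k = 0 then 0 else untwist F k := by
  cases k with
  | zero => rfl
  | succ n =>
    rw [if_neg (by omega)]
    refine onTen_famOf ?_
    have := isFam_untwist h.hom (n + 1)
    rwa [show ((n + 1 : ℕ) : ℤ) + -1 = n by push_cast; ring] at this

theorem IsTw.data_tw {φ : A.Ob → B.Ob} {F : A.Ten →ₗ[K] B.Tot} (h : IsTw A B φ F) :
    h.data.tw = F := by
  refine ten_ext fun L => ?_
  rw [AInfFunctorData.tw, twist_ten, h.data_F]
  split_ifs with h0
  · have : L = [] := List.length_eq_zero_iff.mp h0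
    subst this
    rw [ten_nil, h.hom.one]; simp
  · rw [untwist_ten, if_pos rfl, smul_smul, sgn_mul_self, one_smul]

/-- The functor given by its components with the signs of the bar construction. -/
def IsTw.functor {φ : A.Ob → B.Ob} {F : A.Ten →ₗ[K] B.Tot} (h : IsTw A B φ F) :
    AInfFunctor A B where
  toAInfFunctorData := h.data
  rel k hk := by
    refine eqOnPaths_iff.mpr fun a L b hL hn => ?_
    rw [A.sum_midMul h.data.F L hn, h.data.sum_tensF B.m L hn, sgn_smul_cancel]
    have := h.rel a L b hL
    have h1 := h.data_tw
    rw [h1]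
    refine Eq.trans ?_ this.symm
    exact congrArg (fun G : A.Ten →ₗ[K] B.Tot => G _) h1
  unit x := by
    rw [h.data_F, if_neg (by omega), AInfData.el_one, untwist_ten, if_pos (List.length_singleton ..), h.unit]
    simp [AInfData.oneH, shiftExp]
    rfl
  higher_unit k hk x X Y := by
    rw [h.data_F, if_neg (by omega), AInfData.el_one]
    induction X using ten_induction with
    | h u =>
      induction Y using ten_induction with
      | h v =>
        rw [← ten_append, ← ten_append, untwist_ten]
        split_ifs with h1
        · rw [append_assoc, singleton_append, h.higher, smul_zero]
          grind
        · rfl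
      | h0 => simp
      | hadd X Y hX hY => rw [mul_add, map_add, hX, hY, add_zero]
      | hsmul c X hX => rw [mul_smul_comm, map_smul, hX, smul_zero]
    | h0 => simp
    | hadd X Y hX hY => rw [add_mul, add_mul, map_add, hX, hY, add_zero]
    | hsmul c X hX => rw [smul_mul_assoc, smul_mul_assoc, map_smul, hX, smul_zero]

theorem IsTw.functor_tw {φ : A.Ob → B.Ob} {F : A.Ten →ₗ[K] B.Tot} (h : IsTw A B φ F) :
    h.functor.tw = F := h.data_tw

namespace AInfFunctor

theorem F_ten (f : AInfFunctor A B) (k : ℕ) (L : List A.HEl) :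
    f.F k (ten L) = if L.length = k then sgn K (shiftExp (degs L)) • f.tw (ten L) else 0 := by
  split_ifs with h
  · rw [AInfFunctorData.tw, ← eq_twist_ten, h]
  · cases k with
    | zero => rfl
    | succ n => exact (f.F_isFam n).ne L h

theorem ext_tw {f g : AInfFunctor A B} (h0 : f.obj = g.obj)
    (h : ∀ a L b, IsPath a L b → f.tw (ten L) = g.tw (ten L)) : f = g := by
  have htw : f.tw = g.tw := ten_ext fun L => by
    by_cases hL : ∃ a b, IsPath a L b
    · grind
    · rw [f.tw_hasHom.not_path L hL, g.tw_hasHom.not_path L hL]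
  have hF : ∀ k, f.F k = g.F k := fun k => ten_ext fun L => by
    rw [F_ten, F_ten, htw]
  clear h htw
  obtain ⟨⟨fo, fc⟩, _, _, _⟩ := f
  obtain ⟨⟨go, gc⟩, _, _, _⟩ := g
  change fo = go at h0
  subst h0
  have : fc = gc := funext fun n => onTen_injective (hF (n + 1))
  subst this
  rfl

/-- The identity functor. -/
def id (A : AInfCat K) : AInfFunctor A A := (IsTw.id A).functor

/-- The composite of two functors. -/
def comp (f : AInfFunctor A B) (g : AInfFunctor B C) : AInfFunctor A C :=
  (f.isTw.comp g.isTw).functor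

theorem id_tw (A : AInfCat K) : (id A).tw = ιInv := (IsTw.id A).functor_tw

theorem comp_tw (f : AInfFunctor A B) (g : AInfFunctor B C) :
    (comp f g).tw = IsTw.compTw f.tw g.tw := (f.isTw.comp g.isTw).functor_tw

theorem id_comp (f : AInfFunctor A B) : comp (id A) f = f := by
  refine ext_tw rfl fun a L b hL => ?_
  rw [comp_tw, IsTw.compTw_path _ _ hL, id_tw, coMap_ιInv]; rfl

theorem comp_id (f : AInfFunctor A B) : comp f (id B) = f := by
  refine ext_tw rfl fun a L b hL => ?_
  rw [comp_tw, IsTw.compTw_path _ _ hL, id_tw, ιInv_coMap f.tw_hasHom.one]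

theorem assoc (f : AInfFunctor A B) (g : AInfFunctor B C) (h : AInfFunctor C D) :
    comp (comp f g) h = comp f (comp g h) := by
  refine ext_tw rfl fun a L b hL => ?_
  rw [comp_tw, IsTw.compTw_path _ _ hL, comp_tw, IsTw.coMap_compTw g.tw_hasHom.one hL,
    comp_tw, IsTw.compTw_path _ _ hL, comp_tw, IsTw.compTw, LinearMap.comp_apply,
    LinearMap.comp_apply, pathProj_of_mem (coMap_mem_pathSpan f.tw_hasHom hL)]

theorem isId_id (A : AInfCat K) : (id A).IsId := by
  refine ⟨fun x => rfl, fun x y d v => ?_, fun k hk => ten_ext fun L => ?_⟩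
  · rw [el_eq, F_ten, if_pos (List.length_singleton ..), id_tw, ιInv_ten_cons]
    simp [shiftExp, tot]
  · rw [F_ten, id_tw]
    split_ifs with h
    · match L, h with
      | [], h => simp at h; omega
      | [_], h => simp at h; omega
      | a :: b :: t, h => rw [ιInv_ten_cons, aug_ten_cons, zero_smul, smul_zero]; rfl
    · rfl

theorem isComp_comp (f : AInfFunctor A B) (g : AInfFunctor B C) : f.IsComp g (comp f g) := by
  refine ⟨fun x => rfl, fun k hk => eqOnPaths_iff.mpr fun a L b hL hn => ?_⟩
  rw [f.sum_tensF g.F L hn, F_ten, if_pos hn, comp_tw, IsTw.compTw_path _ _ hL]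
  rfl

end AInfFunctor

end

abbrev Code := List (List (ℕ × ℕ))

/-! ## Partial sums and blocks -/

/-- The partial sums of a list. -/
def partialSums (n : List ℕ) : Set ℕ := {s | ∃ u v, u ++ v = n ∧ u.sum = s}

theorem mem_partialSums_nil {s : ℕ} : s ∈ partialSums [] ↔ s = 0 := by
  constructor
  · rintro ⟨u, v, huv, rfl⟩
    simp_all
  · rintro rfl
    exact ⟨[], [], rfl, rfl⟩

theorem mem_partialSums_cons {a s : ℕ} {n : List ℕ} :
    s ∈ partialSums (a :: n) ↔ s = 0 ∨ ∃ t ∈ partialSums n, s = a + t := by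
  constructor
  · rintro ⟨u, v, huv, rfl⟩
    cases u with
    | nil => exact Or.inl rfl
    | cons b u =>
      rw [cons_append, List.cons.injEq] at huv
      obtain ⟨rfl, rfl⟩ := huv
      exact Or.inr ⟨u.sum, ⟨u, v, rfl, rfl⟩, sum_cons⟩
  · rintro (rfl | ⟨_, ⟨u, v, rfl, rfl⟩, rfl⟩)
    · exact ⟨[], a :: n, rfl, rfl⟩
    · exact ⟨a :: u, v, rfl, sum_cons⟩

theorem zero_mem_partialSums (n : List ℕ) : 0 ∈ partialSums n := ⟨[], n, rfl, rfl⟩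

theorem mem_partialSums_append {s : ℕ} {m n : List ℕ} :
    s ∈ partialSums (m ++ n) ↔ s ∈ partialSums m ∨ ∃ t ∈ partialSums n, s = m.sum + t := by
  induction m generalizing s with
  | nil =>
    rw [nil_append, mem_partialSums_nil]
    constructor
    · intro h; exact Or.inr ⟨s, h, by simp⟩
    · rintro (rfl | ⟨t, ht, rfl⟩)
      · exact zero_mem_partialSums n
      · simpa using ht
  | cons a m ih =>
    simp only [cons_append, mem_partialSums_cons, ih, sum_cons]
    grind

theorem le_sum_of_mem_partialSums {s : ℕ} {n : List ℕ} (h : s ∈ partialSums n) : s ≤ n.sum := by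
  obtain ⟨u, v, rfl, rfl⟩ := h
  simp

theorem mem_partialSums_flatten {s : ℕ} (N : List (List ℕ)) :
    s ∈ partialSums N.flatten ↔
      s ∈ partialSums (N.map List.sum) ∨
        ∃ A n B, A ++ n :: B = N ∧ ∃ t ∈ partialSums n, s = (A.map List.sum).sum + t := by
  induction N generalizing s with
  | nil => simp
  | cons m N ih =>
    rw [flatten_cons, mem_partialSums_append, map_cons, mem_partialSums_cons]
    simp only [ih]
    constructor
    · rintro (h | ⟨t, h | ⟨A, n, B, rfl, t', ht', rfl⟩, rfl⟩)
      · exact Or.inr ⟨[], m, N, rfl, s, h, by simp⟩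
      · exact Or.inl (Or.inr ⟨t, h, rfl⟩)
      · exact Or.inr ⟨m :: A, n, B, rfl, t', ht', by simp [add_assoc]⟩
    · rintro ((rfl | ⟨t, ht, rfl⟩) | ⟨A, n, B, hN, t, ht, rfl⟩)
      · exact Or.inl (zero_mem_partialSums m)
      · exact Or.inr ⟨t, Or.inl ht, rfl⟩
      · cases A with
        | nil =>
          simp only [nil_append, List.cons.injEq] at hN
          obtain ⟨rfl, rfl⟩ := hN
          exact Or.inl (by simpa using ht)
        | cons a A =>
          simp only [cons_append, List.cons.injEq] at hN
          obtain ⟨rfl, rfl⟩ := hN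
          exact Or.inr ⟨(A.map List.sum).sum + t, Or.inr ⟨A, n, B, rfl, t, ht, rfl⟩,
            by simp [add_assoc]⟩

theorem mem_partialSums_filter {s : ℕ} (n : List ℕ) :
    s ∈ partialSums (n.filter fun a => a ≠ 0) ↔ s ∈ partialSums n := by
  induction n generalizing s with
  | nil => rfl
  | cons a n ih =>
    by_cases ha : a = 0
    · subst ha
      rw [filter_cons_of_neg (by simp), ih, mem_partialSums_cons]
      simp only [zero_add, exists_eq_right']
      constructor
      · exact Or.inr
      · rintro (rfl | h)
        · exact zero_mem_partialSums n
        · exact h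
    · rw [filter_cons_of_pos (by simpa using ha), mem_partialSums_cons, mem_partialSums_cons]
      simp only [ih]

namespace CompositionAsSet

variable {p : ℕ}

theorem mem_boundaries_iff_partialSums (T : CompositionAsSet p) (j : Fin (p + 1)) :
    j ∈ T.boundaries ↔ j.val ∈ partialSums T.blocks := by
  rw [T.mem_boundaries_iff_exists_blocks_sum_take_eq]
  constructor
  · rintro ⟨i, -, h⟩
    exact ⟨T.blocks.take i, T.blocks.drop i, take_append_drop .., h⟩
  · rintro ⟨u, v, huv, h⟩
    refine ⟨u.length, ?_, ?_⟩
    · rw [T.card_boundaries_eq_succ_length, ← T.blocks_length, ← huv]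
      simp
    · rw [← huv, List.take_left' rfl, h]

theorem blocks_pos (T : CompositionAsSet p) {i : ℕ} (h : i ∈ T.blocks) : 0 < i := by
  unfold blocks at h
  obtain ⟨k, rfl⟩ := (List.mem_ofFn' ..).mp h
  exact T.blocksFun_pos k

theorem eq_of_blocks {T U : CompositionAsSet p} (h : T.blocks = U.blocks) : T = U := by
  ext j
  rw [mem_boundaries_iff_partialSums, mem_boundaries_iff_partialSums, h]

theorem blocks_eq (T : CompositionAsSet p) {n : List ℕ} (hpos : ∀ i ∈ n, 0 < i) (hsum : n.sum = p)
    (h : ∀ j : Fin (p + 1), j ∈ T.boundaries ↔ j.val ∈ partialSums n) : T.blocks = n := by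
  let c : Composition p := ⟨n, fun {i} hi => hpos i hi, hsum⟩
  have : T = c.toCompositionAsSet := by
    ext j
    rw [h, mem_boundaries_iff_partialSums, Composition.toCompositionAsSet_blocks]
  rw [this, Composition.toCompositionAsSet_blocks]

theorem boundary_eq (T : CompositionAsSet p) (i : ℕ) (hi : i < T.boundaries.card) :
    (T.boundary ⟨i, hi⟩).val = (T.blocks.take i).sum := (T.blocks_partial_sum hi).symm

end CompositionAsSet

/-! ## Vertex maps and edges -/

namespace EndHom

variable {m n p q k : ℕ}

/-- An endpoint-preserving order map as a function on natural numbers, constant from `m` on. -/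
def nat (h : EndHom m n) (i : ℕ) : ℕ := (h.toFun ⟨min i m, by omega⟩).val

theorem val_toFun (h : EndHom m n) (i : Fin (m + 1)) : (h.toFun i).val = h.nat i.val := by
  unfold nat
  congr 2
  ext
  simp only
  omega

theorem nat_mono (h : EndHom m n) : Monotone h.nat := fun i j hij =>
  h.mono (a := ⟨min i m, by omega⟩) (b := ⟨min j m, by omega⟩) (by simp only [Fin.mk_le_mk]; omega)

theorem nat_zero (h : EndHom m n) : h.nat 0 = 0 := by
  have := h.val_toFun 0
  rw [h.map_zero] at this
  exact this.symm

theorem nat_of_le (h : EndHom m n) {i : ℕ} (hi : m ≤ i) : h.nat i = n := by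
  have := h.val_toFun (Fin.last m)
  rw [h.map_last, Fin.val_last, Fin.val_last] at this
  refine Eq.trans ?_ this.symm
  unfold nat
  congr 2
  ext
  simp only
  omega

theorem nat_last (h : EndHom m n) : h.nat m = n := h.nat_of_le le_rfl

theorem nat_le (h : EndHom m n) (i : ℕ) : h.nat i ≤ n := Nat.le_of_lt_succ (h.toFun _).isLt

theorem ext_nat {f g : EndHom m n} (h : ∀ i ≤ m, f.nat i = g.nat i) : f = g := by
  refine EndHom.ext (funext fun i => Fin.ext ?_)
  rw [val_toFun, val_toFun]
  exact h _ (Nat.le_of_lt_succ i.isLt)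

theorem nat_comp (f : EndHom m n) (g : EndHom n k) (i : ℕ) : (f.comp g).nat i = g.nat (f.nat i) := by
  rw [← val_toFun g ⟨f.nat i, Nat.lt_succ_of_le (f.nat_le i)⟩]
  rfl

theorem nat_id (m i : ℕ) : (EndHom.id m).nat i = min i m := rfl

theorem nat_ofEq (h : m = n) (i : ℕ) : (ofEq h).nat i = min i m := by
  subst h
  rfl

theorem nat_add (f : EndHom m n) (g : EndHom p q) (i : ℕ) :
    (f.add g).nat i = if i ≤ m then f.nat i else n + g.nat (i - m) := by
  have key : ∀ i : Fin (m + p + 1), ((f.add g).toFun i).val =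
      if i.val ≤ m then f.nat i else n + g.nat (i - m) := by
    intro i
    by_cases hi : i.val ≤ m
    · simp only [add, hi, dif_pos, if_true]
      exact f.val_toFun ⟨i.val, by omega⟩
    · simp only [add, hi, dif_neg, not_false_eq_true, if_false]
      rw [g.val_toFun ⟨i.val - m, by omega⟩]
  unfold nat at key ⊢
  rw [key]
  simp only
  by_cases hi : i ≤ m
  · grind
  · by_cases hp : m + p ≤ i
    · by_cases h0 : p = 0
      · subst h0
        rw [if_pos (by omega), if_neg hi]
        have h1 := f.nat_of_le (i := min i (m + 0)) (by omega)
        have h2 := g.nat_of_le (i := i - m) (by omega)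
        unfold nat at h1 h2
        rw [h1, h2]
        have h3 : (g.toFun 0).val = q := by rw [show (0 : Fin (0 + 1)) = Fin.last 0 from rfl, g.map_last]; rfl
        rw [g.map_zero] at h3
        have : q = 0 := h3.symm
        omega
      · grind
    · grind

theorem nat_add_left (f : EndHom m n) (g : EndHom p q) {i : ℕ} (hi : i ≤ m) :
    (f.add g).nat i = f.nat i := by rw [nat_add, if_pos hi]

theorem nat_add_right (f : EndHom m n) (g : EndHom p q) (i : ℕ) :
    (f.add g).nat (m + i) = n + g.nat i := by
  rw [nat_add]
  split_ifs with h
  · obtain rfl : i = 0 := by omega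
    simp [nat_zero, nat_last]
  · simp

theorem nat_face {p : ℕ} (i : Fin (p + 1)) (h0 : i ≠ 0) (hl : i ≠ Fin.last p) {j : ℕ}
    (hj : j ≤ p - 1) : (face i h0 hl).nat j = if j < i.val then j else j + 1 := by
  rw [← val_toFun _ ⟨j, by omega⟩]
  simp only [face]
  split_ifs <;> rfl

theorem toFun_eq_iff (f : EndHom m n) (i : Fin (m + 1)) (j : Fin (n + 1)) :
    f.toFun i = j ↔ f.nat i.val = j.val := by
  rw [Fin.ext_iff, val_toFun]

/-- The pairs of values at consecutive vertices. -/
def edges (h : EndHom m n) : List (ℕ × ℕ) := (List.range m).map fun i => (h.nat i, h.nat (i + 1))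

@[simp] theorem length_edges (h : EndHom m n) : h.edges.length = m := by simp [edges]

theorem edges_injective {f : EndHom m n} {g : EndHom p n} (h : f.edges = g.edges) :
    m = p ∧ ∀ i, f.nat i = g.nat i := by
  have hmp : m = p := by simpa using congrArg List.length h
  subst hmp
  refine ⟨rfl, fun i => ?_⟩
  by_cases hi : i < m
  · have h1 : f.edges[i]? = g.edges[i]? := by rw [h]
    simp [edges, hi] at h1
    exact h1.1
  · rw [f.nat_of_le (by omega), g.nat_of_le (by omega)]

end EndHom

/-! ## Codes of necklace maps -/

namespace Nec

theorem eq_of_blocks {U V : Nec} (h : U.T.blocks = V.T.blocks) : U = V := by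
  obtain ⟨p, T⟩ := U
  obtain ⟨q, W⟩ := V
  have hp : p = q := by rw [← T.blocks_sum, ← W.blocks_sum, h]
  subst hp
  have : T = W := CompositionAsSet.eq_of_blocks h
  rw [this]

variable {T U V : Nec}

/-- The code of a necklace map: the list of the beads of its domain, where a bead is given as the
list of the pairs of values at consecutive vertices. -/
def code (h : U ⟶ V) : Code := h.toEndHom.edges.splitWrtCompositionAux U.T.blocks

theorem flatten_code (h : U ⟶ V) : (code h).flatten = h.toEndHom.edges :=
  List.flatten_splitWrtCompositionAux (by rw [U.T.blocks_sum, EndHom.length_edges])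

theorem map_length_code (h : U ⟶ V) : (code h).map List.length = U.T.blocks :=
  List.map_length_splitWrtCompositionAux (by rw [U.T.blocks_sum, EndHom.length_edges])

theorem code_eq {h : U ⟶ V} {W : Code} (h1 : W.flatten = h.toEndHom.edges)
    (h2 : W.map List.length = U.T.blocks) : code h = W := by
  rw [List.eq_iff_flatten_eq, flatten_code, map_length_code]
  exact ⟨h1.symm, h2.symm⟩

theorem ne_nil_of_mem_code {h : U ⟶ V} {x : List (ℕ × ℕ)} (hx : x ∈ code h) : x ≠ [] := by
  have : x.length ∈ U.T.blocks := by
    rw [← map_length_code h]; exact List.mem_map_of_mem hx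
  exact length_pos_iff.mp (U.T.blocks_pos this)

theorem length_code (h : U ⟶ V) : (code h).length = U.T.length := by
  rw [← U.T.blocks_length, ← map_length_code h, length_map]

theorem length_flatten_code (h : U ⟶ V) : (code h).flatten.length = U.p := by
  rw [flatten_code, EndHom.length_edges]

theorem toEndHom_comp (f : T ⟶ U) (g : U ⟶ V) :
    (f ≫ g).toEndHom = f.toEndHom.comp g.toEndHom := rfl

theorem hom_ext {f g : U ⟶ V} (h : ∀ i ≤ U.p, f.toEndHom.nat i = g.toEndHom.nat i) : f = g := by
  have := EndHom.ext_nat h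
  exact NecHom.ext (congrArg EndHom.toFun this)

end Nec

namespace NecSub

variable {T : Nec}

/-- The code of an injective necklace map. -/
def code (g : NecSub T) : Code := Nec.code g.hom

theorem code_injective {g g' : NecSub T} (h : g.code = g'.code) : g = g' := by
  obtain ⟨U, f, hf⟩ := g
  obtain ⟨U', f', hf'⟩ := g'
  have h1 : U = U' := Nec.eq_of_blocks (by
    rw [← Nec.map_length_code f, ← Nec.map_length_code f']; exact congrArg _ h)
  subst h1
  have h2 : f = f' := by
    refine Nec.hom_ext fun i _ => (EndHom.edges_injective ?_).2 i
    rw [← Nec.flatten_code, ← Nec.flatten_code]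
    exact congrArg _ h
  subst h2
  rfl

end NecSub

namespace Nec

theorem getElem_blocks (U : Nec) (k : Fin U.T.length) (h : k.val < U.T.blocks.length) :
    U.T.blocks[k.val] = U.T.blocksFun k := by
  simp [CompositionAsSet.blocks]

theorem blocks_refine (U : Nec) (S : ∀ k : Fin U.T.length, CompositionAsSet (U.T.blocksFun k)) :
    (U.refine S).T.blocks = (List.ofFn fun k => (S k).blocks).flatten := by
  have hmap : (List.ofFn fun k => (S k).blocks).map List.sum = U.T.blocks := by
    rw [map_ofFn]
    unfold CompositionAsSet.blocks
    congr 1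
    funext k
    exact (S k).blocks_sum
  refine CompositionAsSet.blocks_eq _ ?_ ?_ ?_
  · intro i hi
    obtain ⟨n, hn, hi⟩ := List.mem_flatten.mp hi
    obtain ⟨k, rfl⟩ := (List.mem_ofFn' ..).mp hn
    exact (S k).blocks_pos hi
  · rw [List.sum_flatten, hmap, U.T.blocks_sum]; rfl
  · intro j
    rw [mem_partialSums_flatten, hmap]
    refine (U.mem_refine S j).trans ?_
    refine or_congr (U.T.mem_boundaries_iff_partialSums j) ?_
    constructor
    · rintro ⟨k, i, hi, hj⟩
      refine ⟨(List.ofFn fun k => (S k).blocks).take k, (S k).blocks,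
        (List.ofFn fun k => (S k).blocks).drop (k + 1), ?_, i, ?_, ?_⟩
      · have : (S k).blocks = (List.ofFn fun k => (S k).blocks)[k.val]'(by simp) := by simp
        rw [this, ← List.drop_eq_getElem_cons, take_append_drop]
      · exact ((S k).mem_boundaries_iff_partialSums i).mp hi
      · rw [hj, CompositionAsSet.boundary_eq, ← hmap, List.map_take]
    · rintro ⟨A, n, B, hN, t, ht, hj⟩
      have hlen : A.length < U.T.length := by
        have := congrArg List.length hN
        simp at this
        omega
      have hn : n = (S ⟨A.length, hlen⟩).blocks := by
        have h1 : (A ++ n :: B)[A.length]? = some n := by simp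
        grind
      subst hn
      have hle := le_sum_of_mem_partialSums ht
      rw [CompositionAsSet.blocks_sum] at hle
      refine ⟨⟨A.length, hlen⟩, ⟨t, by omega⟩,
        (CompositionAsSet.mem_boundaries_iff_partialSums _ _).mpr ht, ?_⟩
      rw [hj, CompositionAsSet.boundary_eq, ← hmap, ← hN]
      simp

theorem blocks_wedge (U V : Nec) : (U.wedge V).T.blocks = U.T.blocks ++ V.T.blocks := by
  refine CompositionAsSet.blocks_eq _ ?_ ?_ ?_
  · intro i hi
    rcases List.mem_append.mp hi with hi | hi
    · exact U.T.blocks_pos hi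
    · exact V.T.blocks_pos hi
  · rw [List.sum_append, U.T.blocks_sum, V.T.blocks_sum]; rfl
  · intro j
    rw [mem_partialSums_append]
    refine (mem_wedge U V j).trans (or_congr ?_ ?_)
    · constructor
      · rintro ⟨t, ht, hj⟩
        rw [hj]
        exact (U.T.mem_boundaries_iff_partialSums t).mp ht
      · intro hj
        have hle := le_sum_of_mem_partialSums hj
        rw [CompositionAsSet.blocks_sum] at hle
        exact ⟨⟨j.val, by omega⟩, (U.T.mem_boundaries_iff_partialSums _).mpr hj, rfl⟩
    · rw [U.T.blocks_sum]
      constructor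
      · rintro ⟨w, hw, hj⟩
        exact ⟨w, (V.T.mem_boundaries_iff_partialSums w).mp hw, hj⟩
      · rintro ⟨t, ht, hj⟩
        have hle := le_sum_of_mem_partialSums ht
        rw [CompositionAsSet.blocks_sum] at hle
        exact ⟨⟨t, by omega⟩, (V.T.mem_boundaries_iff_partialSums _).mpr ht, hj⟩

theorem blocks_oneBead_pos {n : ℕ} (h : 0 < n) : (oneBead n).blocks = [n] := by
  refine CompositionAsSet.blocks_eq _ (by simpa using h) (by simp) ?_
  intro j
  rw [mem_partialSums_cons]
  simp only [mem_partialSums_nil, oneBead, Fin.ext_iff, Finset.mem_insert, Finset.mem_singleton,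
    exists_eq_left, add_zero, Fin.val_zero, Fin.val_last]

theorem blocks_oneBead_zero : (oneBead 0).blocks = [] := by
  refine CompositionAsSet.blocks_eq _ (by simp) (by simp) ?_
  intro j
  rw [mem_partialSums_nil]
  have : j = 0 := by omega
  subst this
  simp [oneBead]

/-- The shift of an edge. -/
def shiftEdge (s : ℕ) (e : ℕ × ℕ) : ℕ × ℕ := (s + e.1, s + e.2)

theorem edges_add {m n p q : ℕ} (f : EndHom m n) (g : EndHom p q) :
    (f.add g).edges = f.edges ++ g.edges.map (shiftEdge n) := by
  unfold EndHom.edges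
  rw [List.range_add, map_append, List.map_map, List.map_map]
  congr 1
  · refine map_congr_left fun i hi => ?_
    have := List.mem_range.mp hi
    rw [EndHom.nat_add, EndHom.nat_add, if_pos (by omega), if_pos (by omega)]
  · refine map_congr_left fun i hi => ?_
    simp only [Function.comp_apply, shiftEdge]
    rw [EndHom.nat_add, EndHom.nat_add]
    by_cases hi : i = 0
    · subst hi
      rw [if_pos (by omega), if_neg (by omega), f.nat_of_le (by omega), g.nat_zero]
      congr 3; omega
    · grind

theorem code_wedgeMap {T T' U U' : Nec} (f : T ⟶ T') (g : U ⟶ U') :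
    code (wedgeMap f g) = code f ++ (code g).map (List.map (shiftEdge T'.p)) := by
  refine code_eq ?_ ?_
  · rw [List.flatten_append, flatten_code, ← List.map_flatten, flatten_code]
    exact (edges_add f.toEndHom g.toEndHom).symm
  · rw [map_append, map_length_code, List.map_map]
    have : (List.length ∘ List.map (shiftEdge T'.p)) = List.length := by funext x; simp
    rw [this, map_length_code, blocks_wedge]

end Nec

namespace NecSub

theorem code_wedge {T₁ T₂ : Nec} (g₁ : NecSub T₁) (g₂ : NecSub T₂) :
    (wedge g₁ g₂).code = g₁.code ++ g₂.code.map (List.map (Nec.shiftEdge T₁.p)) :=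
  Nec.code_wedgeMap _ _

theorem code_inert {T : Nec} (g : NecSub T)
    (S : ∀ k : Fin g.dom.T.length, CompositionAsSet (g.dom.T.blocksFun k)) :
    (g.inert S).code = (List.ofFn fun k : Fin g.dom.T.length =>
      (g.code[k.val]'(by rw [code, Nec.length_code]; exact k.isLt)).splitWrtCompositionAux
        (S k).blocks).flatten := by
  have hlen : ∀ k : Fin g.dom.T.length, (g.code[k.val]'(by rw [code, Nec.length_code]; exact k.isLt)).length
      = g.dom.T.blocksFun k := by
    intro k
    have h1 := Nec.map_length_code g.hom
    have h2 : (g.code.map List.length)[k.val]? = g.dom.T.blocks[k.val]? := by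
      rw [show g.code.map List.length = g.dom.T.blocks from h1]
    rw [List.getElem?_map, List.getElem?_eq_getElem (by rw [code, Nec.length_code]; exact k.isLt),
      List.getElem?_eq_getElem (by rw [CompositionAsSet.blocks_length]; exact k.isLt),
      Nec.getElem_blocks] at h2
    simpa using h2
  refine Nec.code_eq ?_ ?_
  · rw [List.flatten_flatten, map_ofFn]
    have h1 : (List.flatten ∘ fun k : Fin g.dom.T.length =>
      (g.code[k.val]'(by rw [code, Nec.length_code]; exact k.isLt)).splitWrtCompositionAux
        (S k).blocks) = fun k => g.code[k.val]'(by rw [code, Nec.length_code]; exact k.isLt) := by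
      funext k
      refine List.flatten_splitWrtCompositionAux ?_
      rw [CompositionAsSet.blocks_sum, hlen]
    rw [h1]
    have h2 : (List.ofFn fun k : Fin g.dom.T.length => g.code[k.val]'(by rw [code, Nec.length_code]; exact k.isLt)) =
        g.code := by
      apply ext_getElem
      · simp [code, Nec.length_code]
      · intro i _ _; simp
    rw [h2, code, Nec.flatten_code]
    refine congrArg EndHom.edges (EndHom.ext_nat fun i hi => ?_)
    refine Eq.symm ((EndHom.nat_comp _ _ _).trans ?_)
    congr 1
    exact (EndHom.nat_id _ _).trans (min_eq_left hi)
  · rw [List.map_flatten, map_ofFn]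
    refine Eq.trans ?_ (Nec.blocks_refine g.dom S).symm
    congr 2
    funext k
    refine List.map_length_splitWrtCompositionAux ?_
    rw [CompositionAsSet.blocks_sum, hlen]

end NecSub

open NecSub (code_wedge)
open Nec (shiftEdge ne_nil_of_mem_code toEndHom_comp)
open EndHom (val_toFun nat_id nat_add nat_comp nat_add_left nat_add_right)

/-! ## Codes of faces -/

theorem edges_face {P R : List (ℕ × ℕ)} {e e' : ℕ × ℕ} {φ ψ : ℕ → ℕ} {n : ℕ}
    (h : P ++ e :: e' :: R = (List.range n).map fun i => (φ i, φ (i + 1)))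
    (hψ : ∀ j ≤ n - 1, ψ j = φ (if j < P.length + 1 then j else j + 1)) :
    P ++ (e.1, e'.2) :: R = (List.range (n - 1)).map fun i => (ψ i, ψ (i + 1)) := by
  have hn := congrArg List.length h
  refine ext_getElem (by simp at hn ⊢; omega) fun j h1 h2 => ?_
  have h3 := List.getElem_of_eq h (i := j) (by simp at h1 ⊢; omega)
  have h4 := List.getElem_of_eq h (i := j + 1) (by simp at h1 ⊢; omega)
  simp at hn h1 h2 h3 h4 ⊢
  rw [hψ j (by omega), hψ (j + 1) (by omega)]
  clear h hψ
  grind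

theorem NecSub.code_face {T : Nec} (g : NecSub T) (i : Fin (g.dom.p + 1))
    (hi : i ∉ g.dom.T.boundaries) {X Y : Code} {u v : List (ℕ × ℕ)}
    {e e' : ℕ × ℕ} (hc : g.code = X ++ (u ++ e :: e' :: v) :: Y)
    (hl : i.val = X.flatten.length + u.length + 1) :
    (g.face i hi).code = X ++ (u ++ (e.1, e'.2) :: v) :: Y := by
  have h0 := g.dom.ne_zero_of_compl hi
  have hlast := g.dom.ne_last_of_compl hi
  have hblocks : X.map List.length ++ (u.length + 2 + v.length) :: Y.map List.length =
      g.dom.T.blocks := by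
    rw [← show _ = g.dom.T.blocks from Nec.map_length_code g.hom, show Nec.code g.hom = _ from hc]
    simp
    omega
  have hsum := g.dom.T.blocks_sum
  rw [← hblocks] at hsum
  simp only [List.sum_append, sum_cons, ← length_flatten] at hsum
  have hp : (g.face i hi).dom.p = g.dom.p - 1 := rfl
  refine Nec.code_eq ?_ ?_
  · have hg : X.flatten ++ u ++ e :: e' :: (v ++ Y.flatten) = g.hom.toEndHom.edges := by
      rw [← Nec.flatten_code, ← show g.code = Nec.code g.hom from rfl, hc]; simp
    have hnat : ∀ j ≤ g.dom.p - 1, (g.face i hi).hom.toEndHom.nat j =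
        g.hom.toEndHom.nat (if j < i.val then j else j + 1) := fun j hj =>
      (nat_comp (g.dom.faceMap i hi).toEndHom g.hom.toEndHom j).trans
        (congrArg _ (EndHom.nat_face i h0 hlast hj))
    rw [show (X ++ (u ++ (e.1, e'.2) :: v) :: Y).flatten =
      X.flatten ++ u ++ (e.1, e'.2) :: (v ++ Y.flatten) by simp]
    exact edges_face hg (by simpa only [length_append, ← hl] using hnat)
  · have : (X ++ (u ++ (e.1, e'.2) :: v) :: Y).map List.length =
        X.map List.length ++ (u.length + 1 + v.length) :: Y.map List.length := by
      simp; omega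
    rw [this]
    refine (CompositionAsSet.blocks_eq _ (fun j hj => ?_) ?_ fun j => ?_).symm
    · have hpos := fun k hk => g.dom.T.blocks_pos (i := k) hk
      rw [← hblocks] at hpos
      simp only [List.mem_append, List.mem_cons] at hj hpos
      grind
    · simp only [List.sum_append, sum_cons, ← length_flatten]
      omega
    · refine (g.dom.mem_face i hi j).trans ?_
      refine (CompositionAsSet.mem_boundaries_iff_partialSums _ _).trans ?_
      rw [← hblocks, show ((EndHom.face i h0 hlast).toFun j).val = _ from
        (val_toFun _ _).trans (EndHom.nat_face i h0 hlast (Nat.le_of_lt_succ j.isLt))]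
      have hA := fun t ht => le_sum_of_mem_partialSums (s := t) (n := X.map List.length) ht
      simp only [mem_partialSums_append, mem_partialSums_cons, ← length_flatten] at hA ⊢
      grind

/-! ### Sums over inner vertices -/

section InnerSum

variable {E M : Type*} [AddCommMonoid M]

theorem sum_range_eq_psum (F : ℕ → M) (x : List E) :
    ∑ j ∈ Finset.range (x.length - 1), F j =
      psum (fun u _ v => if v = [] then 0 else F u.length) x := by
  induction x generalizing F with
  | nil => rfl
  | cons a t ih =>
    rw [psum_cons]
    cases t with
    | nil => simp
    | cons b t =>
      rw [if_neg (by simp)]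
      have := ih (fun j => F (j + 1))
      simp only [length_cons, Nat.add_sub_cancel] at this ⊢
      rw [Finset.sum_range_succ', add_comm, this]
      rfl

/-- A sum over the vertices that are not joints, where also the number of smaller such vertices is
given. -/
theorem sum_inner_eq_psum (F : ℕ → ℕ → M) (W : List (List E)) (hW : ∀ x ∈ W, x ≠ []) :
    (∑ i ∈ Finset.range (W.flatten.length + 1), if i ∈ partialSums (W.map List.length) then 0 else
      F i ((Finset.range i).filter fun i' => i' ∉ partialSums (W.map List.length)).card) =
    psum (fun X x _ => ∑ j ∈ Finset.range (x.length - 1),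
      F (X.flatten.length + 1 + j) ((X.map fun x => x.length - 1).sum + j)) W := by
  induction W generalizing F with
  | nil => simp [mem_partialSums_nil]
  | cons x W ih =>
    have hx : 0 < x.length := length_pos_iff.mpr (hW x (by simp))
    rw [psum_cons]
    have hlen : (x :: W).flatten.length + 1 = x.length + (W.flatten.length + 1) := by simp [add_assoc]
    have hmem1 : ∀ i < x.length, i ∈ partialSums ((x :: W).map List.length) ↔ i = 0 := by
      grind [mem_partialSums_cons]
    have hmem2 : ∀ i, x.length + i ∈ partialSums ((x :: W).map List.length) ↔
        i ∈ partialSums (W.map List.length) := by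
      grind [mem_partialSums_cons]
    have hcard1 : ∀ i < x.length, ((Finset.range (i + 1)).filter fun i' =>
        i' ∉ partialSums ((x :: W).map List.length)).card = i := by
      intro i hi
      induction i with
      | zero => simp [zero_mem_partialSums]
      | succ i ihi =>
        rw [Finset.range_add_one, Finset.filter_insert, if_pos (by rw [hmem1 _ hi]; omega),
          Finset.card_insert_of_notMem (by simp), ihi (by omega)]
    have hcard2 : ∀ i, ((Finset.range (x.length + i)).filter fun i' =>
        i' ∉ partialSums ((x :: W).map List.length)).card = x.length - 1 +
        ((Finset.range i).filter fun i' => i' ∉ partialSums (W.map List.length)).card := by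
      intro i
      induction i with
      | zero => simpa [Nat.sub_add_cancel hx] using hcard1 (x.length - 1) (by omega)
      | succ i ihi =>
        rw [← add_assoc, Finset.range_add_one, Finset.range_add_one, Finset.filter_insert,
          Finset.filter_insert]
        simp only [hmem2]
        split_ifs
        · exact ihi
        · rw [Finset.card_insert_of_notMem (by simp), Finset.card_insert_of_notMem (by simp), ihi,
            add_assoc]
    rw [hlen, Finset.sum_range_add]
    congr 1
    · obtain ⟨n, hn⟩ : ∃ n, x.length = n + 1 := ⟨x.length - 1, by omega⟩
      rw [hn, Finset.sum_range_succ', if_pos (zero_mem_partialSums _), add_zero]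
      refine sum_congr (by simp) fun j hj => ?_
      have hj' : j < n := Finset.mem_range.mp hj
      rw [if_neg (by rw [hmem1 _ (by omega)]; omega), hcard1 j (by omega)]
      simp [add_comm]
    · simp only [hmem2, hcard2]
      refine (ih (fun i c => F (x.length + i) (x.length - 1 + c)) fun y hy => hW y (by simp [hy])).trans
        (psum_congr fun X y Y _ => sum_congr rfl fun j _ => ?_)
      simp only [flatten_cons, length_append, map_cons, sum_cons]
      congr 1 <;> omega

end InnerSum

/-! ## Functions on codes -/

section Lift

variable (K : Type*) [Field K] {M : Type*} [AddCommGroup M] [Module K M]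

/-- A function of injective necklace maps, as a function of their codes. -/
def NecSub.lift {T : Nec} (y : NecSub T → M) (W : Code) : M :=
  if h : ∃ g : NecSub T, g.code = W then y h.choose else 0

theorem NecSub.lift_code {T : Nec} (y : NecSub T → M) (g : NecSub T) : lift y g.code = y g := by
  have h : ∃ g' : NecSub T, g'.code = g.code := ⟨g, rfl⟩
  rw [lift, dif_pos h]
  exact congrArg y (NecSub.code_injective h.choose_spec)

theorem NecSub.lift_eq {T : Nec} (y : NecSub T → M) {g : NecSub T} {W : Code}
    (h : g.code = W) : lift y W = y g := by
  rw [← h, lift_code]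

/-- The alternating sum over the inner vertices of a bead. -/
def beadFaces (f : List (ℕ × ℕ) → M) (x : List (ℕ × ℕ)) : M :=
  psum (fun u e v => match v with
    | [] => 0
    | e' :: v => sgn K u.length • f (u ++ (e.1, e'.2) :: v)) x

/-- The alternating sum over the vertices that are not joints. -/
def codeFaces (f : Code → M) (W : Code) : M :=
  psum (fun X x Y => sgn K ((X.map fun x => x.length - 1).sum : ℕ) •
    beadFaces K (fun x' => f (X ++ x' :: Y)) x) W

theorem sum_face_eq {T : Nec} (y : NecSub T → M) (g : NecSub T) :
    (∑ i : {i : Fin (g.dom.p + 1) // i ∉ g.dom.T.boundaries},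
      (-1 : K) ^ (Finset.univ.filter fun i' : Fin (g.dom.p + 1) =>
        i' ∉ g.dom.T.boundaries ∧ i' < i.1).card • y (g.face i.1 i.2)) =
    codeFaces K (NecSub.lift y) g.code := by
  let G : ℕ → M := fun i => if h : ∃ h : i < g.dom.p + 1, ⟨i, h⟩ ∉ g.dom.T.boundaries then
    y (g.face ⟨i, h.choose⟩ h.choose_spec) else 0
  let F : ℕ → ℕ → M := fun i c => (-1 : K) ^ c • G i
  have hbl : g.code.map List.length = g.dom.T.blocks := Nec.map_length_code g.hom
  have hmem : ∀ i : Fin (g.dom.p + 1), i ∈ g.dom.T.boundaries ↔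
      i.val ∈ partialSums (g.code.map List.length) := by
    intro i
    rw [hbl, CompositionAsSet.mem_boundaries_iff_partialSums]
  have hlen : g.code.flatten.length = g.dom.p := Nec.length_flatten_code g.hom
  have h1 := sum_inner_eq_psum F g.code fun x hx => ne_nil_of_mem_code hx
  have hcard : ∀ i : Fin (g.dom.p + 1), (Finset.univ.filter fun i' : Fin (g.dom.p + 1) =>
        i' ∉ g.dom.T.boundaries ∧ i' < i).card =
      ((Finset.range i.val).filter fun i' => i' ∉ partialSums (g.code.map List.length)).card := by
    intro i
    refine Finset.card_bij (fun a _ => a.val) (fun a ha => ?_) (fun a _ b _ h => Fin.ext h)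
      fun b hb => ?_
    · simpa [← hmem, and_comm] using ha
    · rw [Finset.mem_filter, Finset.mem_range] at hb
      exact ⟨⟨b, by omega⟩, by simpa [hmem] using ⟨hb.2, Fin.lt_def.mpr hb.1⟩, rfl⟩
  have h2 : (∑ i : {i : Fin (g.dom.p + 1) // i ∉ g.dom.T.boundaries},
      (-1 : K) ^ (Finset.univ.filter fun i' : Fin (g.dom.p + 1) =>
        i' ∉ g.dom.T.boundaries ∧ i' < i.1).card • y (g.face i.1 i.2)) =
      ∑ i ∈ Finset.range (g.code.flatten.length + 1),
        if i ∈ partialSums (g.code.map List.length) then 0 else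
        F i ((Finset.range i).filter fun i' => i' ∉ partialSums (g.code.map List.length)).card := by
    let H : Fin (g.dom.p + 1) → M := fun i => F i.val
      ((Finset.range i.val).filter fun i' => i' ∉ partialSums (g.code.map List.length)).card
    have h3 := Finset.sum_subtype (Finset.univ.filter fun i => i ∉ g.dom.T.boundaries)
      (p := fun i => i ∉ g.dom.T.boundaries) (F := inferInstance) (by simp) H
    rw [hlen, Finset.sum_range]
    refine Eq.trans ?_ (h3.symm.trans ?_)
    · refine sum_congr rfl fun i _ => ?_
      simp only [H, F, G, hcard]
      rw [dif_pos ⟨i.1.isLt, i.2⟩]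
    · rw [Finset.sum_filter]
      refine sum_congr rfl fun i _ => ?_
      simp only [hmem, H]
      split_ifs <;> rfl
  rw [h2, h1]
  refine psum_congr fun X x Y hXY => ?_
  rw [sum_range_eq_psum, beadFaces, ← DistribSMul.toAddMonoidHom_apply, map_psum (DistribSMul.toAddMonoidHom M _)]
  refine psum_congr fun u e v huv => ?_
  cases v with
  | nil => simp
  | cons e' v =>
    rw [if_neg (by simp)]
    have hlt : X.flatten.length + 1 + u.length < g.dom.p + 1 := by
      rw [← hlen, ← hXY, ← huv]
      simp
      omega
    have hnot : (⟨X.flatten.length + 1 + u.length, hlt⟩ : Fin (g.dom.p + 1)) ∉ g.dom.T.boundaries := by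
      have hA := fun t ht => le_sum_of_mem_partialSums (s := t) (n := X.map List.length) ht
      rw [hmem, ← hXY, ← huv]
      simp only [map_append, map_cons, mem_partialSums_append, mem_partialSums_cons,
        ← length_flatten] at hA ⊢
      grind
    have hG : G (X.flatten.length + 1 + u.length) =
        NecSub.lift y (X ++ (u ++ (e.1, e'.2) :: v) :: Y) := by
      simp only [G]
      rw [dif_pos ⟨hlt, hnot⟩]
      exact (NecSub.lift_eq y (g.code_face _ hnot (by rw [← hXY, ← huv]) (by simp only; omega))).symm
    simp only [F, hG, DistribSMul.toAddMonoidHom_apply]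
    rw [smul_smul, ← sgn_add, neg_one_pow_eq_sgn, Nat.cast_add]

end Lift

open NecSub (lift_code)

/-! ## Codes of images -/

/-- Removal of the degenerate edges. -/
def nondeg (x : List (ℕ × ℕ)) : List (ℕ × ℕ) := x.filter fun e => !(e.1 == e.2)

theorem nondeg_append (x y : List (ℕ × ℕ)) : nondeg (x ++ y) = nondeg x ++ nondeg y :=
  List.filter_append ..

theorem nondeg_flatten (W : Code) : nondeg W.flatten = (W.map nondeg).flatten :=
  List.filter_flatten ..

/-- Removal of the degenerate edges, and of the beads without nondegenerate edges. -/
def nondegCode (W : Code) : Code :=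
  (W.map nondeg).filter fun x => !x.isEmpty

theorem flatten_filter_isEmpty {α : Type*} (W : List (List α)) :
    (W.filter fun x => !x.isEmpty).flatten = W.flatten := by
  induction W with
  | nil => rfl
  | cons x W ih =>
    cases x with
    | nil => rw [filter_cons_of_neg (by simp), ih]; rfl
    | cons a x => rw [filter_cons_of_pos (by simp), flatten_cons, ih]; rfl

theorem flatten_nondegCode (W : Code) : (nondegCode W).flatten = nondeg W.flatten := by
  rw [nondegCode, flatten_filter_isEmpty, nondeg_flatten]

theorem map_length_filter_isEmpty {α : Type*} (W : List (List α)) :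
    (W.filter fun x => !x.isEmpty).map List.length = (W.map List.length).filter fun a => a ≠ 0 := by
  induction W with
  | nil => rfl
  | cons x W ih => grind

namespace EndHom

variable {m n : ℕ} (h : EndHom m n)

theorem nat_inc_epi (i : ℕ) : h.inc.nat (h.epi.nat i) = h.nat i := by
  rw [← nat_comp]
  congr 1
  exact EndHom.ext (funext fun i => h.imEmb_imProj i)

theorem nat_inc_lt {j : ℕ} (hj : j < h.imLen) : h.inc.nat j < h.inc.nat (j + 1) := by
  have := h.imEmb_strictMono (a := ⟨j, by omega⟩) (b := ⟨j + 1, by omega⟩) (by simp)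
  rw [← val_toFun h.inc ⟨j, by omega⟩, ← val_toFun h.inc ⟨j + 1, by omega⟩]
  exact this

theorem nat_epi_succ_le (i : ℕ) : h.epi.nat (i + 1) ≤ h.epi.nat i + 1 := by
  by_contra hlt
  have h1 : h.epi.nat i + 1 < h.imLen + 1 := by
    have := h.epi.nat_le (i + 1); omega
  obtain ⟨k, hk⟩ := h.imProj_surjective ⟨h.epi.nat i + 1, h1⟩
  have hk' : h.epi.nat k.val = h.epi.nat i + 1 := by
    rw [← val_toFun]; exact congrArg Fin.val hk
  rcases Nat.lt_or_ge i k.val with hik | hik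
  · have := h.epi.nat_mono (show i + 1 ≤ k.val from hik)
    omega
  · have := h.epi.nat_mono hik
    omega

theorem nondeg_edges_range {k : ℕ} (hk : k ≤ m) :
    nondeg ((List.range k).map fun i => (h.nat i, h.nat (i + 1))) =
      (List.range (h.epi.nat k)).map fun i => (h.inc.nat i, h.inc.nat (i + 1)) := by
  induction k with
  | zero => rw [nat_zero]; rfl
  | succ k ih =>
    rw [List.range_succ, map_append, nondeg_append, ih (by omega)]
    have h1 := h.nat_epi_succ_le k
    have h2 := h.epi.nat_mono (show k ≤ k + 1 by omega)
    rcases Nat.lt_or_ge (h.epi.nat k) (h.epi.nat (k + 1)) with hlt | hge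
    · have h3 : h.epi.nat (k + 1) = h.epi.nat k + 1 := by omega
      have h4 := h.epi.nat_le (k + 1)
      have h5 := h.nat_inc_lt (j := h.epi.nat k) (by omega)
      rw [h3, List.range_succ, map_append]
      congr 1
      rw [List.map_singleton, List.map_singleton, nat_inc_epi, ← h3, nat_inc_epi]
      rw [← h3, nat_inc_epi, nat_inc_epi] at h5
      simp [nondeg, h5.ne]
    · have h3 : h.epi.nat (k + 1) = h.epi.nat k := by omega
      have h4 : h.nat (k + 1) = h.nat k := by
        rw [← nat_inc_epi, h3, nat_inc_epi]
      rw [h3, List.map_singleton, h4]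
      simp [nondeg]

theorem edges_inc : h.inc.edges = nondeg h.edges := by
  rw [edges, edges, nondeg_edges_range h le_rfl, nat_last]

end EndHom

namespace Nec

variable {T U V : Nec}

theorem length_nondeg_prefix (h : U ⟶ V) {A B : Code} (hAB : A ++ B = code h) :
    (nondeg A.flatten).length = h.toEndHom.epi.nat A.flatten.length := by
  have hle : A.flatten.length ≤ U.p := by
    rw [← length_flatten_code h, ← hAB]; simp
  have h1 : A.flatten = (List.range A.flatten.length).map
      fun i => (h.toEndHom.nat i, h.toEndHom.nat (i + 1)) := by
    have : A.flatten = h.toEndHom.edges.take A.flatten.length := by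
      rw [← flatten_code h, ← hAB, List.flatten_append, List.take_left' rfl]
    conv_lhs => rw [this]
    rw [EndHom.edges, ← List.map_take, List.take_range, min_eq_left hle]
  conv_lhs => rw [h1, EndHom.nondeg_edges_range _ hle]
  simp

theorem blocks_image (h : U ⟶ V) :
    (image h).T.blocks = ((code h).map fun x => (nondeg x).length).filter fun a => a ≠ 0 := by
  have hsum : ∀ A B, A ++ B = code h → (A.map fun x => (nondeg x).length).sum =
      h.toEndHom.epi.nat A.flatten.length := by
    intro A B hAB
    rw [← length_nondeg_prefix h hAB, nondeg_flatten, length_flatten, List.map_map]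
    rfl
  refine CompositionAsSet.blocks_eq _ ?_ ?_ ?_
  · grind
  · have h1 : ∀ n : List ℕ, (n.filter fun a => a ≠ 0).sum = n.sum := by
      intro n
      induction n with
      | nil => rfl
      | cons a n ih => grind
    rw [h1, hsum _ [] (by simp), length_flatten_code, EndHom.nat_last]
    rfl
  · intro j
    rw [mem_partialSums_filter]
    have h1 : j ∈ (image h).T.boundaries ↔ ∃ t ∈ U.T.boundaries, h.toEndHom.epi.toFun t = j :=
      Finset.mem_image
    rw [h1]
    constructor
    · rintro ⟨t, ht, rfl⟩
      rw [CompositionAsSet.mem_boundaries_iff_partialSums, ← map_length_code h] at ht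
      obtain ⟨u, v, huv, hu⟩ := ht
      obtain ⟨A, B, hAB, rfl, rfl⟩ := List.map_eq_append_iff.mp huv.symm
      refine ⟨A.map fun x => (nondeg x).length, B.map fun x => (nondeg x).length, ?_, ?_⟩
      · rw [hAB, map_append]
      · rw [hsum A B hAB.symm, val_toFun, ← hu, length_flatten]
    · rintro ⟨u, v, huv, hu⟩
      obtain ⟨A, B, hAB, rfl, rfl⟩ := List.map_eq_append_iff.mp huv.symm
      have hle : A.flatten.length ≤ U.p := by
        rw [← length_flatten_code h, hAB]; simp
      refine ⟨⟨A.flatten.length, by omega⟩, ?_, ?_⟩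
      · rw [CompositionAsSet.mem_boundaries_iff_partialSums, ← map_length_code h, hAB,
          map_append]
        exact ⟨_, _, rfl, (length_flatten ..).symm⟩
      · refine Fin.ext ?_
        rw [val_toFun, ← hu, hsum A B hAB.symm]

theorem code_imageInc (h : U ⟶ V) : code (imageInc h) = nondegCode (code h) := by
  refine code_eq ?_ ?_
  · rw [flatten_nondegCode, flatten_code]
    exact (EndHom.edges_inc h.toEndHom).symm
  · rw [nondegCode, map_length_filter_isEmpty, List.map_map, blocks_image]
    rfl

theorem beadDims_imageEpi (h : U ⟶ V) :
    beadDims (imageEpi h) = (code h).map fun x => (x.length, (nondeg x).length) := by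
  apply ext_getElem
  · simp [beadDims, length_code]
  · intro k hk1 hk2
    have hk : k < (code h).length := by simpa using hk2
    have hkU : k < U.T.length := by rwa [length_code] at hk
    have hdec : (code h).take k ++ (code h)[k] :: (code h).drop (k + 1) = code h := by simp
    have hdec' : ((code h).take k ++ [(code h)[k]]) ++ (code h).drop (k + 1) = code h := by simp
    have h1 := length_nondeg_prefix h hdec
    have h2 := length_nondeg_prefix h hdec'
    have hbl : ∀ j (hj : j < U.T.boundaries.card), (U.T.boundary ⟨j, hj⟩).val =
        ((code h).take j).flatten.length := by
      intro j hj
      rw [CompositionAsSet.boundary_eq, ← map_length_code h, length_flatten, List.map_take]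
    have htake : (code h).take k ++ [(code h)[k]] = (code h).take (k + 1) :=
      List.take_append_getElem hk
    simp only [beadDims, List.getElem_ofFn, List.getElem_map]
    congr 1
    · have h3 : ((code h).map List.length)[k]? = U.T.blocks[k]? := by rw [map_length_code]
      rw [List.getElem?_map, List.getElem?_eq_getElem hk,
        List.getElem?_eq_getElem (by rwa [CompositionAsSet.blocks_length]),
        getElem_blocks U ⟨k, hkU⟩] at h3
      simpa using h3.symm
    · have h4 : ∀ j (hj : j < U.T.boundaries.card),
          ((imageEpi h).toFun (U.T.boundary ⟨j, hj⟩)).val =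
          h.toEndHom.epi.nat ((code h).take j).flatten.length := by
        intro j hj
        rw [← hbl j hj]
        exact val_toFun h.toEndHom.epi _
      rw [h4, h4, ← htake, ← h1, ← h2, List.flatten_append, nondeg_append, length_append]
      simp

theorem code_comp (f : T ⟶ U) (g : U ⟶ V) :
    code (f ≫ g) = (code f).map (List.map (Prod.map g.toEndHom.nat g.toEndHom.nat)) := by
  refine code_eq ?_ ?_
  · rw [← List.map_flatten, flatten_code]
    simp only [EndHom.edges, List.map_map]
    refine map_congr_left fun i _ => ?_
    exact Prod.ext (nat_comp f.toEndHom g.toEndHom i).symm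
      (nat_comp f.toEndHom g.toEndHom (i + 1)).symm
  · rw [List.map_map, ← map_length_code f]
    simp

theorem exists_of_blocks (n : List ℕ) (hn : ∀ i ∈ n, 0 < i) : ∃ V : Nec, V.p = n.sum ∧ V.T.blocks = n :=
  ⟨⟨n.sum, (⟨n, fun h => hn _ h, rfl⟩ : Composition n.sum).toCompositionAsSet⟩, rfl,
    Composition.toCompositionAsSet_blocks _⟩

/-- A necklace splits at a joint. -/
theorem exists_eq_wedge (V : Nec) {q : ℕ} (hq : q ∈ partialSums V.T.blocks) :
    ∃ V₁ V₂ : Nec, V = V₁.wedge V₂ ∧ V₁.p = q := by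
  obtain ⟨u, v, huv, hu⟩ := hq
  have hpos : ∀ i ∈ u ++ v, 0 < i := fun i hi => V.T.blocks_pos (huv ▸ hi)
  obtain ⟨V₁, h₁, h₁'⟩ := exists_of_blocks u fun i hi => hpos i (List.mem_append_left _ hi)
  obtain ⟨V₂, h₂, h₂'⟩ := exists_of_blocks v fun i hi => hpos i (List.mem_append_right _ hi)
  exact ⟨V₁, V₂, eq_of_blocks (by rw [blocks_wedge, h₁', h₂', huv]), h₁.trans hu⟩

theorem mem_wedge_left {T U : Nec} {i : ℕ} (hi : i < T.p + 1) :
    (⟨i, Nat.lt_of_lt_of_le hi (by omega)⟩ : Fin (T.p + U.p + 1)) ∈ (T.wedge U).T.boundaries ↔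
      ⟨i, hi⟩ ∈ T.T.boundaries := by
  refine (mem_wedge _ _ _).trans ⟨?_, fun h => Or.inl ⟨_, h, rfl⟩⟩
  rintro (⟨t, ht, htv⟩ | ⟨w, _, hwv⟩)
  · rwa [show (⟨i, hi⟩ : Fin (T.p + 1)) = t from Fin.ext htv]
  · have : i = T.p + w.val := hwv
    rw [show (⟨i, hi⟩ : Fin (T.p + 1)) = Fin.last _ from Fin.ext (by simp only [Fin.val_last]; omega)]
    exact T.T.getLast_mem

theorem mem_wedge_right {T U : Nec} {i : ℕ} (hi : i < U.p + 1) :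
    (⟨T.p + i, by omega⟩ : Fin (T.p + U.p + 1)) ∈ (T.wedge U).T.boundaries ↔
      ⟨i, hi⟩ ∈ U.T.boundaries := by
  refine (mem_wedge _ _ _).trans ⟨?_, fun h => Or.inr ⟨_, h, rfl⟩⟩
  rintro (⟨t, _, htv⟩ | ⟨w, hw, hwv⟩)
  · have : T.p + i = t.val := htv
    rw [show (⟨i, hi⟩ : Fin (U.p + 1)) = 0 from Fin.ext (by simp only [Fin.val_zero]; omega)]
    exact U.T.zero_mem
  · have : T.p + i = T.p + w.val := hwv
    rwa [show (⟨i, hi⟩ : Fin (U.p + 1)) = w from Fin.ext (by simp only; omega)]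

/-- A map of wedges that preserves the middle joint is a wedge of maps. -/
theorem exists_wedgeMap {T₁ T₂ V₁ V₂ : Nec} (h : T₁.wedge T₂ ⟶ V₁.wedge V₂)
    (hp : h.toEndHom.nat T₁.p = V₁.p) :
    ∃ (h₁ : T₁ ⟶ V₁) (h₂ : T₂ ⟶ V₂), h = wedgeMap h₁ h₂ := by
  have hmono := h.toEndHom.nat_mono
  have hlast : h.toEndHom.nat (T₁.p + T₂.p) = V₁.p + V₂.p := h.toEndHom.nat_last
  have hle1 : ∀ i ≤ T₁.p, h.toEndHom.nat i ≤ V₁.p := fun i hi => hp ▸ hmono hi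
  have hge2 : ∀ i, V₁.p ≤ h.toEndHom.nat (T₁.p + i) := fun i => by
    have := hmono (show T₁.p ≤ T₁.p + i by omega)
    omega
  have hle2 : ∀ i, h.toEndHom.nat i ≤ V₁.p + V₂.p := h.toEndHom.nat_le
  let f₁ : EndHom T₁.p V₁.p :=
    { toFun := fun i => ⟨h.toEndHom.nat i.val, by have := hle1 i.val (by omega); omega⟩
      mono := fun i j hij => hmono (show i.val ≤ j.val from hij)
      map_zero := Fin.ext h.toEndHom.nat_zero
      map_last := Fin.ext hp }
  let f₂ : EndHom T₂.p V₂.p :=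
    { toFun := fun i => ⟨h.toEndHom.nat (T₁.p + i.val) - V₁.p, by
        have := hle2 (T₁.p + i.val); omega⟩
      mono := fun i j hij => Nat.sub_le_sub_right
        (hmono (Nat.add_le_add_left (show i.val ≤ j.val from hij) _)) _
      map_zero := Fin.ext (by simp [hp])
      map_last := Fin.ext (by simp [hlast]) }
  have hf₁ : ∀ i ≤ T₁.p, f₁.nat i = h.toEndHom.nat i := fun i hi => by
    rw [← val_toFun f₁ ⟨i, by omega⟩]
  have hf₂ : ∀ i ≤ T₂.p, V₁.p + f₂.nat i = h.toEndHom.nat (T₁.p + i) := fun i hi => by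
    rw [← val_toFun f₂ ⟨i, by omega⟩]
    have := hge2 i
    simp only [f₂]
    omega
  have hj : ∀ j : ℕ, (hj : j < V₁.p + V₂.p + 1) → ⟨j, hj⟩ ∈ (V₁.wedge V₂).T.boundaries →
      ∃ i, ∃ hi : i < T₁.p + T₂.p + 1, ⟨i, hi⟩ ∈ (T₁.wedge T₂).T.boundaries ∧
        h.toEndHom.nat i = j := by
    intro j hj hjm
    obtain ⟨i, hi, hij⟩ := Finset.mem_image.mp (h.joints hjm)
    exact ⟨i.val, i.isLt, hi, by rw [← val_toFun]; exact congrArg Fin.val hij⟩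
  let h₁ : T₁ ⟶ V₁ :=
    { f₁ with
      joints := by
        intro j hjm
        obtain ⟨i, hi, him, hij⟩ := hj j.val (by omega) ((mem_wedge_left j.isLt).mpr hjm)
        by_cases hle : i ≤ T₁.p
        · exact Finset.mem_image.mpr ⟨⟨i, by omega⟩, (mem_wedge_left (by omega)).mp him, Fin.ext hij⟩
        · refine Finset.mem_image.mpr ⟨Fin.last _, T₁.T.getLast_mem, Fin.ext ?_⟩
          have := hge2 (i - T₁.p)
          rw [Nat.add_sub_cancel' (by omega)] at this
          refine hp.trans ?_
          omega }
  let h₂ : T₂ ⟶ V₂ :=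
    { f₂ with
      joints := by
        intro j hjm
        obtain ⟨i, hi, him, hij⟩ := hj (V₁.p + j.val) (by omega) ((mem_wedge_right j.isLt).mpr hjm)
        by_cases hle : T₁.p ≤ i
        · obtain ⟨i, rfl⟩ := Nat.exists_eq_add_of_le hle
          refine Finset.mem_image.mpr ⟨⟨i, by omega⟩, (mem_wedge_right (by omega)).mp him, Fin.ext ?_⟩
          refine (congrArg (· - V₁.p) hij).trans ?_
          simp
        · refine Finset.mem_image.mpr ⟨0, T₂.T.zero_mem, f₂.map_zero.trans (Fin.ext ?_)⟩
          have := hle1 i (by omega)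
          simp only [Fin.val_zero]
          omega }
  refine ⟨h₁, h₂, hom_ext fun i hi => ?_⟩
  refine Eq.trans ?_ (nat_add f₁ f₂ i).symm
  split_ifs with hle
  · exact (hf₁ i hle).symm
  · have hi' : i ≤ T₁.p + T₂.p := hi
    rw [hf₂ (i - T₁.p) (by omega), Nat.add_sub_cancel' (by omega)]

end Nec

namespace NecSub

theorem code_ofMap {U V : Nec} (h : U ⟶ V) : (ofMap h).code = nondegCode (Nec.code h) :=
  Nec.code_imageInc h

theorem nat_lt {T : Nec} (g : NecSub T) {i : ℕ} (hi : i < g.dom.p) :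
    g.hom.toEndHom.nat i < g.hom.toEndHom.nat (i + 1) := by
  refine lt_of_le_of_ne (EndHom.nat_mono _ (by omega)) fun h => ?_
  rw [← val_toFun g.hom.toEndHom ⟨i, by omega⟩,
    ← val_toFun g.hom.toEndHom ⟨i + 1, by omega⟩] at h
  have := g.inj (Fin.ext h)
  simp at this

theorem nondeg_edges {T : Nec} (g : NecSub T) : nondeg g.hom.toEndHom.edges = g.hom.toEndHom.edges := by
  refine List.filter_eq_self.mpr fun e he => ?_
  obtain ⟨i, hi, rfl⟩ := mem_map.mp he
  have := g.nat_lt (List.mem_range.mp hi)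
  simp [this.ne]

theorem nondeg_of_mem_code {T : Nec} (g : NecSub T) {x : List (ℕ × ℕ)} (hx : x ∈ g.code) :
    nondeg x = x := by
  refine List.filter_eq_self.mpr fun e he => ?_
  have h1 : e ∈ g.hom.toEndHom.edges := by
    rw [← Nec.flatten_code]
    exact List.mem_flatten.mpr ⟨x, hx, he⟩
  exact List.filter_eq_self.mp g.nondeg_edges e h1

instance (T : Nec) : Finite (NecSub T) := by
  have hp : ∀ g : NecSub T, g.dom.p < T.p + 1 := fun g => by
    have := Fintype.card_le_of_injective _ g.inj
    simpa using this
  refine Finite.of_injective (β := Σ p : Fin (T.p + 1), CompositionAsSet p.val ×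
    (Fin (p.val + 1) → Fin (T.p + 1))) (fun g => ⟨⟨g.dom.p, hp g⟩, g.dom.T, g.hom.toFun⟩) ?_
  rintro ⟨⟨p, U⟩, ⟨⟨f, _, _, _⟩, _⟩, _⟩ ⟨⟨p', U'⟩, ⟨⟨f', _, _, _⟩, _⟩, _⟩ h
  simp only [Sigma.mk.injEq, Fin.mk.injEq] at h
  obtain ⟨rfl, h⟩ := h
  simp only [heq_eq_eq, Prod.mk.injEq] at h
  obtain ⟨rfl, rfl⟩ := h
  rfl

/-- An injective necklace map to a wedge is a wedge of injective necklace maps. -/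
theorem exists_wedge {T₁ T₂ : Nec} (g : NecSub (T₁.wedge T₂)) :
    ∃ (g₁ : NecSub T₁) (g₂ : NecSub T₂), g = wedge g₁ g₂ := by
  obtain ⟨U, h, hi⟩ := g
  obtain ⟨t, ht, htv⟩ := Finset.mem_image.mp (h.joints
    ((Nec.mem_wedge_left (U := T₂) (Nat.lt_succ_self T₁.p)).mpr T₁.T.getLast_mem))
  obtain ⟨U₁, U₂, rfl, hq⟩ := U.exists_eq_wedge
    ((CompositionAsSet.mem_boundaries_iff_partialSums _ _).mp ht)
  obtain ⟨h₁, h₂, rfl⟩ := Nec.exists_wedgeMap h (((congrArg _ hq).trans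
    (val_toFun h.toEndHom t).symm).trans (congrArg Fin.val htv))
  have key : ∀ i j, i ≤ U₁.p + U₂.p → j ≤ U₁.p + U₂.p → (h₁.toEndHom.add h₂.toEndHom).nat i =
      (h₁.toEndHom.add h₂.toEndHom).nat j → i = j := fun i j hi' hj' hij =>
    congrArg Fin.val (@hi ⟨i, Nat.lt_succ_of_le hi'⟩ ⟨j, Nat.lt_succ_of_le hj'⟩
      ((EndHom.toFun_eq_iff (h₁.toEndHom.add h₂.toEndHom) _ _).mpr (hij.trans
        (val_toFun (h₁.toEndHom.add h₂.toEndHom) ⟨j, Nat.lt_succ_of_le hj'⟩).symm)))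
  refine ⟨⟨U₁, h₁, fun i j hij => Fin.ext (key i j (by omega) (by omega) ?_)⟩,
    ⟨U₂, h₂, fun i j hij => Fin.ext (Nat.add_left_cancel (key (U₁.p + i) (U₁.p + j) (by omega)
      (by omega) ?_))⟩, rfl⟩
  · rw [nat_add_left _ _ (by omega), nat_add_left _ _ (by omega)]
    exact (val_toFun _ _).symm.trans ((congrArg Fin.val hij).trans (val_toFun _ _))
  · rw [nat_add_right, nat_add_right]
    exact congrArg _ ((val_toFun _ _).symm.trans
      ((congrArg Fin.val hij).trans (val_toFun _ _)))

end NecSub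

section ListSums

variable {α β M : Type*} [AddCommMonoid M]

theorem dsum_map (φ : β → α) (f : List α → List α → M) (L : List β) :
    dsum f (L.map φ) = dsum (fun u v => f (u.map φ) (v.map φ)) L := by
  induction L generalizing f with
  | nil => rfl
  | cons a t ih => simp only [map_cons, dsum_cons, ih, map_nil]

theorem csum_map (φ : β → α) (f : List (List α) → M) (L : List β) :
    csum f (L.map φ) = csum (fun S => f (S.map (List.map φ))) L := by
  induction hn : L.length using Nat.strong_induction_on generalizing L f with
  | _ n ih =>
  subst hn
  cases L with
  | nil => rfl
  | cons a t =>
    rw [map_cons, csum_cons, csum_cons, dsum_map]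
    refine dsum_congr fun u v huv => ?_
    grind

theorem rsum_map (φ : β → α) (f : List (List (List α)) → M) (X : List (List β)) :
    rsum f (X.map (List.map φ)) = rsum (fun LL => f (LL.map (List.map (List.map φ)))) X := by
  induction X generalizing f with
  | nil => rfl
  | cons x X ih =>
    rw [map_cons, rsum_cons, rsum_cons, csum_map]
    simp only [ih]
    rfl

theorem sum_compositionAsSet (f : List ℕ → M) (n : ℕ) :
    ∑ S : CompositionAsSet n, f S.blocks = ∑ c : Composition n, f c.blocks := by
  symm
  refine Fintype.sum_equiv (compositionEquiv n) _ _ fun c => ?_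
  rw [show compositionEquiv n c = c.toCompositionAsSet from rfl, Composition.toCompositionAsSet_blocks]

theorem sum_compositionAsSet_eq_csum (f : List (List α) → M) (L : List α) {n : ℕ}
    (hn : L.length = n) :
    ∑ S : CompositionAsSet n, f (L.splitWrtCompositionAux S.blocks) = csum f L := by
  rw [sum_compositionAsSet (fun b => f (L.splitWrtCompositionAux b)), sum_composition_eq_csum f L hn]

/-- A sum over families of decompositions of the parts of a list of lists. -/
theorem sum_pi_eq_rsum (f : List (List (List α)) → M) (W : List (List α)) {l : ℕ}
    (hl : W.length = l) (n : Fin l → ℕ) (hn : ∀ k : Fin l, (W[k.val]'(hl ▸ k.isLt)).length = n k) :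
    ∑ S : (∀ k, CompositionAsSet (n k)), f (List.ofFn fun k : Fin l =>
      (W[k.val]'(hl ▸ k.isLt)).splitWrtCompositionAux (S k).blocks) = rsum f W := by
  induction l generalizing W f with
  | zero =>
    obtain rfl := List.length_eq_zero_iff.mp hl
    simp
  | succ l ih =>
    cases W with
    | nil => simp at hl
    | cons x W =>
      have hl' : W.length = l := by simpa using hl
      rw [rsum_cons, ← sum_compositionAsSet_eq_csum _ x (hn 0)]
      rw [← Fintype.sum_equiv (Fin.consEquiv fun k => CompositionAsSet (n k))
        (fun S => f (List.ofFn fun k : Fin (l + 1) =>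
          ((x :: W)[k.val]'(by rw [hl]; exact k.isLt)).splitWrtCompositionAux
            ((Fin.consEquiv fun k => CompositionAsSet (n k)) S k).blocks)) _ (fun _ => rfl),
        Fintype.sum_prod_type]
      refine sum_congr rfl fun S _ => ?_
      rw [← ih _ W hl' (fun k => n k.succ) (fun k => hn k.succ)]
      simp

/-- The sum of the products `d e'` over pairs of members `(d, e)`, `(d', e')` of a list in this
order. -/
def pairSum : List (ℕ × ℕ) → ℕ
  | [] => 0
  | a :: t => a.1 * (t.map Prod.snd).sum + pairSum t

theorem sum_Ioi_eq_pairSum {l : ℕ} (d e : Fin l → ℕ) :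
    ∑ i, ∑ j ∈ Finset.Ioi i, d i * e j = pairSum (List.ofFn fun k => (d k, e k)) := by
  induction l with
  | zero => rfl
  | succ l ih =>
    rw [Fin.sum_univ_succ, Fin.sum_Ioi_zero, List.ofFn_succ, pairSum]
    congr 1
    · rw [← Finset.mul_sum, map_ofFn, List.sum_ofFn]
      rfl
    · rw [← ih]
      refine sum_congr rfl fun i _ => ?_
      rw [Fin.sum_Ioi_succ]

end ListSums

open GradedQuiver

theorem GradedQuiver.mem_shiftTen_append {Q : GradedQuiver K} {L : List Q.HEl}
    {m n : List ℕ} (hd : degs L = (m ++ n).map fun i : ℕ => (i : ℤ) - 1) :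
    ∃ L₁ L₂, L = L₁ ++ L₂ ∧ degs L₁ = (m.map fun i : ℕ => (i : ℤ) - 1) ∧
      degs L₂ = n.map fun i : ℕ => (i : ℤ) - 1 := by
  rw [map_append] at hd
  exact List.map_eq_append_iff.mp hd

theorem GradedQuiver.length_of_degs {Q : GradedQuiver K} {L : List Q.HEl}
    {n : List ℕ} (hd : degs L = n.map fun i : ℕ => (i : ℤ) - 1) : L.length = n.length := by
  have := congrArg List.length hd
  simpa using this

theorem GradedQuiver.sum_degs_of_degs {Q : GradedQuiver K} {L : List Q.HEl}
    {n : List ℕ} (hn : ∀ i ∈ n, 0 < i) (hd : degs L = n.map fun i : ℕ => (i : ℤ) - 1) :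
    (degs L).sum = ((n.map fun i => i - 1).sum : ℕ) := by
  rw [hd]
  clear hd
  induction n with
  | nil => rfl
  | cons a n ih =>
    have := hn a (by simp)
    grind

theorem GradedQuiver.shiftTen_induction {Q : GradedQuiver K} {n : List ℕ}
    {a b : Q.Ob} {P : Q.Ten → Prop} {X : Q.Ten} (hX : X ∈ Q.shiftTen n a b)
    (h : ∀ L : List Q.HEl, IsPath a L b → degs L = (n.map fun i : ℕ => (i : ℤ) - 1) → P (ten L))
    (h0 : P 0) (hadd : ∀ X Y, P X → P Y → P (X + Y)) (hsmul : ∀ (c : K) X, P X → P (c • X)) :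
    P X := by
  rw [shiftTen_eq] at hX
  induction hX using Submodule.span_induction with
  | mem x hx => obtain ⟨L, hL, hd, rfl⟩ := hx; exact h L hL hd
  | zero => exact h0
  | add x y _ _ hx hy => exact hadd x y hx hy
  | smul c x _ hx => exact hsmul c x hx

theorem GradedQuiver.eqOn_shiftTen {Q : GradedQuiver K} {n : List ℕ}
    {a b : Q.Ob} {V : Type*} [AddCommMonoid V] [Module K V] {α β : Q.Ten →ₗ[K] V}
    (h : ∀ L : List Q.HEl, IsPath a L b → degs L = (n.map fun i : ℕ => (i : ℤ) - 1) →
      α (ten L) = β (ten L)) {X : Q.Ten} (hX : X ∈ Q.shiftTen n a b) : α X = β X := by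
  refine shiftTen_induction (P := fun X => α X = β X) hX h (by simp) ?_ ?_
  · intro X Y hX hY; rw [map_add, map_add, hX, hY]
  · intro c X hX; rw [map_smul, map_smul, hX]

theorem GradedQuiver.algebraMap_aug_of_mem {Q : GradedQuiver K} {a b : Q.Ob} {X : Q.Ten} (hX : X ∈ Q.shiftTen [] a b) :
    algebraMap K Q.Ten (Q.aug X) = X := by
  refine eqOn_shiftTen (α := Algebra.linearMap K Q.Ten ∘ₗ Q.aug.toLinearMap) (β := LinearMap.id)
    (fun L _ hd => ?_) hX
  obtain rfl := List.map_eq_nil_iff.mp hd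
  simp

theorem GradedQuiver.eq_zero_of_mem {Q : GradedQuiver K} {a b : Q.Ob} {X : Q.Ten}
    (hX : X ∈ Q.shiftTen [] a b) (h : a ≠ b) : X = 0 := by
  refine eqOn_shiftTen (α := LinearMap.id) (β := 0) (fun L hL hd => ?_) hX
  obtain rfl := List.map_eq_nil_iff.mp hd
  exact absurd hL h

theorem GradedQuiver.ten_mem_shiftTen {Q : GradedQuiver K} {n : List ℕ}
    {a b : Q.Ob} {L : List Q.HEl} (hL : IsPath a L b)
    (hd : degs L = (n.map fun i : ℕ => (i : ℤ) - 1)) : ten L ∈ Q.shiftTen n a b := by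
  rw [shiftTen_eq]
  exact Submodule.subset_span ⟨L, hL, hd, rfl⟩

/-- The dimension of the necklace with a given code. -/
def codeDim {α : Type*} (W : List (List α)) : ℕ := (W.map fun x => x.length - 1).sum

namespace AInfCat

variable (A : AInfCat K)

/-- The map `id^{⊗ r} ⊗ b_s ⊗ id^{⊗ t}` on tensors of length `r + s + t`. -/
def midB (r s t : ℕ) : A.Ten →ₗ[K] A.Ten :=
  tens r (s + t) LinearMap.id (tens s t (ι K ∘ₗ A.b) LinearMap.id)

theorem midB_ten (L₁ L₂ L₃ : List A.HEl) {r s t : ℕ} (hr : L₁.length = r) (hs : L₂.length = s)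
    (ht : L₃.length = t) : A.midB r s t (ten (L₁ ++ (L₂ ++ L₃))) =
      ten L₁ * (ι K (A.b (ten L₂)) * ten L₃) := by
  rw [midB, tens_append _ _ _ _ _ _ hr (by simp [hs, ht]), tens_append _ _ _ _ _ _ hs ht]
  rfl

theorem midMul_eq {n₁ n₂ n₃ : List ℕ} (h₁ : ∀ i ∈ n₁, 0 < i) (h₂ : ∀ i ∈ n₂, 0 < i) {a b : A.Ob}
    {X : A.Ten} (hX : X ∈ A.shiftTen (n₁ ++ (n₂ ++ n₃)) a b) {r s t : ℕ} (hr : n₁.length = r)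
    (hs : n₂.length = s) (ht : n₃.length = t) :
    A.midMul r s t X = sgn K (s * ((n₁.map fun i => i - 1).sum : ℕ) + epsG n₂) • A.midB r s t X := by
  subst hr hs ht
  refine eqOn_shiftTen (β := sgn K (n₂.length * ((n₁.map fun i => i - 1).sum : ℕ) + epsG n₂) •
    A.midB n₁.length n₂.length n₃.length) (fun L hL hd => ?_) hX
  obtain ⟨L₁, L', rfl, hd₁, hd'⟩ := mem_shiftTen_append hd
  obtain ⟨L₂, L₃, rfl, hd₂, hd₃⟩ := mem_shiftTen_append hd'
  have e₁ := length_of_degs hd₁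
  have e₂ := length_of_degs hd₂
  have e₃ := length_of_degs hd₃
  have hm := eq_twist_ten A.m L₂
  rw [e₂] at hm
  rw [LinearMap.smul_apply, A.midB_ten _ _ _ e₁ e₂ e₃, AInfData.midMul,
    tens_append _ _ _ _ _ _ e₁ (by simp [e₂, e₃]), tens_append _ _ _ _ _ _ e₂ e₃, koszul_ten,
    LinearMap.comp_apply, hm, sum_degs_of_degs h₁ hd₁, hd₂,
    shiftExp_map_sub_one _ h₂]
  simp only [map_smul, smul_mul_assoc, mul_smul_comm, smul_smul, ← sgn_add]
  rw [add_comm]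
  rfl

/-- The left hand side of the (TAN) relation, in terms of codes. -/
def barD (Y : Code → A.Ten) (W : Code) : A.Ten :=
  psum (fun X x Z => csum (fun S => sgn K (codeDim X) •
    A.midB X.length S.length Z.length (Y (X ++ (S ++ Z)))) x) W

end AInfCat

theorem phi_atBead (U : Nec) (k : Fin U.T.length) (S : CompositionAsSet (U.T.blocksFun k)) :
    U.phi (U.atBead k S) = ((U.T.blocks.take k).map fun i => i - 1).sum * (S.length - 1) := by
  have h1 : ∀ i, (oneBead (U.T.blocksFun i)).length = 1 := fun i => by
    rw [← CompositionAsSet.blocks_length, Nec.blocks_oneBead_pos (U.T.blocksFun_pos i)]; rfl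
  have h2 : ∀ i, i ≠ k → (U.atBead k S i).length = 1 := fun i hi => by
    rw [atBead, Function.update_of_ne hi, h1]
  have h3 : (U.atBead k S k) = S := by rw [atBead, Function.update_self]
  have h4 : ((U.T.blocks.take k).map fun i => i - 1) =
      (List.ofFn fun i => U.T.blocksFun i - 1).take k := by
    rw [List.map_take, CompositionAsSet.blocks, map_ofFn]; rfl
  rw [h4, List.sum_take_ofFn, Finset.sum_mul, Finset.sum_filter, Nec.phi]
  refine sum_congr rfl fun i _ => ?_
  split_ifs with hik
  · rw [Finset.sum_eq_single k]
    · rw [h3, h2 i (by rintro rfl; omega)]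
    · intro j _ hj
      rw [h2 j hj]; simp
    · grind
  · refine Finset.sum_eq_zero fun j hj => ?_
    grind

namespace NecSub

variable {T : Nec} (g : NecSub T)

theorem length_code : g.code.length = g.dom.T.length := Nec.length_code _

theorem map_length_code : g.code.map List.length = g.dom.T.blocks := Nec.map_length_code _

theorem length_getElem_code (k : ℕ) (hk : k < g.dom.T.length) :
    (g.code[k]'(by rwa [length_code])).length = g.dom.T.blocksFun ⟨k, hk⟩ := by
  have h2 : (g.code.map List.length)[k]? = g.dom.T.blocks[k]? := by rw [map_length_code]
  rw [List.getElem?_map, List.getElem?_eq_getElem (by rwa [length_code]),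
    List.getElem?_eq_getElem (by rwa [CompositionAsSet.blocks_length]),
    Nec.getElem_blocks _ ⟨k, hk⟩] at h2
  simpa using h2

theorem code_inert_atBead (k : Fin g.dom.T.length) (S : CompositionAsSet (g.dom.T.blocksFun k)) :
    (g.inert (g.dom.atBead k S)).code = g.code.take k ++
      ((g.code[k.val]'(by rw [length_code]; exact k.isLt)).splitWrtCompositionAux S.blocks ++
        g.code.drop (k + 1)) := by
  rw [code_inert]
  set f : Fin g.dom.T.length → Code := fun i =>
    (g.code[i.val]'(by rw [length_code]; exact i.isLt)).splitWrtCompositionAux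
      (g.dom.atBead k S i).blocks with hf
  have h1 : ∀ i, i ≠ k → f i = [g.code[i.val]'(by rw [length_code]; exact i.isLt)] := by
    intro i hi
    have h2 : (g.dom.atBead k S i).blocks = [g.dom.T.blocksFun i] := by
      rw [atBead, Function.update_of_ne hi, Nec.blocks_oneBead_pos (g.dom.T.blocksFun_pos i)]
    simp only [hf]
    rw [h2, ← g.length_getElem_code i.val i.isLt]
    simp [List.splitWrtCompositionAux]
  have h2 : f k = (g.code[k.val]'(by rw [length_code]; exact k.isLt)).splitWrtCompositionAux
      S.blocks := by
    simp only [hf, atBead, Function.update_self]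
  have h3 : List.ofFn f = (List.ofFn f).take k ++ f k :: (List.ofFn f).drop (k + 1) := by
    have : f k = (List.ofFn f)[k.val]'(by simp) := by simp
    rw [this, ← List.drop_eq_getElem_cons, take_append_drop]
  have h4 : ∀ L : Code, (L.map fun x => [x]).flatten = L := by
    intro L; induction L with
    | nil => rfl
    | cons a t ih => simp [ih]
  have h5 : (List.ofFn f).take k = (g.code.take k).map fun x => [x] := by
    apply ext_getElem
    · simp [length_code]
    · intro i hi _
      simp only [List.length_take, List.length_ofFn] at hi
      simp only [List.getElem_take, List.getElem_ofFn, List.getElem_map]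
      exact h1 ⟨i, by omega⟩ (by intro h; rw [← h] at hi; simp at hi)
  have h6 : (List.ofFn f).drop (k + 1) = (g.code.drop (k + 1)).map fun x => [x] := by
    apply ext_getElem
    · simp [length_code]
    · intro i hi _
      simp only [List.length_drop, List.length_ofFn] at hi
      simp only [List.getElem_drop, List.getElem_ofFn, List.getElem_map]
      refine h1 ⟨k.val + 1 + i, by omega⟩ ?_
      grind
  grind

theorem lift_mem {Q : GradedQuiver K} {a b : Q.Ob} {y : NecSub T → Q.Ten}
    (hy : ∀ g, y g ∈ Q.shiftTen g.dom.T.blocks a b) (W : Code) :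
    lift y W ∈ Q.shiftTen (W.map List.length) a b := by
  unfold lift
  split_ifs with h
  · have := hy h.choose
    rwa [← map_length_code, h.choose_spec] at this
  · exact Submodule.zero_mem _

end NecSub

namespace AInfCat

variable (A : AInfCat K)

theorem tan_iff {T : Nec} {a b : A.Ob} {y : NecSub T → A.Ten}
    (hy : ∀ g, y g ∈ A.shiftTen g.dom.T.blocks a b) (g : NecSub T) :
    A.TAN y g ↔ A.barD (NecSub.lift y) g.code = codeFaces K (NecSub.lift y) g.code := by
  unfold TAN
  rw [sum_face_eq K y g]
  have key : (∑ k : Fin g.dom.T.length, ∑ S : CompositionAsSet (g.dom.T.blocksFun k),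
    (-1 : K) ^ (epsG S.blocks + g.dom.phi (g.dom.atBead k S)) •
      A.midMul k.val S.length (g.dom.T.length - 1 - k.val) (y (g.inert (g.dom.atBead k S)))) =
      A.barD (NecSub.lift y) g.code := by
    rw [barD, ← sum_fin_eq_psum]
    refine Fintype.sum_equiv (finCongr g.length_code.symm) _ _ fun k => ?_
    have hk : k.val < g.code.length := by rw [g.length_code]; exact k.isLt
    have hlen := g.length_getElem_code k.val k.isLt
    have hget : g.code.get (finCongr g.length_code.symm k) = g.code[k.val] := rfl
    have hval : (finCongr g.length_code.symm k).val = k.val := rfl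
    rw [hget, hval, ← sum_compositionAsSet_eq_csum _ _ hlen]
    refine sum_congr rfl fun S _ => ?_
    have hcode := g.code_inert_atBead k S
    rw [← hcode, lift_code]
    have hmem := hy (g.inert (g.dom.atBead k S))
    have hbl := (g.inert (g.dom.atBead k S)).map_length_code
    rw [hcode, map_append, map_append, List.map_take, List.map_drop, g.map_length_code,
      List.map_length_splitWrtCompositionAux (by rw [S.blocks_sum, hlen])] at hbl
    rw [← hbl] at hmem
    have hSlen : ((g.code[k.val]).splitWrtCompositionAux S.blocks).length = S.length := by
      rw [List.length_splitWrtCompositionAux, S.blocks_length]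
    have hX : (g.code.take k).length = k.val := by rw [List.length_take]; omega
    have hZ : (g.code.drop (k + 1)).length = g.dom.T.length - 1 - k.val := by
      rw [List.length_drop, g.length_code]; omega
    have h1 : ∀ i ∈ g.dom.T.blocks.take k, 0 < i := fun i hi =>
      g.dom.T.blocks_pos (List.mem_of_mem_take hi)
    have h2 : ∀ i ∈ S.blocks, 0 < i := fun i hi => S.blocks_pos hi
    have hdim : codeDim (g.code.take k) = ((g.dom.T.blocks.take k).map fun i => i - 1).sum := by
      rw [codeDim, ← g.map_length_code, ← List.map_take, List.map_map]; rfl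
    have hSpos : 0 < S.length := by
      rw [← S.blocks_length, length_pos_iff]
      intro h0
      have h3 := S.blocks_sum
      rw [h0] at h3
      have := g.dom.T.blocksFun_pos k
      simp at h3; omega
    rw [hSlen, hX, hZ, A.midMul_eq h1 h2 hmem (r := k.val) (s := S.length)
      (t := g.dom.T.length - 1 - k.val) (by rw [List.length_take, CompositionAsSet.blocks_length]; omega)
      S.blocks_length (by rw [List.length_drop, CompositionAsSet.blocks_length]; omega),
      smul_smul, neg_one_pow_eq_sgn, ← sgn_add, phi_atBead, hdim]
    congr 1
    apply sgn_congr
    generalize (List.map (fun i => i - 1) (List.take (↑k) g.dom.T.blocks)).sum = q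
    push_cast [Nat.cast_sub hSpos]
    exact ⟨epsG S.blocks + q * S.length - q, by ring⟩
  rw [key]

end AInfCat

open GradedQuiver

theorem sum_map_pred {n : List ℕ} (h : ∀ i ∈ n, 0 < i) :
    (n.map fun i => i - 1).sum + n.length = n.sum := by
  induction n with
  | nil => rfl
  | cons a n ih =>
    have h1 := h a (by simp)
    grind

theorem List.splitWrtCompositionAux_map_length {α : Type*} (S : List (List α)) :
    S.flatten.splitWrtCompositionAux (S.map List.length) = S := by
  induction S with
  | nil => rfl
  | cons s S ih =>
    simp only [flatten_cons, map_cons, List.splitWrtCompositionAux, List.splitAt_eq,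
      List.take_left, List.drop_left, ih]

namespace NecSub

variable {T : Nec} (g : NecSub T)

/-- A refinement of a code is a code. -/
theorem exists_code_refine {LL : List Code} (h : LL.map List.flatten = g.code)
    (hne : ∀ S ∈ LL, ∀ s ∈ S, s ≠ []) : ∃ g' : NecSub T, g'.code = LL.flatten := by
  have hlen : LL.length = g.dom.T.length := by rw [← g.length_code, ← h, length_map]
  have hk : ∀ k : Fin g.dom.T.length, k.val < LL.length := fun k => by rw [hlen]; exact k.isLt
  have hcode : ∀ k : Fin g.dom.T.length, (g.code[k.val]'(by rw [length_code]; exact k.isLt)) =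
      (LL[k.val]'(hk k)).flatten := fun k => by simp [← h]
  let c : ∀ k : Fin g.dom.T.length, Composition (g.dom.T.blocksFun k) := fun k =>
    { blocks := (LL[k.val]'(hk k)).map List.length
      blocks_pos := by grind
      blocks_sum := by
        rw [← length_flatten, ← hcode, g.length_getElem_code k.val k.isLt] }
  refine ⟨g.inert fun k => (c k).toCompositionAsSet, ?_⟩
  rw [code_inert]
  congr 1
  apply ext_getElem
  · simp [hlen]
  · intro i h1 h2
    rw [List.getElem_ofFn, Composition.toCompositionAsSet_blocks, hcode ⟨i, by omega⟩]
    exact List.splitWrtCompositionAux_map_length _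

theorem exists_code_split {X Z S : Code} {x : List (ℕ × ℕ)}
    (h : X ++ x :: Z = g.code) (hS : S.flatten = x) (hne : ∀ s ∈ S, s ≠ []) :
    ∃ g' : NecSub T, g'.code = X ++ (S ++ Z) := by
  have hs : ∀ L : Code, (L.map fun x => [x]).map List.flatten = L := fun L => by
    induction L with
    | nil => rfl
    | cons a t ih => simpa using ih
  have hs' : ∀ L : Code, (L.map fun x => [x]).flatten = L := fun L => by
    induction L with
    | nil => rfl
    | cons a t ih => simp [ih]
  have hmem : ∀ y ∈ g.code, y ≠ [] := fun y hy => ne_nil_of_mem_code hy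
  obtain ⟨g', hg'⟩ := g.exists_code_refine
    (LL := X.map (fun x => [x]) ++ S :: Z.map fun x => [x])
    (by rw [map_append, map_cons, hs, hs, hS, h]) (by
      intro S' hS' s hsS
      rw [List.mem_append, List.mem_cons] at hS'
      rcases hS' with hS' | rfl | hS'
      · obtain ⟨y, hy, rfl⟩ := mem_map.mp hS'
        grind
      · exact hne s hsS
      · obtain ⟨y, hy, rfl⟩ := mem_map.mp hS'
        grind)
  grind

/-- The union of two adjacent edges of a bead gives the code of a face. -/
theorem exists_code_face {X Z : Code} {u v : List (ℕ × ℕ)} {e e' : ℕ × ℕ}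
    (h : X ++ (u ++ e :: e' :: v) :: Z = g.code) :
    ∃ g' : NecSub T, g'.code = X ++ (u ++ (e.1, e'.2) :: v) :: Z := by
  have hlen : g.code.flatten.length = g.dom.p := Nec.length_flatten_code g.hom
  have hlt : X.flatten.length + u.length + 1 < g.dom.p + 1 := by
    rw [← hlen, ← h]; simp
  have hnot : (⟨X.flatten.length + u.length + 1, hlt⟩ : Fin (g.dom.p + 1)) ∉ g.dom.T.boundaries := by
    rw [CompositionAsSet.mem_boundaries_iff_partialSums, ← g.map_length_code, ← h, map_append,
      map_cons, mem_partialSums_append]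
    simp only [mem_partialSums_cons]
    rw [← length_flatten]
    rintro (h | ⟨t, rfl | ⟨s, hs, rfl⟩, h⟩)
    · have := le_sum_of_mem_partialSums h
      simp_all
    · omega
    · grind
  exact ⟨g.face _ hnot, g.code_face _ hnot h.symm rfl⟩

end NecSub

namespace AInfFunctor

variable {A B : AInfCat K} (f : AInfFunctor A B)

theorem tensF_eq (N : List (List ℕ)) (hN : ∀ n ∈ N, ∀ i ∈ n, 0 < i) {a b : A.Ob} {X : A.Ten}
    (hX : X ∈ A.shiftTen N.flatten a b) : f.tensF (N.map List.length) X =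
      sgn K (((N.map epsG).sum + pairSum (N.map fun n => ((n.map fun i => i - 1).sum,
        n.length - 1)) : ℕ) : ℤ) • groupMap f.tw (N.map List.length) X := by
  induction N generalizing a X with
  | nil => simp [pairSum, AInfFunctorData.tensF, groupMap]
  | cons n N ih =>
    refine eqOn_shiftTen (β := sgn K _ • groupMap f.tw _) (fun L hL hd => ?_) hX
    rw [flatten_cons] at hd
    obtain ⟨L₁, L₂, rfl, hd₁, hd₂⟩ := mem_shiftTen_append hd
    obtain ⟨c, hL₁, hL₂⟩ := isPath_append.mp hL
    have e₁ := length_of_degs hd₁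
    have e₂ := length_of_degs hd₂
    rw [length_flatten] at e₂
    have hm := eq_twist_ten f.F L₁
    rw [e₁] at hm
    have hn : ∀ i ∈ n, 0 < i := hN n (by simp)
    rw [LinearMap.smul_apply, map_cons, AInfFunctorData.tensF, groupMap,
      tens_append _ _ _ _ _ _ e₁ e₂, tens_append _ _ _ _ _ _ e₁ e₂,
      ih (fun n' h' => hN n' (by simp [h'])) (ten_mem_shiftTen hL₂ hd₂), LinearMap.comp_apply,
      LinearMap.comp_apply, koszul_ten, map_smul, hm, sum_degs_of_degs hn hd₁, hd₁,
      shiftExp_map_sub_one _ hn]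
    simp only [map_smul, smul_mul_assoc, mul_smul_comm, smul_smul, ← sgn_add]
    refine congrArg₂ (· • ·) (congrArg _ ?_) rfl
    simp only [map_cons, sum_cons, pairSum, List.map_map]
    push_cast
    simp only [Function.comp_def]
    ring

/-- The map `f_T` has no signs in terms of the shifted components of `f`. -/
theorem push_eq {T : Nec} {a b : A.Ob} {y : NecSub T → A.Ten}
    (hy : ∀ g, y g ∈ A.shiftTen g.dom.T.blocks a b) (g : NecSub T) :
    f.push y g = rsum (fun LL => groupMap f.tw (LL.map List.length) (NecSub.lift y LL.flatten))
      g.code := by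
  rw [← sum_pi_eq_rsum _ g.code g.length_code (fun k => g.dom.T.blocksFun k)
    (fun k => g.length_getElem_code k.val k.isLt)]
  refine sum_congr rfl fun S _ => ?_
  have hcode := g.code_inert S
  have hmem := hy (g.inert S)
  rw [show (g.inert S).dom.T.blocks = _ from Nec.blocks_refine g.dom S] at hmem
  have h1 := f.tensF_eq (List.ofFn fun k => (S k).blocks) (by
    intro n hn i hi
    obtain ⟨k, rfl⟩ := List.mem_ofFn.mp hn
    exact (S k).blocks_pos hi) hmem
  have h2 : (List.ofFn fun k => (S k).blocks).map List.length = List.ofFn fun k => (S k).length := by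
    rw [map_ofFn]
    congr 1
    funext k
    exact (S k).blocks_length
  have h3 : (List.ofFn fun k : Fin g.dom.T.length => (g.code[k.val]'(by
      rw [g.length_code]; exact k.isLt)).splitWrtCompositionAux (S k).blocks).map List.length =
      List.ofFn fun k => (S k).length := by
    rw [map_ofFn]
    congr 1
    funext k
    exact (List.length_splitWrtCompositionAux _ _).trans (S k).blocks_length
  have h4 : pairSum ((List.ofFn fun k => (S k).blocks).map fun n =>
      ((n.map fun i => i - 1).sum, n.length - 1)) = g.dom.phi S := by
    rw [Nec.phi, sum_Ioi_eq_pairSum (fun i => g.dom.T.blocksFun i - (S i).length), map_ofFn]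
    congr 2
    funext k
    have h5 := sum_map_pred fun i hi => (S k).blocks_pos (i := i) hi
    rw [(S k).blocks_sum, (S k).blocks_length] at h5
    simp only [Function.comp_apply, (S k).blocks_length]
    congr 1
    omega
  rw [h2, h4] at h1
  rw [h3, ← hcode, lift_code, h1, smul_smul, neg_one_pow_eq_sgn, map_ofFn, List.sum_ofFn]
  simp only [Function.comp_def]
  rw [sgn_mul_self, one_smul]

end AInfFunctor

namespace AInfCat

variable (A : AInfCat K)

theorem degen_nil (c : A.Ob) (X : A.Ten) : A.degen c [] X = algebraMap K A.Ten (A.aug X) := rfl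

theorem degen_diag_ten (c : A.Ob) (n : ℕ) (M : List (ℕ × ℕ)) (h : A.HEl) (L : List A.HEl)
    (hL : L.length = (M.filter fun q => q.2 ≠ 0).length) :
    A.degen c ((n, n) :: M) (ten (h :: L)) = ten [h] * A.degen h.1.2.1 M (ten L) := by
  rw [degen, if_pos rfl]
  have h1 := split_append' [h] L (r := 1) rfl hL
  rw [← ten_append, singleton_append] at h1
  rw [LinearMap.comp_apply, LinearMap.comp_apply, h1, map_tmul, ten_singleton,
    show ιInv (ι K (tot h)) = tot h from TensorAlgebra.ι_leftInverse _,
    TensorProduct.lift.tmul, tot, GradedQuiver.of, toModule_lof]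
  rfl

theorem degen_unit (c : A.Ob) (M : List (ℕ × ℕ)) (X : A.Ten) :
    A.degen c ((1, 0) :: M) X = ten [A.oneH c] * A.degen c M X := by
  rw [degen, if_neg (by omega), if_pos ⟨rfl, rfl⟩, ← AInfData.el_one]
  rfl

theorem degen_other (c : A.Ob) {n m : ℕ} (M : List (ℕ × ℕ)) (X : A.Ten) (h : n ≠ m)
    (h' : ¬ (n = 1 ∧ m = 0)) : A.degen c ((n, m) :: M) X = 0 := by
  rw [degen, if_neg h, if_neg h']
  rfl

/-- The dimensions of the beads of a map with the given code, and of its image. -/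
def codeDims (W : Code) : List (ℕ × ℕ) := W.map fun x => (x.length, (nondeg x).length)

/-- The value of `pull` in terms of the code of a map that need not be injective. -/
def degenAt (a : A.Ob) (Y : Code → A.Ten) (W : Code) : A.Ten :=
  A.degen a (codeDims W) (Y (nondegCode W))

theorem pull_eq {T T' : Nec} (h : T ⟶ T') (a : A.Ob) (y : NecSub T' → A.Ten) (g : NecSub T) :
    A.pull h a y g = A.degenAt a (NecSub.lift y) (Nec.code (g.hom ≫ h)) := by
  rw [pull, Nec.beadDims_imageEpi, ← lift_code y, NecSub.code_ofMap]
  rfl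

end AInfCat

open GradedQuiver

namespace GradedQuiver

variable {Q R : GradedQuiver K}

theorem mul_mem_shiftTen {m n : List ℕ} {a b c : Q.Ob} {X Y : Q.Ten} (hX : X ∈ Q.shiftTen m a c)
    (hY : Y ∈ Q.shiftTen n c b) : X * Y ∈ Q.shiftTen (m ++ n) a b := by
  refine shiftTen_induction (P := fun X => X * Y ∈ Q.shiftTen (m ++ n) a b) hX (fun L hL hd => ?_)
    (by simp) (fun X X' h h' => by rw [add_mul]; exact Submodule.add_mem _ h h')
    (fun c X h => by rw [smul_mul_assoc]; exact Submodule.smul_mem _ _ h)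
  refine shiftTen_induction (P := fun Y => ten L * Y ∈ Q.shiftTen (m ++ n) a b) hY
    (fun L' hL' hd' => ?_)
    (by simp) (fun X X' h h' => by rw [mul_add]; exact Submodule.add_mem _ h h')
    (fun c X h => by rw [mul_smul_comm]; exact Submodule.smul_mem _ _ h)
  rw [← ten_append]
  refine ten_mem_shiftTen (isPath_append.mpr ⟨c, hL, hL'⟩) ?_
  simp_all

theorem shiftTen_le_lenSpan (n : List ℕ) (a b : Q.Ob) : Q.shiftTen n a b ≤ Q.lenSpan n.length := by
  intro X hX
  refine shiftTen_induction (P := fun X => X ∈ Q.lenSpan n.length) hX (fun L _ hd => ?_)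
    (Submodule.zero_mem _) (fun _ _ => Submodule.add_mem _) (fun c _ => Submodule.smul_mem _ c)
  rw [← length_of_degs hd]
  exact ten_mem_lenSpan L

theorem eqOn_lenSpan {V : Type*} [AddCommMonoid V] [Module K V] {m : ℕ} {α β : Q.Ten →ₗ[K] V}
    {X : Q.Ten} (hX : X ∈ Q.lenSpan m) (h : ∀ L : List Q.HEl, L.length = m → α (ten L) = β (ten L)) :
    α X = β X :=
  lenSpan_induction (P := fun X => α X = β X) hX h (by rw [map_zero, map_zero])
    (fun X Y h h' => by rw [map_add, map_add, h, h']) (fun c X h => by rw [map_smul, map_smul, h])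

/-- Two linear maps agree on products of tensors of given lengths if they agree on pure ones. -/
theorem eqOn_lenSpan_mul {V : Type*} [AddCommMonoid V] [Module K V] {m n : ℕ}
    {α β : Q.Ten ⊗[K] Q.Ten →ₗ[K] V} {X Y : Q.Ten}
    (hX : X ∈ Q.lenSpan m) (hY : Y ∈ Q.lenSpan n)
    (h : ∀ L L' : List Q.HEl, L.length = m → L'.length = n →
      α (ten L ⊗ₜ ten L') = β (ten L ⊗ₜ ten L')) :
    α (X ⊗ₜ Y) = β (X ⊗ₜ Y) := by
  refine eqOn_lenSpan (α := α ∘ₗ (TensorProduct.mk K _ _).flip Y)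
    (β := β ∘ₗ (TensorProduct.mk K _ _).flip Y) hX fun L hL => ?_
  exact eqOn_lenSpan (α := α ∘ₗ (TensorProduct.mk K _ _ (ten L)))
    (β := β ∘ₗ (TensorProduct.mk K _ _ (ten L))) hY fun L' hL' => h L L' hL hL'

theorem split_mul {r t : ℕ} {X Y : Q.Ten} (hX : X ∈ Q.lenSpan r) (hY : Y ∈ Q.lenSpan t) :
    Q.split r t (X * Y) = X ⊗ₜ[K] Y := by
  have := eqOn_lenSpan_mul (α := Q.split r t ∘ₗ LinearMap.mul' K Q.Ten) (β := LinearMap.id) hX hY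
    fun L L' hL hL' => by
      rw [LinearMap.comp_apply, LinearMap.mul'_apply]
      exact split_append' _ _ hL hL'
  simp_all

theorem bilin_eq_of_ten {m n : ℕ} {α β γ : Q.Ten →ₗ[K] R.Ten} {X Y : Q.Ten}
    (hX : X ∈ Q.lenSpan m) (hY : Y ∈ Q.lenSpan n)
    (h : ∀ L L' : List Q.HEl, L.length = m → L'.length = n →
      α (ten L * ten L') = β (ten L) * γ (ten L')) : α (X * Y) = β X * γ Y := by
  have := eqOn_lenSpan_mul (α := α ∘ₗ LinearMap.mul' K Q.Ten)
    (β := LinearMap.mul' K R.Ten ∘ₗ TensorProduct.map β γ) hX hY fun L L' hL hL' => by simp_all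
  simp_all

theorem groupMap_append (F : Q.Ten →ₗ[K] R.Tot) (m n : List ℕ) {X Y : Q.Ten}
    (hX : X ∈ Q.lenSpan m.sum) (hY : Y ∈ Q.lenSpan n.sum) :
    groupMap F (m ++ n) (X * Y) = groupMap F m X * groupMap F n Y := by
  induction m generalizing X Y with
  | nil =>
    refine bilin_eq_of_ten (α := groupMap F n) (β := groupMap F []) (γ := groupMap F n)
      hX hY fun L L' hL _ => ?_
    obtain rfl := List.length_eq_zero_iff.mp hL
    simp [groupMap]
  | cons i m ih =>
    refine bilin_eq_of_ten (α := groupMap F (i :: m ++ n)) (β := groupMap F (i :: m))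
      (γ := groupMap F n) hX hY fun L L' hL hL' => ?_
    have h1 : L.length = i + m.sum := by simpa using hL
    obtain ⟨L₁, L₂, rfl, e₁⟩ : ∃ L₁ L₂, L = L₁ ++ L₂ ∧ L₁.length = i :=
      ⟨L.take i, L.drop i, (take_append_drop _ _).symm, by simp; omega⟩
    have e₂ : L₂.length = m.sum := by simp at h1; omega
    have h2 : ten L₂ ∈ Q.lenSpan m.sum := e₂ ▸ ten_mem_lenSpan L₂
    have h3 : ten L' ∈ Q.lenSpan n.sum := hL' ▸ ten_mem_lenSpan L'
    rw [← ten_append, append_assoc, cons_append, groupMap, groupMap,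
      tens_append _ _ _ _ _ _ e₁ (by simp [e₂, hL']), tens_append _ _ _ _ _ _ e₁ e₂, ten_append,
      ih h2 h3, mul_assoc]

end GradedQuiver

namespace AInfCat

variable (A : AInfCat K)

theorem midB_mul_right {r s t t' : ℕ} {X Y : A.Ten} (hX : X ∈ A.lenSpan (r + (s + t)))
    (hY : Y ∈ A.lenSpan t') : A.midB r s (t + t') (X * Y) = A.midB r s t X * Y := by
  refine bilin_eq_of_ten (α := A.midB r s (t + t')) (β := A.midB r s t) (γ := LinearMap.id) hX hY fun L L' hL hL' => ?_
  obtain ⟨L₁, M, rfl, e₁⟩ : ∃ L₁ L₂, L = L₁ ++ L₂ ∧ L₁.length = r :=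
    ⟨L.take r, L.drop r, (take_append_drop _ _).symm, by simp; omega⟩
  have hM : M.length = s + t := by simp at hL; omega
  obtain ⟨L₂, L₃, rfl, e₂⟩ : ∃ L₁ L₂, M = L₁ ++ L₂ ∧ L₁.length = s :=
    ⟨M.take s, M.drop s, (take_append_drop _ _).symm, by simp; omega⟩
  have e₃ : L₃.length = t := by simp at hM; omega
  rw [← ten_append, append_assoc, append_assoc, A.midB_ten _ _ _ e₁ e₂ (by simp [e₃, hL']),
    A.midB_ten _ _ _ e₁ e₂ e₃, ten_append]
  simp only [mul_assoc, LinearMap.id_apply]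

theorem midB_mul_left {r r' s t : ℕ} {X Y : A.Ten} (hX : X ∈ A.lenSpan r')
    (hY : Y ∈ A.lenSpan (r + (s + t))) : A.midB (r' + r) s t (X * Y) = X * A.midB r s t Y := by
  refine bilin_eq_of_ten (α := A.midB (r' + r) s t) (β := LinearMap.id) (γ := A.midB r s t) hX hY fun L' L hL' hL => ?_
  obtain ⟨L₁, M, rfl, e₁⟩ : ∃ L₁ L₂, L = L₁ ++ L₂ ∧ L₁.length = r :=
    ⟨L.take r, L.drop r, (take_append_drop _ _).symm, by simp; omega⟩
  have hM : M.length = s + t := by simp at hL; omega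
  obtain ⟨L₂, L₃, rfl, e₂⟩ : ∃ L₁ L₂, M = L₁ ++ L₂ ∧ L₁.length = s :=
    ⟨M.take s, M.drop s, (take_append_drop _ _).symm, by simp; omega⟩
  have e₃ : L₃.length = t := by simp at hM; omega
  rw [← ten_append, ← append_assoc, A.midB_ten _ _ _ (by simp [e₁, hL']) e₂ e₃,
    A.midB_ten _ _ _ e₁ e₂ e₃, ten_append]
  simp only [mul_assoc, LinearMap.id_apply]

end AInfCat

/-- The code of a map to the right part of a wedge, in the wedge. -/
def shiftCode (s : ℕ) (W : Code) : Code :=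
  W.map (List.map (shiftEdge s))

theorem codeDim_append {α : Type*} (X Y : List (List α)) : codeDim (X ++ Y) = codeDim X + codeDim Y := by
  simp [codeDim]

theorem codeDim_shiftCode (s : ℕ) (W : Code) : codeDim (shiftCode s W) = codeDim W := by
  simp [codeDim, shiftCode, Function.comp_def]

theorem length_shiftCode (s : ℕ) (W : Code) : (shiftCode s W).length = W.length := by
  simp [shiftCode]

theorem shiftCode_append (s : ℕ) (X Y : Code) :
    shiftCode s (X ++ Y) = shiftCode s X ++ shiftCode s Y := by simp [shiftCode]

section Faces

variable (K : Type*) [Field K] {M N : Type*} [AddCommGroup M] [Module K M] [AddCommGroup N] [Module K N]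

theorem beadFaces_congr {f f' : List (ℕ × ℕ) → M} {x : List (ℕ × ℕ)}
    (h : ∀ u e e' v, u ++ e :: e' :: v = x → f (u ++ (e.1, e'.2) :: v) = f' (u ++ (e.1, e'.2) :: v)) :
    beadFaces K f x = beadFaces K f' x := by
  refine psum_congr fun u e v hv => ?_
  grind

theorem map_beadFaces (φ : M →ₗ[K] N) (f : List (ℕ × ℕ) → M) (x : List (ℕ × ℕ)) :
    φ (beadFaces K f x) = beadFaces K (fun x' => φ (f x')) x := by
  rw [beadFaces, lmap_psum]
  refine psum_congr fun u e v _ => ?_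
  cases v <;> simp

theorem beadFaces_map_shiftEdge (s : ℕ) (f : List (ℕ × ℕ) → M) (x : List (ℕ × ℕ)) :
    beadFaces K f (x.map (shiftEdge s)) =
      beadFaces K (fun x' => f (x'.map (shiftEdge s))) x := by
  rw [beadFaces, psum_map]
  refine psum_congr fun u e v _ => ?_
  cases v with
  | nil => rfl
  | cons e' v => simp [shiftEdge]

theorem codeFaces_congr {f f' : Code → M} {W : Code}
    (h : ∀ X u e e' v Y, X ++ (u ++ e :: e' :: v) :: Y = W →
      f (X ++ (u ++ (e.1, e'.2) :: v) :: Y) = f' (X ++ (u ++ (e.1, e'.2) :: v) :: Y)) :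
    codeFaces K f W = codeFaces K f' W := by
  refine psum_congr fun X x Y hX => ?_
  exact congrArg _ (beadFaces_congr K fun u e e' v hv => h X u e e' v Y (by rw [hv, hX]))

theorem map_codeFaces (φ : M →ₗ[K] N) (f : Code → M) (W : Code) :
    φ (codeFaces K f W) = codeFaces K (fun W' => φ (f W')) W := by
  rw [codeFaces, lmap_psum]
  refine psum_congr fun X x Y _ => ?_
  rw [map_smul, map_beadFaces]

theorem psum_smul {α : Type*} (c : K) (f : List α → α → List α → M) (L : List α) :
    psum (fun u x v => c • f u x v) L = c • psum f L :=
  (map_psum (DistribSMul.toAddMonoidHom M c) f L).symm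

theorem codeFaces_append (f : Code → M) (W₁ W₂ : Code) :
    codeFaces K f (W₁ ++ W₂) = codeFaces K (fun W => f (W ++ W₂)) W₁ +
      sgn K (codeDim W₁) • codeFaces K (fun W => f (W₁ ++ W)) W₂ := by
  rw [codeFaces, psum_append]
  congr 1
  · refine psum_congr fun X x Y _ => ?_
    simp
  · rw [codeFaces, ← psum_smul]
    refine psum_congr fun X x Y _ => ?_
    rw [smul_smul, ← sgn_add, map_append, List.sum_append, codeDim]
    simp

theorem codeFaces_shiftCode (s : ℕ) (f : Code → M) (W : Code) :
    codeFaces K f (shiftCode s W) = codeFaces K (fun W' => f (shiftCode s W')) W := by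
  rw [codeFaces, shiftCode, psum_map]
  refine psum_congr fun X x Y _ => ?_
  rw [beadFaces_map_shiftEdge]
  simp [shiftCode, Function.comp_def]

end Faces

section Wedge

variable {A B : AInfCat K} {T₁ T₂ : Nec} {a b c : A.Ob} {x : NecSub T₁ → A.Ten}
  {y : NecSub T₂ → A.Ten} {z : NecSub (T₁.wedge T₂) → A.Ten}

theorem NecSub.lift_append (hz : ∀ g₁ g₂, z (wedge g₁ g₂) = x g₁ * y g₂)
    {W₁ W₂ : Code} (h₁ : ∃ g : NecSub T₁, g.code = W₁)
    (h₂ : ∃ g : NecSub T₂, g.code = W₂) :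
    NecSub.lift z (W₁ ++ shiftCode T₁.p W₂) = NecSub.lift x W₁ * NecSub.lift y W₂ := by
  obtain ⟨g₁, rfl⟩ := h₁
  obtain ⟨g₂, rfl⟩ := h₂
  rw [lift_code, lift_code, ← hz]
  exact NecSub.lift_eq z (code_wedge g₁ g₂)

theorem AInfCat.barD_append (A : AInfCat K) (Y : Code → A.Ten)
    (W₁ W₂ : Code) : A.barD Y (W₁ ++ W₂) =
      psum (fun X x Z => csum (fun S => sgn K (codeDim X) •
        A.midB X.length S.length (Z.length + W₂.length) (Y ((X ++ (S ++ Z)) ++ W₂))) x) W₁ +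
      sgn K (codeDim W₁) • psum (fun X x Z => csum (fun S => sgn K (codeDim X) •
        A.midB (W₁.length + X.length) S.length Z.length (Y (W₁ ++ (X ++ (S ++ Z))))) x) W₂ := by
  rw [barD, psum_append]
  congr 1
  · simp
  · rw [← psum_smul K]
    refine psum_congr fun X x Z _ => ?_
    rw [← DistribSMul.toAddMonoidHom_apply, map_csum]
    refine csum_congr fun S _ _ => ?_
    rw [DistribSMul.toAddMonoidHom_apply, smul_smul, ← sgn_add, codeDim_append, length_append,
      Nat.cast_add]
    simp only [append_assoc]

theorem NecSub.lift_mem_lenSpan {T : Nec} {y : NecSub T → A.Ten}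
    (hy : ∀ g, y g ∈ A.shiftTen g.dom.T.blocks a b) (W : Code) :
    NecSub.lift y W ∈ A.lenSpan W.length := by
  have := shiftTen_le_lenSpan _ _ _ (NecSub.lift_mem hy W)
  rwa [length_map] at this

theorem barD_wedge (hx : ∀ g, x g ∈ A.shiftTen g.dom.T.blocks a c)
    (hy : ∀ g, y g ∈ A.shiftTen g.dom.T.blocks c b)
    (hz : ∀ g₁ g₂, z (wedge g₁ g₂) = x g₁ * y g₂) (g₁ : NecSub T₁) (g₂ : NecSub T₂) :
    A.barD (NecSub.lift z) (g₁.code ++ shiftCode T₁.p g₂.code) =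
      A.barD (NecSub.lift x) g₁.code * y g₂ +
        sgn K (codeDim g₁.code) • (x g₁ * A.barD (NecSub.lift y) g₂.code) := by
  rw [AInfCat.barD_append]
  congr 1
  · rw [AInfCat.barD, ← mulRight_apply K, lmap_psum]
    refine psum_congr fun X w Z hX => ?_
    rw [lmap_csum]
    refine csum_congr fun S hS hne => ?_
    rw [map_smul, mulRight_apply, length_shiftCode, NecSub.lift_append hz
      (g₁.exists_code_split hX hS hne) ⟨g₂, rfl⟩, lift_code, A.midB_mul_right]
    · have := NecSub.lift_mem_lenSpan hx (X ++ (S ++ Z))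
      grind
    · have := NecSub.lift_mem_lenSpan hy g₂.code
      rwa [lift_code] at this
  · congr 1
    rw [AInfCat.barD, ← mulLeft_apply (R := K), lmap_psum, shiftCode, psum_map]
    refine psum_congr fun X w Z hX => ?_
    rw [lmap_csum, csum_map]
    refine csum_congr fun S hS hne => ?_
    have h1 := NecSub.lift_append hz ⟨g₁, rfl⟩ (g₂.exists_code_split hX hS hne)
    rw [shiftCode_append, shiftCode_append] at h1
    rw [map_smul, mulLeft_apply]
    refine congrArg₂ (· • ·) (congrArg (fun n : ℕ => sgn K (n : ℤ)) (codeDim_shiftCode _ _)) ?_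
    simp only [length_map]
    refine Eq.trans (congrArg _ h1) ?_
    rw [A.midB_mul_left, lift_code]
    · exact NecSub.lift_mem_lenSpan hx _
    · have := NecSub.lift_mem_lenSpan hy (X ++ (S ++ Z))
      rwa [length_append, length_append] at this

theorem codeFaces_wedge (hz : ∀ g₁ g₂, z (wedge g₁ g₂) = x g₁ * y g₂) (g₁ : NecSub T₁)
    (g₂ : NecSub T₂) :
    codeFaces K (NecSub.lift z) (g₁.code ++ shiftCode T₁.p g₂.code) =
      codeFaces K (NecSub.lift x) g₁.code * y g₂ +
        sgn K (codeDim g₁.code) • (x g₁ * codeFaces K (NecSub.lift y) g₂.code) := by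
  rw [codeFaces_append]
  congr 1
  · rw [← mulRight_apply K, map_codeFaces]
    refine codeFaces_congr K fun X u e e' v Y h => ?_
    rw [NecSub.lift_append hz (g₁.exists_code_face h) ⟨g₂, rfl⟩, lift_code]
    rfl
  · congr 1
    rw [← mulLeft_apply (R := K), map_codeFaces, codeFaces_shiftCode]
    refine codeFaces_congr K fun X u e e' v Y h => ?_
    rw [NecSub.lift_append hz ⟨g₁, rfl⟩ (g₂.exists_code_face h), lift_code]
    rfl

theorem mem_shiftTen_wedge (hx : ∀ g, x g ∈ A.shiftTen g.dom.T.blocks a c)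
    (hy : ∀ g, y g ∈ A.shiftTen g.dom.T.blocks c b)
    (hz : ∀ g₁ g₂, z (wedge g₁ g₂) = x g₁ * y g₂) (g : NecSub (T₁.wedge T₂)) :
    z g ∈ A.shiftTen g.dom.T.blocks a b := by
  obtain ⟨g₁, g₂, rfl⟩ := g.exists_wedge
  rw [hz, show (wedge g₁ g₂).dom.T.blocks = _ from Nec.blocks_wedge _ _]
  exact mul_mem_shiftTen (hx g₁) (hy g₂)

theorem tan_wedge (hx : ∀ g, x g ∈ A.shiftTen g.dom.T.blocks a c)
    (hy : ∀ g, y g ∈ A.shiftTen g.dom.T.blocks c b)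
    (hz : ∀ g₁ g₂, z (wedge g₁ g₂) = x g₁ * y g₂) {g₁ : NecSub T₁} {g₂ : NecSub T₂}
    (h₁ : A.TAN x g₁) (h₂ : A.TAN y g₂) : A.TAN z (wedge g₁ g₂) := by
  rw [A.tan_iff hx] at h₁
  rw [A.tan_iff hy] at h₂
  rw [A.tan_iff (mem_shiftTen_wedge hx hy hz), code_wedge]
  have e1 := barD_wedge hx hy hz g₁ g₂
  have e2 := codeFaces_wedge (K := K) hz g₁ g₂
  rw [h₁, h₂] at e1
  exact e1.trans e2.symm

/-- The product of members of the nerve is a member of the nerve. -/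
theorem mem_nerve_wedge (hx : x ∈ A.nerve T₁ a c) (hy : y ∈ A.nerve T₂ c b)
    (hz : ∀ g₁ g₂, z (wedge g₁ g₂) = x g₁ * y g₂) : z ∈ A.nerve (T₁.wedge T₂) a b := by
  refine ⟨mem_shiftTen_wedge hx.1 hy.1 hz, fun g => ?_⟩
  obtain ⟨g₁, g₂, rfl⟩ := g.exists_wedge
  exact tan_wedge hx.1 hy.1 hz (hx.2 g₁) (hy.2 g₂)

theorem push_wedge (f : AInfFunctor A B) (hx : ∀ g, x g ∈ A.shiftTen g.dom.T.blocks a c)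
    (hy : ∀ g, y g ∈ A.shiftTen g.dom.T.blocks c b)
    (hz : ∀ g₁ g₂, z (wedge g₁ g₂) = x g₁ * y g₂) (g₁ : NecSub T₁) (g₂ : NecSub T₂) :
    f.push z (wedge g₁ g₂) = f.push x g₁ * f.push y g₂ := by
  rw [f.push_eq (mem_shiftTen_wedge hx hy hz), f.push_eq hx, f.push_eq hy, code_wedge,
    rsum_append, ← mulRight_apply K, lmap_rsum]
  refine rsum_congr fun P hP hPne => ?_
  rw [rsum_map, mulRight_apply, ← mulLeft_apply (R := K), lmap_rsum]
  refine rsum_congr fun R hR hRne => ?_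
  rw [mulLeft_apply, List.flatten_append, map_append, List.map_map]
  have h1 := NecSub.lift_append hz (g₁.exists_code_refine hP hPne) (g₂.exists_code_refine hR hRne)
  have h2 : (R.map (List.map (List.map (shiftEdge T₁.p)))).flatten =
      shiftCode T₁.p R.flatten := by
    rw [shiftCode, List.map_flatten]
  have h3 : R.map (List.length ∘ List.map (List.map (shiftEdge T₁.p))) = R.map List.length := by
    simp
  rw [h2, h3, h1, groupMap_append]
  · rw [← length_flatten]; exact NecSub.lift_mem_lenSpan hx _
  · rw [← length_flatten]; exact NecSub.lift_mem_lenSpan hy _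

theorem AInfCat.degen_append (A : AInfCat K) (M N : List (ℕ × ℕ)) {a c : A.Ob} {L : List A.HEl}
    (hL : IsPath a L c) (hM : L.length = (M.filter fun q => q.2 ≠ 0).length)
    (hpos : ∀ q ∈ M, 0 < q.1) {Y : A.Ten}
    (hY : Y ∈ A.lenSpan (N.filter fun q => q.2 ≠ 0).length) :
    A.degen a (M ++ N) (ten L * Y) = A.degen a M (ten L) * A.degen c N Y := by
  induction M generalizing a L with
  | nil =>
    obtain rfl := List.length_eq_zero_iff.mp hM
    obtain rfl : a = c := hL
    simp [degen_nil]
  | cons q M ih =>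
    obtain ⟨n, m⟩ := q
    have hn : 0 < n := hpos (n, m) (by simp)
    have hpos' : ∀ q ∈ M, 0 < q.1 := fun q hq => hpos q (by simp [hq])
    by_cases hnm : n = m
    · subst hnm
      rw [filter_cons_of_pos (by simp; omega), length_cons] at hM
      cases L with
      | nil => simp at hM
      | cons h t =>
        have ht : t.length = (M.filter fun q => q.2 ≠ 0).length := by simpa using hM
        have hY' : ten t * Y ∈ A.lenSpan ((M ++ N).filter fun q => q.2 ≠ 0).length := by
          rw [List.filter_append, length_append, ← ht]
          refine lenSpan_induction (P := fun Y => ten t * Y ∈ A.lenSpan (t.length + _)) hY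
            (fun L' hL' => ?_) (by simp) (fun X X' h h' => by
              rw [mul_add]; exact Submodule.add_mem _ h h')
            (fun c X h => by rw [mul_smul_comm]; exact Submodule.smul_mem _ _ h)
          rw [← ten_append, ← hL', ← length_append]
          exact ten_mem_lenSpan _
        rw [cons_append, A.degen_diag_ten a n M h t ht, ten_cons, mul_assoc, mul_assoc,
          ← ih hL.2 ht hpos', ← ten_singleton]
        refine lenSpan_induction (P := fun X => A.degen a ((n, n) :: (M ++ N)) (ten [h] * X) =
          ten [h] * A.degen h.1.2.1 (M ++ N) X) hY' (fun L' hL' => ?_) (by simp)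
          (fun X X' h h' => by rw [mul_add, map_add, h, h', map_add, mul_add])
          (fun c X h => by rw [mul_smul_comm, map_smul, h, map_smul, mul_smul_comm])
        rw [← ten_append, singleton_append, A.degen_diag_ten _ _ _ _ _ hL']
    · by_cases h10 : n = 1 ∧ m = 0
      · obtain ⟨rfl, rfl⟩ := h10
        rw [filter_cons_of_neg (by simp)] at hM
        rw [cons_append, A.degen_unit, A.degen_unit, ih hL hM hpos', mul_assoc]
      · rw [cons_append, A.degen_other a _ _ hnm h10, A.degen_other a _ _ hnm h10, zero_mul]

theorem nondeg_map_shiftEdge (s : ℕ) (x : List (ℕ × ℕ)) :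
    nondeg (x.map (shiftEdge s)) = (nondeg x).map (shiftEdge s) := by
  rw [nondeg, nondeg, filter_map]
  congr 2
  funext e
  rw [Bool.eq_iff_iff]
  simp [shiftEdge]

theorem nondegCode_append (W₁ W₂ : Code) :
    nondegCode (W₁ ++ W₂) = nondegCode W₁ ++ nondegCode W₂ := by
  simp [nondegCode]

theorem nondegCode_shiftCode (s : ℕ) (W : Code) :
    nondegCode (shiftCode s W) = shiftCode s (nondegCode W) := by
  induction W with
  | nil => rfl
  | cons x W ih =>
    have h : ∀ (x : List (ℕ × ℕ)) W, nondegCode (x :: W) = if nondeg x = [] then nondegCode W else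
        nondeg x :: nondegCode W := by
      intro x W
      simp only [nondegCode, map_cons, List.filter_cons]
      by_cases h : nondeg x = [] <;> simp [h]
    rw [h, show shiftCode s (x :: W) = x.map (shiftEdge s) :: shiftCode s W from rfl, h,
      nondeg_map_shiftEdge, ih]
    by_cases hx : nondeg x = []
    · simp [hx]
    · rw [if_neg (by simpa using hx), if_neg hx]
      rfl

theorem AInfCat.codeDims_append (W₁ W₂ : Code) :
    AInfCat.codeDims (W₁ ++ W₂) = AInfCat.codeDims W₁ ++ AInfCat.codeDims W₂ := by
  simp [AInfCat.codeDims]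

theorem AInfCat.codeDims_shiftCode (s : ℕ) (W : Code) :
    AInfCat.codeDims (shiftCode s W) = AInfCat.codeDims W := by
  simp [AInfCat.codeDims, shiftCode, nondeg_map_shiftEdge, Function.comp_def]

theorem AInfCat.map_length_nondegCode (W : Code) :
    (nondegCode W).map List.length =
      ((AInfCat.codeDims W).filter fun q => q.2 ≠ 0).map Prod.snd := by
  rw [nondegCode, map_length_filter_isEmpty, List.map_map, AInfCat.codeDims, filter_map,
    filter_map, List.map_map]
  rfl

theorem AInfCat.degen_codeDims_append (W₁ W₂ : Code) {X Y : A.Ten}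
    (hpos : ∀ x ∈ W₁, x ≠ [])
    (h₁ : X ∈ A.shiftTen ((nondegCode W₁).map List.length) a c)
    (h₂ : Y ∈ A.shiftTen ((nondegCode W₂).map List.length) c b) :
    A.degen a (codeDims W₁ ++ codeDims W₂) (X * Y) =
      A.degen a (codeDims W₁) X * A.degen c (codeDims W₂) Y := by
  refine shiftTen_induction (P := fun X => A.degen a (codeDims W₁ ++ codeDims W₂) (X * Y) =
    A.degen a (codeDims W₁) X * A.degen c (codeDims W₂) Y) h₁ (fun L hL hd => ?_) (by simp)
    (fun X X' h h' => by rw [add_mul, map_add, h, h', map_add, add_mul])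
    (fun c X h => by rw [smul_mul_assoc, map_smul, h, map_smul, smul_mul_assoc])
  refine A.degen_append _ _ hL ?_ ?_ ?_
  · rw [length_of_degs hd, map_length_nondegCode, length_map]
  · intro q hq
    obtain ⟨x, hx, rfl⟩ := mem_map.mp hq
    exact length_pos_iff.mpr (hpos x hx)
  · have := shiftTen_le_lenSpan _ _ _ h₂
    rwa [map_length_nondegCode, length_map] at this

theorem pull_wedge {T₁' T₂' : Nec} (h₁ : T₁' ⟶ T₁) (h₂ : T₂' ⟶ T₂)
    (hx : ∀ g, x g ∈ A.shiftTen g.dom.T.blocks a c)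
    (hy : ∀ g, y g ∈ A.shiftTen g.dom.T.blocks c b)
    (hz : ∀ g₁ g₂, z (wedge g₁ g₂) = x g₁ * y g₂) (g₁ : NecSub T₁') (g₂ : NecSub T₂') :
    A.pull (wedgeMap h₁ h₂) a z (wedge g₁ g₂) = A.pull h₁ a x g₁ * A.pull h₂ c y g₂ := by
  have hcode : Nec.code ((wedge g₁ g₂).hom ≫ wedgeMap h₁ h₂) =
      Nec.code (g₁.hom ≫ h₁) ++ shiftCode T₁.p (Nec.code (g₂.hom ≫ h₂)) := by
    refine Eq.trans ?_ (Nec.code_wedgeMap (g₁.hom ≫ h₁) (g₂.hom ≫ h₂))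
    refine congrArg Nec.code ?_
    refine Nec.hom_ext fun i hi => ?_
    refine (nat_comp (wedge g₁ g₂).hom.toEndHom (wedgeMap h₁ h₂).toEndHom i).trans ?_
    refine Eq.trans ?_ (nat_add (g₁.hom ≫ h₁).toEndHom (g₂.hom ≫ h₂).toEndHom i).symm
    refine (nat_add h₁.toEndHom h₂.toEndHom _).trans ?_
    rw [show (wedge g₁ g₂).hom.toEndHom.nat i = _ from
      nat_add g₁.hom.toEndHom g₂.hom.toEndHom i]
    have e1 : ∀ i, (g₁.hom ≫ h₁).toEndHom.nat i = h₁.toEndHom.nat (g₁.hom.toEndHom.nat i) :=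
      nat_comp _ _
    have e2 : ∀ i, (g₂.hom ≫ h₂).toEndHom.nat i = h₂.toEndHom.nat (g₂.hom.toEndHom.nat i) :=
      nat_comp _ _
    by_cases hi1 : i ≤ g₁.dom.p
    · rw [if_pos hi1, if_pos hi1, if_pos (g₁.hom.toEndHom.nat_le i), e1]
    · rw [if_neg hi1, if_neg hi1, e2]
      split_ifs with h0
      · have h3 : g₂.hom.toEndHom.nat (i - g₁.dom.p) = 0 := by omega
        rw [h3, add_zero, EndHom.nat_last, EndHom.nat_zero, add_zero]
      · rw [Nat.add_sub_cancel_left]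
  rw [AInfCat.pull_eq, AInfCat.pull_eq, AInfCat.pull_eq, hcode, AInfCat.degenAt, nondegCode_append,
    nondegCode_shiftCode, NecSub.lift_append hz ⟨_, NecSub.code_ofMap _⟩ ⟨_, NecSub.code_ofMap _⟩,
    AInfCat.codeDims_append, AInfCat.codeDims_shiftCode]
  refine AInfCat.degen_codeDims_append _ _ (fun x hx => ne_nil_of_mem_code hx)
    (NecSub.lift_mem hx _) (NecSub.lift_mem hy _)

end Wedge

open NecSub (lift_mem_lenSpan lift_append)

open GradedQuiver

/-! ## Slices of tensors -/

section Slices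

variable {K E F E' F' : Type*} [Field K] [AddCommGroup E] [Module K E] [AddCommGroup F] [Module K F]
  [AddCommGroup E'] [Module K E'] [AddCommGroup F'] [Module K F']

/-- Contraction of the second factor with a linear form. -/
def rightSlice (E : Type*) [AddCommGroup E] [Module K E] (l : F →ₗ[K] K) : E ⊗[K] F →ₗ[K] E :=
  (TensorProduct.rid K E).toLinearMap ∘ₗ lTensor E l

/-- Contraction of the first factor with a linear form. -/
def leftSlice (F : Type*) [AddCommGroup F] [Module K F] (l : E →ₗ[K] K) : E ⊗[K] F →ₗ[K] F :=
  (TensorProduct.lid K F).toLinearMap ∘ₗ rTensor F l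

theorem rightSlice_tmul (l : F →ₗ[K] K) (x : E) (y : F) : rightSlice E l (x ⊗ₜ y) = l y • x := by
  simp [rightSlice]

theorem leftSlice_tmul (l : E →ₗ[K] K) (x : E) (y : F) : leftSlice F l (x ⊗ₜ y) = l x • y := by
  simp [leftSlice]

theorem rightSlice_map (α : E →ₗ[K] E') (β : F →ₗ[K] F') (l : F' →ₗ[K] K) (Z : E ⊗[K] F) :
    rightSlice E' l (TensorProduct.map α β Z) = α (rightSlice E (l ∘ₗ β) Z) := by
  induction Z with
  | zero => simp
  | tmul x y => rw [map_tmul, rightSlice_tmul, rightSlice_tmul, map_smul]; rfl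
  | add X Y hX hY => simp only [map_add, hX, hY]

theorem leftSlice_map (α : E →ₗ[K] E') (β : F →ₗ[K] F') (l : E' →ₗ[K] K) (Z : E ⊗[K] F) :
    leftSlice F' l (TensorProduct.map α β Z) = β (leftSlice F (l ∘ₗ α) Z) := by
  induction Z with
  | zero => simp
  | tmul x y => rw [map_tmul, leftSlice_tmul, leftSlice_tmul, map_smul]; rfl
  | add X Y hX hY => simp only [map_add, hX, hY]

theorem eq_of_rightSlice {Z W : E ⊗[K] F} (h : ∀ l : F →ₗ[K] K, rightSlice E l Z = rightSlice E l W) :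
    Z = W := by
  refine (TensorProduct.equivFinsuppOfBasisRight (Module.Basis.ofVectorSpace K F)).injective
    (Finsupp.ext fun i => ?_)
  rw [TensorProduct.equivFinsuppOfBasisRight_apply, TensorProduct.equivFinsuppOfBasisRight_apply]
  exact h _

theorem eq_of_leftSlice {Z W : E ⊗[K] F} (h : ∀ l : E →ₗ[K] K, leftSlice F l Z = leftSlice F l W) :
    Z = W := by
  refine (TensorProduct.equivFinsuppOfBasisLeft (Module.Basis.ofVectorSpace K E)).injective
    (Finsupp.ext fun i => ?_)
  rw [TensorProduct.equivFinsuppOfBasisLeft_apply, TensorProduct.equivFinsuppOfBasisLeft_apply]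
  exact h _

/-- A tensor whose slices are in subspaces `N` and `M` comes from `N ⊗ M`. -/
theorem exists_map_subtype_eq (N : Submodule K E) (M : Submodule K F) {Z : E ⊗[K] F}
    (h₁ : ∀ l : F →ₗ[K] K, rightSlice E l Z ∈ N) (h₂ : ∀ l : E →ₗ[K] K, leftSlice F l Z ∈ M) :
    ∃ W : N ⊗[K] M, TensorProduct.map N.subtype M.subtype W = Z := by
  obtain ⟨p, hp⟩ := LinearMap.exists_leftInverse_of_injective N.subtype (Submodule.ker_subtype N)
  obtain ⟨q, hq⟩ := LinearMap.exists_leftInverse_of_injective M.subtype (Submodule.ker_subtype M)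
  have hp' : ∀ x ∈ N, (p x : E) = x := fun x hx => by
    have := LinearMap.congr_fun hp ⟨x, hx⟩
    exact congrArg Subtype.val this
  have hq' : ∀ x ∈ M, (q x : F) = x := fun x hx => by
    have := LinearMap.congr_fun hq ⟨x, hx⟩
    exact congrArg Subtype.val this
  have e₁ : TensorProduct.map (N.subtype ∘ₗ p) LinearMap.id Z = Z := by
    refine eq_of_rightSlice fun l => ?_
    rw [rightSlice_map, LinearMap.comp_id]
    exact hp' _ (h₁ l)
  have e₂ : TensorProduct.map LinearMap.id (M.subtype ∘ₗ q) Z = Z := by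
    refine eq_of_leftSlice fun l => ?_
    rw [leftSlice_map, LinearMap.comp_id]
    exact hq' _ (h₂ l)
  refine ⟨TensorProduct.map p q Z, ?_⟩
  rw [TensorProduct.map_map]
  conv_rhs => rw [← e₁, ← e₂, TensorProduct.map_map]
  rfl

variable {ι κ : Type*} [Fintype ι] [Fintype κ]

theorem tensor_pi_eq_sum (Z : (ι → E) ⊗[K] (κ → F)) :
    Z = ∑ i, ∑ j, TensorProduct.map (LinearMap.single K (fun _ => E) i)
      (LinearMap.single K (fun _ => F) j)
      (TensorProduct.map (LinearMap.proj i) (LinearMap.proj j) Z) := by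
  induction Z with
  | zero => simp
  | tmul x y =>
    simp only [map_tmul, LinearMap.proj_apply, ← TensorProduct.tmul_sum,
      ← TensorProduct.sum_tmul]
    congr 1
    · exact (LinearMap.sum_single_apply (fun _ => E) x).symm
    · exact (LinearMap.sum_single_apply (fun _ => F) y).symm
  | add X Y hX hY =>
    simp only [map_add, Finset.sum_add_distrib]
    rw [← hX, ← hY]

end Slices

/-! ## Cutting tensors in two parts -/

namespace GradedQuiver

variable {Q : GradedQuiver K}

/-- The projection to tensors that are composable from `a` to `c`. -/
def endIdx (a c : Q.Ob) (w : List (Q.Ob × Q.Ob × ℤ)) : K := if IsPathIdx (Q := Q) a w c then 1 else 0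

/-- The projection to tensors that are composable from `a` to `c` and of degree `d`. -/
def endDegIdx (a c : Q.Ob) (d : ℤ) (w : List (Q.Ob × Q.Ob × ℤ)) : K :=
  if IsPathIdx (Q := Q) a w c ∧ (w.map fun p => p.2.2).sum = d then 1 else 0

theorem endIdx_map (a c : Q.Ob) (L : List Q.HEl) :
    endIdx a c (L.map Sigma.fst) = if IsPath a L c then (1 : K) else 0 := by
  simp only [endIdx, isPathIdx_map]

theorem endDegIdx_map (a c : Q.Ob) (d : ℤ) (L : List Q.HEl) :
    endDegIdx a c d (L.map Sigma.fst) = if IsPath a L c ∧ (degs L).sum = d then (1 : K) else 0 := by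
  simp only [endDegIdx, isPathIdx_map, List.map_map]
  rfl

/-- Deconcatenation of tensors of length `r + t`, followed by a weight on the first part. -/
def cut (Q : GradedQuiver K) (c : List (Q.Ob × Q.Ob × ℤ) → K) (r t : ℕ) : Q.Ten →ₗ[K] Q.Ten ⊗[K] Q.Ten :=
  TensorProduct.map (Q.weight c) LinearMap.id ∘ₗ Q.split r t

theorem cut_mul (c : List (Q.Ob × Q.Ob × ℤ) → K) {r t : ℕ} {X Y : Q.Ten} (hX : X ∈ Q.lenSpan r)
    (hY : Y ∈ Q.lenSpan t) : Q.cut c r t (X * Y) = Q.weight c X ⊗ₜ[K] Y := by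
  rw [cut, LinearMap.comp_apply, split_mul hX hY]
  rfl

theorem cut_ten (c : List (Q.Ob × Q.Ob × ℤ) → K) {r t : ℕ} {L L' : List Q.HEl} (hL : L.length = r)
    (hL' : L'.length = t) :
    Q.cut c r t (ten (L ++ L')) = c (L.map Sigma.fst) • (ten L ⊗ₜ[K] ten L') := by
  rw [ten_append, cut_mul _ (hL ▸ ten_mem_lenSpan L) (hL' ▸ ten_mem_lenSpan L'), weight_ten]
  rfl

theorem isPath_prefix_iff {a b c : Q.Ob} {L : List Q.HEl} (h : IsPath a L c) :
    IsPath a L b ↔ c = b :=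
  ⟨fun h' => h.tgt_unique h', fun h' => h' ▸ h⟩

theorem weight_endIdx_of_mem {a b c : Q.Ob} {n : List ℕ} {X : Q.Ten} (hX : X ∈ Q.shiftTen n a c) :
    Q.weight (endIdx a b) X = if c = b then X else 0 := by
  have := eqOn_shiftTen (α := Q.weight (endIdx a b))
    (β := (if c = b then (1 : K) else 0) • LinearMap.id) (fun L hL _ => by
      rw [weight_ten, endIdx_map, LinearMap.smul_apply]
      simp only [isPath_prefix_iff hL]
      rfl) hX
  rw [this, LinearMap.smul_apply]
  split_ifs <;> simp

/-- The degree of a tensor in `shiftTen n a b`. -/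
def shiftDeg (n : List ℕ) : ℤ := (n.map fun i : ℕ => (i : ℤ) - 1).sum

theorem cut_endDegIdx {m n : List ℕ} {r t : ℕ} (hm : m.length = r) (hn : n.length = t) {a b : Q.Ob}
    (c : Q.Ob) (d : ℤ) {X : Q.Ten} (hX : X ∈ Q.shiftTen (m ++ n) a b) :
    Q.cut (endDegIdx a c d) r t X =
      (if d = shiftDeg m then (1 : K) else 0) • Q.cut (endIdx a c) r t X := by
  refine eqOn_shiftTen (β := (if d = shiftDeg m then (1 : K) else 0) • Q.cut (endIdx a c) r t)
    (fun L hL hd => ?_) hX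
  obtain ⟨L₁, L₂, rfl, hd₁, hd₂⟩ := mem_shiftTen_append hd
  have e₁ := (length_of_degs hd₁).trans hm
  have e₂ := (length_of_degs hd₂).trans hn
  rw [LinearMap.smul_apply, cut_ten _ e₁ e₂, cut_ten _ e₁ e₂, endDegIdx_map, endIdx_map, smul_smul,
    hd₁]
  congr 1
  rw [show (List.map (fun i : ℕ => (i : ℤ) - 1) m).sum = shiftDeg m from rfl]
  grind

theorem exists_finset_cut {m n : List ℕ} {r t : ℕ} (hm : m.length = r) (hn : n.length = t) {a b : Q.Ob}
    {X : Q.Ten} (hX : X ∈ Q.shiftTen (m ++ n) a b) : ∃ C : Finset Q.Ob, ∀ C', C ⊆ C' →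
      ∑ c ∈ C', LinearMap.mul' K Q.Ten (Q.cut (endIdx a c) r t X) = X := by
  refine shiftTen_induction (P := fun X => ∃ C : Finset Q.Ob, ∀ C', C ⊆ C' →
      ∑ c ∈ C', LinearMap.mul' K Q.Ten (Q.cut (endIdx a c) r t X) = X) hX (fun L hL hd => ?_) ?_ ?_ ?_
  · obtain ⟨L₁, L₂, rfl, hd₁, hd₂⟩ := mem_shiftTen_append hd
    obtain ⟨c, hL₁, hL₂⟩ := isPath_append.mp hL
    refine ⟨{c}, fun C' hC' => ?_⟩
    rw [Finset.sum_eq_single c]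
    · rw [cut_ten _ ((length_of_degs hd₁).trans hm) ((length_of_degs hd₂).trans hn), endIdx_map,
        if_pos hL₁, one_smul, LinearMap.mul'_apply, ten_append]
    · intro c' _ hc'
      rw [cut_ten _ ((length_of_degs hd₁).trans hm) ((length_of_degs hd₂).trans hn), endIdx_map,
        if_neg fun h => hc' (h.tgt_unique hL₁), zero_smul, map_zero]
    · intro h
      exact absurd (hC' (Finset.mem_singleton_self c)) h
  · exact ⟨∅, fun C' _ => by simp⟩
  · rintro X Y ⟨C, hC⟩ ⟨D, hD⟩
    refine ⟨C ∪ D, fun C' h => ?_⟩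
    simp only [map_add, Finset.sum_add_distrib]
    rw [hC C' (Finset.union_subset_left h), hD C' (Finset.union_subset_right h)]
  · rintro k X ⟨C, hC⟩
    refine ⟨C, fun C' h => ?_⟩
    simp only [map_smul, ← Finset.smul_sum]
    rw [hC C' h]

end GradedQuiver

namespace AInfCat

variable (A : AInfCat K)

theorem exists_midB_ten {L₂ : List A.HEl} {x y : A.Ob} (hL : IsPath x L₂ y) :
    ∃ h : A.HEl, h.1 = (x, y, (degs L₂).sum + L₂.length - 2) ∧
      ∀ (L₁ L₃ : List A.HEl) (r s t : ℕ), L₁.length = r → L₂.length = s → L₃.length = t →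
        A.midB r s t (ten (L₁ ++ (L₂ ++ L₃))) = ten (L₁ ++ h :: L₃) := by
  obtain ⟨h, hh, hb⟩ := A.b_hasHom.exists_tot hL
  refine ⟨h, hh, fun L₁ L₃ r s t hr hs ht => ?_⟩
  rw [A.midB_ten _ _ _ hr hs ht, hb, ten_append, ten_cons]

theorem cut_midB_left {m n : List ℕ} {r s t l : ℕ} (hm : m.length = r + (s + t)) (hn : n.length = l)
    {a b : A.Ob} (c : A.Ob) (d : ℤ) {X : A.Ten} (hX : X ∈ A.shiftTen (m ++ n) a b) :
    A.cut (endDegIdx a c d) (r + (1 + t)) l (A.midB r s (t + l) X) =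
      (if d = shiftDeg m + s - 2 then (1 : K) else 0) •
        TensorProduct.map (A.midB r s t) LinearMap.id (A.cut (endIdx a c) (r + (s + t)) l X) := by
  refine eqOn_shiftTen (α := A.cut (endDegIdx a c d) (r + (1 + t)) l ∘ₗ A.midB r s (t + l))
    (β := (if d = shiftDeg m + s - 2 then (1 : K) else 0) •
      TensorProduct.map (A.midB r s t) LinearMap.id ∘ₗ A.cut (endIdx a c) (r + (s + t)) l)
    (fun L hL hd => ?_) hX
  obtain ⟨M, L₄, rfl, hd₁, hd₄⟩ := mem_shiftTen_append hd
  have e₄ := (length_of_degs hd₄).trans hn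
  have hM := (length_of_degs hd₁).trans hm
  obtain ⟨L₁, M', rfl, e₁⟩ : ∃ L₁ L₂, M = L₁ ++ L₂ ∧ L₁.length = r :=
    ⟨M.take r, M.drop r, (take_append_drop _ _).symm, by simp; omega⟩
  have hM' : M'.length = s + t := by simp at hM; omega
  obtain ⟨L₂, L₃, rfl, e₂⟩ : ∃ L₁ L₂, M' = L₁ ++ L₂ ∧ L₁.length = s :=
    ⟨M'.take s, M'.drop s, (take_append_drop _ _).symm, by simp; omega⟩
  have e₃ : L₃.length = t := by simp at hM'; omega
  obtain ⟨c', hM, hL₄⟩ := isPath_append.mp hL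
  obtain ⟨x, hL₁, hM'⟩ := isPath_append.mp hM
  obtain ⟨y, hL₂, hL₃⟩ := isPath_append.mp hM'
  obtain ⟨h, hh, hb⟩ := A.exists_midB_ten hL₂
  have hp : IsPath a (L₁ ++ h :: L₃) c' :=
    isPath_append.mpr ⟨x, hL₁, by rw [hh], by rw [hh]; exact hL₃⟩
  have hdeg : (degs (L₁ ++ h :: L₃)).sum = shiftDeg m + s - 2 := by
    rw [shiftDeg, ← hd₁]
    simp only [degs, map_append, map_cons, List.sum_append, sum_cons, hh, e₂]
    ring
  rw [LinearMap.comp_apply, LinearMap.smul_apply, LinearMap.comp_apply,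
    cut_ten _ (by simp [e₁, e₂, e₃]) e₄, map_smul, map_tmul, hb _ _ _ _ _ e₁ e₂ e₃,
    append_assoc, append_assoc, hb _ (L₃ ++ L₄) _ _ _ e₁ e₂ (by simp [e₃, e₄]),
    ← cons_append, ← append_assoc, cut_ten _ (by simp [e₁, e₃]; omega) e₄, endDegIdx_map,
    ← append_assoc, endIdx_map, hdeg, smul_smul]
  simp only [isPath_prefix_iff hp, isPath_prefix_iff hM, append_assoc]
  congr 1
  by_cases h1 : c' = c <;> by_cases h2 : d = shiftDeg m + s - 2 <;> simp [h1, h2, Ne.symm]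

theorem midB_mem_lenSpan {r s t : ℕ} {n : List ℕ} {a b : A.Ob} (hn : n.length = r + (s + t)) {X : A.Ten}
    (hX : X ∈ A.shiftTen n a b) : A.midB r s t X ∈ A.lenSpan (r + (1 + t)) := by
  refine shiftTen_induction (P := fun X => A.midB r s t X ∈ A.lenSpan (r + (1 + t))) hX
    (fun L hL hd => ?_) (by simp) (fun X Y h h' => by rw [map_add]; exact Submodule.add_mem _ h h')
    (fun k X h => by rw [map_smul]; exact Submodule.smul_mem _ _ h)
  have hlen := (length_of_degs hd).trans hn
  obtain ⟨L₁, M', rfl, e₁⟩ : ∃ L₁ L₂, L = L₁ ++ L₂ ∧ L₁.length = r :=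
    ⟨L.take r, L.drop r, (take_append_drop _ _).symm, by simp; omega⟩
  have hM' : M'.length = s + t := by simp at hlen; omega
  obtain ⟨L₂, L₃, rfl, e₂⟩ : ∃ L₁ L₂, M' = L₁ ++ L₂ ∧ L₁.length = s :=
    ⟨M'.take s, M'.drop s, (take_append_drop _ _).symm, by simp; omega⟩
  have e₃ : L₃.length = t := by simp at hM'; omega
  obtain ⟨x, hL₁, hM'⟩ := isPath_append.mp hL
  obtain ⟨y, hL₂, hL₃⟩ := isPath_append.mp hM'
  obtain ⟨h, hh, hb⟩ := A.exists_midB_ten hL₂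
  rw [hb _ _ _ _ _ e₁ e₂ e₃]
  have := ten_mem_lenSpan (L₁ ++ h :: L₃)
  rwa [show (L₁ ++ h :: L₃).length = r + (1 + t) by simp [e₁, e₃]; omega] at this

theorem cut_midB_right {m n : List ℕ} {r s t l : ℕ} (hm : m.length = l) (hn : n.length = r + (s + t))
    {a b : A.Ob} (c : A.Ob) (d : ℤ) {X : A.Ten} (hX : X ∈ A.shiftTen (m ++ n) a b) :
    A.cut (endDegIdx a c d) l (r + (1 + t)) (A.midB (l + r) s t X) =
      (if d = shiftDeg m then (1 : K) else 0) •
        TensorProduct.map LinearMap.id (A.midB r s t) (A.cut (endIdx a c) l (r + (s + t)) X) := by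
  refine eqOn_shiftTen (α := A.cut (endDegIdx a c d) l (r + (1 + t)) ∘ₗ A.midB (l + r) s t)
    (β := (if d = shiftDeg m then (1 : K) else 0) •
      TensorProduct.map LinearMap.id (A.midB r s t) ∘ₗ A.cut (endIdx a c) l (r + (s + t)))
    (fun L hL hd => ?_) hX
  obtain ⟨M, L', rfl, hd₁, hd'⟩ := mem_shiftTen_append hd
  obtain ⟨c', hM, hL'⟩ := isPath_append.mp hL
  have e₁ := (length_of_degs hd₁).trans hm
  have e₂ := (length_of_degs hd').trans hn
  have h1 : ten M ∈ A.lenSpan l := e₁ ▸ ten_mem_lenSpan M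
  have h2 : ten L' ∈ A.lenSpan (r + (s + t)) := e₂ ▸ ten_mem_lenSpan L'
  have h3 := A.midB_mem_lenSpan hn (ten_mem_shiftTen hL' hd')
  rw [LinearMap.comp_apply, LinearMap.smul_apply, LinearMap.comp_apply, ten_append,
    A.midB_mul_left h1 h2, cut_mul _ h1 h3, cut_mul _ h1 h2, map_tmul, weight_ten,
    weight_ten, endDegIdx_map, endIdx_map, LinearMap.id_apply, hd₁, TensorProduct.smul_tmul',
    smul_smul]
  rw [show (List.map (fun i : ℕ => (i : ℤ) - 1) m).sum = shiftDeg m from rfl]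
  congr 2
  grind

end AInfCat

open GradedQuiver

theorem psum_eq_zero {α M : Type*} [AddCommMonoid M] {f : List α → α → List α → M} {L : List α}
    (h : ∀ u x v, u ++ x :: v = L → f u x v = 0) : psum f L = 0 := by
  rw [psum_congr (g := fun _ _ _ => 0) h]
  clear h
  induction L with
  | nil => rfl
  | cons a t ih => rw [psum_cons, ih, add_zero]

theorem csum_eq_zero {α M : Type*} [AddCommMonoid M] {f : List (List α) → M} {L : List α}
    (h : ∀ S : List (List α), S.flatten = L → (∀ s ∈ S, s ≠ []) → f S = 0) : csum f L = 0 := by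
  rw [csum_congr (g := fun _ => 0) h, csum_zero]

/-- The degree of the tensors at a code. -/
def codeDeg {α : Type*} (W : List (List α)) : ℤ := shiftDeg (W.map List.length)

theorem codeDeg_append {α : Type*} (X Y : List (List α)) : codeDeg (X ++ Y) = codeDeg X + codeDeg Y := by
  simp [codeDeg, shiftDeg]

theorem codeDeg_cons {α : Type*} (x : List α) (Y : List (List α)) :
    codeDeg (x :: Y) = x.length - 1 + codeDeg Y := by
  simp [codeDeg, shiftDeg]

theorem codeDeg_eq {α : Type*} (S : List (List α)) : codeDeg S = S.flatten.length - S.length := by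
  induction S with
  | nil => rfl
  | cons s S ih => rw [codeDeg_cons, ih]; simp; ring

theorem codeDeg_split {α : Type*} {X Z S : List (List α)} {x : List α} (hS : S.flatten = x) :
    codeDeg (X ++ (S ++ Z)) + S.length = codeDeg (X ++ x :: Z) + 1 := by
  rw [codeDeg_append, codeDeg_append, codeDeg_append, codeDeg_cons, codeDeg_eq S, hS]
  ring

theorem codeDeg_face {X Z : Code} {u v : List (ℕ × ℕ)} {e e' f : ℕ × ℕ} :
    codeDeg (X ++ (u ++ f :: v) :: Z) = codeDeg (X ++ (u ++ e :: e' :: v) :: Z) - 1 := by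
  rw [codeDeg_append, codeDeg_append, codeDeg_cons, codeDeg_cons]
  simp
  ring

section

variable {Q : GradedQuiver K}

theorem rightSlice_cut_mem {m n : List ℕ} {r t : ℕ} (hm : m.length = r) (hn : n.length = t) {a b : Q.Ob}
    (c : Q.Ob) (l : Q.Ten →ₗ[K] K) {X : Q.Ten} (hX : X ∈ Q.shiftTen (m ++ n) a b) :
    rightSlice Q.Ten l (Q.cut (endIdx a c) r t X) ∈ Q.shiftTen m a c := by
  refine shiftTen_induction (P := fun X => rightSlice Q.Ten l (Q.cut (endIdx a c) r t X) ∈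
    Q.shiftTen m a c) hX (fun L hL hd => ?_) (by simp)
    (fun X Y h h' => by rw [map_add, map_add]; exact Submodule.add_mem _ h h')
    (fun k X h => by rw [map_smul, map_smul]; exact Submodule.smul_mem _ _ h)
  obtain ⟨L₁, L₂, rfl, hd₁, hd₂⟩ := mem_shiftTen_append hd
  rw [cut_ten _ ((length_of_degs hd₁).trans hm) ((length_of_degs hd₂).trans hn), endIdx_map]
  split_ifs with h
  · rw [one_smul, rightSlice_tmul]
    exact Submodule.smul_mem _ _ (ten_mem_shiftTen h hd₁)
  · simp

theorem leftSlice_cut_mem {m n : List ℕ} {r t : ℕ} (hm : m.length = r) (hn : n.length = t) {a b : Q.Ob}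
    (c : Q.Ob) (l : Q.Ten →ₗ[K] K) {X : Q.Ten} (hX : X ∈ Q.shiftTen (m ++ n) a b) :
    leftSlice Q.Ten l (Q.cut (endIdx a c) r t X) ∈ Q.shiftTen n c b := by
  refine shiftTen_induction (P := fun X => leftSlice Q.Ten l (Q.cut (endIdx a c) r t X) ∈
    Q.shiftTen n c b) hX (fun L hL hd => ?_) (by simp)
    (fun X Y h h' => by rw [map_add, map_add]; exact Submodule.add_mem _ h h')
    (fun k X h => by rw [map_smul, map_smul]; exact Submodule.smul_mem _ _ h)
  obtain ⟨L₁, L₂, rfl, hd₁, hd₂⟩ := mem_shiftTen_append hd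
  rw [cut_ten _ ((length_of_degs hd₁).trans hm) ((length_of_degs hd₂).trans hn), endIdx_map]
  obtain ⟨c', hL₁, hL₂⟩ := isPath_append.mp hL
  split_ifs with h
  · rw [one_smul, leftSlice_tmul]
    obtain rfl := h.tgt_unique hL₁
    exact Submodule.smul_mem _ _ (ten_mem_shiftTen hL₂ hd₂)
  · simp

end

section NerveCut

variable {A : AInfCat K} {T₁ T₂ : Nec} {a b : A.Ob}
  {z : NecSub (T₁.wedge T₂) → A.Ten}

/-- The component at the object `c` of a member of the nerve of a wedge, as a function of codes. -/
def cutCode (A : AInfCat K) (a c : A.Ob) (z : NecSub (T₁.wedge T₂) → A.Ten)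
    (W₁ W₂ : Code) : A.Ten ⊗[K] A.Ten :=
  A.cut (endIdx a c) W₁.length W₂.length (NecSub.lift z (W₁ ++ shiftCode T₁.p W₂))

theorem lift_append_mem (hz : ∀ g, z g ∈ A.shiftTen g.dom.T.blocks a b) (W₁ W₂ : Code) :
    NecSub.lift z (W₁ ++ shiftCode T₁.p W₂) ∈
      A.shiftTen (W₁.map List.length ++ W₂.map List.length) a b := by
  have := NecSub.lift_mem hz (W₁ ++ shiftCode T₁.p W₂)
  rwa [map_append, show (shiftCode T₁.p W₂).map List.length = W₂.map List.length by
    simp [shiftCode, Function.comp_def]] at this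

theorem tan_code_wedge (hz : z ∈ A.nerve (T₁.wedge T₂) a b) (g₁ : NecSub T₁) (g₂ : NecSub T₂) :
    A.barD (NecSub.lift z) (g₁.code ++ shiftCode T₁.p g₂.code) =
      codeFaces K (NecSub.lift z) (g₁.code ++ shiftCode T₁.p g₂.code) := by
  have h := (A.tan_iff hz.1 (wedge g₁ g₂)).mp (hz.2 _)
  rwa [code_wedge] at h

theorem cutCode_tan_left (hz : z ∈ A.nerve (T₁.wedge T₂) a b) (c : A.Ob) (g₁ : NecSub T₁)
    (g₂ : NecSub T₂) :
    psum (fun X x Z => csum (fun S => sgn K (codeDim X) •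
      TensorProduct.map (A.midB X.length S.length Z.length) LinearMap.id
        (cutCode A a c z (X ++ (S ++ Z)) g₂.code)) x) g₁.code =
      codeFaces K (fun W => cutCode A a c z W g₂.code) g₁.code := by
  have h := congrArg (A.cut (endDegIdx a c (codeDeg g₁.code - 1)) g₁.code.length g₂.code.length)
    (tan_code_wedge hz g₁ g₂)
  rw [AInfCat.barD_append, codeFaces_append, map_add, map_add, map_smul, map_smul, lmap_psum, lmap_psum,
    map_codeFaces, map_codeFaces] at h
  have h2 : psum (fun X x Z => A.cut (endDegIdx a c (codeDeg g₁.code - 1)) g₁.code.length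
      g₂.code.length (csum (fun S => sgn K (codeDim X) •
        A.midB (g₁.code.length + X.length) S.length Z.length
          (NecSub.lift z (g₁.code ++ (X ++ (S ++ Z))))) x)) (shiftCode T₁.p g₂.code) = 0 := by
    rw [shiftCode, psum_map]
    refine psum_eq_zero fun X x Z hX => ?_
    rw [lmap_csum, csum_map]
    refine csum_eq_zero fun S hS _ => ?_
    have hu := lift_append_mem hz.1 g₁.code (X ++ (S ++ Z))
    rw [shiftCode_append, shiftCode_append] at hu
    have := A.cut_midB_right (r := X.length) (s := S.length) (t := Z.length) (l := g₁.code.length)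
      (by simp) (by simp) c (codeDeg g₁.code - 1) hu
    rw [if_neg (by rw [codeDeg]; omega), zero_smul] at this
    rw [map_smul]
    simp only [length_map]
    rw [← hX]
    simp only [length_append, length_cons]
    rw [show X.length + (Z.length + 1) = X.length + (1 + Z.length) by omega]
    exact (congrArg _ this).trans (smul_zero _)
  have h4 : codeFaces K (fun W => A.cut (endDegIdx a c (codeDeg g₁.code - 1)) g₁.code.length
      g₂.code.length (NecSub.lift z (g₁.code ++ W))) (shiftCode T₁.p g₂.code) = 0 := by
    rw [codeFaces_shiftCode]
    refine (codeFaces_congr K (f' := fun _ => 0) fun X u e e' v Y hX => ?_).trans ?_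
    · rw [cut_endDegIdx (by simp) (by rw [← hX]; simp) c _ (lift_append_mem hz.1 _ _),
        if_neg (by rw [codeDeg]; omega), zero_smul]
    · have := map_codeFaces K (0 : K →ₗ[K] A.Ten ⊗[K] A.Ten) (fun _ => 0) g₂.code
      simpa using this.symm
  rw [h2, h4, smul_zero, add_zero, add_zero] at h
  refine Eq.trans (psum_congr fun X x Z hX => ?_) (h.trans (codeFaces_congr K fun X u e e' v Y hX => ?_))
  · rw [lmap_csum]
    refine csum_congr fun S hS _ => ?_
    have := A.cut_midB_left (r := X.length) (s := S.length) (t := Z.length) (l := g₂.code.length)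
      (by simp) (by simp) c (codeDeg g₁.code - 1) (lift_append_mem hz.1 (X ++ (S ++ Z)) g₂.code)
    have hd := codeDeg_split (X := X) (Z := Z) hS
    rw [hX] at hd
    rw [if_pos (by
      rw [show shiftDeg ((X ++ (S ++ Z)).map List.length) = codeDeg (X ++ (S ++ Z)) from rfl]; omega),
      one_smul] at this
    rw [map_smul, cutCode, length_shiftCode]
    have hl : g₁.code.length = X.length + (1 + Z.length) := by
      rw [← hX]; simp; omega
    rw [hl, this]
    simp
  · rw [cut_endDegIdx (by rw [← hX]; simp) (by simp) c _ (lift_append_mem hz.1 _ _), if_pos (by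
      have := codeDeg_face (X := X) (u := u) (v := v) (Z := Y) (e := e) (e' := e') (f := (e.1, e'.2))
      rw [hX] at this
      exact this.symm), one_smul, cutCode]
    rw [← hX]
    simp

theorem cutCode_tan_right (hz : z ∈ A.nerve (T₁.wedge T₂) a b) (c : A.Ob) (g₁ : NecSub T₁)
    (g₂ : NecSub T₂) :
    psum (fun X x Z => csum (fun S => sgn K (codeDim X) •
      TensorProduct.map LinearMap.id (A.midB X.length S.length Z.length)
        (cutCode A a c z g₁.code (X ++ (S ++ Z)))) x) g₂.code =
      codeFaces K (fun W => cutCode A a c z g₁.code W) g₂.code := by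
  have h := congrArg (A.cut (endDegIdx a c (codeDeg g₁.code)) g₁.code.length g₂.code.length)
    (tan_code_wedge hz g₁ g₂)
  rw [AInfCat.barD_append, codeFaces_append, map_add, map_add, map_smul, map_smul, lmap_psum, lmap_psum,
    map_codeFaces, map_codeFaces] at h
  have h2 : psum (fun X x Z => A.cut (endDegIdx a c (codeDeg g₁.code)) g₁.code.length
      g₂.code.length (csum (fun S => sgn K (codeDim X) •
        A.midB X.length S.length (Z.length + (shiftCode T₁.p g₂.code).length)
          (NecSub.lift z (X ++ (S ++ Z) ++ shiftCode T₁.p g₂.code))) x)) g₁.code = 0 := by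
    refine psum_eq_zero fun X x Z hX => ?_
    rw [lmap_csum]
    refine csum_eq_zero fun S hS _ => ?_
    have := A.cut_midB_left (r := X.length) (s := S.length) (t := Z.length) (l := g₂.code.length)
      (by simp) (by simp) c (codeDeg g₁.code) (lift_append_mem hz.1 (X ++ (S ++ Z)) g₂.code)
    have hd := codeDeg_split (X := X) (Z := Z) hS
    rw [hX] at hd
    rw [if_neg (by
      rw [show shiftDeg ((X ++ (S ++ Z)).map List.length) = codeDeg (X ++ (S ++ Z)) from rfl]; omega),
      zero_smul] at this
    rw [map_smul, length_shiftCode]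
    have hl : g₁.code.length = X.length + (1 + Z.length) := by
      rw [← hX]; simp; omega
    rw [hl, this, smul_zero]
  have h4 : codeFaces K (fun W => A.cut (endDegIdx a c (codeDeg g₁.code)) g₁.code.length
      g₂.code.length (NecSub.lift z (W ++ shiftCode T₁.p g₂.code))) g₁.code = 0 := by
    refine (codeFaces_congr K (f' := fun _ => 0) fun X u e e' v Y hX => ?_).trans ?_
    · rw [cut_endDegIdx (by rw [← hX]; simp) (by simp) c _ (lift_append_mem hz.1 _ _), if_neg (by
        have := codeDeg_face (X := X) (u := u) (v := v) (Z := Y) (e := e) (e' := e') (f := (e.1, e'.2))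
        rw [hX, codeDeg] at this
        omega), zero_smul]
    · have := map_codeFaces K (0 : K →ₗ[K] A.Ten ⊗[K] A.Ten) (fun _ => 0) g₁.code
      simpa using this.symm
  rw [h2, h4, zero_add, zero_add] at h
  have h' := (sgn_smul_cancel (K := K) (V := A.Ten ⊗[K] A.Ten) (codeDim g₁.code : ℤ)).mp h
  rw [codeFaces_shiftCode, shiftCode, psum_map] at h'
  refine Eq.trans (psum_congr fun X x Z hX => ?_) (h'.trans (codeFaces_congr K fun X u e e' v Y hX => ?_))
  · rw [lmap_csum, csum_map]
    refine csum_congr fun S hS _ => ?_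
    have hu := lift_append_mem hz.1 g₁.code (X ++ (S ++ Z))
    have := A.cut_midB_right (r := X.length) (s := S.length) (t := Z.length) (l := g₁.code.length)
      (by simp) (by simp) c (codeDeg g₁.code) hu
    rw [if_pos (show codeDeg g₁.code = shiftDeg (g₁.code.map List.length) from rfl), one_smul] at this
    rw [map_smul]
    refine congrArg₂ (· • ·) (congrArg (fun n : ℕ => sgn K (n : ℤ)) (codeDim_shiftCode _ _).symm) ?_
    simp only [length_map]
    have hl : g₂.code.length = X.length + (1 + Z.length) := by
      rw [← hX]; simp; omega
    rw [shiftCode_append, shiftCode_append] at this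
    rw [hl]
    refine Eq.trans ?_ this.symm
    rw [cutCode, shiftCode_append, shiftCode_append]
    simp
  · rw [cut_endDegIdx (by simp) (by rw [← hX]; simp) c _ (lift_append_mem hz.1 _ _), if_pos (show codeDeg g₁.code = shiftDeg (g₁.code.map List.length) from rfl), one_smul,
      cutCode]
    rw [← hX]
    simp

theorem lift_cutCode {M : Type*} [AddCommGroup M] {T : Nec} (f : Code → M)
    {W : Code} (h : ∃ g : NecSub T, g.code = W) :
    NecSub.lift (fun g : NecSub T => f g.code) W = f W := by
  obtain ⟨g, rfl⟩ := h
  exact lift_code _ g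

theorem rightSlice_mem_nerve (hz : z ∈ A.nerve (T₁.wedge T₂) a b) (c : A.Ob) (g₂ : NecSub T₂)
    (l : A.Ten →ₗ[K] K) :
    (fun g₁ : NecSub T₁ => rightSlice A.Ten l (cutCode A a c z g₁.code g₂.code)) ∈ A.nerve T₁ a c := by
  have hmem : ∀ g₁ : NecSub T₁, rightSlice A.Ten l (cutCode A a c z g₁.code g₂.code) ∈
      A.shiftTen g₁.dom.T.blocks a c := fun g₁ => by
    rw [← g₁.map_length_code]
    exact rightSlice_cut_mem (by simp) (by simp) c l (lift_append_mem hz.1 _ _)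
  refine ⟨hmem, fun g₁ => (A.tan_iff hmem g₁).mpr ?_⟩
  have h := congrArg (rightSlice A.Ten l) (cutCode_tan_left hz c g₁ g₂)
  rw [lmap_psum, map_codeFaces] at h
  refine Eq.trans (psum_congr fun X x Z hX => ?_) (h.trans (codeFaces_congr K fun X u e e' v Y hX => ?_))
  · rw [lmap_csum]
    refine csum_congr fun S hS hne => ?_
    rw [map_smul, rightSlice_map, LinearMap.comp_id,
      lift_cutCode (fun W => rightSlice A.Ten l (cutCode A a c z W g₂.code))
        (g₁.exists_code_split hX hS hne)]
  · exact (lift_cutCode (fun W => rightSlice A.Ten l (cutCode A a c z W g₂.code))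
      (g₁.exists_code_face hX)).symm

theorem leftSlice_mem_nerve (hz : z ∈ A.nerve (T₁.wedge T₂) a b) (c : A.Ob) (g₁ : NecSub T₁)
    (l : A.Ten →ₗ[K] K) :
    (fun g₂ : NecSub T₂ => leftSlice A.Ten l (cutCode A a c z g₁.code g₂.code)) ∈ A.nerve T₂ c b := by
  have hmem : ∀ g₂ : NecSub T₂, leftSlice A.Ten l (cutCode A a c z g₁.code g₂.code) ∈
      A.shiftTen g₂.dom.T.blocks c b := fun g₂ => by
    rw [← g₂.map_length_code]
    exact leftSlice_cut_mem (by simp) (by simp) c l (lift_append_mem hz.1 _ _)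
  refine ⟨hmem, fun g₂ => (A.tan_iff hmem g₂).mpr ?_⟩
  have h := congrArg (leftSlice A.Ten l) (cutCode_tan_right hz c g₁ g₂)
  rw [lmap_psum, map_codeFaces] at h
  refine Eq.trans (psum_congr fun X x Z hX => ?_) (h.trans (codeFaces_congr K fun X u e e' v Y hX => ?_))
  · rw [lmap_csum]
    refine csum_congr fun S hS hne => ?_
    rw [map_smul, leftSlice_map, LinearMap.comp_id,
      lift_cutCode (fun W => leftSlice A.Ten l (cutCode A a c z g₁.code W))
        (g₂.exists_code_split hX hS hne)]
  · exact (lift_cutCode (fun W => leftSlice A.Ten l (cutCode A a c z g₁.code W))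
      (g₂.exists_code_face hX)).symm

end NerveCut

namespace NecSub

theorem fst_lt_snd_of_mem_code {T : Nec} (g : NecSub T) {x : List (ℕ × ℕ)} (hx : x ∈ g.code) {e : ℕ × ℕ}
    (he : e ∈ x) : e.1 < e.2 ∧ e.2 ≤ T.p := by
  have h1 : e ∈ g.hom.toEndHom.edges := by
    rw [← Nec.flatten_code]
    exact List.mem_flatten.mpr ⟨x, hx, he⟩
  obtain ⟨i, hi, rfl⟩ := mem_map.mp h1
  exact ⟨g.nat_lt (List.mem_range.mp hi), g.hom.toEndHom.nat_le _⟩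

theorem wedge_injective₂ {T₁ T₂ : Nec} {g₁ g₁' : NecSub T₁} {g₂ g₂' : NecSub T₂}
    (h : wedge g₁ g₂ = wedge g₁' g₂') : g₁ = g₁' ∧ g₂ = g₂' := by
  have hc := congrArg code h
  rw [code_wedge, code_wedge] at hc
  have hf : ∀ (g₁ : NecSub T₁) (g₂ : NecSub T₂), (g₁.code ++ g₂.code.map (List.map
      (shiftEdge T₁.p))).filter (fun x => x.all fun e => decide (e.2 ≤ T₁.p)) = g₁.code := by
    intro g₁ g₂
    rw [List.filter_append, List.filter_eq_self.mpr, List.filter_eq_nil_iff.mpr, List.append_nil]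
    · intro x hx
      obtain ⟨y, hy, rfl⟩ := mem_map.mp hx
      cases y with
      | nil => exact absurd rfl (ne_nil_of_mem_code hy)
      | cons e y =>
        have := (g₂.fst_lt_snd_of_mem_code hy (List.mem_cons_self ..)).1
        simp [shiftEdge]
        omega
    · intro x hx
      rw [List.all_eq_true]
      intro e he
      exact decide_eq_true (g₁.fst_lt_snd_of_mem_code hx he).2
  have h1 : g₁.code = g₁'.code := by rw [← hf g₁ g₂, hc, hf]
  rw [h1] at hc
  have h2 := List.append_cancel_left hc
  have hinj : Function.Injective (shiftEdge T₁.p) := by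
    rintro ⟨a, b⟩ ⟨c, d⟩ h
    simp only [shiftEdge, Prod.mk.injEq] at h
    grind
  exact ⟨code_injective h1, code_injective
    (List.map_injective_iff.mpr (List.map_injective_iff.mpr hinj) h2)⟩

end NecSub

section Iso

variable (A : AInfCat K) {T₁ T₂ : Nec} {a b : A.Ob}

theorem AInfCat.wedgeAt_lof (g₁ : NecSub T₁) (g₂ : NecSub T₂) (c : A.Ob)
    (W : (A.nerve T₁ a c) ⊗[K] (A.nerve T₂ c b)) :
    A.wedgeAt a b g₁ g₂ (lof K A.Ob
      (fun c => (A.nerve T₁ a c) ⊗[K] (A.nerve T₂ c b)) c W) =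
      LinearMap.mul' K A.Ten (TensorProduct.map (LinearMap.proj g₁ ∘ₗ (A.nerve T₁ a c).subtype)
        (LinearMap.proj g₂ ∘ₗ (A.nerve T₂ c b).subtype) W) := by
  rw [wedgeAt, toModule_lof]
  induction W with
  | zero => simp
  | tmul x y => rfl
  | add X Y hX hY => rw [map_add, hX, hY, map_add, map_add]

theorem AInfCat.wedgeAt_lof_tmul (g₁ : NecSub T₁) (g₂ : NecSub T₂) (c : A.Ob) (x : A.nerve T₁ a c)
    (y : A.nerve T₂ c b) :
    A.wedgeAt a b g₁ g₂ (lof K A.Ob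
      (fun c => (A.nerve T₁ a c) ⊗[K] (A.nerve T₂ c b)) c (x ⊗ₜ y)) = x.1 g₁ * y.1 g₂ := by
  rw [wedgeAt_lof]
  rfl

/-- The values of the canonical map, at all injective necklace maps. -/
def AInfCat.wedgeFun (a b : A.Ob) (T₁ T₂ : Nec) :
    (⨁ c, (A.nerve T₁ a c) ⊗[K] (A.nerve T₂ c b)) →ₗ[K] (NecSub (T₁.wedge T₂) → A.Ten) :=
  LinearMap.pi fun g => A.wedgeAt a b g.exists_wedge.choose g.exists_wedge.choose_spec.choose

theorem AInfCat.wedgeFun_wedge (w : ⨁ c, (A.nerve T₁ a c) ⊗[K] (A.nerve T₂ c b)) (g₁ : NecSub T₁)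
    (g₂ : NecSub T₂) : A.wedgeFun a b T₁ T₂ w (wedge g₁ g₂) = A.wedgeAt a b g₁ g₂ w := by
  have h := (wedge g₁ g₂).exists_wedge.choose_spec.choose_spec
  obtain ⟨h1, h2⟩ := NecSub.wedge_injective₂ h
  have key : ∀ g₁' g₂', g₁ = g₁' → g₂ = g₂' → A.wedgeAt a b g₁' g₂' w = A.wedgeAt a b g₁ g₂ w := by
    rintro _ _ rfl rfl
    rfl
  exact key _ _ h1 h2

theorem AInfCat.wedgeFun_mem (w : ⨁ c, (A.nerve T₁ a c) ⊗[K] (A.nerve T₂ c b)) :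
    A.wedgeFun a b T₁ T₂ w ∈ A.nerve (T₁.wedge T₂) a b := by
  induction w using DirectSum.induction_on with
  | zero => rw [map_zero]; exact Submodule.zero_mem _
  | of c W =>
    induction W with
    | zero => rw [map_zero, map_zero]; exact Submodule.zero_mem _
    | tmul x y =>
      refine mem_nerve_wedge x.2 y.2 fun g₁ g₂ => ?_
      rw [wedgeFun_wedge]
      exact A.wedgeAt_lof_tmul g₁ g₂ c x y
    | add X Y hX hY => rw [map_add, map_add]; exact Submodule.add_mem _ hX hY
  | add X Y hX hY => rw [map_add]; exact Submodule.add_mem _ hX hY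

theorem AInfCat.cut_wedgeAt (g₁ : NecSub T₁) (g₂ : NecSub T₂) (c : A.Ob)
    (w : ⨁ c, (A.nerve T₁ a c) ⊗[K] (A.nerve T₂ c b)) :
    A.cut (endIdx a c) g₁.dom.T.length g₂.dom.T.length (A.wedgeAt a b g₁ g₂ w) =
      TensorProduct.map (LinearMap.proj g₁ ∘ₗ (A.nerve T₁ a c).subtype)
        (LinearMap.proj g₂ ∘ₗ (A.nerve T₂ c b).subtype)
        (component K A.Ob (fun c => (A.nerve T₁ a c) ⊗[K] (A.nerve T₂ c b)) c w) := by
  have : A.cut (endIdx a c) g₁.dom.T.length g₂.dom.T.length ∘ₗ A.wedgeAt a b g₁ g₂ =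
      TensorProduct.map (LinearMap.proj g₁ ∘ₗ (A.nerve T₁ a c).subtype)
        (LinearMap.proj g₂ ∘ₗ (A.nerve T₂ c b).subtype) ∘ₗ
        component K A.Ob (fun c => (A.nerve T₁ a c) ⊗[K] (A.nerve T₂ c b)) c := by
    refine linearMap_ext K fun c' => TensorProduct.ext' fun x y => ?_
    have hx : x.1 g₁ ∈ A.shiftTen g₁.dom.T.blocks a c' := x.2.1 g₁
    have hy : y.1 g₂ ∈ A.shiftTen g₂.dom.T.blocks c' b := y.2.1 g₂
    have hx' := shiftTen_le_lenSpan _ _ _ hx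
    have hy' := shiftTen_le_lenSpan _ _ _ hy
    rw [CompositionAsSet.blocks_length] at hx' hy'
    refine (congrArg (A.cut _ _ _) (A.wedgeAt_lof_tmul g₁ g₂ c' x y)).trans
      ((cut_mul _ hx' hy').trans ?_)
    rw [weight_endIdx_of_mem hx]
    by_cases h : c' = c
    · subst h
      simp
    · rw [if_neg h, TensorProduct.zero_tmul]
      refine Eq.symm ((congrArg _ ((component.of K
        (M := fun c => (A.nerve T₁ a c) ⊗[K] (A.nerve T₂ c b)) _ _ (x ⊗ₜ[K] y)).trans
        (dif_neg h))).trans ?_)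
      exact map_zero _
  exact LinearMap.congr_fun this w

/-- The values at all `g₁ ∨ g₂` determine a member of the tensor product of nerves. -/
theorem AInfCat.eq_of_wedgeAt {w w' : ⨁ c, (A.nerve T₁ a c) ⊗[K] (A.nerve T₂ c b)}
    (h : ∀ g₁ g₂, A.wedgeAt a b g₁ g₂ w = A.wedgeAt a b g₁ g₂ w') : w = w' := by
  have := Fintype.ofFinite (NecSub T₁)
  have := Fintype.ofFinite (NecSub T₂)
  refine DirectSum.ext_component K fun c => ?_
  refine (TensorProduct.map_injective_of_flat_flat (A.nerve T₁ a c).subtype (A.nerve T₂ c b).subtype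
    (Submodule.injective_subtype _) (Submodule.injective_subtype _)) ?_
  rw [tensor_pi_eq_sum (TensorProduct.map _ _ (component K A.Ob _ c w)),
    tensor_pi_eq_sum (TensorProduct.map _ _ (component K A.Ob _ c w'))]
  refine sum_congr rfl fun g₁ _ => sum_congr rfl fun g₂ _ => ?_
  congr 1
  rw [TensorProduct.map_map, TensorProduct.map_map]
  have h1 := A.cut_wedgeAt g₁ g₂ c w
  rw [h g₁ g₂] at h1
  exact h1.symm.trans (A.cut_wedgeAt g₁ g₂ c w')

theorem AInfCat.exists_wedgeAt {z : NecSub (T₁.wedge T₂) → A.Ten} (hz : z ∈ A.nerve (T₁.wedge T₂) a b) :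
    ∃ w : ⨁ c, (A.nerve T₁ a c) ⊗[K] (A.nerve T₂ c b),
      ∀ g₁ g₂, A.wedgeAt a b g₁ g₂ w = z (wedge g₁ g₂) := by
  have := Fintype.ofFinite (NecSub T₁)
  have := Fintype.ofFinite (NecSub T₂)
  let Z : A.Ob → (NecSub T₁ → A.Ten) ⊗[K] (NecSub T₂ → A.Ten) := fun c =>
    ∑ g₁ : NecSub T₁, ∑ g₂ : NecSub T₂, TensorProduct.map (LinearMap.single K (fun _ => A.Ten) g₁)
      (LinearMap.single K (fun _ => A.Ten) g₂) (cutCode A a c z g₁.code g₂.code)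
  have hZ : ∀ c, ∃ W : (A.nerve T₁ a c) ⊗[K] (A.nerve T₂ c b),
      TensorProduct.map (A.nerve T₁ a c).subtype (A.nerve T₂ c b).subtype W = Z c := by
    intro c
    refine exists_map_subtype_eq _ _ (fun l => ?_) fun l => ?_
    · simp only [Z, map_sum, rightSlice_map]
      rw [Finset.sum_comm]
      refine Submodule.sum_mem _ fun g₂ _ => ?_
      have := rightSlice_mem_nerve hz c g₂ (l ∘ₗ LinearMap.single K (fun _ => A.Ten) g₂)
      rwa [← LinearMap.sum_single_apply (fun _ => A.Ten) (fun g₁ : NecSub T₁ => rightSlice A.Ten _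
        (cutCode A a c z g₁.code g₂.code))] at this
    · simp only [Z, map_sum, leftSlice_map]
      refine Submodule.sum_mem _ fun g₁ _ => ?_
      have := leftSlice_mem_nerve hz c g₁ (l ∘ₗ LinearMap.single K (fun _ => A.Ten) g₁)
      rwa [← LinearMap.sum_single_apply (fun _ => A.Ten) (fun g₂ : NecSub T₂ => leftSlice A.Ten _
        (cutCode A a c z g₁.code g₂.code))] at this
  choose W hW using hZ
  have hfin : ∀ p : NecSub T₁ × NecSub T₂, ∃ C : Finset A.Ob, ∀ C', C ⊆ C' →
      ∑ c ∈ C', LinearMap.mul' K A.Ten (cutCode A a c z p.1.code p.2.code) =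
        z (wedge p.1 p.2) := by
    intro p
    obtain ⟨C, hC⟩ := exists_finset_cut (r := p.1.code.length) (t := p.2.code.length)
      (by simp) (by simp) (lift_append_mem hz.1 p.1.code p.2.code)
    refine ⟨C, fun C' h => (hC C' h).trans ?_⟩
    exact NecSub.lift_eq z (code_wedge _ _)
  choose C hC using hfin
  refine ⟨∑ c ∈ Finset.univ.biUnion C, lof K A.Ob
    (fun c => (A.nerve T₁ a c) ⊗[K] (A.nerve T₂ c b)) c (W c), fun g₁ g₂ => ?_⟩
  rw [map_sum, ← hC (g₁, g₂) _ (Finset.subset_biUnion_of_mem C (Finset.mem_univ (g₁, g₂)))]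
  refine sum_congr rfl fun c _ => ?_
  rw [wedgeAt_lof, TensorProduct.map_comp, LinearMap.comp_apply, hW]
  congr 1
  simp only [Z, map_sum, TensorProduct.map_map]
  rw [Finset.sum_eq_single g₁, Finset.sum_eq_single g₂]
  · rw [LinearMap.proj_comp_single_same, LinearMap.proj_comp_single_same, TensorProduct.map_id]
    rfl
  · intro g₂' _ h
    rw [LinearMap.proj_comp_single_ne K (fun _ => A.Ten) _ _ h.symm, TensorProduct.map_zero_right]
    rfl
  · simp
  · intro g₁' _ h
    refine Finset.sum_eq_zero fun g₂' _ => ?_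
    rw [LinearMap.proj_comp_single_ne K (fun _ => A.Ten) _ _ h.symm, TensorProduct.map_zero_left]
    rfl
  · simp

/-- The canonical isomorphism `N_{T₁} ⊗ N_{T₂} ≅ N_{T₁ ∨ T₂}`. -/
def AInfCat.wedgeEquiv (T₁ T₂ : Nec) (a b : A.Ob) :
    (⨁ c, (A.nerve T₁ a c) ⊗[K] (A.nerve T₂ c b)) ≃ₗ[K] A.nerve (T₁.wedge T₂) a b :=
  LinearEquiv.ofBijective ((A.wedgeFun a b T₁ T₂).codRestrict _ A.wedgeFun_mem) (by
    constructor
    · intro w w' h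
      refine A.eq_of_wedgeAt fun g₁ g₂ => ?_
      rw [← A.wedgeFun_wedge, ← A.wedgeFun_wedge]
      exact congrFun (congrArg Subtype.val h) _
    · rintro ⟨z, hz⟩
      obtain ⟨w, hw⟩ := A.exists_wedgeAt hz
      refine ⟨w, Subtype.ext (funext fun g => ?_)⟩
      obtain ⟨g₁, g₂, rfl⟩ := g.exists_wedge
      exact (A.wedgeFun_wedge w g₁ g₂).trans (hw g₁ g₂))

theorem AInfCat.wedgeEquiv_apply (w : ⨁ c, (A.nerve T₁ a c) ⊗[K] (A.nerve T₂ c b)) (g₁ : NecSub T₁)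
    (g₂ : NecSub T₂) :
    (A.wedgeEquiv T₁ T₂ a b w).1 (wedge g₁ g₂) = A.wedgeAt a b g₁ g₂ w :=
  A.wedgeFun_wedge w g₁ g₂

end Iso

open GradedQuiver

namespace Nec

theorem eq_simplex_or_wedge (T : Nec) : T = simplex 0 ∨
    ∃ n T', 0 < n ∧ T = (simplex n).wedge T' ∧ T'.T.blocks.length < T.T.blocks.length := by
  cases hb : T.T.blocks with
  | nil => exact Or.inl (eq_of_blocks (hb.trans blocks_oneBead_zero.symm))
  | cons n L =>
    have hn : 0 < n := T.T.blocks_pos (by rw [hb]; exact List.mem_cons_self)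
    obtain ⟨T', -, hT'⟩ := exists_of_blocks L fun i hi =>
      T.T.blocks_pos (by rw [hb]; exact List.mem_cons_of_mem _ hi)
    refine Or.inr ⟨n, T', hn, eq_of_blocks ?_, by rw [hT']; simp⟩
    rw [blocks_wedge, hT', hb]
    exact congrArg (· ++ L) (blocks_oneBead_pos hn).symm

/-- A necklace map is active if it sends joints to joints. -/
def IsActive {T V : Nec} (e : T ⟶ V) : Prop :=
  ∀ i ∈ T.T.boundaries, e.toFun i ∈ V.T.boundaries

theorem isActive_imageEpi {T V : Nec} (h : T ⟶ V) : IsActive (imageEpi h) :=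
  fun _ hi => Finset.mem_image_of_mem _ hi

theorem IsActive.of_wedgeMap {T₁ T₂ V₁ V₂ : Nec} {h₁ : T₁ ⟶ V₁} {h₂ : T₂ ⟶ V₂}
    (h : IsActive (wedgeMap h₁ h₂)) : IsActive h₁ ∧ IsActive h₂ := by
  constructor <;> intro i hi
  · have h' := h ⟨i.val, by simp only [wedge]; omega⟩ ((mem_wedge_left i.isLt).mpr hi)
    refine (mem_wedge_left (U := V₂) (h₁.toFun i).isLt).mp ?_
    refine Eq.mpr (congrArg (· ∈ (V₁.wedge V₂).T.boundaries) (Fin.ext (Eq.symm ?_))) h'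
    exact (val_toFun _ _).trans ((nat_add_left h₁.toEndHom h₂.toEndHom
      (Nat.le_of_lt_succ i.isLt)).trans (val_toFun _ _).symm)
  · have h' := h ⟨T₁.p + i.val, by simp only [wedge]; omega⟩ ((mem_wedge_right i.isLt).mpr hi)
    refine (mem_wedge_right (T := V₁) (h₂.toFun i).isLt).mp ?_
    refine Eq.mpr (congrArg (· ∈ (V₁.wedge V₂).T.boundaries) (Fin.ext (Eq.symm ?_))) h'
    exact (val_toFun _ _).trans ((nat_add_right h₁.toEndHom h₂.toEndHom _).trans
      (congrArg (V₁.p + ·) (val_toFun h₂.toEndHom i).symm))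

end Nec

namespace NecSub

/-- The restriction of a family along an injective necklace map. -/
def restrict {T : Nec} {M : Type*} (g : NecSub T) (y : NecSub T → M) : NecSub g.dom → M :=
  fun g' => y (g.comp g'.hom g'.inj)

end NecSub

section Induction

variable {A : AInfCat K}

theorem AInfCat.restrict_mem_nerve {T : Nec} (g : NecSub T) {a b : A.Ob} {y : NecSub T → A.Ten}
    (hy : y ∈ A.nerve T a b) : g.restrict y ∈ A.nerve g.dom a b :=
  ⟨fun g' => hy.1 (g.comp g'.hom g'.inj), fun g' => hy.2 (g.comp g'.hom g'.inj)⟩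

theorem AInfCat.wedgeAt_induction {T₁ T₂ : Nec} {a b : A.Ob}
    {P : (NecSub (T₁.wedge T₂) → A.Ten) → Prop} (h0 : P 0) (hadd : ∀ x y,
      x ∈ A.nerve (T₁.wedge T₂) a b → y ∈ A.nerve (T₁.wedge T₂) a b → P x → P y → P (x + y))
    (hmul : ∀ c, ∀ x ∈ A.nerve T₁ a c, ∀ y ∈ A.nerve T₂ c b, ∀ z ∈ A.nerve (T₁.wedge T₂) a b,
      (∀ g₁ g₂, z (wedge g₁ g₂) = x g₁ * y g₂) → P z)
    {z : NecSub (T₁.wedge T₂) → A.Ten} (hz : z ∈ A.nerve (T₁.wedge T₂) a b) : P z := by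
  obtain ⟨w, hw⟩ := A.exists_wedgeAt hz
  have key : ∀ w, P (A.wedgeFun a b T₁ T₂ w) := by
    intro w
    induction w using DirectSum.induction_on with
    | zero => rwa [map_zero]
    | of c W =>
      induction W with
      | zero => rwa [map_zero, map_zero]
      | tmul x y =>
        refine hmul c x.1 x.2 y.1 y.2 _ (A.wedgeFun_mem _) fun g₁ g₂ => ?_
        rw [wedgeFun_wedge]
        exact A.wedgeAt_lof_tmul g₁ g₂ c x y
      | add X Y hX hY =>
        rw [map_add, map_add]
        exact hadd _ _ (A.wedgeFun_mem _) (A.wedgeFun_mem _) hX hY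
    | add X Y hX hY =>
      rw [map_add]
      exact hadd _ _ (A.wedgeFun_mem _) (A.wedgeFun_mem _) hX hY
  have : z = A.wedgeFun a b T₁ T₂ w := funext fun g => by
    obtain ⟨g₁, g₂, rfl⟩ := g.exists_wedge
    rw [A.wedgeFun_wedge, hw]
  rw [this]
  exact key w

/-- An additive property of members of nerves that is multiplicative for wedges holds if it holds for
simplices. -/
theorem AInfCat.nerve_induction {P : ∀ (T : Nec) (_ _ : A.Ob), (NecSub T → A.Ten) → Prop}
    (h0 : ∀ T a b, P T a b 0)
    (hadd : ∀ T a b x y, x ∈ A.nerve T a b → y ∈ A.nerve T a b → P T a b x → P T a b y →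
      P T a b (x + y))
    (hsimplex : ∀ n a b, ∀ y ∈ A.nerve (.simplex n) a b, P (.simplex n) a b y)
    (hmul : ∀ T₁ T₂ a b c, ∀ x ∈ A.nerve T₁ a c, ∀ y ∈ A.nerve T₂ c b,
      ∀ z ∈ A.nerve (T₁.wedge T₂) a b, (∀ g₁ g₂, z (wedge g₁ g₂) = x g₁ * y g₂) →
        P T₁ a c x → P T₂ c b y → P (T₁.wedge T₂) a b z)
    {T : Nec} {a b : A.Ob} {y : NecSub T → A.Ten} (hy : y ∈ A.nerve T a b) : P T a b y := by
  induction hk : T.T.blocks.length using Nat.strong_induction_on generalizing T a b with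
  | _ k ih =>
    obtain rfl | ⟨n, T', -, rfl, hlt⟩ := T.eq_simplex_or_wedge
    · exact hsimplex 0 a b y hy
    · exact wedgeAt_induction (P := P _ a b) (h0 _ a b) (hadd _ a b)
        (fun c x hx y hy z hz hxy => hmul _ _ a b c x hx y hy z hz hxy (hsimplex n a c x hx)
          (ih _ (hk ▸ hlt) hy rfl)) hy

/-- The same for properties of members of nerves and active necklace maps. -/
theorem AInfCat.active_induction
    {P : ∀ (T V : Nec) (_ : T ⟶ V) (_ _ : A.Ob), (NecSub V → A.Ten) → Prop}
    (h0 : ∀ T V e a b, P T V e a b 0)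
    (hadd : ∀ T V e a b x y, x ∈ A.nerve V a b → y ∈ A.nerve V a b → P T V e a b x →
      P T V e a b y → P T V e a b (x + y))
    (hsimplex : ∀ n m (e : simplex n ⟶ simplex m) a b, ∀ y ∈ A.nerve (.simplex m) a b,
      P _ _ e a b y)
    (hmul : ∀ T₁ T₂ V₁ V₂ (e₁ : T₁ ⟶ V₁) (e₂ : T₂ ⟶ V₂) a b c, ∀ x ∈ A.nerve V₁ a c,
      ∀ y ∈ A.nerve V₂ c b, ∀ z ∈ A.nerve (V₁.wedge V₂) a b,
      (∀ g₁ g₂, z (wedge g₁ g₂) = x g₁ * y g₂) →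
        P T₁ V₁ e₁ a c x → P T₂ V₂ e₂ c b y → P _ _ (wedgeMap e₁ e₂) a b z)
    {T V : Nec} {e : T ⟶ V} (he : Nec.IsActive e) {a b : A.Ob} {y : NecSub V → A.Ten}
    (hy : y ∈ A.nerve V a b) : P T V e a b y := by
  have base : ∀ n V (e : simplex n ⟶ V), Nec.IsActive e → ∀ a b, ∀ y ∈ A.nerve V a b,
      P _ _ e a b y := by
    intro n V e he a b y hy
    obtain ⟨m, rfl⟩ : ∃ m, V = simplex m := by
      refine ⟨V.p, congrArg (Nec.mk V.p) (CompositionAsSet.ext ?_)⟩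
      refine Finset.Subset.antisymm (fun i hi => ?_) ?_
      · obtain ⟨j, hj, rfl⟩ := Finset.mem_image.mp (e.joints hi)
        have hj' : j = 0 ∨ j = Fin.last n := by
          have hj'' : j ∈ ({0, Fin.last n} : Finset _) := hj
          exact (Finset.mem_insert.mp hj'').imp_right Finset.mem_singleton.mp
        rcases hj' with rfl | rfl
        · rw [show e.toFun 0 = 0 from e.map_zero]
          exact (simplex V.p).T.zero_mem
        · rw [show e.toFun (Fin.last n) = Fin.last V.p from e.map_last]
          exact (simplex V.p).T.getLast_mem
      · intro i hi
        have hi' : i ∈ ({0, Fin.last V.p} : Finset _) := hi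
        rcases Finset.mem_insert.mp hi' with rfl | hi''
        · exact V.T.zero_mem
        · rw [Finset.mem_singleton.mp hi'']
          exact V.T.getLast_mem
    exact hsimplex _ _ e a b y hy
  induction hk : T.T.blocks.length using Nat.strong_induction_on generalizing T V a b with
  | _ k ih =>
    obtain rfl | ⟨n, T', -, rfl, hlt⟩ := T.eq_simplex_or_wedge
    · exact base 0 V e he a b y hy
    · have hj := he ⟨n, by simp only [Nec.wedge, simplex]; omega⟩
        ((Nec.mem_wedge_left (T := simplex n) (U := T') (Nat.lt_succ_self n)).mpr
          (simplex n).T.getLast_mem)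
      obtain ⟨V₁, V₂, rfl, hq⟩ := V.exists_eq_wedge
        ((CompositionAsSet.mem_boundaries_iff_partialSums _ _).mp hj)
      obtain ⟨e₁, e₂, rfl⟩ := Nec.exists_wedgeMap (T₁ := simplex n) e
        ((val_toFun e.toEndHom _).symm.trans hq.symm)
      obtain ⟨he₁, he₂⟩ := he.of_wedgeMap
      exact wedgeAt_induction (P := P _ _ (wedgeMap e₁ e₂) a b) (h0 _ _ _ a b) (hadd _ _ _ a b)
        (fun c x hx y hy z hz hxy => hmul _ _ _ _ e₁ e₂ a b c x hx y hy z hz hxy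
          (base n _ e₁ he₁ a c x hx) (ih _ (hk ▸ hlt) he₂ hy rfl)) hy

end Induction

open GradedQuiver

namespace AInfCat

variable (A : AInfCat K)

theorem degen_diag_mul (c : A.Ob) (n : ℕ) (M : List (ℕ × ℕ)) (h : A.HEl) {Z : A.Ten}
    (hZ : Z ∈ A.lenSpan (M.filter fun q => q.2 ≠ 0).length) :
    A.degen c ((n, n) :: M) (ten [h] * Z) = ten [h] * A.degen h.1.2.1 M Z :=
  eqOn_lenSpan (α := A.degen c ((n, n) :: M) ∘ₗ mulLeft K (ten [h]))
    (β := mulLeft K (ten [h]) ∘ₗ A.degen h.1.2.1 M) hZ fun L hL => by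
      rw [LinearMap.comp_apply, LinearMap.comp_apply, mulLeft_apply, mulLeft_apply,
        ← ten_append]
      exact A.degen_diag_ten c n M h L hL

theorem degen_nil_ten_nil (c : A.Ob) : A.degen c [] (ten []) = ten [] := by
  rw [degen_nil, ten_nil, map_one, map_one]

/-- A list of degrees that starts with `n - 1` belongs to a nonempty list. -/
theorem exists_cons_of_degs {L : List A.HEl} {n : ℕ} {N : List ℕ} {a b : A.Ob} (hL : IsPath a L b)
    (hd : degs L = (n :: N).map fun i : ℕ => (i : ℤ) - 1) : ∃ h L', L = h :: L' ∧
      ten [h] ∈ A.shiftTen [n] a h.1.2.1 ∧ IsPath h.1.2.1 L' b ∧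
      degs L' = N.map fun i : ℕ => (i : ℤ) - 1 := by
  cases L with
  | nil => simp [degs] at hd
  | cons h L' =>
    simp only [degs, map_cons, List.cons.injEq] at hd
    exact ⟨h, L', rfl, ten_mem_shiftTen ⟨hL.1, rfl⟩ (by simp [degs, hd.1]), hL.2, hd.2⟩

theorem degen_mem_shiftTen (M : List (ℕ × ℕ)) (hpos : ∀ q ∈ M, 0 < q.1) {a b : A.Ob} {X : A.Ten}
    (hX : X ∈ A.shiftTen ((M.filter fun q => q.2 ≠ 0).map Prod.snd) a b) :
    A.degen a M X ∈ A.shiftTen (M.map Prod.fst) a b := by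
  refine shiftTen_induction (P := fun X => A.degen a M X ∈ A.shiftTen (M.map Prod.fst) a b) hX
    (fun L hL hd => ?_) (by rw [map_zero]; exact Submodule.zero_mem _)
    (fun X Y hX hY => by rw [map_add]; exact Submodule.add_mem _ hX hY)
    (fun c X hX => by rw [map_smul]; exact Submodule.smul_mem _ c hX)
  clear hX
  induction M generalizing a L with
  | nil =>
    obtain rfl : L = [] := by simpa [degs] using hd
    rw [degen_nil_ten_nil]
    exact ten_mem_shiftTen hL rfl
  | cons q M ih =>
    obtain ⟨n, m⟩ := q
    have hn : 0 < n := hpos (n, m) List.mem_cons_self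
    have hpos' : ∀ q ∈ M, 0 < q.1 := fun q hq => hpos q (List.mem_cons_of_mem _ hq)
    by_cases hnm : n = m
    · subst hnm
      rw [filter_cons_of_pos (by simpa using hn.ne'), map_cons] at hd
      obtain ⟨h, L', rfl, h1, h2, h3⟩ := A.exists_cons_of_degs hL hd
      rw [degen_diag_ten _ _ _ _ _ _ (by simpa using length_of_degs h3)]
      exact (mul_mem_shiftTen h1 (ih hpos' L' h2 h3) : _ ∈ A.shiftTen ([n] ++ M.map Prod.fst) a b)
    · by_cases h10 : n = 1 ∧ m = 0
      · obtain ⟨rfl, rfl⟩ := h10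
        rw [filter_cons_of_neg (by simp)] at hd
        have h1 : ten [A.oneH a] ∈ A.shiftTen [1] a a :=
          ten_mem_shiftTen ⟨rfl, rfl⟩ (by simp [degs, AInfData.oneH])
        rw [degen_unit]
        exact (mul_mem_shiftTen h1 (ih hpos' L hL hd) :
          _ ∈ A.shiftTen ([1] ++ M.map Prod.fst) a b)
      · rw [degen_other _ _ _ _ hnm h10]
        exact Submodule.zero_mem _

theorem degen_diag (N : List ℕ) (hpos : ∀ n ∈ N, 0 < n) {a b : A.Ob} {X : A.Ten}
    (hX : X ∈ A.shiftTen N a b) : A.degen a (N.map fun n => (n, n)) X = X := by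
  refine eqOn_shiftTen (β := LinearMap.id) (fun L hL hd => ?_) hX
  clear hX
  induction N generalizing a L with
  | nil =>
    obtain rfl : L = [] := by simpa [degs] using hd
    exact A.degen_nil_ten_nil a
  | cons n N ih =>
    obtain ⟨h, L', rfl, h1, h2, h3⟩ := A.exists_cons_of_degs hL hd
    have hpos' : ∀ q ∈ N, 0 < q := fun q hq => hpos q (List.mem_cons_of_mem _ hq)
    have hlen : ((N.map fun n => (n, n)).filter fun q => q.2 ≠ 0).length = N.length := by
      rw [List.filter_eq_self.mpr, length_map]
      intro q hq
      obtain ⟨n, hn, rfl⟩ := mem_map.mp hq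
      simpa using (hpos' n hn).ne'
    rw [map_cons, degen_diag_ten _ _ _ _ _ _ (by rw [hlen]; exact length_of_degs h3),
      ih hpos' L' h2 h3]
    exact (ten_append [h] L').symm

theorem degen_degen (N : List (ℕ × ℕ × ℕ))
    (hN : ∀ t ∈ N, 0 < t.1 ∧ t.2.1 ≤ t.1 ∧ t.2.2 ≤ t.2.1) {a b : A.Ob} {X : A.Ten}
    (hX : X ∈ A.shiftTen ((N.filter fun t => t.2.2 ≠ 0).map fun t => t.2.2) a b) :
    A.degen a (N.map fun t => (t.1, t.2.1))
      (A.degen a ((N.filter fun t => t.2.1 ≠ 0).map fun t => (t.2.1, t.2.2)) X) =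
    A.degen a (N.map fun t => (t.1, t.2.2)) X := by
  refine eqOn_shiftTen (α := A.degen a (N.map fun t => (t.1, t.2.1)) ∘ₗ
    A.degen a ((N.filter fun t => t.2.1 ≠ 0).map fun t => (t.2.1, t.2.2))) (fun L hL hd => ?_) hX
  rw [LinearMap.comp_apply]
  clear hX
  induction N generalizing a L with
  | nil =>
    obtain rfl : L = [] := by simpa [degs] using hd
    simp only [map_nil, List.filter_nil, degen_nil_ten_nil]
  | cons t N ih =>
    obtain ⟨n, m, l⟩ := t
    obtain ⟨hn, hmn, hlm⟩ : 0 < n ∧ m ≤ n ∧ l ≤ m := hN (n, m, l) List.mem_cons_self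
    have hN' : ∀ t ∈ N, 0 < t.1 ∧ t.2.1 ≤ t.1 ∧ t.2.2 ≤ t.2.1 :=
      fun q hq => hN q (List.mem_cons_of_mem _ hq)
    have hfil : (((N.filter fun t => t.2.1 ≠ 0).map fun t => (t.2.1, t.2.2)).filter
        fun q => q.2 ≠ 0).map Prod.snd = (N.filter fun t => t.2.2 ≠ 0).map fun t => t.2.2 := by
      rw [filter_map, List.map_map, List.filter_filter]
      refine congrArg₂ List.map rfl (List.filter_congr fun t ht => ?_)
      have := (hN' t ht).2.2
      by_cases h : t.2.2 = 0
      · simp [h]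
      · simp [h, show t.2.1 ≠ 0 by omega]
    have hmem : ∀ {c : A.Ob} {L : List A.HEl}, IsPath c L b →
        degs L = ((N.filter fun t => t.2.2 ≠ 0).map fun t => t.2.2).map (fun i : ℕ => (i : ℤ) - 1) →
        A.degen c ((N.filter fun t => t.2.1 ≠ 0).map fun t => (t.2.1, t.2.2)) (ten L) ∈
          A.lenSpan ((N.map fun t => (t.1, t.2.1)).filter fun q => q.2 ≠ 0).length := by
      intro c L hL hd
      have := shiftTen_le_lenSpan _ _ _ (A.degen_mem_shiftTen
        ((N.filter fun t => t.2.1 ≠ 0).map fun t => (t.2.1, t.2.2)) (fun q hq => by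
          obtain ⟨t, ht, rfl⟩ := mem_map.mp hq
          exact Nat.pos_of_ne_zero (by simpa using (List.mem_filter.mp ht).2))
        (by rw [hfil]; exact ten_mem_shiftTen hL hd))
      convert this using 2
      rw [filter_map, length_map, length_map, length_map]
      rfl
    by_cases hm : m = 0
    · subst hm
      obtain rfl : l = 0 := by omega
      rw [filter_cons_of_neg (by simp)] at hd ⊢
      rw [map_cons, map_cons]
      by_cases hn1 : n = 1
      · subst hn1
        rw [degen_unit, degen_unit, ih hN' L hL hd]
      · rw [degen_other _ _ _ _ hn.ne' (by omega), degen_other _ _ _ _ hn.ne' (by omega)]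
    · rw [filter_cons_of_pos (by simpa using hm), map_cons, map_cons, map_cons]
      by_cases hml : m = l
      · subst hml
        rw [filter_cons_of_pos (by simpa using hm), map_cons] at hd
        obtain ⟨h, L', rfl, h1, h2, h3⟩ := A.exists_cons_of_degs hL hd
        rw [degen_diag_ten _ _ _ _ _ _ (by
          rw [← length_map (f := Prod.snd), hfil]; exact length_of_degs h3)]
        by_cases hnm : n = m
        · subst hnm
          rw [degen_diag_mul _ _ _ _ _ (hmem h2 h3), ih hN' L' h2 h3, degen_diag_ten]
          have := length_of_degs h3
          rw [length_map] at this
          rw [this, filter_map, length_map]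
          rfl
        · rw [degen_other _ _ _ _ hnm (by omega), degen_other _ _ _ _ hnm (by omega)]
      · by_cases hml' : m = 1 ∧ l = 0
        · obtain ⟨rfl, rfl⟩ := hml'
          rw [filter_cons_of_neg (by simp)] at hd
          rw [degen_unit]
          by_cases hn1 : n = 1
          · subst hn1
            rw [degen_diag_mul _ _ _ _ _ (hmem hL hd), degen_unit]
            exact congrArg _ (ih hN' L hL hd)
          · rw [degen_other _ _ _ _ hn1 (by omega), degen_other _ _ _ _ hn.ne' (by omega)]
        · rw [degen_other _ _ _ _ hml hml', map_zero,
            degen_other _ _ _ _ (show n ≠ l by omega) (show ¬ (n = 1 ∧ l = 0) by omega)]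

end AInfCat

theorem length_nondeg_le (x : List (ℕ × ℕ)) : (nondeg x).length ≤ x.length := List.length_filter_le _ _

theorem nondeg_map_nondeg (φ : ℕ → ℕ) (x : List (ℕ × ℕ)) :
    nondeg ((nondeg x).map (Prod.map φ φ)) = nondeg (x.map (Prod.map φ φ)) := by
  rw [nondeg, nondeg, nondeg, filter_map, filter_map, List.filter_filter]
  refine congrArg (List.map _) (List.filter_congr fun e _ => ?_)
  by_cases h : e.1 = e.2
  · simp [h]
  · simp [h]

theorem nondegCode_map_nondegCode (φ : ℕ → ℕ) (W : Code) :
    nondegCode ((nondegCode W).map (List.map (Prod.map φ φ))) =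
      nondegCode (W.map (List.map (Prod.map φ φ))) := by
  induction W with
  | nil => rfl
  | cons w W ih =>
    have h : ∀ w V, nondegCode (w :: V) = nondegCode [w] ++ nondegCode V :=
      fun w V => nondegCode_append [w] V
    rw [h, map_append, nondegCode_append, ih, map_cons, h (w.map _)]
    refine congrArg (· ++ _) ?_
    by_cases h0 : nondeg w = []
    · have h1 : nondeg (w.map (Prod.map φ φ)) = [] := by
        rw [← nondeg_map_nondeg, h0]
        rfl
      simp [nondegCode, h0, h1]
    · have h2 : nondegCode [w] = [nondeg w] := by simp [nondegCode, h0]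
      rw [h2]
      simp only [nondegCode, map_cons, map_nil, nondeg_map_nondeg]

namespace AInfCat

variable (A : AInfCat K) {T T' T'' : Nec} {a b : A.Ob}

theorem degenAt_mem_shiftTen {Y : Code → A.Ten} {W : Code}
    (hW : ∀ w ∈ W, w ≠ []) (hY : Y (nondegCode W) ∈ A.shiftTen ((nondegCode W).map List.length) a b) :
    A.degenAt a Y W ∈ A.shiftTen (W.map List.length) a b := by
  have := A.degen_mem_shiftTen (codeDims W) (a := a) (b := b) (X := Y (nondegCode W))
    (fun q hq => by
      obtain ⟨w, hw, rfl⟩ := mem_map.mp hq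
      exact List.length_pos_of_ne_nil (hW w hw)) (by rwa [← map_length_nondegCode])
  rwa [codeDims, List.map_map] at this

theorem pull_mem_shiftTen (h : T ⟶ T') {y : NecSub T' → A.Ten}
    (hy : ∀ g, y g ∈ A.shiftTen g.dom.T.blocks a b) (g : NecSub T) :
    A.pull h a y g ∈ A.shiftTen g.dom.T.blocks a b := by
  rw [A.pull_eq, ← Nec.map_length_code (g.hom ≫ h)]
  exact A.degenAt_mem_shiftTen (fun w hw => ne_nil_of_mem_code hw) (NecSub.lift_mem hy _)

theorem pull_of_injective (i : T ⟶ T') (hi : Function.Injective i.toFun) {y : NecSub T' → A.Ten}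
    (hy : ∀ g, y g ∈ A.shiftTen g.dom.T.blocks a b) (g : NecSub T) :
    A.pull i a y g = y ⟨g.dom, g.hom ≫ i, hi.comp g.inj⟩ := by
  let g' : NecSub T' := ⟨g.dom, g.hom ≫ i, hi.comp g.inj⟩
  have h1 : ∀ x ∈ g'.code, nondeg x = x := fun x hx => g'.nondeg_of_mem_code hx
  have h2 : nondegCode g'.code = g'.code := by
    rw [nondegCode, map_congr_left h1, List.map_id', List.filter_eq_self]
    intro x hx
    simpa using ne_nil_of_mem_code hx
  have h3 : codeDims g'.code = g'.dom.T.blocks.map fun n => (n, n) := by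
    rw [← g'.map_length_code, List.map_map]
    exact map_congr_left fun x hx => by rw [h1 x hx]; rfl
  rw [A.pull_eq]
  change A.degenAt a _ g'.code = y g'
  rw [degenAt, h2, h3, lift_code]
  exact A.degen_diag _ (fun n hn => g'.dom.T.blocks_pos hn) (hy g')

theorem pull_comp (h : T ⟶ T') (h' : T' ⟶ T'') {y : NecSub T'' → A.Ten}
    (hy : ∀ g, y g ∈ A.shiftTen g.dom.T.blocks a b) :
    A.pull (h ≫ h') a y = A.pull h a (A.pull h' a y) := by
  funext g
  have hr : A.pull h a (A.pull h' a y) g = A.degen a (codeDims (Nec.code (g.hom ≫ h)))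
      (A.pull h' a y (ofMap (g.hom ≫ h))) :=
    congrArg (fun M => A.degen a M _) (Nec.beadDims_imageEpi _)
  have hcode : Nec.code ((ofMap (g.hom ≫ h)).hom ≫ h') =
      (nondegCode (Nec.code (g.hom ≫ h))).map
        (List.map (Prod.map h'.toEndHom.nat h'.toEndHom.nat)) :=
    (Nec.code_comp _ _).trans (congrArg _ (Nec.code_imageInc _))
  have hcode' : Nec.code (g.hom ≫ h ≫ h') = (Nec.code (g.hom ≫ h)).map
        (List.map (Prod.map h'.toEndHom.nat h'.toEndHom.nat)) :=
    Nec.code_comp (g.hom ≫ h) h'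
  rw [hr, A.pull_eq, A.pull_eq, degenAt, degenAt, hcode, hcode', nondegCode_map_nondegCode]
  set W := Nec.code (g.hom ≫ h) with hW
  set φ := h'.toEndHom.nat
  have key := A.degen_degen (a := a) (b := b) (W.map fun w =>
      (w.length, (nondeg w).length, (nondeg (w.map (Prod.map φ φ))).length))
    (X := NecSub.lift y (nondegCode (W.map (List.map (Prod.map φ φ))))) (fun t ht => by
      obtain ⟨w, hw, rfl⟩ := mem_map.mp ht
      refine ⟨List.length_pos_of_ne_nil (ne_nil_of_mem_code hw), length_nondeg_le w, ?_⟩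
      rw [← nondeg_map_nondeg]
      exact (length_nondeg_le _).trans (length_map _).le) (by
      have := NecSub.lift_mem hy (nondegCode (W.map (List.map (Prod.map φ φ))))
      rw [map_length_nondegCode, codeDims, List.map_map, filter_map, List.map_map] at this
      rw [filter_map, List.map_map]
      exact this)
  refine Eq.trans ?_ (key.symm.trans ?_)
  · rw [codeDims, List.map_map, List.map_map]
    exact congrArg (fun M => A.degen a M _) (map_congr_left fun w _ => by simp)
  · rw [List.map_map, filter_map, List.map_map]
    refine congrArg (fun M => A.degen a _ (A.degen a M _)) ?_
    rw [codeDims, List.map_map, nondegCode, filter_map, List.map_map]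
    have hf : (W.filter fun w => decide ((nondeg w).length ≠ 0)) =
        W.filter ((fun x => !x.isEmpty) ∘ nondeg) :=
      List.filter_congr fun w _ => by by_cases h0 : nondeg w = [] <;> simp [h0]
    refine Eq.trans (congrArg (List.map _) hf) (map_congr_left fun w _ => ?_)
    simp [nondeg_map_nondeg]

end AInfCat

section ListSums

variable {α M : Type*} [AddCommMonoid M]

theorem psum_add (f g : List α → α → List α → M) (L : List α) :
    psum (fun u x v => f u x v + g u x v) L = psum f L + psum g L := by
  induction L generalizing f g with
  | nil => exact (add_zero 0).symm
  | cons h t ih => rw [psum_cons, psum_cons, psum_cons, ih, add_add_add_comm]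

theorem csum_eq_single {f : List (List α) → M} {w : List α} (hw : w ≠ [])
    (h : ∀ S : List (List α), S.flatten = w → (∀ s ∈ S, s ≠ []) → 2 ≤ S.length → f S = 0) :
    csum f w = f [w] := by
  obtain ⟨e, t, rfl⟩ := List.exists_cons_of_ne_nil hw
  rw [csum_cons, dsum_eq_last]
  · rfl
  · intro u v huv hv
    refine csum_eq_zero fun S hS hne => h _ ?_ ?_ ?_
    · grind
    · grind
    · have : S ≠ [] := by
        rintro rfl
        exact hv hS.symm
      have := List.length_pos_of_ne_nil this
      simp only [length_cons]
      omega

theorem csum_psum_csum (h : List (List α) → List (List α) → List (List α) → M)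
    (h0 : ∀ X Z, h X [] Z = 0) (w : List α) :
    csum (fun S => psum (fun X x Z => csum (fun S₀ => h X S₀ Z) x) S) w =
      csum (fun S => dsum (fun X v => dsum (fun S₀ Z => h X S₀ Z) v) S) w := by
  let k : List (List α) → List (List α) → M := fun X v => match v with
    | [] => 0
    | x :: Z => csum (fun S₀ => h X S₀ Z) x
  have hk : ∀ S, psum (fun X x Z => csum (fun S₀ => h X S₀ Z) x) S = dsum k S := fun S => by
    rw [dsum_eq_psum]
    exact (add_zero _).symm
  simp only [hk]
  rw [csum_dsum, csum_dsum]
  refine dsum_congr fun u v _ => csum_congr fun P _ _ => ?_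
  rw [csum_dsum]
  cases v with
  | nil => exact (h0 P []).symm
  | cons e t =>
    rw [csum_cons, dsum_cons]
    have : csum (fun S₀ => csum (fun Z => h P S₀ Z) (e :: t)) [] = 0 := by
      change csum (fun Z => h P [] Z) (e :: t) = 0
      simp only [h0]
      exact csum_zero _
    rw [this, zero_add]
    exact dsum_congr fun u v _ => csum_comm _ _ _

theorem rsum_mem {R : Type*} [Ring R] {N : Type*} [AddCommGroup N] [Module R N] (V : Submodule R N)
    {f : List (List (List α)) → N} {X : List (List α)}
    (h : ∀ LL : List (List (List α)), LL.map List.flatten = X →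
      (∀ S ∈ LL, ∀ s ∈ S, s ≠ []) → f LL ∈ V) : rsum f X ∈ V := by
  rw [← Submodule.Quotient.mk_eq_zero, ← Submodule.mkQ_apply, lmap_rsum]
  refine Eq.trans (rsum_congr fun LL hLL hne => ?_) (lmap_rsum (0 : N →ₗ[R] N ⧸ V) f X).symm
  exact (Submodule.Quotient.mk_eq_zero V).mpr (h LL hLL hne)

end ListSums

theorem neg_dsum {α M : Type*} [AddCommGroup M] (f : List α → List α → M) (L : List α) :
    -dsum f L = dsum (fun u v => -f u v) L :=
  map_dsum (-AddMonoidHom.id M) f L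

section Faces

variable (K : Type*) [Field K] {M : Type*} [AddCommGroup M] [Module K M]

theorem beadFaces_nil (f : List (ℕ × ℕ) → M) : beadFaces K f [] = 0 := rfl

theorem beadFaces_singleton (f : List (ℕ × ℕ) → M) (e : ℕ × ℕ) : beadFaces K f [e] = 0 := by
  simp [beadFaces, psum]

theorem beadFaces_cons (f : List (ℕ × ℕ) → M) (e e' : ℕ × ℕ) (v : List (ℕ × ℕ)) :
    beadFaces K f (e :: e' :: v) =
      f ((e.1, e'.2) :: v) - beadFaces K (fun x => f (e :: x)) (e' :: v) := by
  rw [beadFaces, psum_cons, sub_eq_add_neg]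
  congr 1
  · simp [sgn]
  · rw [beadFaces, ← neg_one_smul K, ← psum_smul K]
    refine psum_congr fun u d v _ => ?_
    cases v with
    | nil => simp
    | cons d' v =>
      rw [smul_smul]
      simp only [length_cons, cons_append, Nat.cast_add, Nat.cast_one, sgn_add, sgn_one]
      rw [mul_comm]

theorem beadFaces_csum {α : Type*} (f : List (ℕ × ℕ) → List (List α) → M) (x : List (ℕ × ℕ)) (v : List α) :
    csum (fun S => beadFaces K (fun x' => f x' S) x) v =
      beadFaces K (fun x' => csum (f x') v) x := by
  cases x with
  | nil => exact csum_zero v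
  | cons e x =>
    induction x generalizing e f with
    | nil =>
      simp only [beadFaces_singleton]
      exact csum_zero v
    | cons e' x ih =>
      simp only [beadFaces_cons, sub_eq_add_neg]
      rw [csum_add, ← ih]
      congr 1
      exact (map_csum (-AddMonoidHom.id M) _ v).symm

theorem beadFaces_dsum (H : List (ℕ × ℕ) → List (ℕ × ℕ) → M) (w : List (ℕ × ℕ)) :
    beadFaces K (fun w' => dsum H w') w =
      dsum (fun a v => beadFaces K (fun x => H x v) a + sgn K a.length • beadFaces K (H a) v) w := by
  cases w with
  | nil => simp [dsum, beadFaces_nil]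
  | cons e w =>
    induction w generalizing e H with
    | nil => simp [dsum, beadFaces_nil, beadFaces_singleton]
    | cons e' v ih =>
      have hlin : beadFaces K (fun x => dsum H (e :: x)) (e' :: v) =
          beadFaces K (fun x => H [] (e :: x)) (e' :: v) +
            beadFaces K (fun x => dsum (fun u z => H (e :: u) z) x) (e' :: v) := by
        simp only [dsum_cons, beadFaces]
        rw [← psum_add]
        refine psum_congr fun u d z _ => ?_
        cases z with
        | nil => simp
        | cons d' z => exact smul_add _ _ _
      rw [beadFaces_cons, hlin, ih, dsum_cons, dsum_cons, dsum_cons, dsum_cons]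
      have key : dsum (fun a z => beadFaces K (fun x => H x z) (e :: e' :: a) +
            sgn K (e :: e' :: a).length • beadFaces K (H (e :: e' :: a)) z) v =
          dsum (fun a z => H ((e.1, e'.2) :: a) z) v - dsum (fun a z =>
            beadFaces K (fun x => H (e :: x) z) (e' :: a) +
            sgn K (e' :: a).length • beadFaces K (H (e :: e' :: a)) z) v := by
        rw [sub_eq_add_neg, neg_dsum, ← dsum_add]
        refine dsum_congr fun a z _ => ?_
        rw [beadFaces_cons]
        simp only [length_cons, Nat.cast_add, Nat.cast_one, sgn_add, sgn_one]
        module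
      rw [key, beadFaces_nil, beadFaces_nil, beadFaces_singleton, beadFaces_cons]
      simp only [List.length_nil, List.length_singleton, Nat.cast_zero, Nat.cast_one, sgn_one, sgn_zero]
      module

theorem csum_beadFaces (G : Code → M) (w : List (ℕ × ℕ)) :
    csum (fun S => psum (fun X x Z => sgn K X.flatten.length •
      beadFaces K (fun x' => G (X ++ x' :: Z)) x) S) w = beadFaces K (fun w' => csum G w') w := by
  induction hn : w.length using Nat.strong_induction_on generalizing w G with
  | _ n ih =>
    cases w with
    | nil => rfl
    | cons e t =>
      let H : List (ℕ × ℕ) → List (ℕ × ℕ) → M := fun x v => match x with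
        | [] => 0
        | x => csum (fun S => G (x :: S)) v
      have hH : beadFaces K (fun w' => csum G w') (e :: t) =
          beadFaces K (fun w' => dsum H w') (e :: t) := by
        refine psum_congr fun u d v _ => ?_
        cases v with
        | nil => rfl
        | cons d' v =>
          refine congrArg (_ • ·) ?_
          have : ∀ x y, csum G (x :: y) = dsum H (x :: y) := fun x y => by
            rw [csum_cons, dsum_cons]
            exact (zero_add _).symm
          cases u with
          | nil => exact this _ _
          | cons x y => exact this _ _
      have h0 : ∀ x, beadFaces K (H []) x = 0 := fun x => by
        cases x with
        | nil => rfl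
        | cons d x =>
          exact (map_beadFaces K (0 : M →ₗ[K] M) (H []) (d :: x)).symm
      rw [hH, beadFaces_dsum, dsum_cons, csum_cons, beadFaces_nil, h0, smul_zero, add_zero, zero_add]
      refine dsum_congr fun u v huv => ?_
      simp only [psum_cons]
      rw [csum_add]
      congr 1
      · simp only [List.flatten_nil, List.length_nil, Nat.cast_zero, sgn_zero, one_smul,
          nil_append]
        rw [beadFaces_csum K (fun x' S => G (x' :: S))]
        refine psum_congr fun u d v _ => ?_
        cases v with
        | nil => rfl
        | cons d' v =>
          refine congrArg (_ • ·) ?_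
          cases u with
          | nil => rfl
          | cons x y => rfl
      · have hlt : v.length < n := by
          rw [← hn, ← huv]
          simp
        change _ = _ • beadFaces K (fun w' => csum (fun S => G ((e :: u) :: S)) w') v
        rw [← ih _ hlt (fun S => G ((e :: u) :: S)) v rfl]
        refine Eq.trans (csum_congr fun S _ _ => ?_)
          (lmap_csum (LinearMap.lsmul K M (sgn K ((e :: u).length : ℤ))) _ v).symm
        rw [LinearMap.lsmul_apply, ← psum_smul K]
        refine psum_congr fun X x Z _ => ?_
        rw [smul_smul, ← sgn_add, flatten_cons, length_append, Nat.cast_add]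
        rfl

end Faces

open GradedQuiver

section Total

variable {Q R : GradedQuiver K}

theorem GradedQuiver.groupMap_mem_shiftTen {φ : Q.Ob → R.Ob} {F : Q.Ten →ₗ[K] R.Tot}
    (hF : HasHom φ (-1) F) (N : List (List ℕ)) {a b : Q.Ob} {X : Q.Ten}
    (hX : X ∈ Q.shiftTen N.flatten a b) :
    groupMap F (N.map List.length) X ∈ R.shiftTen (N.map List.sum) (φ a) (φ b) := by
  refine shiftTen_induction
    (P := fun X => groupMap F (N.map List.length) X ∈ R.shiftTen (N.map List.sum) (φ a) (φ b)) hX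
    (fun L hL hd => ?_) (by rw [map_zero]; exact Submodule.zero_mem _)
    (fun X Y hX hY => by rw [map_add]; exact Submodule.add_mem _ hX hY)
    (fun c X hX => by rw [map_smul]; exact Submodule.smul_mem _ c hX)
  clear hX
  induction N generalizing a L with
  | nil =>
    obtain rfl : L = [] := by simpa [degs] using hd
    have h : groupMap F (([] : List (List ℕ)).map List.length) (ten []) = ten [] :=
      (congrArg (algebraMap K R.Ten) (map_one Q.aug)).trans (map_one _)
    rw [h]
    exact ten_mem_shiftTen (congrArg φ hL) rfl
  | cons n N ih =>
    rw [flatten_cons] at hd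
    obtain ⟨L₁, L₂, rfl, hd₁, hd₂⟩ := mem_shiftTen_append hd
    obtain ⟨c, hL₁, hL₂⟩ := isPath_append.mp hL
    have h : groupMap F ((n :: N).map List.length) (ten (L₁ ++ L₂)) =
        ι K (F (ten L₁)) * groupMap F (N.map List.length) (ten L₂) :=
      tens_append _ _ _ _ _ _ (length_of_degs hd₁) ((length_of_degs hd₂).trans length_flatten)
    obtain ⟨y, hy, hFy⟩ := hF.exists_tot hL₁
    rw [h, hFy, ← ten_singleton]
    have hs : sdeg L₁ = n.sum := by
      rw [sdeg, hd₁, length_of_degs hd₁]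
      clear h hd hd₁
      induction n with
      | nil => rfl
      | cons i n ih => simp at ih ⊢; omega
    have h1 : ten [y] ∈ R.shiftTen [n.sum] (φ a) (φ c) := ten_mem_shiftTen
      ⟨by rw [hy], by rw [hy]; rfl⟩ (by simp only [degs, map_cons, map_nil, hy, hs]; rfl)
    exact (mul_mem_shiftTen h1 (ih L₂ hL₂ hd₂) :
      _ ∈ R.shiftTen ([n.sum] ++ N.map List.sum) (φ a) (φ b))

theorem GradedQuiver.coMap_eq_csum {α : Type*} (F : Q.Ten →ₗ[K] R.Tot) (S : List α) {X : Q.Ten}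
    (hX : X ∈ Q.lenSpan S.length) :
    coMap F X = csum (fun LL => groupMap F (LL.map List.length) X) S := by
  refine lenSpan_induction (P := fun X => coMap F X =
    csum (fun LL => groupMap F (LL.map List.length) X) S) hX (fun L hL => ?_) ?_ ?_ ?_
  · rw [coMap, byLen_ten, hL, LinearMap.sum_apply]
    exact sum_composition_length (fun n => groupMap F n (ten L)) S rfl
  · simp only [map_zero, csum_zero]
  · intro X Y hX hY
    simp only [map_add, csum_add, hX, hY]
  · intro c X hX
    simp only [map_smul, hX]
    exact lmap_csum (LinearMap.lsmul K R.Ten c) _ S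

theorem GradedQuiver.groupMap_singleton (F : Q.Ten →ₗ[K] R.Tot) {k : ℕ} {X : Q.Ten}
    (hX : X ∈ Q.lenSpan k) : groupMap F [k] X = ι K (F X) := by
  refine eqOn_lenSpan (β := ι K ∘ₗ F) hX fun L hL => ?_
  have := groupMap_flatten F [L]
  simpa [hL] using this

theorem AInfCat.midB_zero_zero (A : AInfCat K) {k : ℕ} {X : A.Ten} (hX : X ∈ A.lenSpan k) :
    A.midB 0 k 0 X = ι K (A.b X) := by
  refine eqOn_lenSpan (β := ι K ∘ₗ A.b) hX fun L hL => ?_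
  have := A.midB_ten [] L [] (r := 0) (t := 0) rfl hL rfl
  simpa using this

theorem AInfCat.coDer_eq_dsum {α : Type*} (A : AInfCat K) (S : List (List α)) {a b : A.Ob} {X : A.Ten}
    (hX : X ∈ A.shiftTen (S.map List.length) a b) :
    coDer A.b X = dsum (fun u v => dsum (fun p q => sgn K u.flatten.length •
      A.midB u.length p.length q.length X) v) S := by
  have key : coDer A.b X = dsum (fun u v => dsum (fun p q => sgn K (u.sum : ℕ) •
      A.midB u.length p.length q.length X) v) (S.map List.length) := by
    refine shiftTen_induction (P := fun X => coDer A.b X = dsum (fun u v => dsum (fun p q =>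
      sgn K (u.sum : ℕ) • A.midB u.length p.length q.length X) v) (S.map List.length)) hX
      (fun L hL hd => ?_) ?_ ?_ ?_
    · have hN : S.map List.length = L.map fun h => (h.1.2.2 + 1).toNat := by
        have := congrArg (List.map fun d : ℤ => (d + 1).toNat) hd
        rw [List.map_map, degs, List.map_map] at this
        refine Eq.trans ?_ this.symm
        simp
      have hpos : ∀ h ∈ L, 0 ≤ h.1.2.2 + 1 := fun h hh => by
        have : h.1.2.2 ∈ degs L := mem_map.mpr ⟨h, hh, rfl⟩
        grind
      rw [hN, dsum_map, coDer_ten]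
      refine dsum_congr fun u v huv => ?_
      rw [dsum_map]
      refine dsum_congr fun p q hpq => ?_
      have hu : sdeg u = ((u.map fun h => (h.1.2.2 + 1).toNat).sum : ℕ) := by
        have hpu : ∀ h ∈ u, 0 ≤ h.1.2.2 + 1 := fun h hh =>
          hpos h (huv ▸ List.mem_append_left _ hh)
        clear huv
        induction u with
        | nil => rfl
        | cons h u ih =>
          rw [sdeg_cons, ih fun h' hh => hpu h' (List.mem_cons_of_mem _ hh), map_cons,
            sum_cons, Nat.cast_add, Int.toNat_of_nonneg (hpu h List.mem_cons_self)]
      rw [← hu, ← huv, ← hpq, A.midB_ten u p q (length_map _).symm (length_map _).symm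
        (length_map _).symm, smul_mul_assoc]
    · simp only [map_zero, smul_zero, dsum_zero]
    · intro X Y hX hY
      simp only [map_add, smul_add, dsum_add, hX, hY]
    · intro c X hX
      simp only [map_smul, hX]
      rw [← dsum_smul]
      refine dsum_congr fun u v _ => ?_
      rw [← dsum_smul]
      exact dsum_congr fun p q _ => smul_comm _ _ _
  rw [key, dsum_map]
  refine dsum_congr fun u v _ => ?_
  rw [dsum_map]
  refine dsum_congr fun p q _ => ?_
  rw [← length_flatten, length_map, length_map, length_map]

theorem GradedQuiver.shiftSign_of_mem {N : List ℕ} {a b : Q.Ob} {X : Q.Ten}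
    (hX : X ∈ Q.shiftTen N a b) :
    Q.shiftSign X = sgn K (shiftExp (N.map fun i : ℕ => (i : ℤ) - 1)) • X :=
  eqOn_shiftTen (β := sgn K (shiftExp (N.map fun i : ℕ => (i : ℤ) - 1)) • LinearMap.id)
    (fun L _ hd => by rw [shiftSign_ten, hd]; rfl) hX

/-- Passing from the signs of the (TAN) relation to those of a coderivation. -/
theorem GradedQuiver.psum_sgn_eq {α : Type*} {S : List (List α)} (hS : ∀ s ∈ S, s ≠ []) {a b : Q.Ob}
    {f g : List (List α) → List α → List (List α) → Q.Ten}
    (hf : ∀ X x Z, X ++ x :: Z = S →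
      f X x Z ∈ Q.shiftTen (X.map List.length ++ (x.length - 1) :: Z.map List.length) a b)
    (hg : ∀ X x Z, X ++ x :: Z = S →
      g X x Z ∈ Q.shiftTen (X.map List.length ++ (x.length - 1) :: Z.map List.length) a b)
    (h : psum (fun X x Z => sgn K (codeDim X) • f X x Z) S =
      psum (fun X x Z => sgn K (codeDim X) • g X x Z) S) :
    psum (fun X x Z => sgn K X.flatten.length • f X x Z) S =
      psum (fun X x Z => sgn K X.flatten.length • g X x Z) S := by
  have key : ∀ f : List (List α) → List α → List (List α) → Q.Ten, (∀ X x Z, X ++ x :: Z = S →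
      f X x Z ∈ Q.shiftTen (X.map List.length ++ (x.length - 1) :: Z.map List.length) a b) →
      Q.shiftSign (psum (fun X x Z => sgn K (codeDim X) • f X x Z) S) =
        sgn K (shiftExp ((S.map List.length).map fun i : ℕ => (i : ℤ) - 1) + S.length - 1) •
          psum (fun X x Z => sgn K X.flatten.length • f X x Z) S := by
    intro f hf
    rw [lmap_psum, ← psum_smul K]
    refine psum_congr fun X x Z hX => ?_
    rw [map_smul, shiftSign_of_mem (hf X x Z hX), smul_smul, smul_smul, ← sgn_add, ← sgn_add]
    refine congrArg (· • _) (sgn_congr ⟨-(X.length + Z.length : ℤ), ?_⟩)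
    have hx : 0 < x.length := List.length_pos_of_ne_nil (hS x (by rw [← hX]; simp))
    have hX' : (codeDim X : ℤ) + X.length = X.flatten.length := by
      have := sum_pred_add_length X fun s hs => hS s (by rw [← hX]; simp [hs])
      rw [List.map_map] at this
      exact_mod_cast this
    rw [← hX', ← hX]
    simp only [map_append, map_cons, shiftExp_append, shiftExp, length_map,
      length_cons, length_append, List.map_map]
    push_cast [Nat.cast_sub hx]
    ring
  have h1 := key f hf
  rw [h, key g hg] at h1
  exact ((sgn_smul_cancel _).mp h1).symm

end Total

open GradedQuiver

section Push

variable {A B C : AInfCat K} {T : Nec} {a b : A.Ob} {y : NecSub T → A.Ten}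

theorem AInfCat.midB_mem_shiftTen {N₁ N₂ N₃ : List ℕ} {r s t : ℕ} (h₁ : N₁.length = r)
    (h₂ : N₂.length = s) (h₃ : N₃.length = t) (hpos : 0 < N₂.sum) {X : A.Ten}
    (hX : X ∈ A.shiftTen (N₁ ++ (N₂ ++ N₃)) a b) :
    A.midB r s t X ∈ A.shiftTen (N₁ ++ (N₂.sum - 1) :: N₃) a b := by
  refine shiftTen_induction (P := fun X => A.midB r s t X ∈ A.shiftTen (N₁ ++ (N₂.sum - 1) :: N₃) a b)
    hX (fun L hL hd => ?_) (by rw [map_zero]; exact Submodule.zero_mem _)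
    (fun X Y hX hY => by rw [map_add]; exact Submodule.add_mem _ hX hY)
    (fun c X hX => by rw [map_smul]; exact Submodule.smul_mem _ c hX)
  obtain ⟨L₁, L', rfl, hd₁, hd'⟩ := mem_shiftTen_append hd
  obtain ⟨L₂, L₃, rfl, hd₂, hd₃⟩ := mem_shiftTen_append hd'
  obtain ⟨c, hL₁, hL'⟩ := isPath_append.mp hL
  obtain ⟨c', hL₂, hL₃⟩ := isPath_append.mp hL'
  obtain ⟨h, hh, hb⟩ := A.exists_midB_ten hL₂
  rw [hb L₁ L₃ r s t ((length_of_degs hd₁).trans h₁) ((length_of_degs hd₂).trans h₂)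
    ((length_of_degs hd₃).trans h₃)]
  refine ten_mem_shiftTen (isPath_append.mpr ⟨c, hL₁, by rw [hh], by rw [hh]; exact hL₃⟩) ?_
  have hs : (degs L₂).sum + L₂.length = N₂.sum := by
    rw [hd₂, length_of_degs hd₂]
    clear hX hpos hd hd' hd₂ h₂
    induction N₂ with
    | nil => rfl
    | cons i n ih => simp at ih ⊢; omega
  have e1 : degs (L₁ ++ h :: L₃) = degs L₁ ++ h.1.2.2 :: degs L₃ := by simp [degs]
  grind

theorem csum_mem {α R N : Type*} [Ring R] [AddCommGroup N] [Module R N] (V : Submodule R N)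
    {f : List (List α) → N} {w : List α}
    (h : ∀ S : List (List α), S.flatten = w → (∀ s ∈ S, s ≠ []) → f S ∈ V) : csum f w ∈ V := by
  rw [← Submodule.Quotient.mk_eq_zero, ← Submodule.mkQ_apply, lmap_csum]
  exact csum_eq_zero fun S hS hne => (Submodule.Quotient.mk_eq_zero V).mpr (h S hS hne)

theorem psum_mem {α R N : Type*} [Ring R] [AddCommGroup N] [Module R N] (V : Submodule R N)
    {f : List α → α → List α → N} {w : List α}
    (h : ∀ u x v, u ++ x :: v = w → f u x v ∈ V) : psum f w ∈ V := by
  rw [← Submodule.Quotient.mk_eq_zero, ← Submodule.mkQ_apply, lmap_psum]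
  exact psum_eq_zero fun u x v hw => (Submodule.Quotient.mk_eq_zero V).mpr (h u x v hw)

/-- The coderivation of `A`, on the sum of the values of a member of the nerve at all the codes that
refine a single bead. -/
theorem AInfCat.coDer_csum (hy : y ∈ A.nerve T a b) {g : NecSub T} {w : List (ℕ × ℕ)}
    (hw : g.code = [w]) :
    coDer A.b (csum (NecSub.lift y) w) = beadFaces K (fun w' => csum (NecSub.lift y) w') w := by
  rw [lmap_csum]
  have hmem : ∀ W, NecSub.lift y W ∈ A.shiftTen (W.map List.length) a b := NecSub.lift_mem hy.1
  have h0 : A.b 1 = 0 := A.b_hasHom.one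
  refine Eq.trans (csum_congr (g := fun S => dsum (fun X v => dsum (fun S₀ Z =>
      if S₀ = [] then 0 else sgn K X.flatten.length •
        A.midB X.length S₀.length Z.length (NecSub.lift y (X ++ (S₀ ++ Z)))) v) S) fun S _ _ => ?_) ?_
  · rw [A.coDer_eq_dsum S (hmem S)]
    refine dsum_congr fun X v hX => dsum_congr fun S₀ Z hv => ?_
    rw [hv, hX]
    split_ifs with h
    · subst h
      have : A.midB X.length 0 Z.length (NecSub.lift y S) = 0 := by
        refine eqOn_lenSpan (β := 0) (lift_mem_lenSpan hy.1 S) fun L hL => ?_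
        have hl : L.length = X.length + Z.length := by
          rw [hL, ← hX, ← hv]; simp
        have := A.midB_ten (L.take X.length) [] (L.drop X.length) (r := X.length) (s := 0)
          (t := Z.length) (by simp [hl]) rfl (by simp [hl])
        simp_all
      rw [List.length_nil, this, smul_zero]
    · rfl
  · rw [← csum_psum_csum _ (fun _ _ => if_pos rfl), ← csum_beadFaces]
    refine csum_congr fun S hS hne => ?_
    obtain ⟨g', hg'⟩ := g.exists_code_split (X := []) (Z := []) hw.symm hS hne
    rw [nil_append, List.append_nil] at hg'
    have htan := (A.tan_iff hy.1 g').mp (hy.2 g')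
    rw [hg'] at htan
    refine Eq.trans (psum_congr (g := fun X x Z => sgn K X.flatten.length • csum (fun S₀ =>
      A.midB X.length S₀.length Z.length (NecSub.lift y (X ++ (S₀ ++ Z)))) x) fun X x Z hX => ?_) ?_
    · refine Eq.trans (csum_congr fun S₀ hS₀ _ => if_neg ?_)
        (lmap_csum (LinearMap.lsmul K A.Ten (sgn K (X.flatten.length : ℤ))) _ x).symm
      rintro rfl
      exact hne x (by rw [← hX]; simp) hS₀.symm
    · refine psum_sgn_eq hne (a := a) (b := b) (fun X x Z hX => ?_) (fun X x Z hX => ?_) ?_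
      · refine csum_mem _ fun S₀ hS₀ _ => ?_
        have hs : (S₀.map List.length).sum = x.length := by rw [← length_flatten, hS₀]
        rw [← hs]
        refine midB_mem_shiftTen (length_map _) (length_map _) (length_map _) ?_ ?_
        · rw [hs]
          exact List.length_pos_of_ne_nil (hne x (by rw [← hX]; simp))
        · have := hmem (X ++ (S₀ ++ Z))
          rwa [map_append, map_append] at this
      · refine psum_mem _ fun u e v hx => ?_
        cases v with
        | nil => exact Submodule.zero_mem _
        | cons e' v =>
          refine Submodule.smul_mem _ _ ?_
          have := hmem (X ++ (u ++ (e.1, e'.2) :: v) :: Z)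
          rw [map_append, map_cons] at this
          rwa [← hx, show (u ++ e :: e' :: v).length - 1 = (u ++ (e.1, e'.2) :: v).length by simp]
      · refine Eq.trans (psum_congr fun X x Z _ => ?_) htan
        exact lmap_csum (LinearMap.lsmul K A.Ten (sgn K (codeDim X : ℤ))) _ x

namespace AInfFunctor

variable (f : AInfFunctor A B)

theorem push_mem_shiftTen (hy : ∀ g, y g ∈ A.shiftTen g.dom.T.blocks a b) (g : NecSub T) :
    f.push y g ∈ B.shiftTen g.dom.T.blocks (f.obj a) (f.obj b) := by
  rw [f.push_eq hy]
  refine rsum_mem _ fun LL hLL _ => ?_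
  have hN : (LL.map (List.map List.length)).flatten = LL.flatten.map List.length :=
    List.map_flatten.symm
  have := groupMap_mem_shiftTen f.tw_hasHom (LL.map (List.map List.length)) (a := a) (b := b)
    (X := NecSub.lift y LL.flatten) (by rw [hN]; exact NecSub.lift_mem hy _)
  rw [List.map_map, List.map_map] at this
  have h1 : LL.map (List.length ∘ List.map List.length) = LL.map List.length :=
    map_congr_left fun S _ => length_map _
  have h2 : LL.map (List.sum ∘ List.map List.length) = LL.map (List.length ∘ List.flatten) :=
    map_congr_left fun S _ => length_flatten.symm
  rwa [h1, h2, ← List.map_map, hLL, g.map_length_code] at this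

theorem push_eq_of_bead (hy : ∀ g, y g ∈ A.shiftTen g.dom.T.blocks a b) {g : NecSub T}
    {w : List (ℕ × ℕ)} (hw : g.code = [w]) :
    f.push y g = ι K (f.tw (csum (NecSub.lift y) w)) := by
  rw [f.push_eq hy, hw, rsum_singleton, ← LinearMap.comp_apply, lmap_csum]
  refine csum_congr fun S _ _ => ?_
  rw [List.flatten_singleton]
  exact groupMap_singleton _ (lift_mem_lenSpan hy S)

theorem push_eq_of_nil (hy : ∀ g, y g ∈ A.shiftTen g.dom.T.blocks a b) {g : NecSub T}
    (hw : g.code = []) : f.push y g = algebraMap K B.Ten (A.aug (y g)) := by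
  rw [f.push_eq hy, hw, ← lift_code y g, hw]
  rfl

theorem csum_push (hy : ∀ g, y g ∈ A.shiftTen g.dom.T.blocks a b) {g : NecSub T}
    {w : List (ℕ × ℕ)} (hw : g.code = [w]) :
    csum (NecSub.lift (f.push y)) w = coMap f.tw (csum (NecSub.lift y) w) := by
  rw [lmap_csum]
  refine Eq.trans (csum_congr (g := fun S => rsum (fun LL =>
    groupMap f.tw (LL.map List.length) (NecSub.lift y LL.flatten)) S) fun S hS hne => ?_)
    ((csum_rsum _ w).trans (csum_congr fun S hS hne => ?_))
  · obtain ⟨g', hg'⟩ := g.exists_code_split (X := []) (Z := []) hw.symm hS hne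
    rw [nil_append, List.append_nil] at hg'
    rw [NecSub.lift_eq _ hg', f.push_eq hy, hg']
  · rw [coMap_eq_csum _ S (lift_mem_lenSpan hy S)]
    exact csum_congr fun LL hLL _ => by rw [hLL]

end AInfFunctor

theorem Nec.code_refl_simplex {n : ℕ} (hn : 0 < n) :
    ∃ w, (NecSub.refl (simplex n)).code = [w] := by
  have h : (NecSub.refl (simplex n)).code.map List.length = [n] :=
    (NecSub.map_length_code _).trans (blocks_oneBead_pos hn)
  match hc : (NecSub.refl (simplex n)).code with
  | [] => simp [hc] at h
  | [w] => exact ⟨w, rfl⟩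
  | _ :: _ :: _ => simp [hc] at h

theorem Nec.code_refl_simplex_zero : (NecSub.refl (simplex 0)).code = [] := by
  have h : (NecSub.refl (simplex 0)).code.map List.length = [] :=
    (NecSub.map_length_code _).trans blocks_oneBead_zero
  exact List.map_eq_nil_iff.mp h

theorem NecSub.refl_wedge (T₁ T₂ : Nec) :
    refl (T₁.wedge T₂) = wedge (refl T₁) (refl T₂) := by
  have h : 𝟙 (T₁.wedge T₂) = wedgeMap (𝟙 T₁) (𝟙 T₂) := Nec.hom_ext fun i hi => by
    refine Eq.trans (nat_id _ i) (Eq.trans ?_ (nat_add (EndHom.id T₁.p)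
      (EndHom.id T₂.p) i).symm)
    have hi' : i ≤ T₁.p + T₂.p := hi
    rw [nat_id, nat_id]
    grind
  simp only [refl, wedge, h]

theorem AInfCat.tan_add {x y : NecSub T → A.Ten} {g : NecSub T} (hx : A.TAN x g) (hy : A.TAN y g) :
    A.TAN (x + y) g := by
  unfold AInfCat.TAN at hx hy ⊢
  simp only [Pi.add_apply, map_add, smul_add, Finset.sum_add_distrib, hx, hy]

theorem AInfCat.tan_restrict (g : NecSub T) : A.TAN (g.restrict y) (NecSub.refl _) ↔ A.TAN y g := Iff.rfl

theorem AInfCat.tan_zero (g : NecSub T) : A.TAN (0 : NecSub T → A.Ten) g := by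
  unfold AInfCat.TAN
  simp

theorem AInfCat.tan_iff_of_bead {y : NecSub T → A.Ten} (hy : ∀ g, y g ∈ A.shiftTen g.dom.T.blocks a b)
    {g : NecSub T} {w : List (ℕ × ℕ)} (hw : g.code = [w]) :
    A.TAN y g ↔ ι K (A.b (csum (NecSub.lift y) w)) =
      beadFaces K (fun x => NecSub.lift y [x]) w := by
  have h1 : A.barD (NecSub.lift y) [w] = ι K (A.b (csum (NecSub.lift y) w)) := by
    rw [barD, psum_cons, ← LinearMap.comp_apply, lmap_csum]
    refine (add_zero _).trans (csum_congr fun S _ _ => ?_)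
    rw [nil_append, List.append_nil]
    refine Eq.trans ?_ (A.midB_zero_zero (lift_mem_lenSpan hy S))
    simp [codeDim]
  have h2 : codeFaces K (NecSub.lift y) [w] = beadFaces K (fun x => NecSub.lift y [x]) w := by
    rw [codeFaces, psum_cons]
    refine (add_zero _).trans ?_
    simp
  rw [A.tan_iff hy, hw, h1, h2]

namespace AInfFunctor

variable (f : AInfFunctor A B)

theorem push_add (x y : NecSub T → A.Ten) : f.push (x + y) = f.push x + f.push y := by
  funext g
  simp only [push, Pi.add_apply, map_add, smul_add, Finset.sum_add_distrib]

theorem push_zero : f.push (0 : NecSub T → A.Ten) = 0 := by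
  funext g
  simp only [push, Pi.zero_apply, map_zero, smul_zero, Finset.sum_const_zero]

theorem push_restrict (g : NecSub T) : f.push (g.restrict y) = g.restrict (f.push y) := rfl

theorem tan_push_bead (hy : y ∈ A.nerve T a b) {g : NecSub T} {w : List (ℕ × ℕ)} (hw : g.code = [w]) :
    B.TAN (f.push y) g := by
  have hp := f.push_mem_shiftTen hy.1
  rw [AInfCat.tan_iff_of_bead hp hw]
  have h2 : B.b (coMap f.tw (csum (NecSub.lift y) w)) = f.tw (coDer A.b (csum (NecSub.lift y) w)) := by
    rw [lmap_csum, lmap_csum, lmap_csum, lmap_csum]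
    exact csum_congr fun S _ _ => eqOn_shiftTen (α := B.b ∘ₗ coMap f.tw) (β := f.tw ∘ₗ coDer A.b)
      (fun L hL _ => f.isTw.rel _ _ _ hL) (NecSub.lift_mem hy.1 S)
  rw [f.csum_push hy.1 hw, h2, A.coDer_csum hy hw, ← LinearMap.comp_apply, map_beadFaces]
  refine beadFaces_congr K fun u e e' v h => ?_
  obtain ⟨g', hg'⟩ := g.exists_code_face (X := []) (Z := []) (u := u) (e := e) (e' := e') (v := v)
    (by rw [hw, h]; rfl)
  rw [nil_append] at hg'
  rw [NecSub.lift_eq _ hg', f.push_eq_of_bead hy.1 hg']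
  rfl

theorem push_mem_nerve (hy : y ∈ A.nerve T a b) : f.push y ∈ B.nerve T (f.obj a) (f.obj b) := by
  refine ⟨f.push_mem_shiftTen hy.1, fun g => ?_⟩
  rw [← AInfCat.tan_restrict, ← push_restrict]
  refine AInfCat.nerve_induction (P := fun T _ _ y => B.TAN (f.push y) (NecSub.refl T)) ?_ ?_ ?_ ?_
    (AInfCat.restrict_mem_nerve g hy)
  · intro T a b
    rw [push_zero]
    exact AInfCat.tan_zero _
  · intro T a b x y _ _ hx hy
    rw [push_add]
    exact AInfCat.tan_add hx hy
  · intro n a b y hy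
    obtain rfl | hn := Nat.eq_zero_or_pos n
    · rw [B.tan_iff (f.push_mem_shiftTen hy.1), Nec.code_refl_simplex_zero]
      rfl
    · obtain ⟨w, hw⟩ := Nec.code_refl_simplex hn
      exact f.tan_push_bead hy hw
  · intro T₁ T₂ a b c x hx y hy z hz hxy h₁ h₂
    rw [NecSub.refl_wedge]
    exact tan_wedge (f.push_mem_shiftTen hx.1) (f.push_mem_shiftTen hy.1)
      (push_wedge f hx.1 hy.1 hxy) h₁ h₂

/-- Equality of two additive and multiplicative operations on members of nerves that commute with
restrictions. -/
theorem eq_of_nerve {D : AInfCat K} {φ ψ : ∀ {T : Nec}, (NecSub T → A.Ten) → (NecSub T → D.Ten)}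
    (hφ : ∀ {T : Nec} (x y : NecSub T → A.Ten), φ (x + y) = φ x + φ y)
    (hψ : ∀ {T : Nec} (x y : NecSub T → A.Ten), ψ (x + y) = ψ x + ψ y)
    (hφr : ∀ {T : Nec} (g : NecSub T) (y : NecSub T → A.Ten), φ (g.restrict y) (NecSub.refl _) = φ y g)
    (hψr : ∀ {T : Nec} (g : NecSub T) (y : NecSub T → A.Ten), ψ (g.restrict y) (NecSub.refl _) = ψ y g)
    (hs : ∀ n a b, ∀ y ∈ A.nerve (.simplex n) a b, φ y (NecSub.refl _) = ψ y (NecSub.refl _))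
    (hφm : ∀ {T₁ T₂ a b c}, ∀ x ∈ A.nerve T₁ a c, ∀ y ∈ A.nerve T₂ c b,
      ∀ z ∈ A.nerve (T₁.wedge T₂) a b, (∀ g₁ g₂, z (wedge g₁ g₂) = x g₁ * y g₂) →
      ∀ g₁ g₂, φ z (wedge g₁ g₂) = φ x g₁ * φ y g₂)
    (hψm : ∀ {T₁ T₂ a b c}, ∀ x ∈ A.nerve T₁ a c, ∀ y ∈ A.nerve T₂ c b,
      ∀ z ∈ A.nerve (T₁.wedge T₂) a b, (∀ g₁ g₂, z (wedge g₁ g₂) = x g₁ * y g₂) →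
      ∀ g₁ g₂, ψ z (wedge g₁ g₂) = ψ x g₁ * ψ y g₂)
    (hy : y ∈ A.nerve T a b) : φ y = ψ y := by
  funext g
  rw [← hφr, ← hψr]
  refine AInfCat.nerve_induction
    (P := fun T _ _ y => φ y (NecSub.refl T) = ψ y (NecSub.refl T)) ?_ ?_ hs ?_
    (AInfCat.restrict_mem_nerve g hy)
  · intro T a b
    have h1 : φ (0 : NecSub T → A.Ten) = 0 := by simpa using hφ (0 : NecSub T → A.Ten) 0
    have h2 : ψ (0 : NecSub T → A.Ten) = 0 := by simpa using hψ (0 : NecSub T → A.Ten) 0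
    rw [h1, h2]
  · intro T a b x y _ _ hx hy
    rw [hφ, hψ, Pi.add_apply, Pi.add_apply, hx, hy]
  · intro T₁ T₂ a b c x hx y hy z hz hxy h₁ h₂
    rw [NecSub.refl_wedge, hφm x hx y hy z hz hxy, hψm x hx y hy z hz hxy, h₁, h₂]

theorem push_id (hy : y ∈ A.nerve T a b) : (id A).push y = y := by
  refine eq_of_nerve (φ := fun y => (id A).push y) (ψ := fun y => y) (fun x y => push_add _ x y)
    (fun x y => rfl) (fun g y => rfl) (fun g y => rfl) (fun n a b y hy => ?_)
    (fun x hx y hy z hz hxy => push_wedge _ hx.1 hy.1 hxy) (fun x hx y hy z hz hxy => hxy) hy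
  obtain rfl | hn := Nat.eq_zero_or_pos n
  · rw [push_eq_of_nil _ hy.1 Nec.code_refl_simplex_zero]
    refine algebraMap_aug_of_mem (a := a) (b := b) ?_
    rw [← show (NecSub.refl (simplex 0)).dom.T.blocks = [] from Nec.blocks_oneBead_zero]
    exact hy.1 _
  · obtain ⟨w, hw⟩ := Nec.code_refl_simplex hn
    have hw0 : w ≠ [] := ne_nil_of_mem_code (h := (NecSub.refl (simplex n)).hom)
      (hw ▸ List.mem_singleton_self w :)
    have hl := lift_mem_lenSpan hy.1
    rw [push_eq_of_bead _ hy.1 hw, id_tw, ← LinearMap.comp_apply, lmap_csum, csum_eq_single hw0]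
    · rw [← lift_code y, hw]
      refine eqOn_lenSpan (β := LinearMap.id) (hl [w]) fun L hL => ?_
      obtain ⟨h, rfl⟩ := List.length_eq_one_iff.mp hL
      rw [LinearMap.comp_apply, ιInv_ten_cons, ten_nil, map_one, one_smul, ten_singleton]
      rfl
    · intro S _ _ hS
      refine eqOn_lenSpan (β := 0) (hl S) fun L hL => ?_
      match L, hL with
      | [], hL => simp at hL; omega
      | [_], hL => simp at hL; omega
      | h :: h' :: L, _ =>
        rw [LinearMap.comp_apply, ιInv_ten_cons, aug_ten_cons, zero_smul, map_zero]
        rfl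

theorem push_comp (g : AInfFunctor B C) (hy : y ∈ A.nerve T a b) :
    (comp f g).push y = g.push (f.push y) := by
  refine eq_of_nerve (φ := fun y => (comp f g).push y) (ψ := fun y => g.push (f.push y))
    (fun x y => push_add _ x y) (fun x y => by rw [push_add, push_add]) (fun g y => rfl)
    (fun g y => rfl) (fun n a b y hy => ?_)
    (fun x hx y hy z hz hxy => push_wedge _ hx.1 hy.1 hxy)
    (fun x hx y hy z hz hxy => push_wedge g (f.push_mem_shiftTen hx.1) (f.push_mem_shiftTen hy.1)
      (push_wedge f hx.1 hy.1 hxy)) hy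
  obtain rfl | hn := Nat.eq_zero_or_pos n
  · rw [push_eq_of_nil _ hy.1 Nec.code_refl_simplex_zero,
      push_eq_of_nil _ (f.push_mem_shiftTen hy.1) Nec.code_refl_simplex_zero,
      push_eq_of_nil _ hy.1 Nec.code_refl_simplex_zero]
    simp
  · obtain ⟨w, hw⟩ := Nec.code_refl_simplex hn
    rw [push_eq_of_bead _ hy.1 hw, push_eq_of_bead _ (f.push_mem_shiftTen hy.1) hw,
      f.csum_push hy.1 hw, comp_tw]
    refine congrArg _ ?_
    rw [lmap_csum, lmap_csum, lmap_csum]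
    exact csum_congr fun S _ _ => eqOn_shiftTen (β := g.tw ∘ₗ coMap f.tw)
      (fun L hL _ => IsTw.compTw_path _ _ hL) (NecSub.lift_mem hy.1 S)

end AInfFunctor

end Push

open GradedQuiver

section ListSums

variable {α M : Type*} [AddCommMonoid M]

theorem dsum_eq_of_append {f : List α → List α → M} (t w : List α)
    (h : ∀ u v, u ++ v = t ++ w → v ≠ w → f u v = 0) : dsum f (t ++ w) = f t w := by
  induction t generalizing f with
  | nil =>
    cases w with
    | nil => rfl
    | cons e w =>
      refine dsum_snoc_nil _ _ _ fun u v huv hu => h u v huv ?_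
      rintro rfl
      exact hu (List.append_left_eq_self.mp huv)
  | cons e t ih =>
    rw [cons_append, dsum_cons, ih, h [] (e :: (t ++ w)) rfl, zero_add]
    · intro he
      have := congrArg List.length he
      simp at this
      omega
    · grind

theorem csum_eq_pair {f : List (List α) → M} {w₁ w₂ : List α} (h₁ : w₁ ≠ []) (h₂ : w₂ ≠ [])
    (h : ∀ S : List (List α), S.flatten = w₁ ++ w₂ → (∀ s ∈ S, s ≠ []) → S ≠ [w₁, w₂] → f S = 0) :
    csum f (w₁ ++ w₂) = f [w₁, w₂] := by
  obtain ⟨e, t, rfl⟩ := List.exists_cons_of_ne_nil h₁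
  rw [cons_append, csum_cons, dsum_eq_of_append t w₂]
  · refine csum_eq_single h₂ fun S hS hne h2 => h _ (by simp [hS]) ?_ ?_
    · grind
    · grind
  · intro u v huv hv
    refine csum_eq_zero fun S hS hne => h _ (by simp [hS, huv]) ?_ ?_
    · grind
    · grind

end ListSums

section Faces

variable {K : Type*} [Field K] {M : Type*} [AddCommGroup M] [Module K M]

theorem beadFaces_map (φ : ℕ → ℕ) (f : List (ℕ × ℕ) → M) (x : List (ℕ × ℕ)) :
    beadFaces K f (x.map (Prod.map φ φ)) =
      beadFaces K (fun x' => f (x'.map (Prod.map φ φ))) x := by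
  rw [beadFaces, psum_map]
  refine psum_congr fun u e v _ => ?_
  grind

theorem beadFaces_eq_zero {f : List (ℕ × ℕ) → M} {x : List (ℕ × ℕ)}
    (h : ∀ u e e' v, u ++ e :: e' :: v = x → f (u ++ (e.1, e'.2) :: v) = 0) :
    beadFaces K f x = 0 :=
  (beadFaces_congr K (f' := fun _ => 0) h).trans
    (map_beadFaces (N := M) K (0 : M →ₗ[K] M) f x).symm

theorem beadFaces_degen_head {f : List (ℕ × ℕ) → M} {p : ℕ}
    (h : ∀ x, (p, p) ∈ x → x ≠ [(p, p)] → f x = 0) (r : ℕ) (v : List (ℕ × ℕ)) :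
    beadFaces K f ((p, p) :: (p, r) :: v) = f ((p, r) :: v) := by
  rw [beadFaces_cons, beadFaces_eq_zero, sub_zero]
  simp_all

theorem beadFaces_degen_mid {f : List (ℕ × ℕ) → M} {p : ℕ}
    (h : ∀ x, (p, p) ∈ x → x ≠ [(p, p)] → f x = 0) (u : List (ℕ × ℕ)) (q r : ℕ) (v : List (ℕ × ℕ)) :
    beadFaces K f (u ++ (q, p) :: (p, p) :: (p, r) :: v) = 0 := by
  induction u generalizing f with
  | nil =>
    rw [nil_append, beadFaces_cons, beadFaces_degen_head, sub_self]
    grind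
  | cons e u ih =>
    obtain ⟨e', s, hs, hp⟩ : ∃ e' s, u ++ (q, p) :: (p, p) :: (p, r) :: v = e' :: s ∧ (p, p) ∈ s := by
      cases u <;> simp
    have := ih (f := fun x => f (e :: x)) fun x hx _ => h _ (by simp [hx]) (fun h => by simp_all)
    rw [hs] at this
    rw [cons_append, hs, beadFaces_cons, this, sub_zero]
    grind

theorem beadFaces_degen_last {f : List (ℕ × ℕ) → M} {p : ℕ}
    (h : ∀ x, (p, p) ∈ x → x ≠ [(p, p)] → f x = 0) (u : List (ℕ × ℕ)) (q : ℕ) :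
    beadFaces K f (u ++ [(q, p), (p, p)]) = sgn K u.length • f (u ++ [(q, p)]) := by
  induction u generalizing f with
  | nil =>
    rw [nil_append, beadFaces_cons, beadFaces_singleton]
    simp
  | cons e u ih =>
    obtain ⟨e', s, hs, hp⟩ : ∃ e' s, u ++ [(q, p), (p, p)] = e' :: s ∧ (p, p) ∈ s := by
      cases u <;> simp
    have := ih (f := fun x => f (e :: x)) fun x hx _ => h _ (by simp [hx]) (fun h => by simp_all)
    rw [hs] at this
    rw [cons_append, hs, beadFaces_cons, this, h _ (by simp [hp]) (fun h => by simp_all)]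
    simp only [length_cons, Nat.cast_add, Nat.cast_one, sgn_add, sgn_one, cons_append]
    module

end Faces

section Unit

variable (A : AInfCat K)

/-- The span of the tensors of length `k` that have an identity among their factors. -/
def AInfCat.unitSpan (k : ℕ) : Submodule K A.Ten :=
  Submodule.span K {w | ∃ (u : List A.HEl) (x : A.Ob) (v : List A.HEl),
    (u ++ A.oneH x :: v).length = k ∧ w = ten (u ++ A.oneH x :: v)}

theorem AInfCat.eq_zero_of_unitSpan {V : Type*} [AddCommGroup V] [Module K V] {k : ℕ}
    {F : A.Ten →ₗ[K] V} (h : ∀ u x v, (u ++ A.oneH x :: v).length = k → F (ten (u ++ A.oneH x :: v)) = 0)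
    {X : A.Ten} (hX : X ∈ A.unitSpan k) : F X = 0 := by
  refine (Submodule.span_le (p := LinearMap.ker F)).mpr ?_ hX
  rintro _ ⟨u, x, v, hl, rfl⟩
  exact h u x v hl

theorem AInfCat.ten_mul_mem_unitSpan (h : A.HEl) {k : ℕ} {X : A.Ten} (hX : X ∈ A.unitSpan k) :
    ten [h] * X ∈ A.unitSpan (k + 1) := by
  refine (Submodule.span_le (p := (A.unitSpan (k + 1)).comap (mulLeft K (ten [h])))).mpr ?_ hX
  rintro _ ⟨u, x, v, hl, rfl⟩
  exact Submodule.subset_span ⟨h :: u, x, v, by simpa using hl, by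
    rw [mulLeft_apply, ← ten_append]; rfl⟩

theorem AInfCat.oneH_mul_mem_unitSpan (x : A.Ob) {k : ℕ} {X : A.Ten} (hX : X ∈ A.lenSpan k) :
    ten [A.oneH x] * X ∈ A.unitSpan (k + 1) := by
  refine (Submodule.span_le (p := (A.unitSpan (k + 1)).comap
    (mulLeft K (ten [A.oneH x])))).mpr ?_ hX
  rintro _ ⟨L, hl, rfl⟩
  exact Submodule.subset_span ⟨[], x, L, by simpa using hl, by
    rw [mulLeft_apply, ← ten_append]; rfl⟩

theorem AInfCat.degen_mem_unitSpan (M : List (ℕ × ℕ)) (hpos : ∀ q ∈ M, 0 < q.1)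
    (hM : ∃ q ∈ M, q.1 ≠ q.2) {a b : A.Ob} {X : A.Ten}
    (hX : X ∈ A.shiftTen ((M.filter fun q => q.2 ≠ 0).map Prod.snd) a b) :
    A.degen a M X ∈ A.unitSpan M.length := by
  induction M generalizing a X with
  | nil => simp at hM
  | cons q M ih =>
    obtain ⟨n, m⟩ := q
    have hpos' : ∀ q ∈ M, 0 < q.1 := fun q hq => hpos q (by simp [hq])
    by_cases hnm : n = m
    · subst hnm
      have hn : n ≠ 0 := (hpos (n, n) (by simp)).ne'
      have hM' : ∃ q ∈ M, q.1 ≠ q.2 := by simpa using hM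
      rw [filter_cons_of_pos (by simpa using hn), map_cons] at hX
      refine shiftTen_induction (P := fun X => A.degen a ((n, n) :: M) X ∈ A.unitSpan (M.length + 1))
        hX ?_ ?_ ?_ ?_
      · intro L hL hd
        obtain ⟨h, L', rfl, -, hp, hd'⟩ := A.exists_cons_of_degs hL hd
        rw [A.degen_diag_ten _ _ _ _ _ (by rw [length_of_degs hd', length_map])]
        exact A.ten_mul_mem_unitSpan h (ih hpos' hM' (ten_mem_shiftTen hp hd'))
      · rw [map_zero]; exact Submodule.zero_mem _
      · intro X Y hX hY; rw [map_add]; exact Submodule.add_mem _ hX hY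
      · intro c X hX; rw [map_smul]; exact Submodule.smul_mem _ c hX
    · by_cases h10 : n = 1 ∧ m = 0
      · obtain ⟨rfl, rfl⟩ := h10
        rw [filter_cons_of_neg (by simp)] at hX
        rw [A.degen_unit]
        have := shiftTen_le_lenSpan _ _ _ (A.degen_mem_shiftTen M hpos' hX)
        rw [length_map] at this
        exact A.oneH_mul_mem_unitSpan a this
      · rw [A.degen_other _ _ _ hnm h10]
        exact Submodule.zero_mem _

theorem AInfCat.degen_eq_zero (M : List (ℕ × ℕ)) (hpos : ∀ q ∈ M, 0 < q.1) {a : A.Ob} {X : A.Ten}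
    (hX : X ∈ A.lenSpan (M.filter fun q => q.2 ≠ 0).length)
    (h : ∃ q ∈ M, q.1 ≠ q.2 ∧ q.1 ≠ 1) : A.degen a M X = 0 := by
  refine eqOn_lenSpan (β := 0) hX fun L hL => ?_
  clear hX
  rw [LinearMap.zero_apply]
  induction M generalizing a L with
  | nil => simp at h
  | cons q M ih =>
    obtain ⟨n, m⟩ := q
    have hpos' : ∀ q ∈ M, 0 < q.1 := fun q hq => hpos q (by simp [hq])
    by_cases hq : n ≠ m ∧ ¬ (n = 1 ∧ m = 0)
    · exact A.degen_other _ _ _ hq.1 hq.2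
    have h' : ∃ q ∈ M, q.1 ≠ q.2 ∧ q.1 ≠ 1 := by grind
    by_cases hnm : n = m
    · subst hnm
      have hn : n ≠ 0 := (hpos (n, n) (by simp)).ne'
      rw [filter_cons_of_pos (by simpa using hn)] at hL
      match L, hL with
      | h :: L, hL =>
        rw [A.degen_diag_ten _ _ _ _ _ (by simpa using hL), ih hpos' h' L (by simpa using hL), mul_zero]
    · have h10 : n = 1 ∧ m = 0 := by tauto
      obtain ⟨rfl, rfl⟩ := h10
      rw [filter_cons_of_neg (by simp)] at hL
      rw [A.degen_unit, ih hpos' h' L hL, mul_zero]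

theorem AInfCat.b_unitSpan {k : ℕ} (hk : k ≠ 2) {X : A.Ten} (hX : X ∈ A.unitSpan k) : A.b X = 0 := by
  refine A.eq_zero_of_unitSpan (fun u x v hl => ?_) hX
  rw [AInfData.b, twist_ten, hl, ten_append, ← singleton_append, ten_append, ← A.el_one, ← mul_assoc]
  obtain hk' | hk' : 2 < k ∨ k = 1 := by simp at hl; omega
  · rw [A.mul_unit k hk', smul_zero]
  · subst hk'
    obtain ⟨rfl, rfl⟩ : u = [] ∧ v = [] := by
      simp at hl
      exact ⟨List.length_eq_zero_iff.mp (by omega), List.length_eq_zero_iff.mp (by omega)⟩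
    rw [ten_nil, _root_.one_mul, _root_.mul_one, A.one_cycle, smul_zero]

theorem AInfCat.ι_b_oneH_mul {k : ℕ} {a b : A.Ob} {X : A.Ten} (hX : X ∈ A.shiftTen [k] a b) :
    ι K (A.b (ten [A.oneH a] * X)) = X := by
  refine eqOn_shiftTen (α := ι K ∘ₗ A.b ∘ₗ mulLeft K (ten [A.oneH a]))
    (β := LinearMap.id) (fun L hL hd => ?_) hX
  obtain ⟨h, rfl⟩ := List.length_eq_one_iff.mp (length_of_degs hd)
  obtain ⟨⟨x, y, d⟩, v⟩ := h
  obtain ⟨rfl, rfl⟩ := hL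
  change ι K (A.b (ten [A.oneH _] * ten [_])) = _
  rw [← ten_append, AInfData.b, twist_ten, ten_append, ← A.el_one, ← el_eq]
  have := A.one_mul x y d v
  refine (congrArg (fun z => ι K (sgn K _ • z)) this).trans ?_
  simp only [degs, AInfData.oneH, shiftExp, map_cons, map_nil, singleton_append,
    length_cons, List.length_nil, mul_zero, zero_mul, Nat.cast_zero, add_zero, sgn_zero, one_smul]
  rfl

theorem AInfCat.ι_b_mul_oneH {k : ℕ} {a b : A.Ob} {X : A.Ten} (hX : X ∈ A.shiftTen [k] a b) :
    ι K (A.b (X * ten [A.oneH b])) = sgn K (k - 1) • X := by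
  refine eqOn_shiftTen (α := ι K ∘ₗ A.b ∘ₗ mulRight K (ten [A.oneH b]))
    (β := sgn K (k - 1) • LinearMap.id) (fun L hL hd => ?_) hX
  obtain ⟨h, rfl⟩ := List.length_eq_one_iff.mp (length_of_degs hd)
  obtain ⟨⟨x, y, d⟩, v⟩ := h
  obtain ⟨rfl, rfl⟩ := hL
  have hdk : d = k - 1 := by simpa [degs] using hd
  change ι K (A.b (ten [_] * ten [A.oneH _])) = _
  rw [← ten_append, AInfData.b, twist_ten, ten_append, ← A.el_one, ← el_eq]
  have := A.mul_one x y d v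
  refine (congrArg (fun z => ι K (sgn K _ • z)) this).trans ?_
  simp only [degs, AInfData.oneH, shiftExp, map_cons, map_nil, singleton_append,
    length_cons, List.length_nil, zero_mul, Nat.cast_zero, add_zero, zero_add, Nat.cast_one,
    _root_.one_mul, hdk, map_smul]
  rfl

section Degen

variable {A} {a b : A.Ob} {Y : Code → A.Ten}

theorem length_nondeg_ne {s : List (ℕ × ℕ)} {p : ℕ} (h : (p, p) ∈ s) : s.length ≠ (nondeg s).length := by
  refine (List.length_filter_lt_length_iff_exists.mpr ⟨(p, p), h, ?_⟩).ne'
  simp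

theorem codeDims_pos {S : Code} (hS : ∀ s ∈ S, s ≠ []) :
    ∀ q ∈ AInfCat.codeDims S, 0 < q.1 := by
  intro q hq
  obtain ⟨s, hs, rfl⟩ := mem_map.mp hq
  exact length_pos_iff.mpr (hS s hs)

theorem AInfCat.degenAt_mem_unitSpan (hY : ∀ W, Y W ∈ A.shiftTen (W.map List.length) a b)
    {S : Code} (hS : ∀ s ∈ S, s ≠ []) {p : ℕ} (hp : (p, p) ∈ S.flatten) :
    A.degenAt a Y S ∈ A.unitSpan S.length := by
  obtain ⟨s, hs, hp⟩ := List.mem_flatten.mp hp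
  have := A.degen_mem_unitSpan (codeDims S) (codeDims_pos hS)
    ⟨_, List.mem_map_of_mem hs, length_nondeg_ne hp⟩ (map_length_nondegCode S ▸ hY (nondegCode S))
  rwa [codeDims, length_map] at this

theorem AInfCat.degenAt_eq_zero (hY : ∀ W, Y W ∈ A.shiftTen (W.map List.length) a b)
    {S : Code} (hS : ∀ s ∈ S, s ≠ []) {s : List (ℕ × ℕ)} (hs : s ∈ S) {p : ℕ}
    (hp : (p, p) ∈ s) (hsp : s ≠ [(p, p)]) : A.degenAt a Y S = 0 := by
  have := shiftTen_le_lenSpan _ _ _ (hY (nondegCode S))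
  rw [map_length_nondegCode, length_map] at this
  refine A.degen_eq_zero _ (codeDims_pos hS) this ⟨_, List.mem_map_of_mem hs, length_nondeg_ne hp, ?_⟩
  intro h1
  obtain ⟨e, rfl⟩ := List.length_eq_one_iff.mp h1
  exact hsp (by rw [List.mem_singleton.mp hp])

theorem AInfCat.degenAt_head (p : ℕ) (S : Code) :
    A.degenAt a Y ([(p, p)] :: S) = ten [A.oneH a] * A.degenAt a Y S := by
  have h : nondegCode ([(p, p)] :: S) = nondegCode S := by simp [nondegCode, nondeg]
  have h' : codeDims ([(p, p)] :: S) = (1, 0) :: codeDims S := by simp [codeDims, nondeg]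
  rw [degenAt, h, h', degen_unit]
  rfl

theorem AInfCat.degenAt_last (hY : ∀ W, Y W ∈ A.shiftTen (W.map List.length) a b)
    {S : Code} (hS : ∀ s ∈ S, s ≠ []) (p : ℕ) :
    A.degenAt a Y (S ++ [[(p, p)]]) = A.degenAt a Y S * ten [A.oneH b] := by
  have h : nondegCode [[(p, p)]] = [] := by simp [nondegCode, nondeg]
  have h1 : (1 : A.Ten) ∈ A.shiftTen ((nondegCode [[(p, p)]]).map List.length) b b := by
    rw [h, ← ten_nil]
    exact ten_mem_shiftTen rfl rfl
  have := degen_codeDims_append S [[(p, p)]] hS (hY _) h1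
  have h' : codeDims [[(p, p)]] = [(1, 0)] := by simp [codeDims, nondeg]
  rw [degenAt, nondegCode_append, h, List.append_nil, codeDims_append]
  rw [_root_.mul_one, h', degen_unit, degen_nil] at this
  rw [h', this, degenAt]
  simp

theorem AInfCat.eq_or_eq_of_degenAt_ne_zero (hY : ∀ W, Y W ∈ A.shiftTen (W.map List.length) a b)
    {S : Code} (hS : ∀ s ∈ S, s ≠ []) {u v : List (ℕ × ℕ)} {p : ℕ}
    (hw : S.flatten = u ++ (p, p) :: v) (h : A.b (A.degenAt a Y S) ≠ 0) :
    u = [] ∧ S = [[(p, p)], v] ∨ v = [] ∧ S = [u, [(p, p)]] := by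
  have h2 : S.length = 2 := by
    by_contra h2
    exact h (A.b_unitSpan h2 (degenAt_mem_unitSpan hY hS (p := p) (by rw [hw]; simp)))
  obtain ⟨s₁, s₂, rfl⟩ := List.length_eq_two.mp h2
  have hz : ∀ s ∈ [s₁, s₂], (p, p) ∈ s → s = [(p, p)] := by
    intro s hs hp
    by_contra hsp
    exact h (by rw [degenAt_eq_zero hY hS hs hp hsp, map_zero])
  have hz₁ := hz s₁ (by simp)
  have hz₂ := hz s₂ (by simp)
  rw [flatten_cons, List.flatten_singleton] at hw
  rcases List.append_eq_append_iff.mp hw with ⟨t, hu, ht⟩ | ⟨t, hs, ht⟩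
  · right
    have := hz₂ (by rw [ht]; simp)
    rw [ht] at this
    rcases t with _ | ⟨e, t⟩
    · simp_all
    · simp at this
  · rcases t with _ | ⟨e, t⟩
    · right
      rw [nil_append] at ht
      have := hz₂ (by rw [← ht]; simp)
      rw [← ht] at this
      exact ⟨by simpa using this, by rw [hs, List.append_nil, ← ht, this]⟩
    · left
      obtain ⟨rfl, rfl⟩ := List.cons.inj ht
      have := hz₁ (by rw [hs]; simp)
      rw [hs] at this
      rcases u with _ | ⟨e, u⟩
      · simp_all
      · simp at this

theorem AInfCat.degenAt_single_mem (hY : ∀ W, Y W ∈ A.shiftTen (W.map List.length) a b)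
    {w : List (ℕ × ℕ)} (hw : w ≠ []) : A.degenAt a Y [w] ∈ A.shiftTen [w.length] a b := by
  have h : ∀ s ∈ [w], s ≠ [] := fun s hs => List.mem_singleton.mp hs ▸ hw
  have := A.degenAt_mem_shiftTen h (hY (nondegCode [w]))
  rwa [List.map_singleton] at this

/-- The (TAN) relation of a degenerate simplex. -/
theorem AInfCat.b_csum_degenAt (hY : ∀ W, Y W ∈ A.shiftTen (W.map List.length) a b)
    {u v : List (ℕ × ℕ)} {p : ℕ} (hu : u = [] ∨ ∃ u' q, u = u' ++ [(q, p)])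
    (hv : v = [] ∨ ∃ r v', v = (p, r) :: v') :
    ι K (A.b (csum (A.degenAt a Y) (u ++ (p, p) :: v))) =
      beadFaces K (fun x => A.degenAt a Y [x]) (u ++ (p, p) :: v) := by
  have hf : ∀ x : List (ℕ × ℕ), (p, p) ∈ x → x ≠ [(p, p)] → A.degenAt a Y [x] = 0 := by
    intro x hx hxp
    refine degenAt_eq_zero hY ?_ (List.mem_singleton_self x) hx hxp
    grind
  have key : ∀ S : Code, S.flatten = u ++ (p, p) :: v → (∀ s ∈ S, s ≠ []) →
      ¬ (u = [] ∧ S = [[(p, p)], v]) → ¬ (v = [] ∧ S = [u, [(p, p)]]) →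
      (ι K ∘ₗ A.b) (A.degenAt a Y S) = 0 := by
    intro S hw hS h1 h2
    by_contra h
    refine (eq_or_eq_of_degenAt_ne_zero hY hS hw fun h0 => h ?_).elim h1 h2
    rw [LinearMap.comp_apply, h0, map_zero]
  rw [← LinearMap.comp_apply, lmap_csum]
  rcases hu with rfl | ⟨u', q, rfl⟩ <;> rcases hv with rfl | ⟨r, v', rfl⟩
  · rw [nil_append, beadFaces_singleton]
    refine csum_eq_zero fun S hS hne => key S hS hne ?_ ?_ <;>
    · rintro ⟨-, rfl⟩
      simp at hne
  · rw [nil_append, beadFaces_degen_head hf]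
    refine (csum_eq_pair (w₁ := [(p, p)]) (by simp) (by simp) fun S hS hne hS' =>
      key S hS hne (by simp [hS']) (by simp)).trans ?_
    rw [degenAt_head]
    exact A.ι_b_oneH_mul (degenAt_single_mem hY (by simp))
  · rw [append_assoc, singleton_append, beadFaces_degen_last hf, ← singleton_append,
      ← append_assoc, csum_eq_pair (by simp) (by simp) fun S hS hne hS' =>
        key S hS hne (by simp) (by simp [hS'])]
    have := degenAt_last hY (S := [u' ++ [(q, p)]]) (by simp) p
    rw [LinearMap.comp_apply]
    refine (congrArg (fun z => ι K (A.b z)) this).trans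
      ((A.ι_b_mul_oneH (degenAt_single_mem hY (by simp))).trans ?_)
    simp
  · rw [append_assoc, singleton_append, beadFaces_degen_mid hf, ← singleton_append,
      ← append_assoc]
    exact csum_eq_zero fun S hS hne => key S hS hne (by simp) (by simp)

end Degen

end Unit

open GradedQuiver

theorem EndHom.exists_edges_of_not_injective {m n : ℕ} (e : EndHom m n)
    (he : ¬ Function.Injective e.toFun) : ∃ u p v, e.edges = u ++ (p, p) :: v ∧
      (u = [] ∨ ∃ u' q, u = u' ++ [(q, p)]) ∧ (v = [] ∨ ∃ r v', v = (p, r) :: v') := by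
  obtain ⟨i, hi, hp⟩ : ∃ i < m, e.nat i = e.nat (i + 1) := by
    by_contra! h
    refine he (StrictMono.injective ?_)
    intro i j hij
    have hij' : i.val < j.val := hij
    have h1 : e.nat i.val < e.nat (i.val + 1) :=
      lt_of_le_of_ne (e.nat_mono (Nat.le_succ _)) (h _ (by omega))
    have h2 : e.nat (i.val + 1) ≤ e.nat j.val := e.nat_mono hij'
    change (e.toFun i).val < (e.toFun j).val
    rw [e.val_toFun, e.val_toFun]
    omega
  obtain ⟨k, rfl⟩ := Nat.exists_eq_add_of_le (Nat.succ_le_of_lt hi)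
  refine ⟨(List.range i).map fun j => (e.nat j, e.nat (j + 1)), e.nat i,
    (List.range k).map fun j => (e.nat (i + 1 + j), e.nat (i + 1 + j + 1)), ?_, ?_, ?_⟩
  · rw [edges, List.range_add, List.range_succ, map_append, map_append, append_assoc,
      List.map_singleton, ← hp, List.map_map]
    rfl
  · cases i with
    | zero => exact Or.inl rfl
    | succ i => exact Or.inr ⟨_, _, by rw [List.range_succ, map_append, List.map_singleton]⟩
  · cases k with
    | zero => exact Or.inl rfl
    | succ k => exact Or.inr ⟨_, _, by rw [List.range_succ_eq_map, map_cons, add_zero, ← hp]⟩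

section Pull

variable {A B : AInfCat K} {T T' : Nec} {a b : A.Ob}

theorem AInfCat.pull_add (h : T ⟶ T') (x y : NecSub T' → A.Ten) :
    A.pull h a (x + y) = A.pull h a x + A.pull h a y :=
  funext fun _ => map_add _ _ _

theorem AInfCat.pull_zero (h : T ⟶ T') : A.pull h a (0 : NecSub T' → A.Ten) = 0 :=
  funext fun _ => map_zero _

theorem AInfCat.pull_restrict (h : T ⟶ T') (y : NecSub T' → A.Ten) (g : NecSub T) :
    g.restrict (A.pull h a y) = A.pull (g.hom ≫ h) a y := rfl

theorem AInfCat.pull_eq_restrict {i : T ⟶ T'} (hi : Function.Injective i.toFun) {y : NecSub T' → A.Ten}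
    (hy : ∀ g, y g ∈ A.shiftTen g.dom.T.blocks a b) :
    A.pull i a y = NecSub.restrict ⟨T, i, hi⟩ y :=
  funext fun g => A.pull_of_injective i hi hy g

theorem AInfCat.pull_id {y : NecSub T → A.Ten} (hy : ∀ g, y g ∈ A.shiftTen g.dom.T.blocks a b) :
    A.pull (𝟙 T) a y = y :=
  pull_eq_restrict (fun _ _ h => h) hy

theorem AInfCat.lift_pull (h : T ⟶ T') (y : NecSub T' → A.Ten) {S : Code}
    (hS : ∃ g : NecSub T, g.code = S) : NecSub.lift (A.pull h a y) S =
      A.degenAt a (NecSub.lift y) (S.map (List.map (Prod.map h.toEndHom.nat h.toEndHom.nat))) := by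
  obtain ⟨g, rfl⟩ := hS
  rw [lift_code, pull_eq, Nec.code_comp]
  rfl

theorem AInfCat.csum_lift_pull (h : T ⟶ T') (y : NecSub T' → A.Ten) {g : NecSub T} {w : List (ℕ × ℕ)}
    (hw : g.code = [w]) : csum (NecSub.lift (A.pull h a y)) w =
      csum (A.degenAt a (NecSub.lift y)) (w.map (Prod.map h.toEndHom.nat h.toEndHom.nat)) := by
  rw [csum_map]
  refine csum_congr fun S hS hne => lift_pull h y ?_
  obtain ⟨g', hg'⟩ := g.exists_code_split (X := []) (Z := []) hw.symm hS hne
  exact ⟨g', by simpa using hg'⟩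

theorem Nec.map_code_refl {n m : ℕ} (e : simplex n ⟶ simplex m) {w : List (ℕ × ℕ)}
    (hw : (NecSub.refl (simplex n)).code = [w]) :
    w.map (Prod.map e.toEndHom.nat e.toEndHom.nat) = e.toEndHom.edges := by
  have h := flatten_code ((NecSub.refl (simplex n)).hom ≫ e)
  rw [code_comp] at h
  change ((NecSub.refl (simplex n)).code.map _).flatten = _ at h
  rw [hw, List.map_singleton, List.flatten_singleton] at h
  exact h

theorem AInfCat.tan_pull_simplex {n m : ℕ} (e : simplex n ⟶ simplex m)
    {y : NecSub (simplex m) → A.Ten} (hy : y ∈ A.nerve (.simplex m) a b) :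
    A.TAN (A.pull e a y) (NecSub.refl _) := by
  have hp := A.pull_mem_shiftTen e hy.1
  by_cases he : Function.Injective e.toFun
  · rw [pull_eq_restrict he hy.1]
    exact (restrict_mem_nerve _ hy).2 _
  obtain rfl | hn := Nat.eq_zero_or_pos n
  · rw [A.tan_iff hp, Nec.code_refl_simplex_zero]
    rfl
  obtain ⟨w, hw⟩ := Nec.code_refl_simplex hn
  rw [tan_iff_of_bead hp hw, csum_lift_pull e y hw]
  obtain ⟨u, p, v, huv, hu, hv⟩ := e.toEndHom.exists_edges_of_not_injective he
  refine Eq.trans ?_ (Eq.trans (beadFaces_map e.toEndHom.nat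
    (fun x => A.degenAt a (NecSub.lift y) [x]) w) (beadFaces_congr K fun u e₁ e₂ v h => ?_))
  · rw [Nec.map_code_refl e hw, huv]
    exact b_csum_degenAt (NecSub.lift_mem hy.1) hu hv
  · obtain ⟨g', hg'⟩ := (NecSub.refl (simplex n)).exists_code_face (X := []) (Z := [])
      (u := u) (e := e₁) (e' := e₂) (v := v) (by rw [hw, h]; rfl)
    exact (lift_pull e y ⟨g', hg'⟩).symm

theorem AInfCat.pull_mem_nerve (h : T ⟶ T') {y : NecSub T' → A.Ten} (hy : y ∈ A.nerve T' a b) :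
    A.pull h a y ∈ A.nerve T a b := by
  refine ⟨A.pull_mem_shiftTen h hy.1, fun g => ?_⟩
  have hi : Function.Injective (Nec.imageInc (g.hom ≫ h)).toFun := (ofMap (g.hom ≫ h)).inj
  rw [← tan_restrict, pull_restrict, ← Nec.imageEpi_imageInc (g.hom ≫ h), A.pull_comp _ _ hy.1,
    pull_eq_restrict hi hy.1]
  refine active_induction (P := fun T V e a b y => A.TAN (A.pull e a y) (NecSub.refl T)) ?_ ?_ ?_ ?_
    (Nec.isActive_imageEpi _) (restrict_mem_nerve (ofMap (g.hom ≫ h)) hy)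
  · intro T V e a b
    rw [pull_zero]
    exact tan_zero _
  · intro T V e a b x y _ _ hx hy
    rw [pull_add]
    exact tan_add hx hy
  · intro n m e a b y hy
    exact tan_pull_simplex e hy
  · intro T₁ T₂ V₁ V₂ e₁ e₂ a b c x hx y hy z hz hxy h₁ h₂
    rw [NecSub.refl_wedge]
    exact tan_wedge (A.pull_mem_shiftTen e₁ hx.1) (A.pull_mem_shiftTen e₂ hy.1)
      (pull_wedge e₁ e₂ hx.1 hy.1 hxy) h₁ h₂

namespace AInfFunctor

variable (f : AInfFunctor A B)

theorem tw_unitSpan {k : ℕ} (hk : k ≠ 1) {X : A.Ten} (hX : X ∈ A.unitSpan k) : f.tw X = 0 := by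
  refine A.eq_zero_of_unitSpan (fun u x v hl => f.isTw.higher u x v ?_) hX
  rintro h
  simp_all

theorem push_pull_simplex {n m : ℕ} (e : simplex n ⟶ simplex m)
    {y : NecSub (simplex m) → A.Ten} (hy : y ∈ A.nerve (.simplex m) a b) :
    f.push (A.pull e a y) (NecSub.refl _) = B.pull e (f.obj a) (f.push y) (NecSub.refl _) := by
  have hp := A.pull_mem_shiftTen e hy.1
  by_cases he : Function.Injective e.toFun
  · rw [AInfCat.pull_eq_restrict he hy.1, AInfCat.pull_eq_restrict he (f.push_mem_shiftTen hy.1)]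
    rfl
  obtain rfl | hn := Nat.eq_zero_or_pos n
  · refine absurd (fun i j _ => ?_) he
    exact Fin.ext ((Nat.lt_one_iff.mp i.isLt).trans (Nat.lt_one_iff.mp j.isLt).symm)
  obtain ⟨w, hw⟩ := Nec.code_refl_simplex hn
  obtain ⟨u, p, v, huv, hu, hv⟩ := e.toEndHom.exists_edges_of_not_injective he
  have hw' := Nec.map_code_refl e hw
  have hpw : (p, p) ∈ e.toEndHom.edges := by rw [huv]; simp
  rw [f.push_eq_of_bead hp hw, AInfCat.csum_lift_pull e y hw, hw', AInfCat.pull_eq, Nec.code_comp]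
  change _ = B.degenAt (f.obj a) (NecSub.lift (f.push y)) ((NecSub.refl (simplex n)).code.map _)
  rw [hw, List.map_singleton, hw']
  have hY := NecSub.lift_mem hy.1
  by_cases h1 : e.toEndHom.edges = [(p, p)]
  · have hm : m = 0 := by
      have hl := congrArg List.length h1
      rw [EndHom.edges, length_map, List.length_range] at hl
      change n = 1 at hl
      subst hl
      have h2 : e.toEndHom.nat 0 = p ∧ e.toEndHom.nat 1 = p := by
        have : e.toEndHom.edges = [(e.toEndHom.nat 0, e.toEndHom.nat 1)] := rfl
        rw [this] at h1
        simpa using h1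
      exact e.toEndHom.nat_last.symm.trans (h2.2.trans (h2.1.symm.trans e.toEndHom.nat_zero))
    subst hm
    have hc := Nec.code_refl_simplex_zero
    rw [h1, csum_cons]
    change ι K (f.tw (A.degenAt a (NecSub.lift y) ([(p, p)] :: []))) =
      B.degenAt (f.obj a) (NecSub.lift (f.push y)) ([(p, p)] :: [])
    rw [AInfCat.degenAt_head, AInfCat.degenAt_head]
    change ι K (f.tw (ten [A.oneH a] * algebraMap K A.Ten (A.aug (NecSub.lift y [])))) =
      ten [B.oneH (f.obj a)] * algebraMap K B.Ten (B.aug (NecSub.lift (f.push y) []))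
    rw [NecSub.lift_eq _ hc, NecSub.lift_eq _ hc, f.push_eq_of_nil hy.1 hc, ← Algebra.commutes,
      ← Algebra.commutes, ← Algebra.smul_def, ← Algebra.smul_def, map_smul, map_smul, f.isTw.unit,
      ten_singleton]
    simp
  · rw [AInfCat.degenAt_eq_zero (NecSub.lift_mem (f.push_mem_shiftTen hy.1)) (by
      rintro s hs rfl; rw [← List.mem_singleton.mp hs] at hpw; simp at hpw)
      (List.mem_singleton_self _) hpw h1]
    refine (congrArg _ ?_).trans (map_zero (ι K))
    rw [lmap_csum]
    refine csum_eq_zero fun S hS hne => ?_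
    by_cases hS1 : S.length = 1
    · obtain ⟨s, rfl⟩ := List.length_eq_one_iff.mp hS1
      rw [List.flatten_singleton] at hS
      subst hS
      rw [AInfCat.degenAt_eq_zero hY hne (List.mem_singleton_self _) hpw h1, map_zero]
    · exact f.tw_unitSpan hS1 (AInfCat.degenAt_mem_unitSpan hY hne (by rwa [hS]))

theorem push_pull (h : T ⟶ T') {y : NecSub T' → A.Ten} (hy : y ∈ A.nerve T' a b) :
    f.push (A.pull h a y) = B.pull h (f.obj a) (f.push y) := by
  funext g
  have h1 : f.push (A.pull (g.hom ≫ h) a y) (NecSub.refl g.dom) =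
      B.pull (g.hom ≫ h) (f.obj a) (f.push y) (NecSub.refl g.dom) := by
    have hi : Function.Injective (Nec.imageInc (g.hom ≫ h)).toFun := (ofMap (g.hom ≫ h)).inj
    rw [← Nec.imageEpi_imageInc (g.hom ≫ h), A.pull_comp _ _ hy.1,
      B.pull_comp _ _ (f.push_mem_shiftTen hy.1), AInfCat.pull_eq_restrict hi hy.1,
      AInfCat.pull_eq_restrict hi (f.push_mem_shiftTen hy.1), ← push_restrict]
    refine AInfCat.active_induction (P := fun T V e a b y => f.push (A.pull e a y) (NecSub.refl T) =
        B.pull e (f.obj a) (f.push y) (NecSub.refl T)) ?_ ?_ ?_ ?_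
      (Nec.isActive_imageEpi _) (AInfCat.restrict_mem_nerve (ofMap (g.hom ≫ h)) hy)
    · intro T V e a b
      rw [AInfCat.pull_zero, push_zero, push_zero, AInfCat.pull_zero]
    · intro T V e a b x y _ _ hx hy
      rw [AInfCat.pull_add, push_add, push_add, AInfCat.pull_add, Pi.add_apply, Pi.add_apply, hx, hy]
    · intro n m e a b y hy
      exact f.push_pull_simplex e hy
    · intro T₁ T₂ V₁ V₂ e₁ e₂ a b c x hx y hy z hz hxy h₁ h₂
      rw [NecSub.refl_wedge, push_wedge f (A.pull_mem_shiftTen e₁ hx.1) (A.pull_mem_shiftTen e₂ hy.1)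
        (pull_wedge e₁ e₂ hx.1 hy.1 hxy), h₁, h₂]
      exact (pull_wedge e₁ e₂ (f.push_mem_shiftTen hx.1) (f.push_mem_shiftTen hy.1)
        (push_wedge f hx.1 hy.1 hxy) _ _).symm
  exact h1

end AInfFunctor

end Pull

open GradedQuiver

section Maps

variable (A : AInfCat K) {B : AInfCat K} {T T' T₁ T₂ T₁' T₂' : Nec} {a b : A.Ob}

/-- The map `h^*` of spaces `N_T(a, b)`. -/
def AInfCat.pullHom (h : T ⟶ T') (a b : A.Ob) : A.nerve T' a b →ₗ[K] A.nerve T a b where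
  toFun y := ⟨A.pull h a y.1, pull_mem_nerve h y.2⟩
  map_add' _ _ := Subtype.ext (pull_add h _ _)
  map_smul' c y := Subtype.ext (funext fun g =>
    map_smul (A.degen a (beadDims (Nec.imageEpi (g.hom ≫ h)))) c (y.1 (ofMap (g.hom ≫ h))))

/-- The map `f_T` of spaces `N_T(a, b)`. -/
def AInfFunctor.pushHom {A : AInfCat K} (f : AInfFunctor A B) (T : Nec) (a b : A.Ob) :
    A.nerve T a b →ₗ[K] B.nerve T (f.obj a) (f.obj b) where
  toFun y := ⟨f.push y.1, f.push_mem_nerve y.2⟩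
  map_add' _ _ := Subtype.ext (f.push_add _ _)
  map_smul' c y := Subtype.ext (funext fun g => by
    change f.push (c • y.1) g = c • f.push y.1 g
    rw [push, push, Finset.smul_sum]
    exact sum_congr rfl fun S _ =>
      (congrArg _ (map_smul (f.tensF _) c _)).trans (smul_comm _ _ _))

/-- The comultiplication of the nerve. -/
def AInfCat.nerveComul (p q : ℕ) (a b : A.Ob) : A.nerve (.simplex (p + q)) a b →ₗ[K]
    ⨁ c, (A.nerve (.simplex p) a c) ⊗[K] (A.nerve (.simplex q) c b) :=
  (A.wedgeEquiv _ _ a b).symm.toLinearMap ∘ₗ A.pullHom (splitMap p q) a b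

theorem AInfCat.wedgeEquiv_nerveComul (p q : ℕ) (y : A.nerve (.simplex (p + q)) a b) :
    A.wedgeEquiv _ _ a b (A.nerveComul p q a b y) = A.pullHom (splitMap p q) a b y :=
  LinearEquiv.apply_symm_apply _ _

theorem AInfCat.wedgeAt_nerveComul (p q : ℕ) (y : A.nerve (.simplex (p + q)) a b)
    (g₁ : NecSub (.simplex p)) (g₂ : NecSub (.simplex q)) :
    A.wedgeAt a b g₁ g₂ (A.nerveComul p q a b y) =
      A.pull (splitMap p q) a y.1 (wedge g₁ g₂) := by
  exact (A.wedgeEquiv_apply _ g₁ g₂).symm.trans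
    (congrArg (fun z : A.nerve _ a b => z.1 (wedge g₁ g₂)) (A.wedgeEquiv_nerveComul p q y))

variable {A}

theorem AInfCat.eq_wedgeEquiv {V : Type*} [AddCommGroup V] [Module K V]
    {F : (⨁ c, (A.nerve T₁ a c) ⊗[K] (A.nerve T₂ c b)) →ₗ[K] V} {G : A.nerve (T₁.wedge T₂) a b →ₗ[K] V}
    (h : ∀ c (x : A.nerve T₁ a c) (y : A.nerve T₂ c b) (z : A.nerve (T₁.wedge T₂) a b),
      (∀ g₁ g₂, z.1 (wedge g₁ g₂) = x.1 g₁ * y.1 g₂) →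
      F (lof K A.Ob (fun c => (A.nerve T₁ a c) ⊗[K] (A.nerve T₂ c b)) c (x ⊗ₜ y)) = G z)
    (W : ⨁ c, (A.nerve T₁ a c) ⊗[K] (A.nerve T₂ c b)) : F W = G (A.wedgeEquiv T₁ T₂ a b W) := by
  have : F = G ∘ₗ (A.wedgeEquiv T₁ T₂ a b).toLinearMap := by
    refine linearMap_ext _ fun c => TensorProduct.ext' fun x y => ?_
    refine h c x y _ fun g₁ g₂ => ?_
    exact (A.wedgeEquiv_apply _ g₁ g₂).trans (A.wedgeAt_lof_tmul g₁ g₂ c x y)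
  rw [this]
  rfl

/-- The component at `g` of a member of a nerve. -/
def AInfCat.nerveEval (a b : A.Ob) (g : NecSub T) : A.nerve T a b →ₗ[K] A.Ten :=
  LinearMap.proj g ∘ₗ (A.nerve T a b).subtype

theorem AInfCat.pull_eq_pull_of_code {h : T ⟶ T'} {g : NecSub T} {h' : T₁ ⟶ T'} {g' : NecSub T₁}
    (hc : Nec.code (g.hom ≫ h) = Nec.code (g'.hom ≫ h')) (y : NecSub T' → A.Ten) :
    A.pull h a y g = A.pull h' a y g' := by
  rw [pull_eq, pull_eq, hc]

/-- The nerve as a linear quiver. -/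
abbrev AInfCat.nerveObj (A : AInfCat K) (T : Nec) (a b : A.Ob) : ModuleCat.{u} K :=
  ModuleCat.of K (A.nerve T a b)

theorem quivMap_lof_tmul {O O' : Type u} (φ : O → O') {P Q : O → O → ModuleCat.{u} K}
    {P' Q' : O' → O' → ModuleCat.{u} K}
    (α : ∀ a b, P a b →ₗ[K] P' (φ a) (φ b)) (β : ∀ a b, Q a b →ₗ[K] Q' (φ a) (φ b)) (a b c : O)
    (x : P a c) (y : Q c b) :
    quivMap φ α β a b (lof K O (fun c => P a c ⊗[K] Q c b) c (x ⊗ₜ y)) =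
      lof K O' (fun c => P' (φ a) c ⊗[K] Q' c (φ b)) (φ c) (α a c x ⊗ₜ β c b y) := by
  simp [quivMap]

theorem AInfCat.wedgeAt_quivMap_pull (h₁ : T₁' ⟶ T₁) (h₂ : T₂' ⟶ T₂)
    (W : ⨁ c, (A.nerve T₁ a c) ⊗[K] (A.nerve T₂ c b)) (g₁ : NecSub T₁') (g₂ : NecSub T₂') :
    A.wedgeAt a b g₁ g₂ (quivMap (P := A.nerveObj T₁) (Q := A.nerveObj T₂) (P' := A.nerveObj T₁')
      (Q' := A.nerveObj T₂') (fun c => c) (A.pullHom h₁) (A.pullHom h₂) a b W) =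
      A.pull (wedgeMap h₁ h₂) a (A.wedgeEquiv T₁ T₂ a b W).1 (wedge g₁ g₂) := by
  refine eq_wedgeEquiv (F := A.wedgeAt a b g₁ g₂ ∘ₗ quivMap (P := A.nerveObj T₁) (Q := A.nerveObj T₂)
    (P' := A.nerveObj T₁') (Q' := A.nerveObj T₂') (fun c => c) (A.pullHom h₁) (A.pullHom h₂) a b)
    (G := nerveEval a b (wedge g₁ g₂) ∘ₗ A.pullHom (wedgeMap h₁ h₂) a b)
    (fun c x y z hz => ?_) W
  refine (congrArg (A.wedgeAt a b g₁ g₂) (quivMap_lof_tmul (P := A.nerveObj T₁) (Q := A.nerveObj T₂)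
    (P' := A.nerveObj T₁') (Q' := A.nerveObj T₂') (fun c => c) _ _ a b c x y)).trans ?_
  exact (A.wedgeAt_lof_tmul g₁ g₂ c _ _).trans (pull_wedge h₁ h₂ x.2.1 y.2.1 hz g₁ g₂).symm

theorem AInfFunctor.wedgeAt_quivMap_push (f : AInfFunctor A B)
    (W : ⨁ c, (A.nerve T₁ a c) ⊗[K] (A.nerve T₂ c b)) (g₁ : NecSub T₁) (g₂ : NecSub T₂) :
    B.wedgeAt (f.obj a) (f.obj b) g₁ g₂ (quivMap (P := A.nerveObj T₁) (Q := A.nerveObj T₂)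
      (P' := B.nerveObj T₁) (Q' := B.nerveObj T₂) f.obj (f.pushHom T₁) (f.pushHom T₂) a b W) =
      f.push (A.wedgeEquiv T₁ T₂ a b W).1 (wedge g₁ g₂) := by
  refine AInfCat.eq_wedgeEquiv (F := B.wedgeAt (f.obj a) (f.obj b) g₁ g₂ ∘ₗ
    quivMap (P := A.nerveObj T₁) (Q := A.nerveObj T₂)
    (P' := B.nerveObj T₁) (Q' := B.nerveObj T₂) f.obj (f.pushHom T₁) (f.pushHom T₂) a b)
    (G := AInfCat.nerveEval _ _ (wedge g₁ g₂) ∘ₗ f.pushHom _ a b) (fun c x y z hz => ?_) W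
  refine (congrArg (B.wedgeAt _ _ g₁ g₂) (quivMap_lof_tmul (P := A.nerveObj T₁) (Q := A.nerveObj T₂)
    (P' := B.nerveObj T₁) (Q' := B.nerveObj T₂) f.obj _ _ a b c x y)).trans ?_
  exact (B.wedgeAt_lof_tmul g₁ g₂ (f.obj c) _ _).trans (push_wedge f x.2.1 y.2.1 hz g₁ g₂).symm

end Maps

open GradedQuiver

namespace NecSub

theorem code_hom_comp_of_nat {T T' : Nec} (g : NecSub T) {h : T ⟶ T'}
    (hh : ∀ i ≤ T.p, h.toEndHom.nat i = i) : Nec.code (g.hom ≫ h) = g.code := by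
  rw [Nec.code_comp]
  refine (map_congr_left fun x hx => ?_).trans (List.map_id _)
  refine (map_congr_left fun e he => ?_).trans (List.map_id _)
  have := g.fst_lt_snd_of_mem_code hx he
  grind

theorem code_wedge_assoc {T₁ T₂ T₃ : Nec} (g₁ : NecSub T₁) (g₂ : NecSub T₂) (g₃ : NecSub T₃) :
    (wedge (wedge g₁ g₂) g₃).code = (wedge g₁ (wedge g₂ g₃)).code := by
  simp only [code_wedge, map_append, append_assoc, List.map_map]
  congr 3
  funext x
  simp only [Function.comp_apply, List.map_map]
  congr 1
  funext e
  simp [shiftEdge, Nec.wedge, add_assoc]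

theorem code_simplex_zero (g : NecSub (simplex 0)) : g.code = [] := by
  refine List.eq_nil_iff_forall_not_mem.mpr fun x hx => ?_
  obtain ⟨e, he⟩ := List.exists_mem_of_ne_nil x (ne_nil_of_mem_code hx)
  have := g.fst_lt_snd_of_mem_code hx he
  have h0 : (simplex 0).p = 0 := rfl
  omega

theorem eq_refl_simplex_zero (g : NecSub (simplex 0)) : g = refl _ :=
  code_injective (g.code_simplex_zero.trans (code_simplex_zero _).symm)

theorem blocks_simplex_zero (g : NecSub (simplex 0)) : g.dom.T.blocks = [] := by
  rw [← map_length_code, code_simplex_zero, map_nil]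

theorem code_wedge_simplex_zero_left {T : Nec} (g₁ : NecSub (simplex 0)) (g₂ : NecSub T) :
    (wedge g₁ g₂).code = g₂.code := by
  rw [code_wedge, code_simplex_zero, nil_append]
  refine (map_congr_left fun x _ => ?_).trans (List.map_id _)
  refine (map_congr_left fun e _ => ?_).trans (List.map_id _)
  simp [shiftEdge, simplex]

theorem code_wedge_simplex_zero_right {T : Nec} (g₁ : NecSub T) (g₂ : NecSub (simplex 0)) :
    (wedge g₁ g₂).code = g₁.code := by
  rw [code_wedge, code_simplex_zero, map_nil, List.append_nil]

end NecSub

section Triple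

variable {A : AInfCat K} {T₁ T₂ T₃ : Nec} {a b : A.Ob}

theorem lmap_lTensor_lof {O : Type u} {M N N' : O → Type u} [∀ d, AddCommMonoid (M d)]
    [∀ d, Module K (M d)] [∀ d, AddCommMonoid (N d)] [∀ d, Module K (N d)] [∀ d, AddCommMonoid (N' d)]
    [∀ d, Module K (N' d)] (f : ∀ d, N d →ₗ[K] N' d) (d : O) (x : M d) (y : N d) :
    lmap (fun d => lTensor (M d) (f d))
      (lof K O (fun d => M d ⊗[K] N d) d (x ⊗ₜ y)) =
      lof K O (fun d => M d ⊗[K] N' d) d (x ⊗ₜ f d y) := by simp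

theorem lmap_rTensor_lof {O : Type u} {M N N' : O → Type u} [∀ d, AddCommMonoid (M d)]
    [∀ d, Module K (M d)] [∀ d, AddCommMonoid (N d)] [∀ d, Module K (N d)] [∀ d, AddCommMonoid (N' d)]
    [∀ d, Module K (N' d)] (f : ∀ d, N d →ₗ[K] N' d) (d : O) (x : N d) (y : M d) :
    lmap (fun d => rTensor (M d) (f d))
      (lof K O (fun d => N d ⊗[K] M d) d (x ⊗ₜ y)) =
      lof K O (fun d => N' d ⊗[K] M d) d (f d x ⊗ₜ y) := by simp

theorem quivAssoc_lof_tmul {O : Type u} (P Q R : O → O → ModuleCat.{u} K) (a b c d : O) (x : P a d)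
    (y : Q d c) (z : R c b) :
    quivAssoc P Q R a b (lof K O (fun c => (⨁ d, P a d ⊗[K] Q d c) ⊗[K] R c b) c
      (lof K O (fun d => P a d ⊗[K] Q d c) d (x ⊗ₜ y) ⊗ₜ z)) =
    lof K O (fun d => P a d ⊗[K] (⨁ c, Q d c ⊗[K] R c b)) d
      (x ⊗ₜ lof K O (fun c => Q d c ⊗[K] R c b) c (y ⊗ₜ z)) := by
  simp [quivAssoc]

theorem AInfCat.wedgeEquiv_lof_tmul {c : A.Ob} (x : A.nerve T₁ a c) (y : A.nerve T₂ c b)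
    (g₁ : NecSub T₁) (g₂ : NecSub T₂) :
    (A.wedgeEquiv T₁ T₂ a b (lof K A.Ob
      (fun c => (A.nerve T₁ a c) ⊗[K] (A.nerve T₂ c b)) c (x ⊗ₜ y))).1 (wedge g₁ g₂) =
      x.1 g₁ * y.1 g₂ :=
  (A.wedgeEquiv_apply _ g₁ g₂).trans (A.wedgeAt_lof_tmul g₁ g₂ c x y)

section Family

variable {N : A.Ob → Type u} [∀ d, AddCommMonoid (N d)] [∀ d, Module K (N d)]
  (e : ∀ d, N d ≃ₗ[K] A.nerve T₂ d b)

/-- The isomorphism of `N_{T₁} ⊗ N_{T₂}` with `N_{T₁ ∨ T₂}`, preceded by an identification with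
`N_{T₂}` of the second factor. -/
def AInfCat.wedgeEquivOf (T₁ : Nec) (a : A.Ob) :
    (⨁ d, A.nerve T₁ a d ⊗[K] N d) →ₗ[K] A.nerve (T₁.wedge T₂) a b :=
  (A.wedgeEquiv T₁ T₂ a b).toLinearMap ∘ₗ
    lmap fun d => lTensor (A.nerve T₁ a d) (e d).toLinearMap

theorem AInfCat.wedgeEquivOf_injective : Function.Injective (wedgeEquivOf e T₁ a) := by
  refine (A.wedgeEquiv T₁ T₂ a b).injective.comp ?_
  refine (DirectSum.lmap_injective _).mpr fun d => ?_
  exact (LinearEquiv.lTensor (A.nerve T₁ a d) (e d)).injective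

theorem AInfCat.eq_of_wedgeEquivOf (e : ∀ d, N d ≃ₗ[K] A.nerve (T₂.wedge T₃) d b)
    {Z Z' : ⨁ d, A.nerve T₁ a d ⊗[K] N d} (h : ∀ g₁ g₂ g₃,
      (wedgeEquivOf e T₁ a Z).1 (wedge g₁ (wedge g₂ g₃)) =
        (wedgeEquivOf e T₁ a Z').1 (wedge g₁ (wedge g₂ g₃))) : Z = Z' := by
  refine wedgeEquivOf_injective e (Subtype.ext (funext fun g => ?_))
  obtain ⟨g₁, g', rfl⟩ := g.exists_wedge
  obtain ⟨g₂, g₃, rfl⟩ := g'.exists_wedge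
  exact h g₁ g₂ g₃

theorem AInfCat.wedgeEquivOf_lof_tmul {d : A.Ob} (x : A.nerve T₁ a d) (w : N d) (g₁ : NecSub T₁)
    (g : NecSub T₂) : (wedgeEquivOf e T₁ a (lof K A.Ob
      (fun d => A.nerve T₁ a d ⊗[K] N d) d (x ⊗ₜ w))).1 (wedge g₁ g) = x.1 g₁ * (e d w).1 g := by
  refine Eq.trans (congrArg (fun w => (A.wedgeEquiv T₁ T₂ a b w).1 (wedge g₁ g))
    (lmap_lTensor_lof (M := fun d => A.nerve T₁ a d) (fun d => (e d).toLinearMap) d x w)) ?_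
  exact wedgeEquiv_lof_tmul x (e d w) g₁ g

theorem AInfCat.wedgeEquivOf_lTensor {T₃ : Nec} (α : ∀ d, A.nerve T₃ d b →ₗ[K] N d) (h : T₂ ⟶ T₃)
    (hα : ∀ d y, e d (α d y) = A.pullHom h d b y)
    (W : ⨁ d, A.nerve T₁ a d ⊗[K] A.nerve T₃ d b) (g₁ : NecSub T₁) (g : NecSub T₂) :
    (wedgeEquivOf e T₁ a (lmap (fun d =>
      lTensor (A.nerve T₁ a d) (α d)) W)).1 (wedge g₁ g) =
      A.pull (wedgeMap (𝟙 _) h) a (A.wedgeEquiv _ _ a b W).1 (wedge g₁ g) := by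
  refine eq_wedgeEquiv (F := nerveEval a b (wedge g₁ g) ∘ₗ wedgeEquivOf e T₁ a ∘ₗ
    lmap fun d => lTensor (A.nerve T₁ a d) (α d))
    (G := nerveEval a b (wedge g₁ g) ∘ₗ A.pullHom (wedgeMap (𝟙 _) h) a b)
    (fun d x y z hz => ?_) W
  refine (congrArg (fun w => (wedgeEquivOf e T₁ a w).1 (wedge g₁ g))
    (lmap_lTensor_lof (M := fun d => A.nerve T₁ a d) (N := fun d => A.nerve T₃ d b) α d x y)).trans ?_
  refine (wedgeEquivOf_lof_tmul e x (α d y) g₁ g).trans ?_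
  refine Eq.trans ?_ (pull_wedge (𝟙 T₁) h x.2.1 y.2.1 hz g₁ g).symm
  rw [pull_id x.2.1, hα]
  rfl

theorem AInfCat.wedgeAt_rTensor {N : A.Ob → Type u} [∀ c, AddCommMonoid (N c)] [∀ c, Module K (N c)]
    (e : ∀ c, N c ≃ₗ[K] A.nerve T₂ a c) {T₃ : Nec} (α : ∀ c, A.nerve T₃ a c →ₗ[K] N c) (h : T₂ ⟶ T₃)
    (hα : ∀ c x, e c (α c x) = A.pullHom h a c x)
    (W : ⨁ c, A.nerve T₃ a c ⊗[K] A.nerve T₁ c b) (g : NecSub T₂) (g₁ : NecSub T₁) :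
    A.wedgeAt a b g g₁ (lmap (fun c =>
      rTensor (A.nerve T₁ c b) (e c).toLinearMap)
      (lmap (fun c => rTensor (A.nerve T₁ c b) (α c)) W)) =
      A.pull (wedgeMap h (𝟙 _)) a (A.wedgeEquiv _ _ a b W).1 (wedge g g₁) := by
  refine eq_wedgeEquiv (F := A.wedgeAt a b g g₁ ∘ₗ lmap (fun c =>
      rTensor (A.nerve T₁ c b) (e c).toLinearMap) ∘ₗ
      lmap fun c => rTensor (A.nerve T₁ c b) (α c))
    (G := nerveEval a b (wedge g g₁) ∘ₗ A.pullHom (wedgeMap h (𝟙 _)) a b)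
    (fun c x y z hz => ?_) W
  refine (congrArg (fun w => A.wedgeAt a b g g₁ (lmap (fun c =>
      rTensor (A.nerve T₁ c b) (e c).toLinearMap) w))
    (lmap_rTensor_lof (M := fun c => A.nerve T₁ c b) (N := fun c => A.nerve T₃ a c) α c x y)).trans ?_
  refine (congrArg (fun w => A.wedgeAt a b g g₁ w) (lmap_rTensor_lof (M := fun c => A.nerve T₁ c b)
    (fun c => (e c).toLinearMap) c (α c x) y)).trans ?_
  refine (A.wedgeAt_lof_tmul g g₁ c (e c (α c x)) y).trans ?_
  refine Eq.trans ?_ (pull_wedge h (𝟙 T₁) x.2.1 y.2.1 hz g g₁).symm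
  rw [pull_id y.2.1, hα]
  rfl

end Family

theorem AInfCat.wedgeEquivOf_quivAssoc
    (V : ⨁ c, (⨁ d, A.nerve T₁ a d ⊗[K] A.nerve T₂ d c) ⊗[K] A.nerve T₃ c b)
    (g₁ : NecSub T₁) (g₂ : NecSub T₂) (g₃ : NecSub T₃) :
    (wedgeEquivOf (fun d => A.wedgeEquiv T₂ T₃ d b) T₁ a
      (quivAssoc (A.nerveObj T₁) (A.nerveObj T₂) (A.nerveObj T₃) a b V)).1
      (wedge g₁ (wedge g₂ g₃)) =
    A.wedgeAt a b (wedge g₁ g₂) g₃ (lmap (fun c =>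
      rTensor (A.nerve T₃ c b) (A.wedgeEquiv T₁ T₂ a c).toLinearMap) V) := by
  have : nerveEval a b (wedge g₁ (wedge g₂ g₃)) ∘ₗ
      wedgeEquivOf (fun d => A.wedgeEquiv T₂ T₃ d b) T₁ a ∘ₗ
      quivAssoc (A.nerveObj T₁) (A.nerveObj T₂) (A.nerveObj T₃) a b =
      A.wedgeAt a b (wedge g₁ g₂) g₃ ∘ₗ lmap (fun c =>
        rTensor (A.nerve T₃ c b) (A.wedgeEquiv T₁ T₂ a c).toLinearMap) := by
    refine linearMap_ext _ fun c => TensorProduct.ext (linearMap_ext _ fun d =>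
      TensorProduct.ext' fun x y => LinearMap.ext fun z => ?_)
    refine (congrArg (fun w => (wedgeEquivOf (fun d => A.wedgeEquiv T₂ T₃ d b) T₁ a w).1
      (wedge g₁ (wedge g₂ g₃))) (quivAssoc_lof_tmul (A.nerveObj T₁) (A.nerveObj T₂)
      (A.nerveObj T₃) a b c d x y z)).trans ?_
    refine (wedgeEquivOf_lof_tmul (fun d => A.wedgeEquiv T₂ T₃ d b) x (lof K A.Ob
      (fun c => (A.nerve T₂ d c) ⊗[K] (A.nerve T₃ c b)) c (y ⊗ₜ z)) g₁ (wedge g₂ g₃)).trans ?_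
    refine (congrArg (x.1 g₁ * ·) (wedgeEquiv_lof_tmul y z g₂ g₃)).trans ?_
    refine Eq.symm ((congrArg (fun w => A.wedgeAt a b (wedge g₁ g₂) g₃ w)
      (lmap_rTensor_lof (M := fun c => A.nerve T₃ c b) (fun c => (A.wedgeEquiv T₁ T₂ a c).toLinearMap)
        c (lof K A.Ob (fun d => (A.nerve T₁ a d) ⊗[K] (A.nerve T₂ d c)) d (x ⊗ₜ y)) z)).trans
      ?_)
    refine (A.wedgeAt_lof_tmul (wedge g₁ g₂) g₃ c (A.wedgeEquiv T₁ T₂ a c (lof K A.Ob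
      (fun d => (A.nerve T₁ a d) ⊗[K] (A.nerve T₂ d c)) d (x ⊗ₜ y))) z).trans ?_
    exact (congrArg (· * z.1 g₃) (wedgeEquiv_lof_tmul x y g₁ g₂)).trans (_root_.mul_assoc _ _ _)
  exact LinearMap.congr_fun this V

theorem AInfCat.wedgeAt_rTensor_nerveComul (p q r : ℕ) (y : A.nerve (.simplex (p + q + r)) a b)
    (g : NecSub ((simplex p).wedge (.simplex q))) (g₃ : NecSub (.simplex r)) :
    A.wedgeAt a b g g₃ (lmap (fun c => rTensor (A.nerve (.simplex r) c b)
      (A.wedgeEquiv (.simplex p) (.simplex q) a c).toLinearMap)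
      (lmap (fun c => rTensor (A.nerve (.simplex r) c b) (A.nerveComul p q a c))
        (A.nerveComul (p + q) r a b y))) =
      A.pull (wedgeMap (splitMap p q) (𝟙 _)) a (A.pull (splitMap (p + q) r) a y.1)
        (wedge g g₃) := by
  have h1 := wedgeAt_rTensor (T₁ := .simplex r) (b := b)
    (fun c => A.wedgeEquiv (.simplex p) (.simplex q) a c)
    (fun c => A.nerveComul p q a c) (splitMap p q) (fun c x => A.wedgeEquiv_nerveComul p q x)
    (A.nerveComul (p + q) r a b y) g g₃
  exact Eq.trans h1 (congrArg (fun z : A.nerve _ a b => A.pull (wedgeMap (splitMap p q) (𝟙 _))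
    a z.1 (wedge g g₃)) (A.wedgeEquiv_nerveComul (p + q) r y))

theorem AInfCat.wedgeEquivOf_lTensor_nerveComul (p q r : ℕ) (y : A.nerve (.simplex (p + (q + r))) a b)
    (g₁ : NecSub (.simplex p)) (g : NecSub ((simplex q).wedge (.simplex r))) :
    (wedgeEquivOf (fun d => A.wedgeEquiv (.simplex q) (.simplex r) d b) (.simplex p) a
      (lmap (fun c => lTensor (A.nerve (.simplex p) a c) (A.nerveComul q r c b))
        (A.nerveComul p (q + r) a b y))).1 (wedge g₁ g) =
      A.pull (wedgeMap (𝟙 _) (splitMap q r)) a (A.pull (splitMap p (q + r)) a y.1)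
        (wedge g₁ g) := by
  have h2 := wedgeEquivOf_lTensor (T₁ := .simplex p) (a := a)
    (fun d => A.wedgeEquiv (.simplex q) (.simplex r) d b)
    (fun d => A.nerveComul q r d b) (splitMap q r) (fun d x => A.wedgeEquiv_nerveComul q r x)
    (A.nerveComul p (q + r) a b y) g₁ g
  exact Eq.trans h2 (congrArg (fun z : A.nerve _ a b => A.pull (wedgeMap (𝟙 _) (splitMap q r))
    a z.1 (wedge g₁ g)) (A.wedgeEquiv_nerveComul p (q + r) y))

theorem AInfCat.pull_splitMap_assoc (p q r : ℕ) (y : A.nerve (.simplex (p + (q + r))) a b)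
    (g₁ : NecSub (.simplex p)) (g₂ : NecSub (.simplex q)) (g₃ : NecSub (.simplex r)) :
    A.pull (wedgeMap (splitMap p q) (𝟙 (simplex r))) a (A.pull (splitMap (p + q) r) a
      (A.pull (simplexMap (EndHom.ofEq (Nat.add_assoc p q r))) a y.1))
      (wedge (wedge g₁ g₂) g₃) =
    A.pull (wedgeMap (𝟙 (simplex p)) (splitMap q r)) a
      (A.pull (splitMap p (q + r)) a y.1) (wedge g₁ (wedge g₂ g₃)) := by
  rw [← A.pull_comp _ _ y.2.1, ← A.pull_comp _ _ y.2.1, ← A.pull_comp _ _ y.2.1]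
  refine pull_eq_pull_of_code ?_ y.1
  rw [NecSub.code_hom_comp_of_nat, NecSub.code_hom_comp_of_nat, NecSub.code_wedge_assoc]
  · intro i hi
    change i ≤ p + (q + r) at hi
    rw [toEndHom_comp, nat_comp]
    refine (nat_id (p + (q + r)) _).trans ?_
    have := nat_add (EndHom.id p) (EndHom.id (q + r)) i
    rw [nat_id, nat_id] at this
    refine (congrArg (min · _) this).trans ?_
    split_ifs <;> omega
  · intro i hi
    change i ≤ p + q + r at hi
    rw [toEndHom_comp, nat_comp, toEndHom_comp, nat_comp]
    have := nat_add (EndHom.id (p + q)) (EndHom.id r) i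
    rw [nat_id, nat_id] at this
    refine (EndHom.nat_ofEq (Nat.add_assoc p q r) _).trans ?_
    refine (congrArg (fun j => min j (p + q + r)) ((nat_id (p + q + r) _).trans
      (congrArg (fun j => min j (p + q + r)) this))).trans ?_
    split_ifs <;> omega

theorem AInfCat.nerveComul_coassoc (p q r : ℕ) (y : A.nerve (.simplex (p + (q + r))) a b) :
    quivAssoc (A.nerveObj (.simplex p)) (A.nerveObj (.simplex q)) (A.nerveObj (.simplex r)) a b
      (lmap (fun c => rTensor (A.nerve (.simplex r) c b) (A.nerveComul p q a c))
        (A.nerveComul (p + q) r a b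
          (A.pullHom (simplexMap (EndHom.ofEq (Nat.add_assoc p q r))) a b y))) =
      lmap (fun c => lTensor (A.nerve (.simplex p) a c) (A.nerveComul q r c b))
        (A.nerveComul p (q + r) a b y) := by
  refine eq_of_wedgeEquivOf (T₁ := .simplex p) (fun d => A.wedgeEquiv (.simplex q) (.simplex r) d b)
    fun g₁ g₂ g₃ => ?_
  refine (wedgeEquivOf_quivAssoc (T₁ := .simplex p) (T₂ := .simplex q) (T₃ := .simplex r)
    (lmap (fun c => rTensor (A.nerve (.simplex r) c b) (A.nerveComul p q a c))
        (A.nerveComul (p + q) r a b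
          (A.pullHom (simplexMap (EndHom.ofEq (Nat.add_assoc p q r))) a b y))) g₁ g₂ g₃).trans ?_
  refine (wedgeAt_rTensor_nerveComul p q r
    (A.pullHom (simplexMap (EndHom.ofEq (Nat.add_assoc p q r))) a b y) _ g₃).trans ?_
  refine Eq.trans ?_ (wedgeEquivOf_lTensor_nerveComul p q r y g₁ _).symm
  exact pull_splitMap_assoc p q r y g₁ g₂ g₃

end Triple

open GradedQuiver

section Structure

variable (A : AInfCat K) {B C : AInfCat K} {T T' : Nec} {a b : A.Ob}

theorem DirectSum.component_lof_ne {O : Type u} {M : O → Type u} [∀ c, AddCommMonoid (M c)]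
    [∀ c, Module K (M c)] {c d : O} (h : c ≠ d) (m : M c) :
    component K O M d (lof K O M c m) = 0 := by
  rw [component.of, dif_neg h]

/-- The counit of the nerve. -/
def AInfCat.nerveCounit (a b : A.Ob) : A.nerve (.simplex 0) a b →ₗ[K] K :=
  A.aug.toLinearMap ∘ₗ nerveEval a b (NecSub.refl (.simplex 0))

variable {A}

theorem AInfCat.mem_shiftTen_nil (y : A.nerve (.simplex 0) a b) (g : NecSub (.simplex 0)) :
    y.1 g ∈ A.shiftTen [] a b := by
  have := y.2.1 g
  rwa [NecSub.blocks_simplex_zero] at this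

theorem AInfCat.algebraMap_nerveCounit (y : A.nerve (.simplex 0) a b) :
    algebraMap K A.Ten (A.nerveCounit a b y) = y.1 (NecSub.refl (.simplex 0)) :=
  GradedQuiver.algebraMap_aug_of_mem (mem_shiftTen_nil y _)

theorem AInfCat.nerve_eq_zero (h : a ≠ b) (y : A.nerve (.simplex 0) a b) : y = 0 :=
  Subtype.ext (funext fun g => GradedQuiver.eq_zero_of_mem (mem_shiftTen_nil y g) h)

theorem AInfCat.nerveCounit_bijective (a : A.Ob) : Function.Bijective (A.nerveCounit a a) := by
  refine ⟨fun y z h => Subtype.ext (funext fun g => ?_), fun k => ?_⟩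
  · rw [g.eq_refl_simplex_zero, ← algebraMap_nerveCounit, ← algebraMap_nerveCounit, h]
  · have h1 : ∀ g : NecSub (.simplex 0), algebraMap K A.Ten k ∈ A.shiftTen g.dom.T.blocks a a := by
      intro g
      rw [g.blocks_simplex_zero, Algebra.algebraMap_eq_smul_one]
      exact Submodule.smul_mem _ _ (Submodule.subset_span
        ⟨fun _ => a, rfl, rfl, fun i => i.elim0, by simp⟩)
    refine ⟨⟨fun _ => algebraMap K A.Ten k, h1, fun g => ?_⟩, ?_⟩
    · rw [A.tan_iff h1, g.code_simplex_zero]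
      rfl
    · exact AlgHom.commutes A.aug k

theorem AInfCat.lid_nerveCounit (W : ⨁ c, A.nerve (.simplex 0) a c ⊗[K] A.nerve T c b)
    (g : NecSub T) :
    ((TensorProduct.lid K (A.nerve T a b)) (rTensor (A.nerve T a b) (A.nerveCounit a a)
      (component K A.Ob (fun c => A.nerve (.simplex 0) a c ⊗[K] A.nerve T c b) a W))).1 g =
      A.wedgeAt a b (NecSub.refl _) g W := by
  have : nerveEval a b g ∘ₗ (TensorProduct.lid K (A.nerve T a b)).toLinearMap ∘ₗ
      rTensor (A.nerve T a b) (A.nerveCounit a a) ∘ₗ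
      component K A.Ob (fun c => A.nerve (.simplex 0) a c ⊗[K] A.nerve T c b) a =
      A.wedgeAt a b (NecSub.refl _) g := by
    refine linearMap_ext _ fun c => TensorProduct.ext' fun x y => ?_
    refine Eq.trans ?_ (A.wedgeAt_lof_tmul (NecSub.refl _) g c x y).symm
    by_cases h : c = a
    · subst h
      refine (congrArg (fun w => ((TensorProduct.lid K (A.nerve T c b))
        (rTensor (A.nerve T c b) (A.nerveCounit c c) w)).1 g)
        (component.lof_self K (M := fun d => A.nerve (.simplex 0) c d ⊗[K] A.nerve T d b) c
          (x ⊗ₜ y))).trans ?_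
      rw [← algebraMap_nerveCounit, ← Algebra.smul_def]
      rfl
    · refine (congrArg (fun w => ((TensorProduct.lid K (A.nerve T a b))
        (rTensor (A.nerve T a b) (A.nerveCounit a a) w)).1 g)
        (component_lof_ne (M := fun d => A.nerve (.simplex 0) a d ⊗[K] A.nerve T d b) h
          (x ⊗ₜ y))).trans ?_
      rw [map_zero, map_zero, nerve_eq_zero (Ne.symm h) x]
      exact (zero_mul _).symm
  exact LinearMap.congr_fun this W

theorem AInfCat.rid_nerveCounit (W : ⨁ c, A.nerve T a c ⊗[K] A.nerve (.simplex 0) c b)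
    (g : NecSub T) :
    ((TensorProduct.rid K (A.nerve T a b)) (lTensor (A.nerve T a b) (A.nerveCounit b b)
      (component K A.Ob (fun c => A.nerve T a c ⊗[K] A.nerve (.simplex 0) c b) b W))).1 g =
      A.wedgeAt a b g (NecSub.refl _) W := by
  have : nerveEval a b g ∘ₗ (TensorProduct.rid K (A.nerve T a b)).toLinearMap ∘ₗ
      lTensor (A.nerve T a b) (A.nerveCounit b b) ∘ₗ
      component K A.Ob (fun c => A.nerve T a c ⊗[K] A.nerve (.simplex 0) c b) b =
      A.wedgeAt a b g (NecSub.refl _) := by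
    refine linearMap_ext _ fun c => TensorProduct.ext' fun x y => ?_
    refine Eq.trans ?_ (A.wedgeAt_lof_tmul g (NecSub.refl _) c x y).symm
    by_cases h : c = b
    · subst h
      refine (congrArg (fun w => ((TensorProduct.rid K (A.nerve T a c))
        (lTensor (A.nerve T a c) (A.nerveCounit c c) w)).1 g)
        (component.lof_self K (M := fun d => A.nerve T a d ⊗[K] A.nerve (.simplex 0) d c) c
          (x ⊗ₜ y))).trans ?_
      rw [← algebraMap_nerveCounit, ← Algebra.commutes, ← Algebra.smul_def]
      rfl
    · refine (congrArg (fun w => ((TensorProduct.rid K (A.nerve T a b))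
        (lTensor (A.nerve T a b) (A.nerveCounit b b) w)).1 g)
        (component_lof_ne (M := fun d => A.nerve T a d ⊗[K] A.nerve (.simplex 0) d b) h
          (x ⊗ₜ y))).trans ?_
      rw [map_zero, map_zero, nerve_eq_zero h y]
      exact (mul_zero _).symm
  exact LinearMap.congr_fun this W

theorem AInfCat.pull_splitMap_zero_left (n : ℕ) (y : A.nerve (.simplex n) a b)
    (g : NecSub (.simplex n)) :
    A.pull (splitMap 0 n) a (A.pull (simplexMap (EndHom.ofEq (Nat.zero_add n))) a y.1)
      (wedge (NecSub.refl _) g) = y.1 g := by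
  rw [← A.pull_comp _ _ y.2.1]
  refine Eq.trans (pull_eq_pull_of_code (h' := 𝟙 _) (g' := g) ?_ y.1) (congrFun (pull_id y.2.1) g)
  rw [Category.comp_id, NecSub.code_hom_comp_of_nat]
  · exact NecSub.code_wedge_simplex_zero_left _ g
  · intro i hi
    change i ≤ 0 + n at hi
    rw [toEndHom_comp, nat_comp]
    refine (EndHom.nat_ofEq (Nat.zero_add n) _).trans ?_
    refine (congrArg (fun j => min j (0 + n)) (nat_id (0 + n) i)).trans ?_
    omega

theorem AInfCat.pull_splitMap_zero_right (n : ℕ) (y : A.nerve (.simplex n) a b)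
    (g : NecSub (.simplex n)) :
    A.pull (splitMap n 0) a y.1 (wedge g (NecSub.refl _)) = y.1 g := by
  refine Eq.trans (pull_eq_pull_of_code (h' := 𝟙 _) (g' := g) ?_ y.1) (congrFun (pull_id y.2.1) g)
  rw [Category.comp_id, NecSub.code_hom_comp_of_nat]
  · exact NecSub.code_wedge_simplex_zero_right g _
  · intro i hi
    exact min_eq_left hi

theorem AInfCat.nerveComul_pullHom {p p' q q' : ℕ} (f : EndHom p p') (g : EndHom q q')
    (y : A.nerve (.simplex (p' + q')) a b) :
    A.nerveComul p q a b (A.pullHom (simplexMap (f.add g)) a b y) =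
      quivMap (P := A.nerveObj (.simplex p')) (Q := A.nerveObj (.simplex q'))
        (P' := A.nerveObj (.simplex p)) (Q' := A.nerveObj (.simplex q)) (fun c => c)
        (A.pullHom (simplexMap f)) (A.pullHom (simplexMap g)) a b (A.nerveComul p' q' a b y) := by
  refine A.eq_of_wedgeAt fun g₁ g₂ => ?_
  refine (A.wedgeAt_nerveComul p q _ g₁ g₂).trans
    (Eq.trans ?_ (wedgeAt_quivMap_pull _ _ _ g₁ g₂).symm)
  refine Eq.trans ?_ (congrArg (fun z : A.nerve _ a b => A.pull (wedgeMap (simplexMap f)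
    (simplexMap g)) a z.1 (wedge g₁ g₂)) (A.wedgeEquiv_nerveComul p' q' y).symm)
  refine (congrFun (A.pull_comp _ _ y.2.1) _).symm.trans
    (Eq.trans ?_ (congrFun (A.pull_comp _ _ y.2.1) _))
  exact congrArg (fun h => A.pull h a y.1 (wedge g₁ g₂)) (NecHom.ext rfl)

end Structure

open GradedQuiver

section Functor

variable (A : AInfCat K) {B C : AInfCat K} {a b : A.Ob}

/-- The nerve, as a templicial vector space. -/
def AInfCat.nerveStr : TemplicialStr A.nerveQuiver where
  map f a b := A.pullHom (simplexMap f) a b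
  map_id _ _ _ := LinearMap.ext fun y => Subtype.ext (pull_id y.2.1)
  map_comp f g _ _ := LinearMap.ext fun y => Subtype.ext
    (A.pull_comp (simplexMap f) (simplexMap g) y.2.1)
  comul p q a b := A.nerveComul p q a b
  comul_map f g _ _ := LinearMap.ext fun y => nerveComul_pullHom f g y
  coassoc p q r _ _ := LinearMap.ext fun y => nerveComul_coassoc p q r y
  counit a := A.nerveCounit a a
  counit_left n _ _ := LinearMap.ext fun y => Subtype.ext (funext fun g =>
    (lid_nerveCounit _ g).trans ((A.wedgeAt_nerveComul 0 n _ _ g).trans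
      (pull_splitMap_zero_left n y g)))
  counit_right n _ _ := LinearMap.ext fun y => Subtype.ext (funext fun g =>
    (rid_nerveCounit _ g).trans ((A.wedgeAt_nerveComul n 0 y g _).trans
      (pull_splitMap_zero_right n y g)))
  counit_bijective := nerveCounit_bijective
  counit_off_diagonal _ _ h := ⟨fun y z => (nerve_eq_zero h y).trans (nerve_eq_zero h z).symm⟩

variable {A}

theorem AInfFunctor.nerveComul_pushHom (f : AInfFunctor A B) (p q : ℕ)
    (y : A.nerve (.simplex (p + q)) a b) :
    quivMap (P := A.nerveObj (.simplex p)) (Q := A.nerveObj (.simplex q))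
      (P' := B.nerveObj (.simplex p)) (Q' := B.nerveObj (.simplex q)) f.obj
      (f.pushHom (.simplex p)) (f.pushHom (.simplex q)) a b (A.nerveComul p q a b y) =
      B.nerveComul p q (f.obj a) (f.obj b) (f.pushHom (.simplex (p + q)) a b y) := by
  refine B.eq_of_wedgeAt fun g₁ g₂ => ?_
  refine (f.wedgeAt_quivMap_push _ g₁ g₂).trans
    (Eq.trans ?_ (B.wedgeAt_nerveComul p q _ g₁ g₂).symm)
  refine (congrArg (fun z : A.nerve _ a b => f.push z.1 (wedge g₁ g₂))
    (A.wedgeEquiv_nerveComul p q y)).trans ?_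
  exact congrFun (f.push_pull (splitMap p q) y.2) _

theorem AInfFunctor.nerveCounit_pushHom (f : AInfFunctor A B) (y : A.nerve (.simplex 0) a b) :
    B.nerveCounit (f.obj a) (f.obj b) (f.pushHom (.simplex 0) a b y) = A.nerveCounit a b y :=
  (congrArg B.aug (f.push_eq_of_nil y.2.1 Nec.code_refl_simplex_zero)).trans (AlgHom.commutes B.aug _)

/-- The map of templicial vector spaces of an `A_∞`-functor. -/
def AInfFunctor.nerveMap (f : AInfFunctor A B) :
    TemplicialHom (K := K) ⟨A.Ob, A.nerveQuiver, A.nerveStr⟩ ⟨B.Ob, B.nerveQuiver, B.nerveStr⟩ where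
  obj := f.obj
  app n a b := f.pushHom (.simplex n) a b
  naturality h _ _ := LinearMap.ext fun y => Subtype.ext (f.push_pull (simplexMap h) y.2)
  comul p q _ _ := LinearMap.ext fun y => f.nerveComul_pushHom p q y
  counit _ := LinearMap.ext fun y => f.nerveCounit_pushHom y

variable (K) in
/-- The category of strictly unital `A_∞`-categories. -/
abbrev ainfCat : Category.{u} (AInfCat K) :=
  ainfCategory K AInfFunctor.id AInfFunctor.comp (fun f => f.id_comp) (fun f => f.comp_id)
    (fun f g h => f.assoc g h)

variable (K) in
/-- The nerve functor. -/
def nerveFunctor : letI := ainfCat K; AInfCat K ⥤ TemplicialVect K :=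
  letI := ainfCat K
  { obj := fun A => ⟨A.Ob, A.nerveQuiver, A.nerveStr⟩
    map := fun {A B} (f : AInfFunctor A B) => f.nerveMap
    map_id := fun A => TemplicialHom.ext rfl (heq_of_eq (funext fun _ => funext fun a => funext fun b =>
      LinearMap.ext fun y => Subtype.ext (AInfFunctor.push_id (a := a) (b := b) y.2)))
    map_comp := fun {A B C} f g => TemplicialHom.ext rfl (heq_of_eq (funext fun _ => funext fun a =>
      funext fun b => LinearMap.ext fun y => Subtype.ext
        (AInfFunctor.push_comp (a := a) (b := b) f g y.2))) }

end Functor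

end

theorem mainTheorem5 (K : Type u) [Field K] :
    -- Strictly unital `A_∞`-categories and `A_∞`-functors form a category.
    ∃ (idF : ∀ A : AInfCat K, AInfFunctor A A)
      (compF : ∀ {A B C : AInfCat K}, AInfFunctor A B → AInfFunctor B C → AInfFunctor A C)
      (id_comp : ∀ {A B : AInfCat K} (f : AInfFunctor A B), compF (idF A) f = f)
      (comp_id : ∀ {A B : AInfCat K} (f : AInfFunctor A B), compF f (idF B) = f)
      (assoc : ∀ {A B C D : AInfCat K} (f : AInfFunctor A B) (g : AInfFunctor B C)
        (h : AInfFunctor C D), compF (compF f g) h = compF f (compF g h)),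
      (∀ A : AInfCat K, (idF A).IsId) ∧
      (∀ (A B C : AInfCat K) (f : AInfFunctor A B) (g : AInfFunctor B C),
        f.IsComp g (compF f g)) ∧
    -- The maps `h^*` make `T ↦ N_T(a, b)` a functor on the opposite of the category of necklaces.
    (∀ (A : AInfCat K) (T T' : Nec) (h : T ⟶ T') (a b : A.Ob), ∀ y ∈ A.nerve T' a b,
      A.pull h a y ∈ A.nerve T a b) ∧
    (∀ (A : AInfCat K) (T : Nec) (a b : A.Ob), ∀ y ∈ A.nerve T a b, A.pull (𝟙 T) a y = y) ∧
    (∀ (A : AInfCat K) (T T' T'' : Nec) (h : T ⟶ T') (h' : T' ⟶ T'') (a b : A.Ob),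
      ∀ y ∈ A.nerve T'' a b, A.pull (h ≫ h') a y = A.pull h a (A.pull h' a y)) ∧
    -- The canonical map is an isomorphism `N_{T₁} ⊗ N_{T₂} ≅ N_{T₁ ∨ T₂}`, natural in `T₁` and `T₂`.
    (∀ (A : AInfCat K) (T₁ T₂ : Nec) (a b : A.Ob),
      ∃ e : (⨁ c, (A.nerve T₁ a c) ⊗[K] (A.nerve T₂ c b)) ≃ₗ[K] A.nerve (T₁.wedge T₂) a b,
        ∀ w g₁ g₂, (e w).1 (NecSub.wedge g₁ g₂) = A.wedgeAt a b g₁ g₂ w) ∧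
    (∀ (A : AInfCat K) (T₁ T₁' T₂ T₂' : Nec) (h₁ : T₁ ⟶ T₁') (h₂ : T₂ ⟶ T₂') (a b c : A.Ob),
      ∀ x ∈ A.nerve T₁' a c, ∀ y ∈ A.nerve T₂' c b, ∀ z ∈ A.nerve (T₁'.wedge T₂') a b,
        (∀ g₁ g₂, z (NecSub.wedge g₁ g₂) = x g₁ * y g₂) →
        ∀ g₁ g₂, A.pull (Nec.wedgeMap h₁ h₂) a z (NecSub.wedge g₁ g₂) =
          A.pull h₁ a x g₁ * A.pull h₂ c y g₂) ∧
    -- The maps `f_T` are natural in `T` and compatible with the isomorphisms.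
    (∀ (A B : AInfCat K) (f : AInfFunctor A B) (T : Nec) (a b : A.Ob), ∀ y ∈ A.nerve T a b,
      f.push y ∈ B.nerve T (f.obj a) (f.obj b)) ∧
    (∀ (A B : AInfCat K) (f : AInfFunctor A B) (T T' : Nec) (h : T ⟶ T') (a b : A.Ob),
      ∀ y ∈ A.nerve T' a b, f.push (A.pull h a y) = B.pull h (f.obj a) (f.push y)) ∧
    (∀ (A B : AInfCat K) (f : AInfFunctor A B) (T₁ T₂ : Nec) (a b c : A.Ob),
      ∀ x ∈ A.nerve T₁ a c, ∀ y ∈ A.nerve T₂ c b, ∀ z ∈ A.nerve (T₁.wedge T₂) a b,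
        (∀ g₁ g₂, z (NecSub.wedge g₁ g₂) = x g₁ * y g₂) →
        ∀ g₁ g₂, f.push z (NecSub.wedge g₁ g₂) = f.push x g₁ * f.push y g₂) ∧
    -- The maps `f_T` respect identities and composition.
    (∀ (A : AInfCat K) (T : Nec) (a b : A.Ob), ∀ y ∈ A.nerve T a b, (idF A).push y = y) ∧
    (∀ (A B C : AInfCat K) (f : AInfFunctor A B) (g : AInfFunctor B C) (T : Nec) (a b : A.Ob),
      ∀ y ∈ A.nerve T a b, (compF f g).push y = g.push (f.push y)) ∧
    -- The nerve is a functor to templicial vector spaces, with `N(A)_n = N_{Δ^n}`.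
    letI : Category.{u} (AInfCat K) := ainfCategory K idF compF id_comp comp_id assoc
    ∃ (str : ∀ A : AInfCat K, TemplicialStr A.nerveQuiver)
      (mapF : ∀ {A B : AInfCat K}, AInfFunctor A B →
        TemplicialHom (K := K) ⟨A.Ob, A.nerveQuiver, str A⟩ ⟨B.Ob, B.nerveQuiver, str B⟩)
      (N : AInfCat K ⥤ TemplicialVect K),
      N.toPrefunctor =
        { obj := fun A => ⟨A.Ob, A.nerveQuiver, str A⟩
          map := fun {A B} (f : AInfFunctor A B) => mapF f } ∧
      (∀ (A : AInfCat K) (m n : ℕ) (f : EndHom m n) (a b : A.Ob) (y : A.nerve (.simplex n) a b),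
        ((str A).map f a b y : A.nerve (.simplex m) a b).1 = A.pull (Nec.simplexMap f) a y.1) ∧
      (∀ (A : AInfCat K) (p q : ℕ) (a b : A.Ob) (y : A.nerve (.simplex (p + q)) a b)
        (g₁ : NecSub (.simplex p)) (g₂ : NecSub (.simplex q)),
        A.wedgeAt a b g₁ g₂ ((str A).comul p q a b y) =
          A.pull (Nec.splitMap p q) a y.1 (NecSub.wedge g₁ g₂)) ∧
      (∀ (A : AInfCat K) (a : A.Ob) (y : A.nerve (.simplex 0) a a),
        algebraMap K A.Ten ((str A).counit a y) = y.1 (NecSub.refl (.simplex 0))) ∧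
      (∀ (A B : AInfCat K) (f : AInfFunctor A B), (mapF f).obj = f.obj) ∧
      (∀ (A B : AInfCat K) (f : AInfFunctor A B) (n : ℕ) (a b : A.Ob)
        (y : A.nerve (.simplex n) a b),
        ((mapF f).app n a b y : B.nerve (.simplex n) _ _).1 = f.push y.1) := by
  refine ⟨AInfFunctor.id, AInfFunctor.comp, fun f => f.id_comp, fun f => f.comp_id,
    fun f g h => f.assoc g h, AInfFunctor.isId_id, fun A B C f g => f.isComp_comp g, ?_⟩
  refine ⟨fun A T T' h a b y hy => AInfCat.pull_mem_nerve h hy,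
    fun A T a b y hy => AInfCat.pull_id hy.1,
    fun A T T' T'' h h' a b y hy => A.pull_comp h h' hy.1,
    fun A T₁ T₂ a b => ⟨A.wedgeEquiv T₁ T₂ a b, fun w g₁ g₂ => A.wedgeEquiv_apply w g₁ g₂⟩,
    fun A T₁ T₁' T₂ T₂' h₁ h₂ a b c x hx y hy z _ hxy => pull_wedge h₁ h₂ hx.1 hy.1 hxy,
    fun A B f T a b y hy => f.push_mem_nerve hy,
    fun A B f T T' h a b y hy => f.push_pull h hy,
    fun A B f T₁ T₂ a b c x hx y hy z _ hxy => push_wedge f hx.1 hy.1 hxy,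
    fun A T a b y hy => AInfFunctor.push_id hy,
    fun A B C f g T a b y hy => AInfFunctor.push_comp f g hy, ?_⟩
  exact ⟨AInfCat.nerveStr, AInfFunctor.nerveMap, nerveFunctor K, rfl, fun A m n f a b y => rfl,
    fun A p q a b y g₁ g₂ => A.wedgeAt_nerveComul p q y g₁ g₂,
    fun A a y => AInfCat.algebraMap_nerveCounit y, fun A B f => rfl, fun A B f n a b y => rfl⟩

end
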